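/- Let $\beta\in\{1,4\}$, let $a$ be real, and let $$w_1(x)=x^{(a-1)/2}e^{-x},\qquad w_4(x)=x^{a+1}e^{-x}\qquad(x>0),$$ where the exponent of $x$ in $w_\beta$ is assumed to be $>-1$. Consider $N$ eigenvalues in $(0,\infty)$ with joint probability density proportional to $\prod_{l=1}^N w_\beta(x_l)\prod_{1\le j<k\le N}|x_k-x_j|^\beta$ (LOE for $\beta=1$, LSE for $\beta=4$), let $\rho_{(1),N}$ be the eigenvalue density ($N$ times the one-variable marginal), and put $$\hat N=N+\tfrac{a-1}{2}\ (\beta=1),\qquad \hat N=N+\tfrac{a+1}{4}\ (\beta=4),\qquad \mathcal D_yf(y)=\frac{d}{dy}\bigl(yf(y)\bigr).$$ (i) As $N\to\infty$, locally uniformly in $y>0$, the hard edge scaled density has an expansion $$\frac1{4\hat N}\,\rho_{(1),N}\Bigl(\frac{y}{4\hat N}\Bigr)=r_0(y)+\frac{1}{(2\sqrt\beta\,\hat N)^2}\,r_1(y)+o(N^{-2}),$$ where $r_0,r_1$ (which depend on $\beta$ and $a$) are smooth on $(0,\infty)$, and for all $y>0$ $$r_1\Bigl(\frac y2\Bigr)=-\frac1{12}\Bigl(8\,\mathcal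 D_y^2\,r_0\Bigl(\frac y2\Bigr)+\mathcal D_y\Bigl(y\,r_0\Bigl(\frac y2\Bigr)\Bigr)+2(a^2-5)\,\mathcal D_y\,r_0\Bigl(\frac y2\Bigr)\Bigr),$$ where $r_0(y/2)$ is regarded as a function of $y$. (ii) Let $E_N(k;(0,s))$ be the probability that exactly $k$ eigenvalues lie in $(0,s)$, and let $\mathcal E_{N}((0,s);\xi)=\sum_{k\ge0}(1-\xi)^kE_N(k;(0,s))$. Let $U\subset\mathbb C$ be an open set containing $0$. Suppose that there are functions $\mathcal E^{\rm h},\mathcal E^{1}$ of $y>0$ and $\xi\in U$ such that, as $N\to\infty$, locally uniformly in $(y,\xi)\in(0,\infty)\times U$, $$\mathcal E_{N}\Bigl(\Bigl(0,\frac{y}{4\hat N}\Bigr);\xi\Bigr)=\mathcal E^{\rm h}(y;\xi)+\frac{1}{(2\sqrt\beta\,\hat N)^2}\,\mathcal E^{1}(y;\xi)+o(N^{-2}),$$ and that $\mathcal E^{\rm h}(\,\cdot\,;\xi)$ is twice continuously differentiable on $(0,\infty)$ for each $\xi\in U$. Suppose further that $\mathcal E^1$ results from $\mathcal E^{\rm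 h}$ by applying a $\xi$-independent differential operator in $y$ of order at most two with polynomial coefficients: there are polynomials $p_0,p_1,p_2$ in $y$ with $\mathcal E^1(y;\xi)=p_2(y)\frac{d^2}{dy^2}\mathcal E^{\rm h}(y;\xi)+p_1(y)\frac{d}{dy}\mathcal E^{\rm h}(y;\xi)+p_0(y)\mathcal E^{\rm h}(y;\xi)$ for all $y>0$ and $\xi\in U$. Then for all $y>0$ and $\xi\in U$ $$\mathcal E^{1}(y;\xi)=-\frac16\Bigl(4y^2\frac{d}{dy}+y^2+(a^2-1)y\Bigr)\frac{d}{dy}\,\mathcal E^{\rm h}(y;\xi).$$ -/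

import Mathlib

open Filter Set MeasureTheory
open scoped ContDiff

noncomputable section

/-- The unnormalised eigenvalue density
`∏ w(x_l) ∏_{j<k} |x_k - x_j|^β` of the ensemble with weight `w` and Dyson index `β`. -/
def ensembleWeight (β : ℕ) (w : ℝ → ℝ) {N : ℕ} (x : Fin N → ℝ) : ℝ :=
  (∏ l, w (x l)) * ∏ j, ∏ k ∈ Finset.Ioi j, |x k - x j| ^ β

/-- The normalisation constant of the ensemble. -/
def ensembleZ (β : ℕ) (w : ℝ → ℝ) (N : ℕ) : ℝ :=
  ∫ x : Fin N → ℝ, ensembleWeight β w x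

/-- The eigenvalue density `ρ_{(1),N}(x)`: `N` times the marginal of the (normalised) joint
probability density function in one variable. -/
def ensembleDensity (β : ℕ) (w : ℝ → ℝ) : ℕ → ℝ → ℝ
  | 0, _ => 0
  | n + 1, x =>
      ((n : ℝ) + 1) *
        (∫ z : Fin n → ℝ, ensembleWeight β w (Fin.cons x z : Fin (n + 1) → ℝ)) /
          ensembleZ β w (n + 1)

/-- `E_{N,β}(k;(0,s);w)`: the probability that exactly `k` of the `N` eigenvalues lie in
`(0,s)`. -/
def ensembleCountProb (β : ℕ) (w : ℝ → ℝ) (N k : ℕ) (s : ℝ) : ℝ :=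
  (∫ x in {x : Fin N → ℝ | {l : Fin N | 0 < x l ∧ x l < s}.ncard = k}, ensembleWeight β w x) /
    ensembleZ β w N

/-- The generating function `∑_k (1-ξ)^k E_{N,β}(k;(0,s);w)`
(the terms with `k > N` of the sum vanish). -/
def ensembleGenFun (β : ℕ) (w : ℝ → ℝ) (N : ℕ) (s : ℝ) (ξ : ℂ) : ℂ :=
  ∑ k ∈ Finset.range (N + 1), (1 - ξ) ^ k * (ensembleCountProb β w N k s : ℂ)

/-- The exponent of the Laguerre weight: `(a-1)/2` for `β = 1` and `a+1` for `β = 4`. -/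
def laguerreExponent (β : ℕ) (a : ℝ) : ℝ :=
  if β = 1 then (a - 1) / 2 else a + 1

/-- The Laguerre weight `w_β` on `(0,∞)`: `x^{(a-1)/2} e^{-x}` for `β = 1` and
`x^{a+1} e^{-x}` for `β = 4`. -/
def laguerreWeight (β : ℕ) (a x : ℝ) : ℝ :=
  if 0 < x then x ^ laguerreExponent β a * Real.exp (-x) else 0

/-- The shifted size: `N + (a-1)/2` for `β = 1` and `N + (a+1)/4` for `β = 4`. -/
def hardEdgeSize (β : ℕ) (a : ℝ) (N : ℕ) : ℝ :=
  if β = 1 then N + (a - 1) / 2 else N + (a + 1) / 4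

/-- The density in the hard edge variable `x = y / (4 N')`, with `N' = hardEdgeSize β a N`. -/
def hardEdgeDensity (β : ℕ) (a : ℝ) (N : ℕ) (y : ℝ) : ℝ :=
  1 / (4 * hardEdgeSize β a N) *
    ensembleDensity β (laguerreWeight β a) N (y / (4 * hardEdgeSize β a N))

/-- The generating function for the interval `(0, y / (4 N'))`. -/
def hardEdgeGenFun (β : ℕ) (a : ℝ) (N : ℕ) (y : ℝ) (ξ : ℂ) : ℂ :=
  ensembleGenFun β (laguerreWeight β a) N (y / (4 * hardEdgeSize β a N)) ξ

/-- The expansion parameter is the inverse of `(2 √β N')^2`. -/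
def hardEdgeScale (β : ℕ) (a : ℝ) (N : ℕ) : ℝ :=
  (2 * √(β : ℝ) * hardEdgeSize β a N) ^ 2

/-- `r₀` and `r₁` are the first two coefficients of the large `N` expansion
`ρ_N(y) = r₀(y) + r₁(y) / (2 √β N')^2 + ⋯` of the hard edge scaled density, with a remainder
that is `o(N^{-2})` locally uniformly in `y > 0`. (As `N' → ∞`, this contains the convergence
of the density to `r₀`, so `r₀` and `r₁` are uniquely determined on `(0,∞)`.) -/
def IsHardEdgeDensityExpansion (β : ℕ) (a : ℝ) (r₀ r₁ : ℝ → ℝ) : Prop :=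
  TendstoLocallyUniformlyOn
    (fun (N : ℕ) (y : ℝ) => hardEdgeScale β a N * (hardEdgeDensity β a N y - r₀ y))
    r₁ atTop (Ioi 0)

/-- `E₀` and `E₁` are the first two coefficients of the large `N` expansion
`𝓔_N((0, y/(4N')); ξ) = E₀(y,ξ) + E₁(y,ξ) / (2 √β N')^2 + ⋯` of the generating function, with a
remainder that is `o(N^{-2})` locally uniformly in `y > 0` and `ξ ∈ U`. -/
def IsHardEdgeGenFunExpansion (β : ℕ) (a : ℝ) (U : Set ℂ) (E₀ E₁ : ℝ → ℂ → ℂ) : Prop :=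
  TendstoLocallyUniformlyOn
    (fun (N : ℕ) (p : ℝ × ℂ) =>
      (hardEdgeScale β a N : ℂ) * (hardEdgeGenFun β a N p.1 p.2 - E₀ p.1 p.2))
    (fun p => E₁ p.1 p.2) atTop (Ioi 0 ×ˢ U)

/-- The operator `𝒟_y = (d/dy) y`, that is `f ↦ (y f(y))'`. -/
def opD (f : ℝ → ℝ) : ℝ → ℝ :=
  fun y => deriv (fun t => t * f t) y

end

/-! Idea of part (i). Both joint densities have Pfaffian structure. For β = 1 the factor |Δ| is the
symmetrisation of a determinant times signs along pairs of variables (de Bruijn); for β = 4 the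
factor Δ^4 is a confluent Vandermonde determinant of values and derivatives. In a skew orthogonal
basis made of Laguerre polynomials the eigenvalue density is therefore a sum over pairs
(`ensembleDensity_one`, `ensembleDensity_four`). This sum telescopes to a closed expression in one
Laguerre polynomial L_n, its derivative and one antiderivative, with n = N - 1 for β = 1 and n = 2N
for β = 4; for β = 1 there is one further term linear in L_n (`laguerreDensity_one`,
`laguerreDensity_four`).

The function y = e^(-x/2) L_n satisfies x y'' + (a+1) y' + (κ - x/4) y = 0 with κ = n + (a+1)/2,
which is N̂ or 2N̂. In the variable z = 4κx only ε = 1/(64 κ²) remains in this equation, so the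
power series coefficients expand in ε. The constants in front are Gamma quotients whose arguments
are placed symmetrically with respect to κ, and they too expand in κ^(-2). This is the reason for
the shift in N̂ and for the absence of a term of order 1/N. The first corrections can be written
through the limit functions p (of Bessel type), u = z p' and q (an antiderivative), and the relation
between r₀ and r₁ becomes a polynomial identity in p, u, q. It holds separately for the quadratic
and the linear term, hence for both ensembles (`hasDerivAt_edgeDeriv`).

Idea of part (ii). At ξ = 0 the generating function is 1, which forces p₀ = 0. Its ξ-derivative at 0
is minus the mean number of eigenvalues, so the ξ-derivatives of the two terms of the expansion are
antiderivatives of -r₀ and -r₁ (`deriv_genFun_sub`). The assumed differential relation passes to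
these ξ-derivatives (`deriv_correction_eq`); as no joint regularity is available, this is done in
weak form, against polynomial test functions. By part (i) the operator in the conclusion, applied to
an antiderivative of r₀, is an antiderivative of r₁. Subtracting, (p₂ + 2y²/3) r₀' + (p₁ + (y² +
(a²-1)y)/6) r₀ is constant.

It remains to see that r₀ solves no first order linear equation with polynomial coefficients and
constant right side (`eq_zero_of_hardEdgeLimit`). The equation is continued analytically to the
negative axis. There the series have positive coefficients: the Euler derivative of the continued
function grows faster than every power, because a Cauchy-Schwarz defect is bounded below as a
variance, while the function itself grows more slowly than every exponential. A nontrivial equation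
would enforce growth at most polynomial or at least exponential (`eq_zero_of_intermediate_growth`).
-/

noncomputable section

/-! ### Laguerre polynomials and their orthogonality. -/

open Polynomial in
/-- The Laguerre polynomials `L_n^{(α)}`. -/
def laguerre : ℕ → ℝ → ℝ[X]
  | 0, _ => 1
  | n + 1, α => C (1 / ((n : ℝ) + 1)) *
      (C ((n : ℝ) + 1 + α) * laguerre n α - X * laguerre n (α + 1))

namespace laguerre
open Polynomial

theorem zero_eq (α : ℝ) : laguerre 0 α = 1 := by rw [laguerre]

theorem succ_mul (n : ℕ) (α : ℝ) :
    C ((n : ℝ) + 1) * laguerre (n + 1) α =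
      C ((n : ℝ) + 1 + α) * laguerre n α - X * laguerre n (α + 1) := by
  rw [laguerre, ← mul_assoc, ← C_mul, mul_one_div_cancel (by positivity), C_1, one_mul]

theorem C_succ_ne (n : ℕ) : (C ((n : ℝ) + 1) : ℝ[X]) ≠ 0 :=
  C_ne_zero.2 (by positivity)

/-- The defining recursion raises the parameter instead of linking three degrees, so the induction
needs its hypothesis at both `α` and `α + 1`. -/
theorem succ_sub (n : ℕ) (α : ℝ) :
    laguerre (n + 1) α = laguerre (n + 1) (α + 1) - laguerre n (α + 1) := by
  induction n generalizing α with
  | zero =>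
    have h1 := succ_mul 0 α
    have h2 := succ_mul 0 (α + 1)
    simp only [zero_eq, Nat.cast_zero, zero_add, C_1, one_mul, C_add] at h1 h2 ⊢
    rw [h1, h2]; ring
  | succ n ih =>
    have h1 := succ_mul (n + 1) α
    have h2 := succ_mul (n + 1) (α + 1)
    have h3 := succ_mul n (α + 1)
    have i1 := ih α
    have i2 := ih (α + 1)
    apply mul_left_cancel₀ (C_succ_ne (n + 1))
    push_cast [C_add, C_1] at h1 h2 h3 i1 i2 ⊢
    linear_combination h1 - h2 + (C (n : ℝ) + 1 + 1 + C α) * i1 + X * (-i2) + h3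

theorem derivative_succ (n : ℕ) (α : ℝ) :
    derivative (laguerre (n + 1) α) = -laguerre n (α + 1) := by
  induction n generalizing α with
  | zero =>
    have h1 := succ_mul 0 α
    simp only [zero_eq, Nat.cast_zero, zero_add, C_1, one_mul, C_add] at h1 ⊢
    rw [h1]; simp
  | succ n ih =>
    have h1 := congrArg derivative (succ_mul (n + 1) α)
    have h3 := succ_mul n (α + 1)
    have i1 := ih α
    have i2 := ih (α + 1)
    apply mul_left_cancel₀ (C_succ_ne (n + 1))
    simp only [derivative_mul, derivative_sub, derivative_C, derivative_X, zero_mul, zero_add,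
      one_mul] at h1
    rw [i1, i2] at h1
    push_cast [C_add, C_1] at h1 h3 ⊢
    linear_combination h1 + h3

/-- The first order relation between `L_{n+1}` and `L_n`. -/
theorem X_mul_derivative (n : ℕ) (α : ℝ) :
    X * derivative (laguerre (n + 1) α) =
      C ((n : ℝ) + 1) * laguerre (n + 1) α - C ((n : ℝ) + 1 + α) * laguerre n α := by
  rw [derivative_succ, succ_mul]; ring

/-- The raising relation. -/
theorem raising (n : ℕ) (α : ℝ) :
    X * derivative (laguerre n (α + 1)) + (C (α + 1) - X) * laguerre n (α + 1) =
      C ((n : ℝ) + 1) * laguerre (n + 1) α := by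
  cases n with
  | zero =>
    rw [succ_mul]
    simp only [zero_eq, derivative_one, Nat.cast_zero, C_add, C_1, C_0]; ring
  | succ n =>
    rw [succ_mul, X_mul_derivative, succ_sub n α]
    push_cast [C_add, C_1]; ring

/-- `2xL_k' + (a+1-x)L_k = (k+1)L_{k+1} - (k+a)L_{k-1}`. -/
theorem three_term_derivative (n : ℕ) (α : ℝ) :
    2 * X * derivative (laguerre (n + 1) α) + (C (α + 1) - X) * laguerre (n + 1) α =
      C ((n : ℝ) + 2) * laguerre (n + 2) α - C ((n : ℝ) + 1 + α) * laguerre n α := by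
  have h1 := X_mul_derivative n α
  have h2 := succ_mul (n + 1) α
  have h3 := succ_sub n α
  have h4 := derivative_succ n α
  push_cast [C_add, C_1] at h1 h2 h3 ⊢
  have e2 : (C 2 : ℝ[X]) = 1 + 1 := by rw [← C_1, ← C_add]; norm_num
  rw [e2]
  rw [h4] at h1 ⊢
  linear_combination h1 - h2 - X * h3

theorem natDegree_le (n : ℕ) (α : ℝ) : (laguerre n α).natDegree ≤ n := by
  induction n generalizing α with
  | zero => simp [zero_eq]
  | succ n ih =>
    rw [laguerre]
    refine (natDegree_C_mul_le _ _).trans ((natDegree_sub_le _ _).trans (max_le ?_ ?_))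
    · exact (natDegree_C_mul_le _ _).trans ((ih α).trans (Nat.le_succ n))
    · refine natDegree_mul_le.trans ?_
      have := ih (α + 1)
      have h : (X : ℝ[X]).natDegree ≤ 1 := natDegree_X_le
      omega

end laguerre

open Polynomial in
/-- The moment functional `p ↦ ∫₀^∞ p(x) x^α e^{-x} dx`. -/
def gammaFunctional (α : ℝ) : ℝ[X] →ₗ[ℝ] ℝ :=
  Polynomial.lsum fun k => Real.Gamma (α + k + 1) • LinearMap.id

namespace gammaFunctional
open Polynomial

theorem monomial_eq (α : ℝ) (k : ℕ) (c : ℝ) :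
    gammaFunctional α (monomial k c) = Real.Gamma (α + k + 1) * c := by
  rw [gammaFunctional, lsum_apply, sum_monomial_index] <;> simp

theorem monomial_integrable {α : ℝ} (hα : -1 < α) (k : ℕ) (c : ℝ) :
    IntegrableOn (fun x : ℝ => (monomial k c).eval x * (x ^ α * Real.exp (-x))) (Ioi 0) ∧
    ∫ x in Ioi (0 : ℝ), (monomial k c).eval x * (x ^ α * Real.exp (-x)) =
      Real.Gamma (α + k + 1) * c := by
  have hs : 0 < α + k + 1 := by have : (0 : ℝ) ≤ k := k.cast_nonneg; linarith
  have key : EqOn (fun x : ℝ => c * (Real.exp (-x) * x ^ (α + k + 1 - 1)))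
      (fun x => (monomial k c).eval x * (x ^ α * Real.exp (-x))) (Ioi 0) := by
    intro x hx
    have hx : 0 < x := hx
    simp only [eval_monomial]
    rw [show α + k + 1 - 1 = α + k by ring, Real.rpow_add hx, Real.rpow_natCast]; ring
  have hI : IntegrableOn (fun x : ℝ => c * (Real.exp (-x) * x ^ (α + k + 1 - 1))) (Ioi 0) :=
    (Real.GammaIntegral_convergent hs).const_mul c
  refine ⟨hI.congr_fun key measurableSet_Ioi, ?_⟩
  rw [← setIntegral_congr_fun measurableSet_Ioi key, integral_const_mul,
    ← Real.Gamma_eq_integral hs, mul_comm]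

theorem integrable_and_eq {α : ℝ} (hα : -1 < α) (p : ℝ[X]) :
    IntegrableOn (fun x : ℝ => p.eval x * (x ^ α * Real.exp (-x))) (Ioi 0) ∧
    ∫ x in Ioi (0 : ℝ), p.eval x * (x ^ α * Real.exp (-x)) = gammaFunctional α p := by
  induction p using Polynomial.induction_on' with
  | add p q hp hq =>
    simp only [eval_add, add_mul, map_add]
    exact ⟨hp.1.add hq.1, by rw [integral_add hp.1 hq.1, hp.2, hq.2]⟩
  | monomial k c => rw [monomial_eq]; exact monomial_integrable hα k c

theorem X_mul (α : ℝ) (p : ℝ[X]) : gammaFunctional α (X * p) = gammaFunctional (α + 1) p := by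
  induction p using Polynomial.induction_on' with
  | add p q hp hq => rw [mul_add, map_add, map_add, hp, hq]
  | monomial k c =>
    rw [X_mul_monomial, monomial_eq, monomial_eq]; push_cast; congr 2; ring

/-- The algebraic form of ∫ (x^(α+1) e^(-x) p)' = 0; on monomials it is the functional equation of
Gamma. -/
theorem by_parts {α : ℝ} (hα : -1 < α) (p : ℝ[X]) :
    gammaFunctional α (X * derivative p + (C (α + 1) - X) * p) = 0 := by
  induction p using Polynomial.induction_on' with
  | add p q hp hq =>
    have e := congrArg₂ (· + ·) hp hq
    simp only [← map_add, add_zero] at e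
    rw [← e, derivative_add]
    congr 1; ring
  | monomial k c =>
    have hs : α + k + 1 ≠ 0 := by have : (0 : ℝ) ≤ k := k.cast_nonneg; linarith
    have e : X * derivative (monomial k c) = monomial k (k * c : ℝ) := by
      cases k with
      | zero => simp
      | succ k => rw [derivative_monomial, X_mul_monomial]; simp [mul_comm]
    rw [e, sub_mul, C_mul_monomial, X_mul_monomial, map_add, map_sub, monomial_eq, monomial_eq,
      monomial_eq]
    push_cast
    rw [show α + (k + 1) + 1 = (α + k + 1) + 1 by ring, Real.Gamma_add_one hs]; ring

/-- The raising relation and integration by parts trade L_{n+1}^(α) for L_n^(α+1) at the cost of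
differentiating the other factor. As the derivative of L_{m+1}^(α) is -L_m^(α+1), both degrees drop
by one while the parameter rises, and the induction closes. -/
theorem laguerre_orthogonal {α : ℝ} (hα : -1 < α) (m n : ℕ) :
    gammaFunctional α (laguerre m α * laguerre n α) =
      if m = n then Real.Gamma (n + α + 1) / n.factorial else 0 := by
  have step : ∀ {α : ℝ}, -1 < α → ∀ (f : ℝ[X]) (n : ℕ),
      ((n : ℝ) + 1) * gammaFunctional α (f * laguerre (n + 1) α) =
        -gammaFunctional (α + 1) (derivative f * laguerre n (α + 1)) := by
    intro α hα f n
    have h := by_parts hα (f * laguerre n (α + 1))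
    rw [← X_mul, ← smul_eq_mul, ← map_smul, smul_eq_C_mul, eq_neg_iff_add_eq_zero, ← map_add, ← h]
    congr 1
    rw [derivative_mul]
    linear_combination -f * laguerre.raising n α
  have zero : ∀ {α : ℝ}, -1 < α → ∀ n : ℕ, gammaFunctional α (laguerre (n + 1) α) = 0 := by
    intro α hα n
    have := step hα 1 n
    rw [one_mul, derivative_one, zero_mul, map_zero, neg_zero] at this
    exact (mul_eq_zero.1 this).resolve_left (by positivity)
  induction n generalizing m α with
  | zero =>
    cases m with
    | zero =>
      have h := monomial_eq α 0 1
      rw [monomial_zero_left, C_1] at h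
      rw [laguerre.zero_eq, mul_one, h]; simp
    | succ m => simp [laguerre.zero_eq, zero hα m]
  | succ n ih =>
    cases m with
    | zero => simp [laguerre.zero_eq, zero hα n]
    | succ m =>
      have h := step hα (laguerre (m + 1) α) n
      rw [laguerre.derivative_succ, neg_mul, map_neg, neg_neg, ih (by linarith) m] at h
      have hn : (n : ℝ) + 1 ≠ 0 := by positivity
      by_cases hmn : m = n
      · subst hmn
        simp only [if_true] at h ⊢
        rw [eq_div_iff (by positivity)] at h ⊢
        rw [Nat.factorial_succ]; push_cast
        rw [show (m : ℝ) + 1 + α + 1 = m + (α + 1) + 1 by ring, ← h]; ring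
      · simpa [hmn, hn] using h

end gammaFunctional

/-! ### Polarised Pfaffians over paired indices. -/

set_option linter.unusedSectionVars false

/-- An index set consisting of pairs, labelled by `J`, and of unpaired elements `R`. -/
abbrev PairIndex (J R : Type) := (J ⊕ J) ⊕ R

namespace PairIndex
variable {J R : Type}

/-- The partner of an index. -/
def star : PairIndex J R → PairIndex J R
  | .inl (.inl j) => .inl (.inr j)
  | .inl (.inr j) => .inl (.inl j)
  | .inr r => .inr r

@[simp] theorem star_star (a : PairIndex J R) : star (star a) = a := by
  rcases a with (j | j) | r <;> rfl

theorem star_ne (a : J ⊕ J) : star (.inl a : PairIndex J R) ≠ .inl a := by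
  rcases a with j | j <;> simp [star]

/-- The element of the pair `j` selected by a boolean. -/
def block (j : J) : Bool → PairIndex J R
  | false => .inl (.inl j)
  | true => .inl (.inr j)

/-- The index set as a sum of a product. -/
def blockEquiv : (J × Bool) ⊕ R ≃ PairIndex J R where
  toFun := Sum.elim (fun p => block p.1 p.2) Sum.inr
  invFun := fun a => match a with
    | .inl (.inl j) => .inl (j, false)
    | .inl (.inr j) => .inl (j, true)
    | .inr r => .inr r
  left_inv := by rintro (⟨j, _ | _⟩ | r) <;> rfl
  right_inv := by rintro ((j | j) | r) <;> rfl

variable [Fintype J] [DecidableEq J] [Fintype R] [DecidableEq R]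

/-- The product of the values of the form `A` along the pairs and of `ℓ` along the single indices,
after the permutation `τ`. -/
def pairProd (A : PairIndex J R → PairIndex J R → ℝ) (l : PairIndex J R → ℝ)
    (τ : Equiv.Perm (PairIndex J R)) : ℝ :=
  (∏ j, A (τ (.inl (.inl j))) (τ (.inl (.inr j)))) * ∏ r, l (τ (.inr r))

/-- The signed sum of `pairProd`, a polarised Pfaffian. -/
def pairSum (A : PairIndex J R → PairIndex J R → ℝ) (l : PairIndex J R → ℝ) : ℝ :=
  ∑ τ : Equiv.Perm (PairIndex J R), ((τ.sign : ℤ) : ℝ) * pairProd A l τ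

/-- `A` is a skew form which is nondegenerate on every pair, with all other entries zero, and `ℓ`
is nonzero on the unpaired indices only (if there are any). -/
structure IsBlock (A : PairIndex J R → PairIndex J R → ℝ) (l : PairIndex J R → ℝ) : Prop where
  anti : ∀ a b, A b a = -A a b
  eq_star : ∀ a b, A a b ≠ 0 → b = star a ∧ a.isLeft
  pair_ne : ∀ j, A (.inl (.inl j)) (.inl (.inr j)) ≠ 0
  l_left : ∀ (_ : R) a, l (.inl a) = 0
  l_right : ∀ r, l (.inr r) ≠ 0

namespace IsBlock
variable {A : PairIndex J R → PairIndex J R → ℝ} {l : PairIndex J R → ℝ}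

theorem star_ne_zero (h : IsBlock A l) (a : J ⊕ J) : A (.inl a) (star (.inl a)) ≠ 0 := by
  rcases a with j | j
  · exact h.pair_ne j
  · rw [star, h.anti]; exact neg_ne_zero.2 (h.pair_ne j)

theorem isRight (h : IsBlock A l) (r : R) {a : PairIndex J R} (ha : l a ≠ 0) : a.isRight := by
  rcases a with a | r
  · exact absurd (h.l_left r a) ha
  · rfl

/-- Nonzero factors `l` force `τ` to map the unpaired indices into themselves. Injectivity on a
finite set makes this map onto, so no paired index can land there. -/
theorem isLeft_of_ne_zero (h : IsBlock A l) {τ : Equiv.Perm (PairIndex J R)}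
    (hl : ∀ r, l (τ (.inr r)) ≠ 0) (a : J ⊕ J) : (τ (.inl a)).isLeft := by
  by_contra hc
  obtain ⟨r, hr⟩ := Sum.isRight_iff.1 (Sum.not_isLeft.1 (by simpa using hc))
  have hmap : ∀ r, ∃ r', τ (.inr r) = .inr r' := fun r => Sum.isRight_iff.1 (h.isRight r (hl r))
  choose f hf using hmap
  have hinj : Function.Injective f := fun r₁ r₂ h12 => by
    have : τ (.inr r₁) = τ (.inr r₂) := by rw [hf, hf, h12]
    simpa using this
  obtain ⟨r', hr'⟩ := (Finite.injective_iff_surjective.1 hinj) r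
  have : τ (.inl a) = τ (.inr r') := by rw [hr, hf, hr']
  simp at this

/-- If the product over all pairs but one is nonzero, the remaining indices form a pair. -/
theorem eq_star_of_ne_zero (h : IsBlock A l) {τ : Equiv.Perm (PairIndex J R)} {j : J}
    (hA : ∀ j', j' ≠ j → A (τ (.inl (.inl j'))) (τ (.inl (.inr j'))) ≠ 0)
    (hl : ∀ r, l (τ (.inr r)) ≠ 0) :
    τ (.inl (.inr j)) = star (τ (.inl (.inl j))) ∧ (τ (.inl (.inl j))).isLeft := by
  have hleft := h.isLeft_of_ne_zero hl (.inl j)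
  refine ⟨?_, hleft⟩
  obtain ⟨a, ha⟩ := Sum.isLeft_iff.1 hleft
  obtain ⟨t, ht⟩ := τ.surjective (star (τ (.inl (.inl j))))
  have hstarleft : (star (τ (.inl (.inl j)))).isLeft := by
    rw [ha]; rcases a with i | i <;> rfl
  rcases t with (j' | j') | r
  · by_cases hj : j' = j
    · subst hj
      rw [ha] at ht
      exact absurd ht.symm (star_ne a)
    · have := (h.eq_star _ _ (hA j' hj)).1
      rw [ht, star_star] at this
      simp at this
  · by_cases hj : j' = j
    · subst hj; exact ht
    · have := (h.eq_star _ _ (hA j' hj)).1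
      rw [ht] at this
      have := congrArg star this
      rw [star_star, star_star] at this
      simp only [EmbeddingLike.apply_eq_iff_eq, Sum.inl.injEq] at this
      exact absurd this.symm hj
  · have h1 := h.isRight r (hl r)
    rw [ht] at h1
    simp [Sum.isRight_iff, Sum.isLeft_iff] at h1 hstarleft
    obtain ⟨y, hy⟩ := h1; rw [hy] at hstarleft; simp at hstarleft

/-- A permutation with nonzero product permutes the blocks and flips some of them. The block
permutation moves both members at once, so its sign enters squared; every flip costs -1 in the sign
of `τ` and -1 in `A`, and these cancel. -/
theorem sign_mul_pairProd [Subsingleton R] (h : IsBlock A l) (τ : Equiv.Perm (PairIndex J R))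
    (hτ : pairProd A l τ ≠ 0) :
    ((τ.sign : ℤ) : ℝ) * pairProd A l τ = pairProd A l 1 := by
  have hne := mul_ne_zero_iff.1 hτ
  have hA : ∀ j, A (τ (.inl (.inl j))) (τ (.inl (.inr j))) ≠ 0 := fun j =>
    Finset.prod_ne_zero_iff.1 hne.1 j (Finset.mem_univ _)
  have hl : ∀ r, l (τ (.inr r)) ≠ 0 := fun r =>
    Finset.prod_ne_zero_iff.1 hne.2 r (Finset.mem_univ _)
  have hR : ∀ r, τ (.inr r) = .inr r := fun r => by
    obtain ⟨r', hr'⟩ := Sum.isRight_iff.1 (h.isRight r (hl r))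
    rw [hr', Subsingleton.elim r' r]
  have hex : ∀ j, ∃ p : J × Bool, τ (.inl (.inl j)) = block p.1 p.2 := fun j => by
    obtain ⟨a, ha⟩ := Sum.isLeft_iff.1 (h.eq_star _ _ (hA j)).2
    rcases a with i | i
    · exact ⟨(i, false), ha⟩
    · exact ⟨(i, true), ha⟩
  choose p hp using hex
  have hp' : ∀ j, τ (.inl (.inr j)) = block (p j).1 (!(p j).2) := fun j => by
    rw [(h.eq_star _ _ (hA j)).1, hp]
    cases (p j).2 <;> rfl
  -- Two pairs in one block would share an element: their first members coincide, or the first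
  -- member of one is the second of the other.
  have hinj : Function.Injective fun j => (p j).1 := by
    intro j₁ j₂ h12
    simp only at h12
    by_cases hb : (p j₁).2 = (p j₂).2
    · have : τ (.inl (.inl j₁)) = τ (.inl (.inl j₂)) := by rw [hp, hp, h12, hb]
      simpa using this
    · have : τ (.inl (.inl j₁)) = τ (.inl (.inr j₂)) := by
        rw [hp, hp', h12]; congr 1; revert hb; cases (p j₁).2 <;> cases (p j₂).2 <;> simp
      simp at this
  let π : Equiv.Perm J := Equiv.ofBijective _ (Finite.injective_iff_bijective.1 hinj)
  let fl : J → Equiv.Perm Bool := fun j => if (p j).2 then Equiv.swap false true else 1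
  let ρ : Equiv.Perm (J × Bool) :=
    Equiv.prodCongrLeft (fun _ : Bool => π) * Equiv.prodCongrRight fl
  have hτρ : τ = blockEquiv.permCongr (Equiv.sumCongr ρ (1 : Equiv.Perm R)) := by
    ext a
    have hρ : ∀ j b, ρ (j, b) = ((p j).1, xor (p j).2 b) := by
      intro j b
      simp only [ρ, fl, Equiv.Perm.mul_apply, Equiv.prodCongrRight_apply,
        Equiv.prodCongrLeft_apply, π, Equiv.ofBijective_apply]
      congr 1
      cases (p j).2 <;> cases b <;> simp
    rw [Equiv.permCongr_apply]
    rcases a with (j | j) | r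
    · rw [hp]
      change _ = blockEquiv (Sum.inl (ρ (j, false)))
      rw [hρ]; simp [blockEquiv]
    · rw [hp']
      change _ = blockEquiv (Sum.inl (ρ (j, true)))
      rw [hρ]; simp [blockEquiv]
    · rw [hR]; rfl
  have hsign : ((τ.sign : ℤ) : ℝ) = ∏ j, (if (p j).2 then (-1 : ℝ) else 1) := by
    rw [hτρ, Equiv.Perm.sign_permCongr, Equiv.Perm.sign_sumCongr]
    simp only [ρ, Equiv.Perm.sign_mul, Equiv.Perm.sign_prodCongrLeft,
      Equiv.Perm.sign_prodCongrRight, Finset.prod_const, Finset.card_univ, Fintype.card_bool,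
      Int.units_sq, one_mul, Equiv.Perm.sign_one, mul_one]
    push_cast
    refine Finset.prod_congr rfl fun j _ => ?_
    simp only [fl]
    split_ifs <;> simp
  have hprod : pairProd A l τ =
      (∏ j, (if (p j).2 then (-1 : ℝ) else 1)) * pairProd A l 1 := by
    have h1 : pairProd A l 1 = (∏ j, A (.inl (.inl j)) (.inl (.inr j))) * ∏ r, l (.inr r) := rfl
    have h2 : ∏ j, A (.inl (.inl j)) (.inl (.inr j)) =
        ∏ j, A (.inl (.inl (π j))) (.inl (.inr (π j))) :=
      (Equiv.prod_comp π fun j => A (.inl (.inl j)) (.inl (.inr j))).symm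
    rw [h1, h2, ← mul_assoc, ← Finset.prod_mul_distrib]
    simp only [pairProd, hR]
    congr 1
    refine Finset.prod_congr rfl fun j _ => ?_
    rw [hp, hp']
    simp only [π, Equiv.ofBijective_apply]
    cases (p j).2
    · simp [block]
    · simp only [block, Bool.not_true, if_true]
      rw [h.anti]; ring
  rw [hsign, hprod, ← mul_assoc, ← Finset.prod_mul_distrib]
  rw [Finset.prod_eq_one, one_mul]
  intro j _
  split_ifs <;> norm_num

/-- All nonvanishing terms agree with the term of the identity, so nothing can cancel. -/
theorem pairSum_ne_zero [Subsingleton R] (h : IsBlock A l) : pairSum A l ≠ 0 := by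
  have h1 : pairProd A l 1 ≠ 0 :=
    mul_ne_zero (Finset.prod_ne_zero_iff.2 fun j _ => h.pair_ne j)
      (Finset.prod_ne_zero_iff.2 fun r _ => h.l_right r)
  classical
  have : pairSum A l =
      ((Finset.univ.filter fun τ => pairProd A l τ ≠ 0).card : ℝ) * pairProd A l 1 := by
    rw [pairSum, ← nsmul_eq_mul, ← Finset.sum_const, Finset.sum_filter]
    refine Finset.sum_congr rfl fun τ _ => ?_
    split_ifs with hτ
    · exact h.sign_mul_pairProd τ hτ
    · rw [not_not.1 hτ, mul_zero]
  rw [this]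
  refine mul_ne_zero (Nat.cast_ne_zero.2 (Finset.card_ne_zero.2 ⟨1, ?_⟩)) h1
  simpa using h1

/-- Replacing the form at one pair by `B` multiplies every term of the sum by a ratio. -/
theorem mul_erase_eq (h : IsBlock A l) (B : PairIndex J R → PairIndex J R → ℝ)
    (τ : Equiv.Perm (PairIndex J R)) (j : J) :
    B (τ (.inl (.inl j))) (τ (.inl (.inr j))) *
        ((∏ j' ∈ Finset.univ.erase j, A (τ (.inl (.inl j'))) (τ (.inl (.inr j')))) *
          ∏ r, l (τ (.inr r))) =
      pairProd A l τ * (B (τ (.inl (.inl j))) (star (τ (.inl (.inl j)))) /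
        A (τ (.inl (.inl j))) (star (τ (.inl (.inl j))))) := by
  rw [pairProd, ← Finset.mul_prod_erase _ _ (Finset.mem_univ j)]
  set rest := (∏ j' ∈ Finset.univ.erase j, A (τ (.inl (.inl j'))) (τ (.inl (.inr j')))) *
          ∏ r, l (τ (.inr r)) with hrest
  rw [mul_assoc _ (∏ j' ∈ Finset.univ.erase j, _), ← hrest]
  by_cases h0 : rest = 0
  · rw [h0]; ring
  · have hne := mul_ne_zero_iff.1 h0
    obtain ⟨h1, h2⟩ := h.eq_star_of_ne_zero (τ := τ) (j := j)
      (fun j' hj' => Finset.prod_ne_zero_iff.1 hne.1 j' (by simpa using hj'))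
      (fun r => Finset.prod_ne_zero_iff.1 hne.2 r (Finset.mem_univ _))
    obtain ⟨a, ha⟩ := Sum.isLeft_iff.1 h2
    have := h.star_ne_zero a
    rw [h1, ha]
    field_simp

end IsBlock
end PairIndex

/-! ### Integration over paired coordinates and the sign kernel. -/

set_option linter.unusedSectionVars false

namespace PairIndex
variable {J R : Type} [Fintype J] [DecidableEq J] [Fintype R] [DecidableEq R]

/-- The measurable equivalence splitting the coordinates into pairs and single coordinates. -/
def splitEquiv : (PairIndex J R → ℝ) ≃ᵐ (J → ℝ × ℝ) × (R → ℝ) :=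
  (MeasurableEquiv.sumPiEquivProdPi fun _ : PairIndex J R => ℝ).trans
    (MeasurableEquiv.prodCongr
      ((MeasurableEquiv.sumPiEquivProdPi fun _ : J ⊕ J => ℝ).trans
        (MeasurableEquiv.arrowProdEquivProdArrow ℝ ℝ J).symm) (MeasurableEquiv.refl _))

theorem splitEquiv_measurePreserving (μ : PairIndex J R → Measure ℝ) [∀ i, SigmaFinite (μ i)] :
    MeasurePreserving (splitEquiv (J := J) (R := R)) (Measure.pi μ)
      ((Measure.pi fun j => (μ (.inl (.inl j))).prod (μ (.inl (.inr j)))).prod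
        (Measure.pi fun r => μ (.inr r))) := by
  have h1 := measurePreserving_sumPiEquivProdPi μ
  have h2 := measurePreserving_sumPiEquivProdPi fun a : J ⊕ J => μ (.inl a)
  have h3 := (measurePreserving_arrowProdEquivProdArrow ℝ ℝ J (fun j => μ (.inl (.inl j)))
    fun j => μ (.inl (.inr j))).symm
  exact ((h3.comp h2).prod (MeasurePreserving.id _)).comp h1

theorem pairs_integral (μ : PairIndex J R → Measure ℝ) [∀ i, SigmaFinite (μ i)]
    (f : J → ℝ × ℝ → ℝ) (g : R → ℝ → ℝ) :
    ∫ y, (∏ j, f j (y (.inl (.inl j)), y (.inl (.inr j)))) * ∏ r, g r (y (.inr r)) ∂Measure.pi μ =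
      (∏ j, ∫ p, f j p ∂(μ (.inl (.inl j))).prod (μ (.inl (.inr j)))) *
        ∏ r, ∫ t, g r t ∂μ (.inr r) := by
  have h := (splitEquiv_measurePreserving μ).integral_comp'
    (g := fun q : (J → ℝ × ℝ) × (R → ℝ) => (∏ j, f j (q.1 j)) * ∏ r, g r (q.2 r))
  rw [integral_prod_mul (fun q : J → ℝ × ℝ => ∏ j, f j (q j)) (fun q : R → ℝ => ∏ r, g r (q r)),
    integral_fintype_prod_eq_prod, integral_fintype_prod_eq_prod] at h
  exact h

theorem pairs_integrable (μ : PairIndex J R → Measure ℝ) [∀ i, SigmaFinite (μ i)]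
    (f : J → ℝ × ℝ → ℝ) (g : R → ℝ → ℝ)
    (hf : ∀ j, Integrable (f j) ((μ (.inl (.inl j))).prod (μ (.inl (.inr j)))))
    (hg : ∀ r, Integrable (g r) (μ (.inr r))) :
    Integrable (fun y => (∏ j, f j (y (.inl (.inl j)), y (.inl (.inr j)))) *
      ∏ r, g r (y (.inr r))) (Measure.pi μ) := by
  have h := (splitEquiv_measurePreserving μ).integrable_comp_emb
    splitEquiv.measurableEmbedding
    (g := fun q : (J → ℝ × ℝ) × (R → ℝ) => (∏ j, f j (q.1 j)) * ∏ r, g r (q.2 r))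
  exact h.2 ((Integrable.fintype_prod_dep hf).mul_prod (Integrable.fintype_prod hg))

end PairIndex

theorem measurable_real_sign : Measurable Real.sign := by
  unfold Real.sign
  exact Measurable.ite measurableSet_Iio measurable_const
    (Measurable.ite measurableSet_Ioi measurable_const measurable_const)

theorem abs_real_sign_le (t : ℝ) : |Real.sign t| ≤ 1 := by
  rcases Real.sign_apply_eq t with h | h | h <;> rw [h] <;> norm_num

theorem integrable_mul_sign {μ ν : Measure ℝ} [SigmaFinite μ] [SigmaFinite ν] {f g : ℝ → ℝ}
    (hf : Integrable f μ) (hg : Integrable g ν) :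
    Integrable (fun p : ℝ × ℝ => f p.1 * g p.2 * Real.sign (p.2 - p.1)) (μ.prod ν) :=
  (hf.mul_prod hg).mul_bdd
    (measurable_real_sign.comp (measurable_snd.sub measurable_fst)).aestronglyMeasurable
    (Eventually.of_forall fun _ => (abs_real_sign_le _ : ‖_‖ ≤ (1 : ℝ)))

/-- The skew form `∬ f(x) g(y) sgn(y - x)`. -/
def signForm (f g : ℝ → ℝ) : ℝ :=
  ∫ p : ℝ × ℝ, f p.1 * g p.2 * Real.sign (p.2 - p.1)

/-- The function `x ↦ ∫ g(y) sgn(y - x) dy`. -/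
def signInt (g : ℝ → ℝ) (x : ℝ) : ℝ := ∫ y, g y * Real.sign (y - x)

theorem signForm_anti (f g : ℝ → ℝ) : signForm g f = -signForm f g := by
  unfold signForm
  rw [← integral_neg, Measure.volume_eq_prod, ← integral_prod_swap]
  refine integral_congr_ae (Eventually.of_forall fun p => ?_)
  simp only [Prod.fst_swap, Prod.snd_swap]
  rw [← neg_sub p.2 p.1, Real.sign_neg]; ring

theorem signForm_eq {f g : ℝ → ℝ} (hf : Integrable f) (hg : Integrable g) :
    signForm f g = ∫ x, f x * signInt g x := by
  unfold signForm signInt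
  rw [Measure.volume_eq_prod, integral_prod _ (integrable_mul_sign hf hg)]
  refine integral_congr_ae (Eventually.of_forall fun x => ?_)
  simp only [mul_assoc]
  rw [integral_const_mul]

namespace PairIndex
variable {J R : Type} [Fintype J] [DecidableEq J] [Fintype R] [DecidableEq R]

/-- The determinant of a family of functions, times the signs of the differences along pairs. -/
def signDet (φ : PairIndex J R → ℝ → ℝ) (y : PairIndex J R → ℝ) : ℝ :=
  (Matrix.of fun a i => φ a (y i)).det *
    ∏ j, Real.sign (y (.inl (.inr j)) - y (.inl (.inl j)))

/-- In the Leibniz expansion the signs attach to the pairs, so that every term is a product over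
separate pairs and single coordinates and Fubini applies to it. -/
theorem signDet_eq (φ : PairIndex J R → ℝ → ℝ) (y : PairIndex J R → ℝ) :
    signDet φ y = ∑ τ : Equiv.Perm (PairIndex J R), ((τ.sign : ℤ) : ℝ) *
      ((∏ j, (fun p : ℝ × ℝ => φ (τ (.inl (.inl j))) p.1 * φ (τ (.inl (.inr j))) p.2 *
        Real.sign (p.2 - p.1)) (y (.inl (.inl j)), y (.inl (.inr j)))) *
        ∏ r, φ (τ (.inr r)) (y (.inr r))) := by
  rw [signDet, Matrix.det_apply', Finset.sum_mul]
  refine Finset.sum_congr rfl fun τ _ => ?_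
  simp only [Matrix.of_apply, Fintype.prod_sum_type, Finset.prod_mul_distrib]
  ring

variable (φ : PairIndex J R → ℝ → ℝ) (μ : PairIndex J R → Measure ℝ) [∀ i, SigmaFinite (μ i)]

theorem signDet_integrable (h : ∀ a i, Integrable (φ a) (μ i)) :
    Integrable (signDet φ) (Measure.pi μ) := by
  simp only [funext (signDet_eq φ)]
  exact integrable_finsetSum _ fun τ _ => (pairs_integrable μ _ _
    (fun j => integrable_mul_sign (h _ _) (h _ _)) fun r => h _ _).const_mul _

theorem signDet_integral (h : ∀ a i, Integrable (φ a) (μ i)) :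
    ∫ y, signDet φ y ∂Measure.pi μ = ∑ τ : Equiv.Perm (PairIndex J R), ((τ.sign : ℤ) : ℝ) *
      ((∏ j, ∫ p : ℝ × ℝ, φ (τ (.inl (.inl j))) p.1 * φ (τ (.inl (.inr j))) p.2 *
        Real.sign (p.2 - p.1) ∂(μ (.inl (.inl j))).prod (μ (.inl (.inr j)))) *
        ∏ r, ∫ t, φ (τ (.inr r)) t ∂μ (.inr r)) := by
  simp only [funext (signDet_eq φ)]
  rw [integral_finsetSum]
  · refine Finset.sum_congr rfl fun τ _ => ?_
    rw [integral_const_mul]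
    exact congrArg _ (pairs_integral μ (fun j p => φ (τ (.inl (.inl j))) p.1 *
      φ (τ (.inl (.inr j))) p.2 * Real.sign (p.2 - p.1)) fun r => φ (τ (.inr r)))
  · exact fun τ _ => (pairs_integrable μ _ _
      (fun j => integrable_mul_sign (h _ _) (h _ _)) fun r => h _ _).const_mul _

/-- The quotient by which a pair sum changes when one variable is fixed at `x`. -/
def ratio (φ : PairIndex J R → ℝ → ℝ) (x : ℝ) : PairIndex J R → ℝ
  | .inl a => φ (.inl a) x * signInt (φ (star (.inl a))) x /
      signForm (φ (.inl a)) (φ (star (.inl a)))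
  | .inr r => φ (.inr r) x / ∫ t, φ (.inr r) t

theorem dirac_integral_fst (x : ℝ) {f g : ℝ → ℝ} (hg : Integrable g) :
    ∫ p : ℝ × ℝ, f p.1 * g p.2 * Real.sign (p.2 - p.1) ∂(Measure.dirac x).prod volume =
      f x * signInt g x := by
  rw [integral_prod _ (integrable_mul_sign (integrable_dirac (by simp)) hg),
    integral_dirac, signInt, ← integral_const_mul]
  simp only [mul_assoc]

theorem dirac_integral_snd (x : ℝ) {f g : ℝ → ℝ} (hf : Integrable f) :
    ∫ p : ℝ × ℝ, f p.1 * g p.2 * Real.sign (p.2 - p.1) ∂volume.prod (Measure.dirac x) =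
      -(g x * signInt f x) := by
  rw [integral_prod_symm _ (integrable_mul_sign hf (integrable_dirac (by simp))),
    integral_dirac, signInt, ← integral_const_mul, ← integral_neg]
  refine integral_congr_ae (Eventually.of_forall fun y => ?_)
  simp only
  rw [← neg_sub y x, Real.sign_neg]; ring

theorem signDet_integral_volume (hi : ∀ a, Integrable (φ a)) :
    ∫ y, signDet φ y = pairSum (fun a b => signForm (φ a) (φ b)) (fun a => ∫ t, φ a t) := by
  exact signDet_integral φ (fun _ => volume) fun a _ => hi a

/-- The integral with one variable fixed. -/
theorem signDet_integral_dirac [Subsingleton R] (hi : ∀ a, Integrable (φ a))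
    (hB : IsBlock (fun a b => signForm (φ a) (φ b)) (fun a => ∫ t, φ a t))
    (x : ℝ) (s : PairIndex J R) (μ : PairIndex J R → Measure ℝ) [∀ i, SigmaFinite (μ i)]
    (hs : μ s = Measure.dirac x) (hμ : ∀ i, i ≠ s → μ i = volume) :
    ∫ y, signDet φ y ∂Measure.pi μ = ∑ τ : Equiv.Perm (PairIndex J R), ((τ.sign : ℤ) : ℝ) *
      pairProd (fun a b => signForm (φ a) (φ b)) (fun a => ∫ t, φ a t) τ * ratio φ x (τ s) := by
  have hint : ∀ a i, Integrable (φ a) (μ i) := fun a i => by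
    by_cases h : i = s
    · rw [h, hs]; exact integrable_dirac (by simp)
    · rw [hμ i h]; exact hi a
  rw [signDet_integral φ μ hint]
  refine Finset.sum_congr rfl fun τ _ => ?_
  rw [mul_assoc]
  congr 1
  -- Only the factor containing the fixed variable changes. That variable is the first or the second
  -- member of a pair, or the unpaired one; in each case the support of the block form determines
  -- the partner, and the change is multiplication by `ratio`.
  rcases s with (j | j) | r
  · rw [← Finset.mul_prod_erase _ _ (Finset.mem_univ j), hs, hμ (.inl (.inr j)) (by simp),
      dirac_integral_fst x (hi _), mul_assoc]
    have key := hB.mul_erase_eq (fun a b => φ a x * signInt (φ b) x) τ j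
    have e1 : ∏ j' ∈ Finset.univ.erase j, (∫ p : ℝ × ℝ, φ (τ (.inl (.inl j'))) p.1 *
        φ (τ (.inl (.inr j'))) p.2 * Real.sign (p.2 - p.1)
          ∂(μ (.inl (.inl j'))).prod (μ (.inl (.inr j')))) =
        ∏ j' ∈ Finset.univ.erase j, signForm (φ (τ (.inl (.inl j')))) (φ (τ (.inl (.inr j')))) := by
      refine Finset.prod_congr rfl fun j' hj' => ?_
      rw [hμ _ (by simpa using Finset.ne_of_mem_erase hj'), hμ _ (by simp)]; rfl
    have e2 : ∏ r, ∫ t, φ (τ (.inr r)) t ∂μ (.inr r) = ∏ r, ∫ t, φ (τ (.inr r)) t :=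
      Finset.prod_congr rfl fun r _ => by rw [hμ _ (by simp)]
    rw [e1, e2, key]
    by_cases h0 : pairProd (fun a b => signForm (φ a) (φ b)) (fun a => ∫ t, φ a t) τ = 0
    · rw [h0]; ring
    · have hne := mul_ne_zero_iff.1 h0
      obtain ⟨a, ha⟩ := Sum.isLeft_iff.1 (hB.isLeft_of_ne_zero (τ := τ)
        (fun r => Finset.prod_ne_zero_iff.1 hne.2 r (Finset.mem_univ _)) (.inl j))
      rw [ha]; rfl
  · rw [← Finset.mul_prod_erase _ _ (Finset.mem_univ j), hs, hμ (.inl (.inl j)) (by simp),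
      dirac_integral_snd x (hi _), mul_assoc]
    have key := hB.mul_erase_eq (fun a b => -(φ b x * signInt (φ a) x)) τ j
    have e1 : ∏ j' ∈ Finset.univ.erase j, (∫ p : ℝ × ℝ, φ (τ (.inl (.inl j'))) p.1 *
        φ (τ (.inl (.inr j'))) p.2 * Real.sign (p.2 - p.1)
          ∂(μ (.inl (.inl j'))).prod (μ (.inl (.inr j')))) =
        ∏ j' ∈ Finset.univ.erase j, signForm (φ (τ (.inl (.inl j')))) (φ (τ (.inl (.inr j')))) := by
      refine Finset.prod_congr rfl fun j' hj' => ?_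
      rw [hμ (.inl (.inr j')) (by simpa using Finset.ne_of_mem_erase hj'), hμ _ (by simp)]; rfl
    have e2 : ∏ r, ∫ t, φ (τ (.inr r)) t ∂μ (.inr r) = ∏ r, ∫ t, φ (τ (.inr r)) t :=
      Finset.prod_congr rfl fun r _ => by rw [hμ _ (by simp)]
    rw [e1, e2, key]
    by_cases h0 : pairProd (fun a b => signForm (φ a) (φ b)) (fun a => ∫ t, φ a t) τ = 0
    · rw [h0]; ring
    · have hne := mul_ne_zero_iff.1 h0
      obtain ⟨h1, -⟩ := hB.eq_star_of_ne_zero (τ := τ) (j := j)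
        (fun j' _ => Finset.prod_ne_zero_iff.1 hne.1 j' (Finset.mem_univ _))
        (fun r => Finset.prod_ne_zero_iff.1 hne.2 r (Finset.mem_univ _))
      obtain ⟨a, ha⟩ := Sum.isLeft_iff.1 (hB.isLeft_of_ne_zero (τ := τ)
        (fun r => Finset.prod_ne_zero_iff.1 hne.2 r (Finset.mem_univ _)) (.inr j))
      -- The ratio is read here from the second member of the pair; antisymmetry turns the sign of
      -- numerator and denominator alike.
      have h2 : τ (.inl (.inl j)) = star (.inl a) := by rw [← ha, h1, star_star]
      rw [h2, star_star, ha]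
      simp only [ratio]
      rw [signForm_anti (φ (.inl a)), neg_div_neg_eq]
  · have e1 : (∏ j', (∫ p : ℝ × ℝ, φ (τ (.inl (.inl j'))) p.1 *
        φ (τ (.inl (.inr j'))) p.2 * Real.sign (p.2 - p.1)
          ∂(μ (.inl (.inl j'))).prod (μ (.inl (.inr j'))))) =
        ∏ j', signForm (φ (τ (.inl (.inl j')))) (φ (τ (.inl (.inr j')))) := by
      refine Finset.prod_congr rfl fun j' _ => ?_
      rw [hμ _ (by simp), hμ _ (by simp)]; rfl
    have hu : (Finset.univ : Finset R) = {r} := by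
      ext r'; simp [Subsingleton.elim r' r]
    rw [e1, pairProd, hu, Finset.prod_singleton, Finset.prod_singleton, hs, integral_dirac,
      mul_assoc]
    by_cases h0 : ∏ j', signForm (φ (τ (.inl (.inl j')))) (φ (τ (.inl (.inr j')))) = 0
    · rw [h0]; ring
    · congr 1
      -- If all pair factors are nonzero, `τ` maps the paired indices onto themselves, which leaves
      -- `r` fixed.
      have hr : τ (.inr r) = .inr r := by
        by_contra hc
        have hl : (τ (.inr r)).isLeft := by
          rcases hq : τ (.inr r) with a | r'
          · rfl
          · exact absurd (hq.trans (by rw [Subsingleton.elim r' r])) hc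
        have hmap : ∀ a : J ⊕ J, ∃ b, τ (.inl a) = .inl b := by
          intro a
          have hA : ∀ j', signForm (φ (τ (.inl (.inl j')))) (φ (τ (.inl (.inr j')))) ≠ 0 :=
            fun j' => Finset.prod_ne_zero_iff.1 h0 j' (Finset.mem_univ _)
          rcases a with j | j
          · exact Sum.isLeft_iff.1 (hB.eq_star _ _ (hA j)).2
          · refine Sum.isLeft_iff.1 (hB.eq_star _ (τ (.inl (.inl j))) ?_).2
            rw [signForm_anti]; exact neg_ne_zero.2 (hA j)
        choose f hf using hmap
        have hinj : Function.Injective f := fun a b hab => by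
          have : τ (.inl a) = τ (.inl b) := by rw [hf, hf, hab]
          simpa using this
        obtain ⟨b, hb⟩ := Sum.isLeft_iff.1 hl
        obtain ⟨a, ha⟩ := (Finite.injective_iff_surjective.1 hinj) b
        have : τ (.inr r) = τ (.inl a) := by rw [hb, hf, ha]
        simp at this
      rw [hr]
      simp only [ratio]
      rw [mul_div_cancel₀ _ (hB.l_right r)]

end PairIndex

/-! ### The density for β = 1 from a skew orthogonal basis. -/

/-- Reindexing of coordinates preserves product measures. -/
theorem measurePreserving_reindex {ι ι' : Type} [Fintype ι] [Fintype ι'] (f : ι ≃ ι')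
    (μ : ι' → Measure ℝ) [∀ i, SigmaFinite (μ i)] :
    MeasurePreserving (MeasurableEquiv.piCongrLeft (fun _ => ℝ) f).symm (Measure.pi μ)
      (Measure.pi fun i => μ (f i)) :=
  (measurePreserving_piCongrLeft μ f).symm

theorem integral_reindex {ι ι' : Type} [Fintype ι] [Fintype ι'] (f : ι ≃ ι')
    (μ : ι' → Measure ℝ) [∀ i, SigmaFinite (μ i)] (F : (ι → ℝ) → ℝ) :
    ∫ y, F (fun i => y (f i)) ∂Measure.pi μ = ∫ y, F y ∂Measure.pi fun i => μ (f i) :=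
  (measurePreserving_reindex f μ).integral_comp' (g := F)

theorem integrable_reindex {ι ι' : Type} [Fintype ι] [Fintype ι'] (f : ι ≃ ι')
    (μ : ι' → Measure ℝ) [∀ i, SigmaFinite (μ i)] {F : (ι → ℝ) → ℝ}
    (hF : Integrable F (Measure.pi fun i => μ (f i))) :
    Integrable (fun y => F (fun i => y (f i))) (Measure.pi μ) :=
  ((measurePreserving_reindex f μ).integrable_comp_emb
    (MeasurableEquiv.measurableEmbedding _)).2 hF

/-- The product measure with the variable `0` fixed at `x`. -/
def consMeasure (n : ℕ) (x : ℝ) : Fin (n + 1) → Measure ℝ :=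
  Fin.cons (Measure.dirac x) fun _ => volume

instance (n : ℕ) (x : ℝ) (i : Fin (n + 1)) : SigmaFinite (consMeasure n x i) := by
  refine Fin.cases ?_ (fun i => ?_) i
  · exact (inferInstance : SigmaFinite (Measure.dirac x))
  · exact (inferInstance : SigmaFinite (volume : Measure ℝ))

/-- Treating the fixed variable as integrated against a Dirac mass keeps all variables on the same
footing, so that the coordinates can still be permuted. -/
theorem integral_cons {n : ℕ} (x : ℝ) (G : (Fin (n + 1) → ℝ) → ℝ) :
    ∫ z : Fin n → ℝ, G (Fin.cons x z) = ∫ y, G y ∂Measure.pi (consMeasure n x) := by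
  have h := (measurePreserving_piFinSuccAbove (consMeasure n x) 0).symm.integral_comp' (g := G)
  rw [← h]
  change _ = ∫ p, _ ∂((Measure.dirac x).prod (Measure.pi fun _ : Fin n => (volume : Measure ℝ)))
  rw [Measure.dirac_prod, MeasurableEmbedding.integral_map (measurableEmbedding_prodMk_left x)]
  refine integral_congr_ae (Eventually.of_forall fun z => ?_)
  simp only [MeasurableEquiv.piFinSuccAbove_symm_apply, Fin.insertNthEquiv, Equiv.coe_fn_mk,
    Fin.insertNth_zero]
  rfl

theorem sum_perm_apply_zero {n : ℕ} (h : Fin (n + 1) → ℝ) :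
    ∑ σ : Equiv.Perm (Fin (n + 1)), h (σ 0) = (n.factorial : ℝ) * ∑ i, h i := by
  rw [← Equiv.sum_comp Equiv.Perm.decomposeFin.symm, Fintype.sum_prod_type, Finset.mul_sum]
  refine Finset.sum_congr rfl fun i _ => ?_
  simp only [Equiv.Perm.decomposeFin_symm_apply_zero, Finset.sum_const, Finset.card_univ,
    Fintype.card_perm, Fintype.card_fin, nsmul_eq_mul]

theorem eval_det_eq {n : ℕ} (p : Fin n → Polynomial ℝ) (hp : ∀ i, (p i).natDegree < n)
    (v : Fin n → ℝ) :
    (Matrix.of fun i j => (p j).eval (v i)).det =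
      (Matrix.vandermonde v).det * (Matrix.of fun i j : Fin n => (p j).coeff i).det := by
  rw [← Matrix.det_mul]
  congr 1
  ext i j
  simp only [Matrix.of_apply, Matrix.mul_apply, Matrix.vandermonde_apply]
  rw [Polynomial.eval_eq_sum_range' (hp j), ← Fin.sum_univ_eq_sum_range
    (fun k => (p j).coeff k * v i ^ k)]
  exact Finset.sum_congr rfl fun k _ => mul_comm _ _

theorem vandermonde_det_comp {n : ℕ} (v : Fin n → ℝ) (σ : Equiv.Perm (Fin n)) :
    (Matrix.vandermonde fun i => v (σ i)).det =
      ((σ.sign : ℤ) : ℝ) * (Matrix.vandermonde v).det := by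
  have : (Matrix.vandermonde fun i => v (σ i)) = (Matrix.vandermonde v).submatrix σ id := rfl
  rw [this, Matrix.det_permute]

/-- The signed symmetrisation of a product of signs along pairs is a multiple of the sign of the
Vandermonde determinant. -/
theorem exists_symm_sign {n : ℕ} {J : Type} [Fintype J] (b c : J → Fin n) :
    ∃ C : ℝ, ∀ v : Fin n → ℝ,
      (∑ σ : Equiv.Perm (Fin n), ((σ.sign : ℤ) : ℝ) *
        ∏ j, Real.sign (v (σ (c j)) - v (σ (b j)))) * (Matrix.vandermonde v).det =
      C * |(Matrix.vandermonde v).det| := by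
  let H : (Fin n → ℝ) → ℝ := fun v => ∑ σ : Equiv.Perm (Fin n), ((σ.sign : ℤ) : ℝ) *
        ∏ j, Real.sign (v (σ (c j)) - v (σ (b j)))
  -- The symmetrised sign is antisymmetric, and it depends only on the order of the points. Sorting
  -- therefore reduces to increasing points, where it is a constant and the Vandermonde determinant
  -- is positive.
  have hH : ∀ (v : Fin n → ℝ) (τ : Equiv.Perm (Fin n)),
      H (fun i => v (τ i)) = ((τ.sign : ℤ) : ℝ) * H v := by
    intro v τ
    simp only [H]
    rw [← Equiv.sum_comp (Equiv.mulLeft τ⁻¹), Finset.mul_sum]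
    refine Finset.sum_congr rfl fun σ _ => ?_
    have hτ : ∀ i, τ (τ⁻¹ i) = i := τ.apply_symm_apply
    simp only [Equiv.coe_mulLeft, Equiv.Perm.sign_mul, Equiv.Perm.sign_inv, Equiv.Perm.mul_apply,
      hτ]
    push_cast; ring
  have hmono : ∀ v : Fin n → ℝ, StrictMono v → H v = H fun i => (i : ℝ) := by
    intro v hv
    simp only [H]
    refine Finset.sum_congr rfl fun σ _ => ?_
    congr 1
    refine Finset.prod_congr rfl fun j _ => ?_
    rcases lt_trichotomy (σ (c j)) (σ (b j)) with h | h | h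
    · rw [Real.sign_of_neg (sub_neg.2 (hv h)), Real.sign_of_neg]
      rw [sub_neg]; exact_mod_cast h
    · rw [h]; simp
    · rw [Real.sign_of_pos (sub_pos.2 (hv h)), Real.sign_of_pos]
      rw [sub_pos]; exact_mod_cast h
  refine ⟨H fun i => (i : ℝ), fun v => ?_⟩
  change H v * _ = _
  by_cases hinj : Function.Injective v
  · set τ := Tuple.sort v
    have hsm : StrictMono fun i => v (τ i) :=
      (Tuple.monotone_sort v).strictMono_of_injective (hinj.comp τ.injective)
    have h1 := hH v τ
    have h2 := vandermonde_det_comp v τ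
    have hpos : 0 < (Matrix.vandermonde fun i => v (τ i)).det := by
      rw [Matrix.det_vandermonde]
      exact Finset.prod_pos fun i _ => Finset.prod_pos fun j hj =>
        sub_pos.2 (hsm (Finset.mem_Ioi.1 hj))
    have hs : ((τ.sign : ℤ) : ℝ) * ((τ.sign : ℤ) : ℝ) = 1 := by
      rcases Int.units_eq_one_or τ.sign with h | h <;> rw [h] <;> norm_num
    have habs : |(Matrix.vandermonde v).det| = (Matrix.vandermonde fun i => v (τ i)).det := by
      rw [← abs_of_pos hpos, h2, abs_mul]
      rcases Int.units_eq_one_or τ.sign with h | h <;> rw [h] <;> simp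
    rw [habs, ← hmono _ hsm, h1, h2]
    linear_combination -(H v * (Matrix.vandermonde v).det) * hs
  · have : (Matrix.vandermonde v).det = 0 := by
      by_contra h; exact hinj (Matrix.det_vandermonde_ne_zero_iff.1 h)
    rw [this]; simp

theorem ensembleWeight_one (w : ℝ → ℝ) {n : ℕ} (y : Fin n → ℝ) :
    ensembleWeight 1 w y = (∏ l, w (y l)) * |(Matrix.vandermonde y).det| := by
  simp only [ensembleWeight, pow_one, Matrix.det_vandermonde, Finset.abs_prod]

namespace PairIndex
variable {J R : Type} [Fintype J] [DecidableEq J] [Fintype R] [DecidableEq R]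

/-- The determinant of weighted polynomials is ∏ w times the Vandermonde determinant times a
coefficient determinant. Symmetrising the signs along the pairs replaces Δ by |Δ|, the factor of the
β = 1 weight. -/
theorem exists_symm_signDet {n : ℕ} (e : PairIndex J R ≃ Fin n) (w : ℝ → ℝ)
    (q : PairIndex J R → Polynomial ℝ) (hq : ∀ a, (q a).natDegree < n) :
    ∃ C : ℝ, ∀ y : Fin n → ℝ,
      ∑ σ : Equiv.Perm (Fin n), signDet (fun a t => w t * (q a).eval t) (fun i => y (σ (e i))) =
        C * ensembleWeight 1 w y := by
  obtain ⟨C, hC⟩ := exists_symm_sign (fun j : J => e (.inl (.inl j))) fun j => e (.inl (.inr j))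
  let D : ℝ := (Matrix.of fun i j : Fin n => (q (e.symm j)).coeff i).det
  refine ⟨C * D, fun y => ?_⟩
  have hdet : ∀ v : Fin n → ℝ,
      (Matrix.of fun a i : PairIndex J R => w (v (e i)) * (q a).eval (v (e i))).det =
        (∏ l, w (v l)) * ((Matrix.vandermonde v).det * D) := by
    intro v
    rw [← eval_det_eq _ (fun i => hq _), ← e.prod_comp, ← Matrix.det_transpose,
      ← Matrix.det_submatrix_equiv_self e, ← Matrix.det_mul_column]
    congr 1
    ext i a
    simp [Matrix.of_apply]
  have hper : ∀ σ : Equiv.Perm (Fin n),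
      signDet (fun a t => w t * (q a).eval t) (fun i => y (σ (e i))) =
        (∏ l, w (y l)) * D * (Matrix.vandermonde y).det * (((σ.sign : ℤ) : ℝ) *
          ∏ j, Real.sign (y (σ (e (.inl (.inr j)))) - y (σ (e (.inl (.inl j)))))) := by
    intro σ
    rw [signDet, hdet fun i => y (σ i), vandermonde_det_comp, Equiv.prod_comp σ fun i => w (y i)]
    ring
  simp only [hper]
  rw [← Finset.mul_sum, ensembleWeight_one]
  linear_combination (∏ l, w (y l)) * D * hC y

/-- The density of an ensemble with `β = 1`, in terms of a skew orthogonal basis. -/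
theorem ensembleDensity_one [Subsingleton R] {n : ℕ} (e : PairIndex J R ≃ Fin (n + 1)) (w : ℝ → ℝ)
    (q : PairIndex J R → Polynomial ℝ) (hq : ∀ a, (q a).natDegree < n + 1)
    (φ : PairIndex J R → ℝ → ℝ) (hφ : φ = fun a t => w t * (q a).eval t)
    (hi : ∀ a, Integrable (φ a))
    (hB : IsBlock (fun a b => signForm (φ a) (φ b)) (fun a => ∫ t, φ a t)) :
    ensembleZ 1 w (n + 1) ≠ 0 ∧
      ∀ x, ensembleDensity 1 w (n + 1) x = ∑ a, ratio φ x a := by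
  obtain ⟨C, hC⟩ := exists_symm_signDet e w q hq
  rw [← hφ] at hC
  set Φ := pairSum (fun a b => signForm (φ a) (φ b)) (fun a => ∫ t, φ a t) with hΦ
  have hΦ0 : Φ ≠ 0 := hB.pairSum_ne_zero
  -- All (n+1)! symmetrised terms have the same integral, because Lebesgue measure is invariant
  -- under relabelling.
  have hZ : C * ensembleZ 1 w (n + 1) = ((n + 1).factorial : ℝ) * Φ := by
    rw [ensembleZ, ← integral_const_mul]
    simp only [← hC]
    rw [integral_finsetSum]
    · have : ∀ σ : Equiv.Perm (Fin (n + 1)),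
          ∫ y : Fin (n + 1) → ℝ, signDet φ (fun i => y (σ (e i))) = Φ := fun σ => by
        rw [hΦ, ← signDet_integral_volume φ hi]
        exact integral_reindex (e.trans σ) (fun _ => volume) (signDet φ)
      simp only [this, Finset.sum_const, Finset.card_univ, Fintype.card_perm, Fintype.card_fin,
        nsmul_eq_mul]
    · exact fun σ _ => integrable_reindex (e.trans σ) (fun _ => volume)
        (signDet_integrable φ (fun _ => volume) fun a _ => hi a)
  -- `C` is never computed: it is nonzero because `Φ` is, and it cancels from the density.
  have hC0 : C ≠ 0 := by
    rintro rfl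
    rw [zero_mul] at hZ
    exact mul_ne_zero (Nat.cast_ne_zero.2 (Nat.factorial_ne_zero _)) hΦ0 hZ.symm
  have hZ0 : ensembleZ 1 w (n + 1) ≠ 0 := by
    intro h
    rw [h, mul_zero] at hZ
    exact mul_ne_zero (Nat.cast_ne_zero.2 (Nat.factorial_ne_zero _)) hΦ0 hZ.symm
  refine ⟨hZ0, fun x => ?_⟩
  have hI : C * ∫ z : Fin n → ℝ, ensembleWeight 1 w (Fin.cons x z : Fin (n + 1) → ℝ) =
      (n.factorial : ℝ) * Φ * ∑ a, ratio φ x a := by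
    rw [integral_cons x (ensembleWeight 1 w), ← integral_const_mul]
    simp only [← hC]
    have hint : ∀ (a : PairIndex J R) (i : Fin (n + 1)), Integrable (φ a) (consMeasure n x i) := by
      intro a i
      refine Fin.cases ?_ (fun i => ?_) i
      · exact (integrable_dirac (by simp) : Integrable (φ a) (Measure.dirac x))
      · exact hi a
    rw [integral_finsetSum]
    -- After relabelling by `e` and `σ` the Dirac mass sits at the index `e.symm (σ⁻¹ 0)`.
    · have : ∀ σ : Equiv.Perm (Fin (n + 1)),
          ∫ y, signDet φ (fun i => y (σ (e i))) ∂Measure.pi (consMeasure n x) =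
            ∑ τ : Equiv.Perm (PairIndex J R), ((τ.sign : ℤ) : ℝ) *
              pairProd (fun a b => signForm (φ a) (φ b)) (fun a => ∫ t, φ a t) τ *
                ratio φ x (τ (e.symm (σ⁻¹ 0))) := fun σ => by
        rw [← signDet_integral_dirac φ hi hB x (e.symm (σ⁻¹ 0))
          (fun i => consMeasure n x (σ (e i)))]
        · exact integral_reindex (e.trans σ) (consMeasure n x) (signDet φ)
        · simp [consMeasure]
        · intro i hne
          obtain ⟨k, hk⟩ := Fin.exists_succ_eq.2 (show σ (e i) ≠ 0 from fun h0 => hne (by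
            rw [← h0]; simp))
          rw [← hk]; rfl
      simp only [this]
      rw [Finset.sum_comm, hΦ, pairSum, mul_assoc, Finset.sum_mul, Finset.mul_sum]
      refine Finset.sum_congr rfl fun τ _ => ?_
      rw [← Finset.mul_sum]
      -- Every index is hit by n! of the permutations `σ`, so the sum does not depend on `τ`.
      have h1 : ∑ σ : Equiv.Perm (Fin (n + 1)), ratio φ x (τ (e.symm (σ⁻¹ 0))) =
          (n.factorial : ℝ) * ∑ a, ratio φ x a := by
        rw [← Equiv.sum_comp (Equiv.inv (Equiv.Perm (Fin (n + 1))))]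
        simp only [Equiv.inv_apply, inv_inv]
        rw [sum_perm_apply_zero fun i => ratio φ x (τ (e.symm i)),
          Equiv.sum_comp e.symm fun i => ratio φ x (τ i), Equiv.sum_comp τ]
      rw [h1]; ring
    · exact fun σ _ => integrable_reindex (e.trans σ) (consMeasure n x)
        (signDet_integrable φ (fun i => consMeasure n x (σ (e i))) fun a i => hint a _)
  rw [ensembleDensity, div_eq_iff hZ0]
  apply mul_left_cancel₀ hC0
  rw [Nat.factorial_succ] at hZ
  push_cast at hZ
  linear_combination ((n : ℝ) + 1) * hI - (∑ a, ratio φ x a) * hZ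

end PairIndex

/-! ### The density for β = 4 from confluent Vandermonde determinants. -/

theorem prod_Ioi_eq_ite {n : ℕ} (f : Fin n → Fin n → ℝ) :
    ∏ i, ∏ j ∈ Finset.Ioi i, f i j = ∏ i, ∏ j, if i < j then f i j else 1 := by
  refine Finset.prod_congr rfl fun i _ => ?_
  rw [← Finset.prod_filter]
  exact Finset.prod_congr (by ext; simp) fun _ _ => rfl

theorem vandermonde_det_append {n : ℕ} (u v : Fin n → ℝ) :
    (Matrix.vandermonde (Fin.append u v)).det =
      (Matrix.vandermonde u).det * (Matrix.vandermonde v).det * ∏ i, ∏ j, (v j - u i) := by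
  rw [Matrix.det_vandermonde, Matrix.det_vandermonde, Matrix.det_vandermonde, prod_Ioi_eq_ite,
    prod_Ioi_eq_ite, prod_Ioi_eq_ite, Fin.prod_univ_add]
  simp only [Fin.prod_univ_add, Fin.append_left, Fin.append_right, Finset.prod_mul_distrib]
  have h1 : ∀ i j : Fin n, Fin.castAdd n i < Fin.natAdd n j := fun i j => by
    rw [Fin.lt_def]; simp; omega
  have h2 : ∀ i j : Fin n, ¬ Fin.natAdd n i < Fin.castAdd n j := fun i j => (h1 j i).le.not_gt
  have h3 : ∀ i j : Fin n, Fin.castAdd n i < Fin.castAdd n j ↔ i < j := fun i j => Iff.rfl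
  have h4 : ∀ i j : Fin n, Fin.natAdd n i < Fin.natAdd n j ↔ i < j := fun i j => by
    rw [Fin.lt_def, Fin.lt_def]; simp only [Fin.val_natAdd]; omega
  simp only [h1, h2, h3, h4, if_true, if_false, Finset.prod_const_one]
  ring

/-- These are the cross factors between the points and their shifted copies once the shift tends to
0. Up to sign they supply the two powers of Δ that the two single blocks leave missing from Δ^4. -/
theorem prod_offdiag {n : ℕ} (x : Fin n → ℝ) :
    ∏ i, ∏ j, (if j = i then 1 else x j - x i) =
      (∏ i : Fin n, ∏ _j ∈ Finset.Ioi i, (-1 : ℝ)) * (Matrix.vandermonde x).det ^ 2 := by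
  have h : ∀ i j : Fin n, (if j = i then 1 else x j - x i) =
      (if i < j then x j - x i else 1) * (if j < i then x j - x i else 1) := by
    intro i j
    rcases lt_trichotomy i j with h | h | h
    · simp [h, h.ne', h.not_gt]
    · simp [h]
    · simp [h, h.ne, h.not_gt]
  simp only [h, Finset.prod_mul_distrib]
  rw [Finset.prod_comm (f := fun i j => if j < i then x j - x i else 1), ← prod_Ioi_eq_ite,
    ← prod_Ioi_eq_ite, Matrix.det_vandermonde, sq, ← mul_assoc, mul_comm]
  congr 1
  rw [← Finset.prod_mul_distrib]
  refine Finset.prod_congr rfl fun i _ => ?_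
  rw [← Finset.prod_mul_distrib]
  exact Finset.prod_congr rfl fun j _ => by ring

/-- The determinant of values and derivatives of polynomials is a multiple of the fourth power of
the Vandermonde determinant. -/
theorem exists_confluent_det {n : ℕ} (q : Fin n ⊕ Fin n → Polynomial ℝ)
    (hq : ∀ a, (q a).natDegree < n + n) :
    ∃ C : ℝ, ∀ x : Fin n → ℝ,
      (Matrix.of fun a i : Fin n ⊕ Fin n => Sum.elim (fun j => (q a).eval (x j))
        (fun j => (q a).derivative.eval (x j)) i).det = C * (Matrix.vandermonde x).det ^ 4 := by
  let e : Fin n ⊕ Fin n ≃ Fin (n + n) := finSumFinEquiv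
  let D : ℝ := (Matrix.of fun i j : Fin (n + n) => (q (e.symm j)).coeff i).det
  let S : ℝ := ∏ i : Fin n, ∏ _j ∈ Finset.Ioi i, (-1 : ℝ)
  refine ⟨D * S, fun x => ?_⟩
  -- The derivative columns are replaced by difference quotients of step h. Column operations then
  -- give the Vandermonde determinant of the 2n points x_j, x_j + h divided by h^n, and h tends to 0
  -- at the end.
  let A : ℝ → Matrix (Fin n ⊕ Fin n) (Fin n ⊕ Fin n) ℝ := fun h => Matrix.of fun a i =>
    Sum.elim (fun j => (q a).eval (x j))
      (fun j => h⁻¹ * ((q a).eval (x j + h) - (q a).eval (x j))) i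
  have hdet : ∀ h : ℝ, h ≠ 0 → (A h).det =
      D * ((Matrix.vandermonde x).det * (Matrix.vandermonde fun j => x j + h).det *
        ∏ i, ∏ j, (if j = i then 1 else x j + h - x i)) := by
    intro h hh
    have h1 : (A h * Matrix.fromBlocks 1 1 0 (h • (1 : Matrix (Fin n) (Fin n) ℝ))).det =
        (Matrix.of fun a i => (q a).eval ((Fin.append x fun j => x j + h) (e i))).det := by
      congr 1
      ext a i
      rw [Matrix.mul_apply, Fintype.sum_sum_type]
      rcases i with j | j
      · simp [A, Matrix.one_apply, e]
      · simp only [A, Matrix.of_apply, Sum.elim_inl, Sum.elim_inr, Matrix.fromBlocks_apply₁₂,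
          Matrix.fromBlocks_apply₂₂, Matrix.smul_apply, Matrix.one_apply, smul_eq_mul, mul_ite,
          mul_one, mul_zero, Finset.sum_ite_eq', Finset.mem_univ, if_true, e,
          finSumFinEquiv_apply_right, Fin.append_right]
        field_simp
        ring
    have h2 : (Matrix.of fun a i => (q a).eval ((Fin.append x fun j => x j + h) (e i))).det =
        (Matrix.vandermonde (Fin.append x fun j => x j + h)).det * D := by
      rw [← eval_det_eq _ (fun i => hq _), ← Matrix.det_transpose,
        ← Matrix.det_submatrix_equiv_self e]
      congr 1
      ext i a
      simp [Matrix.of_apply]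
    -- The n diagonal factors equal h and cancel the powers of h in the difference quotients.
    have h3 : ∏ i, ∏ j, (x j + h - x i) =
        h ^ n * ∏ i, ∏ j, (if j = i then 1 else x j + h - x i) := by
      have : h ^ n = ∏ _i : Fin n, h := by simp
      rw [this, ← Finset.prod_mul_distrib]
      refine Finset.prod_congr rfl fun i _ => ?_
      rw [← Finset.mul_prod_erase _ _ (Finset.mem_univ i),
        ← Finset.mul_prod_erase _ (fun j => if j = i then 1 else x j + h - x i)
          (Finset.mem_univ i)]
      rw [if_pos rfl, one_mul, add_sub_cancel_left]
      congr 1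
      exact Finset.prod_congr rfl fun j hj => (if_neg (Finset.ne_of_mem_erase hj)).symm
    rw [h2, vandermonde_det_append, h3, Matrix.det_mul, Matrix.det_fromBlocks_zero₂₁,
      Matrix.det_one, Matrix.det_smul, Matrix.det_one, Fintype.card_fin] at h1
    have hn : h ^ n ≠ 0 := pow_ne_zero _ hh
    apply mul_right_cancel₀ hn
    linear_combination h1
  have hR : Tendsto (fun h : ℝ => D * ((Matrix.vandermonde x).det *
      (Matrix.vandermonde fun j => x j + h).det *
        ∏ i, ∏ j, (if j = i then 1 else x j + h - x i))) (nhdsWithin 0 {0}ᶜ)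
      (nhds (D * ((Matrix.vandermonde x).det * (Matrix.vandermonde x).det *
        (S * (Matrix.vandermonde x).det ^ 2)))) := by
    have hc : Continuous fun h : ℝ => D * ((Matrix.vandermonde x).det *
      (Matrix.vandermonde x).det * ∏ i, ∏ j, (if j = i then 1 else x j + h - x i)) := by
      refine continuous_const.mul (continuous_const.mul ?_)
      refine continuous_finsetProd _ fun i _ => continuous_finsetProd _ fun j _ => ?_
      split_ifs
      · exact continuous_const
      · fun_prop
    have h0 := hc.tendsto 0
    simp only [add_zero, prod_offdiag] at h0
    simp only [Matrix.det_vandermonde_add]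
    exact h0.mono_left nhdsWithin_le_nhds
  have hL : Tendsto (fun h => (A h).det) (nhdsWithin 0 {0}ᶜ) (nhds
      (Matrix.of fun a i : Fin n ⊕ Fin n => Sum.elim (fun j => (q a).eval (x j))
        (fun j => (q a).derivative.eval (x j)) i).det) := by
    have hA : Tendsto A (nhdsWithin 0 {0}ᶜ) (nhds
      (Matrix.of fun a i : Fin n ⊕ Fin n => Sum.elim (fun j => (q a).eval (x j))
        (fun j => (q a).derivative.eval (x j)) i)) := by
      refine tendsto_pi_nhds.2 fun a => tendsto_pi_nhds.2 fun i => ?_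
      rcases i with j | j
      · exact tendsto_const_nhds
      · exact hasDerivAt_iff_tendsto_slope_zero.1 ((q a).hasDerivAt (x j))
    exact ((continuous_id.matrix_det).tendsto _).comp hA
  have hev : ∀ᶠ h in nhdsWithin (0 : ℝ) {0}ᶜ, (A h).det =
      D * ((Matrix.vandermonde x).det * (Matrix.vandermonde fun j => x j + h).det *
        ∏ i, ∏ j, (if j = i then 1 else x j + h - x i)) :=
    eventually_nhdsWithin_of_forall fun h hh => hdet h hh
  have := tendsto_nhds_unique (hL.congr' hev) hR
  rw [this]; ring

theorem ensembleWeight_four (w : ℝ → ℝ) {n : ℕ} (y : Fin n → ℝ) :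
    ensembleWeight 4 w y = (∏ l, w (y l)) * (Matrix.vandermonde y).det ^ 4 := by
  simp only [ensembleWeight, Matrix.det_vandermonde, ← Finset.prod_pow]
  congr 1
  refine Finset.prod_congr rfl fun i _ => Finset.prod_congr rfl fun j _ => ?_
  rw [← abs_pow, abs_of_nonneg (by positivity)]

namespace PairIndex
variable {J R : Type} [Fintype J] [DecidableEq J] [Fintype R] [DecidableEq R]

/-- The signed sum of products of `f j` along the pairs. -/
def formSum (f : J → PairIndex J R → PairIndex J R → ℝ) : ℝ :=
  ∑ τ : Equiv.Perm (PairIndex J R), ((τ.sign : ℤ) : ℝ) *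
    ∏ j, f j (τ (.inl (.inl j))) (τ (.inl (.inr j)))

/-- Only the antisymmetric part of each form survives the signed sum, so antisymmetrising one pair
doubles it; the induction treats the pairs one by one. -/
theorem formSum_antisymm (f : J → PairIndex J R → PairIndex J R → ℝ) :
    formSum (fun j a b => f j a b - f j b a) = 2 ^ Fintype.card J * formSum f := by
  have key : ∀ T : Finset J,
      formSum (fun j a b => if j ∈ T then f j a b - f j b a else f j a b) =
        2 ^ T.card * formSum f := by
    intro T
    induction T using Finset.induction_on with
    | empty => simp
    | insert j T hj ih =>
      rw [Finset.card_insert_of_notMem hj, pow_succ, mul_right_comm, ← ih]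
      let rest : Equiv.Perm (PairIndex J R) → ℝ := fun τ => ∏ j' ∈ Finset.univ.erase j,
        (if j' ∈ T then f j' (τ (.inl (.inl j'))) (τ (.inl (.inr j'))) -
          f j' (τ (.inl (.inr j'))) (τ (.inl (.inl j')))
        else f j' (τ (.inl (.inl j'))) (τ (.inl (.inr j'))))
      have e1 : formSum (fun j a b => if j ∈ T then f j a b - f j b a else f j a b) =
          ∑ τ : Equiv.Perm (PairIndex J R), ((τ.sign : ℤ) : ℝ) *
            (f j (τ (.inl (.inl j))) (τ (.inl (.inr j))) * rest τ) := by
        refine Finset.sum_congr rfl fun τ _ => ?_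
        beta_reduce
        rw [← Finset.mul_prod_erase _ _ (Finset.mem_univ j)]
        simp only [if_neg hj, rest]
      have e2 : formSum (fun j' a b => if j' ∈ insert j T then f j' a b - f j' b a
          else f j' a b) =
          ∑ τ : Equiv.Perm (PairIndex J R), ((τ.sign : ℤ) : ℝ) *
            ((f j (τ (.inl (.inl j))) (τ (.inl (.inr j))) -
              f j (τ (.inl (.inr j))) (τ (.inl (.inl j)))) * rest τ) := by
        refine Finset.sum_congr rfl fun τ _ => ?_
        beta_reduce
        rw [← Finset.mul_prod_erase _ _ (Finset.mem_univ j)]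
        simp only [if_pos (Finset.mem_insert_self j T), rest]
        congr 2
        refine Finset.prod_congr rfl fun j' hj' => ?_
        simp [Finset.ne_of_mem_erase hj']
      -- Composing with the transposition of the two members of pair `j` changes the sign and leaves
      -- the other pairs alone.
      have e3 : ∑ τ : Equiv.Perm (PairIndex J R), ((τ.sign : ℤ) : ℝ) *
            (f j (τ (.inl (.inr j))) (τ (.inl (.inl j))) * rest τ) =
          -∑ τ : Equiv.Perm (PairIndex J R), ((τ.sign : ℤ) : ℝ) *
            (f j (τ (.inl (.inl j))) (τ (.inl (.inr j))) * rest τ) := by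
        rw [← Equiv.sum_comp (Equiv.mulRight
          (Equiv.swap (.inl (.inl j) : PairIndex J R) (.inl (.inr j)))), ← Finset.sum_neg_distrib]
        refine Finset.sum_congr rfl fun τ _ => ?_
        have hr : rest (τ * Equiv.swap (.inl (.inl j) : PairIndex J R) (.inl (.inr j))) =
            rest τ := by
          refine Finset.prod_congr rfl fun j' hj' => ?_
          have hne := Finset.ne_of_mem_erase hj'
          rw [Equiv.Perm.mul_apply, Equiv.Perm.mul_apply,
            Equiv.swap_apply_of_ne_of_ne (by simp [hne]) (by simp),
            Equiv.swap_apply_of_ne_of_ne (by simp) (by simp [hne])]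
        rw [Equiv.coe_mulRight, hr, Equiv.Perm.sign_mul, Equiv.Perm.sign_swap (by simp),
          Equiv.Perm.mul_apply, Equiv.Perm.mul_apply, Equiv.swap_apply_left,
          Equiv.swap_apply_right]
        push_cast; ring
      rw [e1, e2]
      simp only [sub_mul, mul_sub, Finset.sum_sub_distrib]
      rw [e3]; ring
  have := key Finset.univ
  simpa using this

/-- The density of an ensemble with `β = 4`, in terms of a skew orthogonal basis. -/
theorem ensembleDensity_four {n : ℕ} (w : ℝ → ℝ)
    (q : PairIndex (Fin (n + 1)) Empty → Polynomial ℝ)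
    (hq : ∀ a, (q a).natDegree < (n + 1) + (n + 1))
    (hi : ∀ p : Polynomial ℝ, Integrable fun t => p.eval t * w t)
    (hB : IsBlock (fun a b => ∫ t, (Polynomial.wronskian (q a) (q b)).eval t * w t) (fun _ => 0)) :
    ensembleZ 4 w (n + 1) ≠ 0 ∧
      ∀ x, ensembleDensity 4 w (n + 1) x = ∑ j : Fin (n + 1),
        (Polynomial.wronskian (q (.inl (.inl j))) (q (.inl (.inr j)))).eval x * w x /
          ∫ t, (Polynomial.wronskian (q (.inl (.inl j))) (q (.inl (.inr j)))).eval t * w t := by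
  obtain ⟨C, hC⟩ := exists_confluent_det (fun a => q (.inl a)) (fun a => hq _)
  let I : PairIndex (Fin (n + 1)) Empty → PairIndex (Fin (n + 1)) Empty → ℝ → ℝ :=
    fun a b t => (q a * (q b).derivative).eval t * w t
  have hI : ∀ a b, Integrable (I a b) := fun a b => hi _
  -- The Leibniz expansion groups the value column and the derivative column of one point, so every
  -- term is a product of functions of one variable.
  have hW : ∀ y : Fin (n + 1) → ℝ, C * ensembleWeight 4 w y =
      ∑ τ : Equiv.Perm (PairIndex (Fin (n + 1)) Empty), ((τ.sign : ℤ) : ℝ) *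
        ∏ j, I (τ (.inl (.inl j))) (τ (.inl (.inr j))) (y j) := by
    intro y
    rw [ensembleWeight_four]
    have h1 := hC y
    rw [← Matrix.det_submatrix_equiv_self (Equiv.sumEmpty (Fin (n + 1) ⊕ Fin (n + 1)) Empty),
      Matrix.det_apply'] at h1
    rw [mul_left_comm, ← h1, Finset.mul_sum]
    refine Finset.sum_congr rfl fun τ _ => ?_
    have hs : ∀ a : PairIndex (Fin (n + 1)) Empty,
        (Sum.inl (Equiv.sumEmpty (Fin (n + 1) ⊕ Fin (n + 1)) Empty a) :
          PairIndex (Fin (n + 1)) Empty) = a := by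
      rintro (a | a)
      · rfl
      · exact a.elim
    simp only [Fintype.prod_sum_type, Matrix.submatrix_apply, Matrix.of_apply, hs,
      Equiv.sumEmpty_apply_inl, Sum.elim_inl, Sum.elim_inr, I, Polynomial.eval_mul,
      Finset.prod_mul_distrib, Finset.univ_eq_empty, Finset.prod_empty]
    ring
  set A : PairIndex (Fin (n + 1)) Empty → PairIndex (Fin (n + 1)) Empty → ℝ :=
    fun a b => ∫ t, (Polynomial.wronskian (q a) (q b)).eval t * w t with hA
  have hAI : ∀ a b, (∫ t, I a b t) - ∫ t, I b a t = A a b := by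
    intro a b
    rw [← integral_sub (hI a b) (hI b a)]
    simp only [hA, I, Polynomial.wronskian, Polynomial.eval_sub, sub_mul, mul_comm (q b)]
  set Φ := pairSum A (fun _ => 0) with hΦ
  have hΦ0 : Φ ≠ 0 := hB.pairSum_ne_zero
  have hΦf : Φ = formSum (fun _ a b => A a b) := by
    simp [hΦ, pairSum, pairProd, formSum]
  have hZ : 2 ^ (n + 1) * (C * ensembleZ 4 w (n + 1)) = Φ := by
    rw [ensembleZ, ← integral_const_mul]
    simp only [hW]
    rw [integral_finsetSum]
    · simp only [integral_const_mul, integral_fintype_prod_volume_eq_prod]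
      have := formSum_antisymm (R := Empty) (fun (_ : Fin (n + 1)) a b => ∫ t, I a b t)
      simp only [hAI, Fintype.card_fin] at this
      rw [hΦf, this, formSum]
    · exact fun τ _ => (Integrable.fintype_prod_dep fun j => hI _ _).const_mul _
  have hC0 : C ≠ 0 := by
    rintro rfl
    rw [zero_mul, mul_zero] at hZ
    exact hΦ0 hZ.symm
  have hZ0 : ensembleZ 4 w (n + 1) ≠ 0 := by
    intro h
    rw [h, mul_zero, mul_zero] at hZ
    exact hΦ0 hZ.symm
  refine ⟨hZ0, fun x => ?_⟩
  set B : PairIndex (Fin (n + 1)) Empty → PairIndex (Fin (n + 1)) Empty → ℝ :=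
    fun a b => (Polynomial.wronskian (q a) (q b)).eval x * w x with hBdef
  have hBI : ∀ a b, I a b x - I b a x = B a b := by
    intro a b
    simp only [hBdef, I, Polynomial.wronskian, Polynomial.eval_sub, sub_mul, mul_comm (q b)]
  let Ψ : Fin (n + 1) → ℝ := fun j => formSum (R := Empty) fun j' a b =>
    if j' = j then B a b else A a b
  have hΨ0 : 2 ^ (n + 1) * (C * ∫ z : Fin n → ℝ,
      ensembleWeight 4 w (Fin.cons x z : Fin (n + 1) → ℝ)) = Ψ 0 := by
    rw [← integral_const_mul]
    simp only [hW, Fin.prod_univ_succ, Fin.cons_zero, Fin.cons_succ]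
    rw [integral_finsetSum]
    · simp only [integral_const_mul, integral_fintype_prod_volume_eq_prod]
      have := formSum_antisymm (R := Empty) (fun (j : Fin (n + 1)) a b =>
        if j = 0 then I a b x else ∫ t, I a b t)
      have e : (fun (j : Fin (n + 1)) a b => (if j = 0 then I a b x else ∫ t, I a b t) -
          (if j = 0 then I b a x else ∫ t, I b a t)) =
          fun j a b => if j = 0 then B a b else A a b := by
        funext j a b
        split_ifs
        · exact hBI a b
        · exact hAI a b
      rw [e, Fintype.card_fin] at this
      simp only [Ψ]
      rw [this, formSum]
      simp only [Fin.prod_univ_succ, if_true, Fin.succ_ne_zero, if_false]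
    · exact fun τ _ => ((Integrable.fintype_prod_dep fun j => hI _ _).const_mul _).const_mul _
  -- The special slot is moved from 0 to `j` by the same transposition on first and on second
  -- members, together an even permutation.
  have hΨj : ∀ j, Ψ j = Ψ 0 := by
    intro j
    let s : Equiv.Perm (PairIndex (Fin (n + 1)) Empty) :=
      Equiv.sumCongr (Equiv.sumCongr (Equiv.swap 0 j) (Equiv.swap 0 j)) 1
    have hs : s.sign = 1 := by
      simp only [s, Equiv.Perm.sign_sumCongr, Equiv.Perm.sign_one, mul_one]
      exact Int.units_mul_self _
    simp only [Ψ, formSum]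
    rw [← Equiv.sum_comp (Equiv.mulRight s)]
    refine Finset.sum_congr rfl fun τ _ => ?_
    simp only [Equiv.coe_mulRight, Equiv.Perm.sign_mul, hs, mul_one, Equiv.Perm.mul_apply]
    congr 1
    rw [← Equiv.prod_comp (Equiv.swap 0 j)]
    refine Finset.prod_congr rfl fun j' _ => ?_
    simp only [s, Equiv.sumCongr_apply, Sum.map_inl, Sum.map_inr, Equiv.swap_apply_self]
    simp [Equiv.swap_apply_eq_iff]
  have hsum : ∑ j, Ψ j = Φ * ∑ j, B (.inl (.inl j)) (.inl (.inr j)) /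
      A (.inl (.inl j)) (.inl (.inr j)) := by
    simp only [Ψ, formSum]
    rw [Finset.sum_comm, hΦ, pairSum, Finset.sum_mul]
    refine Finset.sum_congr rfl fun τ _ => ?_
    rw [← Finset.mul_sum, mul_assoc]
    congr 1
    have h1 : ∀ j : Fin (n + 1), (∏ j', if j' = j then B (τ (.inl (.inl j'))) (τ (.inl (.inr j')))
        else A (τ (.inl (.inl j'))) (τ (.inl (.inr j')))) =
        pairProd A (fun _ => 0) τ * (B (τ (.inl (.inl j))) (star (τ (.inl (.inl j)))) /
          A (τ (.inl (.inl j))) (star (τ (.inl (.inl j))))) := by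
      intro j
      rw [← hB.mul_erase_eq B τ j, ← Finset.mul_prod_erase _ _ (Finset.mem_univ j), if_pos rfl,
        Finset.univ_eq_empty (α := Empty), Finset.prod_empty, mul_one]
      congr 1
      exact Finset.prod_congr rfl fun j' hj' => if_neg (Finset.ne_of_mem_erase hj')
    simp only [h1]
    rw [← Finset.mul_sum]
    by_cases h0 : pairProd A (fun _ => 0) τ = 0
    · rw [h0, zero_mul, zero_mul]
    congr 1
    -- The quotient has the same value on both members of a pair. Its sum over all indices is
    -- invariant under `τ`, and half of it is the sum over the pairs.
    let ψ : PairIndex (Fin (n + 1)) Empty → ℝ := fun a => B a (star a) / A a (star a)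
    have hψ : ∀ a, ψ (star a) = ψ a := by
      intro a
      simp only [ψ, star_star]
      have hb : B (star a) a = -B a (star a) := by
        simp only [hBdef, Polynomial.wronskian, Polynomial.eval_sub, Polynomial.eval_mul]; ring
      rw [hb, hB.anti a (star a), neg_div_neg_eq]
    have hne := mul_ne_zero_iff.1 h0
    have h2 : ∀ j, τ (.inl (.inr j)) = star (τ (.inl (.inl j))) := fun j =>
      (hB.eq_star _ _ (Finset.prod_ne_zero_iff.1 hne.1 j (Finset.mem_univ _))).1
    have h3 : ∑ a, ψ (τ a) = ∑ a, ψ a := Equiv.sum_comp τ ψ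
    simp only [Fintype.sum_sum_type, h2, hψ, Finset.univ_eq_empty, Finset.sum_empty,
      add_zero] at h3
    have h4 : ∀ j : Fin (n + 1), ψ (.inl (.inr j)) = ψ (.inl (.inl j)) := fun j =>
      hψ (.inl (.inl j))
    simp only [h4] at h3
    have h5 : ∑ j, ψ (τ (.inl (.inl j))) = ∑ j, ψ (.inl (.inl j)) := by linarith
    exact h5
  simp only [hΨj, Finset.sum_const, Finset.card_univ, Fintype.card_fin, nsmul_eq_mul] at hsum
  rw [ensembleDensity, div_eq_iff hZ0]
  apply mul_left_cancel₀ hC0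
  apply mul_left_cancel₀ (pow_ne_zero (n + 1) (two_ne_zero (α := ℝ)))
  push_cast at hsum
  rw [← hZ, ← hΨ0] at hsum
  linear_combination hsum

end PairIndex

/-! ### The symplectic ensemble: skew orthogonal basis and closed form of the density. -/

theorem integral_laguerreWeight {β : ℕ} {a : ℝ} (ha : -1 < laguerreExponent β a)
    (p : Polynomial ℝ) :
    Integrable (fun t => p.eval t * laguerreWeight β a t) ∧
      ∫ t, p.eval t * laguerreWeight β a t = gammaFunctional (laguerreExponent β a) p := by
  have h := gammaFunctional.integrable_and_eq ha p
  have e : (fun t => p.eval t * laguerreWeight β a t) = (Ioi (0 : ℝ)).indicator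
      fun x => p.eval x * (x ^ laguerreExponent β a * Real.exp (-x)) := by
    funext t
    simp only [laguerreWeight, indicator, mem_Ioi]
    split_ifs <;> simp
  rw [e, integrable_indicator_iff measurableSet_Ioi, integral_indicator measurableSet_Ioi]
  exact h

namespace laguerre
open Polynomial PairIndex

/-- The polynomial `γ` of degree `2i` for which `x^((a+1)/2) e^(-x/2) γ(x)` is an antiderivative of
`x^((a-1)/2) e^(-x/2) L_{2i+1}(x)`. -/
def antideriv (a : ℝ) : ℕ → ℝ[X]
  | 0 => C 2
  | i + 1 => C (1 / (2 * (i : ℝ) + 3)) *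
      (C (2 * (i : ℝ) + 2 + a) * antideriv a i + C 2 * laguerre (2 * i + 2) a)

theorem antideriv_zero (a : ℝ) : antideriv a 0 = C 2 := by rw [antideriv]

theorem antideriv_succ (a : ℝ) (i : ℕ) : C (2 * (i : ℝ) + 3) * antideriv a (i + 1) =
    C (2 * (i : ℝ) + 2 + a) * antideriv a i + C 2 * laguerre (2 * i + 2) a := by
  rw [antideriv, ← mul_assoc, ← C_mul, mul_one_div_cancel (by positivity), C_1, one_mul]

theorem natDegree_antideriv_le (a : ℝ) (i : ℕ) : (antideriv a i).natDegree ≤ 2 * i := by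
  induction i with
  | zero => simp [antideriv_zero]
  | succ i ih =>
    rw [antideriv]
    refine (natDegree_C_mul_le _ _).trans ((natDegree_add_le _ _).trans (max_le ?_ ?_))
    · exact (natDegree_C_mul_le _ _).trans (ih.trans (by omega))
    · exact (natDegree_C_mul_le _ _).trans ((natDegree_le _ _).trans (by omega))

/-- Multiplied by x^((a-1)/2) e^(-x/2) / 2 this is the antiderivative property. The induction works
because, by `three_term_derivative`, (2i+3) L_{2i+3} - (2i+2+a) L_{2i+1} is, up to the same weight,
twice the derivative of x^((a+1)/2) e^(-x/2) L_{2i+2}. -/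
theorem X_mul_derivative_antideriv (a : ℝ) (i : ℕ) :
    C 2 * X * derivative (antideriv a i) =
      C 2 * laguerre (2 * i + 1) a - (C (a + 1) - X) * antideriv a i := by
  induction i with
  | zero =>
    have h := succ_mul 0 a
    simp only [zero_eq, Nat.cast_zero, zero_add, C_1, one_mul, C_add] at h
    simp only [antideriv_zero, derivative_C, mul_zero, zero_add, h, C_add, C_1]; ring
  | succ i ih =>
    have h1 := antideriv_succ a i
    have h2 := congrArg derivative h1
    simp only [derivative_add, derivative_C_mul] at h2
    have h3 := three_term_derivative (2 * i + 1) a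
    have hne : (C (2 * (i : ℝ) + 3) : ℝ[X]) ≠ 0 := C_ne_zero.2 (by positivity)
    apply mul_left_cancel₀ hne
    have e2 : 2 * (i + 1) + 1 = 2 * i + 1 + 2 := by ring
    rw [e2]
    have c2 : (C (2 : ℝ) : ℝ[X]) = 2 := rfl
    have e3 : 2 * i + 1 + 1 = 2 * i + 2 := by ring
    rw [e3] at h3
    push_cast at h3
    have c3 : (C (2 * (i : ℝ) + 1 + 2) : ℝ[X]) = C (2 * (i : ℝ) + 3) := by congr 1; ring
    have c4 : (C (2 * (i : ℝ) + 1 + 1 + a) : ℝ[X]) = C (2 * (i : ℝ) + 2 + a) := by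
      congr 1; ring
    rw [c3, c4] at h3
    simp only [c2] at *
    linear_combination 2 * X * h2 + C (2 * (i : ℝ) + 2 + a) * ih + 2 * h3 +
      (C (a + 1) - X) * h1

/-- With L_j' = -L_{j-1}^(a+1) and L_j = L_j^(a+1) - L_{j-1}^(a+1) the Wronskian is a difference of
two products of polynomials orthogonal for the weight x^(a+1) e^(-x). Hence only neighbouring
degrees pair. -/
theorem skew_laguerre {a : ℝ} (ha : -1 < a + 1) (j k : ℕ) :
    gammaFunctional (a + 1) (wronskian (laguerre j a) (laguerre k a)) =
      (if j = k + 1 then Real.Gamma (k + (a + 1) + 1) / k.factorial else 0) -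
        if k = j + 1 then Real.Gamma (j + (a + 1) + 1) / j.factorial else 0 := by
  have ho := gammaFunctional.laguerre_orthogonal ha
  rcases j with _ | j <;> rcases k with _ | k
  · simp [wronskian, zero_eq]
  · have : wronskian (laguerre 0 a) (laguerre (k + 1) a) =
        -(laguerre 0 (a + 1) * laguerre k (a + 1)) := by
      simp only [wronskian, zero_eq, derivative_succ, derivative_one]; ring
    rw [this, map_neg, ho]
    by_cases h : k = 0
    · subst h; simp
    · simp [h, Ne.symm h]
  · have : wronskian (laguerre (j + 1) a) (laguerre 0 a) =
        laguerre j (a + 1) * laguerre 0 (a + 1) := by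
      simp only [wronskian, zero_eq, derivative_succ, derivative_one]; ring
    rw [this, ho]
    by_cases h : j = 0
    · subst h; simp
    · simp [h]
  · have : wronskian (laguerre (j + 1) a) (laguerre (k + 1) a) =
        laguerre j (a + 1) * laguerre (k + 1) (a + 1) -
          laguerre k (a + 1) * laguerre (j + 1) (a + 1) := by
      simp only [wronskian, derivative_succ]
      rw [succ_sub j a, succ_sub k a]; ring
    rw [this, map_sub, ho, ho]
    simp only [Nat.succ_inj]

theorem wronskian_anti (p q : ℝ[X]) : wronskian q p = -wronskian p q := by
  simp only [wronskian]; ring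

theorem C_mul_wronskian_antideriv (a : ℝ) (i : ℕ) (q : ℝ[X]) :
    C (2 * (i : ℝ) + 3) * wronskian (antideriv a (i + 1)) q =
      C (2 * (i : ℝ) + 2 + a) * wronskian (antideriv a i) q +
        C 2 * wronskian (laguerre (2 * i + 2) a) q := by
  have h1 := antideriv_succ a i
  have h2 := congrArg derivative h1
  simp only [derivative_add, derivative_C_mul] at h2
  simp only [wronskian]
  linear_combination derivative q * h1 - q * h2

theorem skew_antideriv_succ (a : ℝ) (i : ℕ) (q : ℝ[X]) :
    (2 * (i : ℝ) + 3) * gammaFunctional (a + 1) (wronskian (antideriv a (i + 1)) q) =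
      (2 * (i : ℝ) + 2 + a) * gammaFunctional (a + 1) (wronskian (antideriv a i) q) +
        2 * gammaFunctional (a + 1) (wronskian (laguerre (2 * i + 2) a) q) := by
  have h := congrArg (gammaFunctional (a + 1)) (C_mul_wronskian_antideriv a i q)
  rw [(gammaFunctional (a + 1)).map_add, C_mul', C_mul', C_mul'] at h
  simpa only [map_smul, smul_eq_mul] using h

theorem skew_antideriv_zero (a : ℝ) (q : ℝ[X]) :
    gammaFunctional (a + 1) (wronskian (antideriv a 0) q) =
      2 * gammaFunctional (a + 1) (wronskian (laguerre 0 a) q) := by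
  have : wronskian (antideriv a 0) q = C 2 * wronskian (laguerre 0 a) q := by
    simp only [wronskian, antideriv_zero, zero_eq, derivative_C, derivative_one]; ring
  rw [this, C_mul', map_smul, smul_eq_mul]

/-- Parity: γ_i is a combination of Laguerre polynomials of even degree, and two of these are never
neighbours. -/
theorem skew_antideriv_even {a : ℝ} (ha : -1 < a + 1) (i m : ℕ) :
    gammaFunctional (a + 1) (wronskian (antideriv a i) (laguerre (2 * m) a)) = 0 := by
  induction i with
  | zero =>
    rw [skew_antideriv_zero, skew_laguerre ha, if_neg (by omega), if_neg (by omega)]; simp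
  | succ i ih =>
    have h := skew_antideriv_succ a i (laguerre (2 * m) a)
    rw [ih, skew_laguerre ha, if_neg (by omega), if_neg (by omega)] at h
    simp only [sub_zero, mul_zero, add_zero, mul_eq_zero] at h
    exact h.resolve_left (by positivity)

theorem skew_antideriv_antideriv {a : ℝ} (ha : -1 < a + 1) (i j : ℕ) :
    gammaFunctional (a + 1) (wronskian (antideriv a i) (antideriv a j)) = 0 := by
  induction i with
  | zero =>
    have h := skew_antideriv_even ha j 0
    rw [mul_zero] at h
    rw [skew_antideriv_zero, wronskian_anti, map_neg, h]; simp
  | succ i ih =>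
    have h := skew_antideriv_succ a i (antideriv a j)
    rw [ih, wronskian_anti _ (laguerre (2 * i + 2) a), map_neg,
      show 2 * i + 2 = 2 * (i + 1) by ring, skew_antideriv_even ha] at h
    simp only [neg_zero, mul_zero, add_zero, mul_eq_zero] at h
    exact h.resolve_left (by positivity)

/-- For i < m no degree in γ_i neighbours 2m+1; at i = m the new Laguerre term gives the norm; at i
= m + 1 the inherited term and the new one cancel, after which the value stays 0. -/
theorem skew_antideriv_odd {a : ℝ} (ha : -1 < a + 1) (i m : ℕ) :
    gammaFunctional (a + 1) (wronskian (antideriv a i) (laguerre (2 * m + 1) a)) =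
      if i = m then -2 * (Real.Gamma (2 * i + a + 2) / (2 * i + 1).factorial) else 0 := by
  induction i with
  | zero =>
    rw [skew_antideriv_zero, skew_laguerre ha, if_neg (by omega)]
    by_cases h : m = 0
    · subst h; simp [show a + 1 + 1 = a + 2 by ring]
    · rw [if_neg (by omega), if_neg (Ne.symm h)]; simp
  | succ i ih =>
    have h := skew_antideriv_succ a i (laguerre (2 * m + 1) a)
    rw [ih, skew_laguerre ha] at h
    have hi : (0 : ℝ) ≤ i := i.cast_nonneg
    have hpos : (2 * (i : ℝ) + 3) ≠ 0 := by positivity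
    apply mul_left_cancel₀ hpos
    rw [h]
    have hG : Real.Gamma (2 * (i : ℝ) + a + 3) =
        (2 * (i : ℝ) + a + 2) * Real.Gamma (2 * (i : ℝ) + a + 2) := by
      rw [← Real.Gamma_add_one (by linarith)]; congr 1; ring
    rcases eq_or_ne i m with rfl | h1
    · rw [if_pos rfl, if_pos (by omega), if_neg (by omega), if_neg (by omega)]
      rw [show ((2 * i + 1 : ℕ) : ℝ) + (a + 1) + 1 = 2 * i + a + 3 by push_cast; ring, hG]
      have := Nat.cast_ne_zero (R := ℝ).2 (Nat.factorial_ne_zero (2 * i + 1))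
      field_simp; ring
    · rcases eq_or_ne (i + 1) m with rfl | h2
      · rw [if_neg h1, if_neg (by omega), if_pos (by omega), if_pos rfl]
        rw [show 2 * (i + 1) + 1 = (2 * i + 2) + 1 by ring, Nat.factorial_succ (2 * i + 2)]
        have := Nat.cast_ne_zero (R := ℝ).2 (Nat.factorial_ne_zero (2 * i + 2))
        push_cast
        rw [show 2 * (i : ℝ) + 2 + (a + 1) + 1 = 2 * ((i : ℝ) + 1) + a + 2 by ring]
        have h3 : (2 * (i : ℝ) + 2 + 1) ≠ 0 := by positivity
        field_simp; ring
      · rw [if_neg h1, if_neg (by omega), if_neg (by omega), if_neg h2]; simp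

/-- The skew orthogonal basis for `β = 4`. -/
def skewBasis (a : ℝ) (N : ℕ) : PairIndex (Fin N) Empty → ℝ[X]
  | .inl (.inl j) => antideriv a j
  | .inl (.inr j) => laguerre (2 * j + 1) a

theorem isBlock_skewBasis {a : ℝ} (ha : -1 < a + 1) (N : ℕ) :
    IsBlock (fun b c => gammaFunctional (a + 1) (wronskian (skewBasis a N b) (skewBasis a N c)))
      (fun _ => 0) where
  anti b c := by rw [wronskian_anti, map_neg]
  eq_star b c h := by
    rcases b with (i | i) | r
    · refine ⟨?_, rfl⟩
      rcases c with (j | j) | r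
      · exact absurd (skew_antideriv_antideriv ha i j) h
      · rw [PairIndex.star]
        by_contra hne
        refine h ?_
        simp only [skewBasis]
        rw [skew_antideriv_odd ha, if_neg fun h' => hne (by rw [Fin.ext h'])]
      · exact r.elim
    · refine ⟨?_, rfl⟩
      rcases c with (j | j) | r
      · rw [PairIndex.star]
        by_contra hne
        refine h ?_
        simp only [skewBasis]
        rw [wronskian_anti, map_neg, skew_antideriv_odd ha,
          if_neg fun h' => hne (by rw [Fin.ext h']), neg_zero]
      · refine absurd ?_ h
        simp only [skewBasis]
        rw [skew_laguerre ha, if_neg (by omega), if_neg (by omega), sub_zero]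
      · exact r.elim
    · exact r.elim
  pair_ne j := by
    simp only [skewBasis]
    rw [skew_antideriv_odd ha, if_pos rfl]
    have : 0 < Real.Gamma (2 * (j : ℕ) + a + 2) := Real.Gamma_pos_of_pos (by
      have : (0 : ℝ) ≤ (j : ℕ) := Nat.cast_nonneg _
      linarith)
    positivity
  l_left r := r.elim
  l_right r := r.elim

/-- The bracket in the closed form of the eigenvalue density; `g` stands for the value of the
normalised antiderivative. -/
def bracket (n : ℕ) (a x g : ℝ) : ℝ :=
  2 * x * (derivative (laguerre n a)).eval x ^ 2 +
    2 * (a - x) * (laguerre n a).eval x * (derivative (laguerre n a)).eval x +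
    (2 * n + 2) * (laguerre n a).eval x ^ 2 - (n + 1) * (laguerre n a).eval x * g

theorem eval_X_mul_derivative (n : ℕ) (a x : ℝ) :
    x * (derivative (laguerre n a)).eval x = ((n : ℝ) + 1) * (laguerre (n + 1) a).eval x -
      ((n : ℝ) + 1 + a - x) * (laguerre n a).eval x := by
  rcases n with _ | n
  · have h := congrArg (eval x) (succ_mul 0 a)
    simp only [zero_eq, eval_mul, eval_sub, eval_C, eval_X, eval_one] at h ⊢
    simp only [derivative_one, eval_zero]
    linear_combination -h
  · have h1 := congrArg (eval x) (X_mul_derivative n a)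
    have h2 := congrArg (eval x) (three_term_derivative n a)
    simp only [eval_mul, eval_sub, eval_add, eval_C, eval_X, eval_ofNat] at h1 h2
    push_cast
    linear_combination h2 - h1

theorem eval_X_mul_derivative_succ (n : ℕ) (a x : ℝ) :
    x * (derivative (laguerre (n + 1) a)).eval x =
      ((n : ℝ) + 1) * (laguerre (n + 1) a).eval x - ((n : ℝ) + 1 + a) * (laguerre n a).eval x := by
  simpa only [eval_mul, eval_sub, eval_C, eval_X] using congrArg (eval x) (X_mul_derivative n a)

theorem eval_succ_succ (n : ℕ) (a x : ℝ) :
    ((n : ℝ) + 2) * (laguerre (n + 2) a).eval x =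
      (2 * n + 3 + a - x) * (laguerre (n + 1) a).eval x -
        ((n : ℝ) + 1 + a) * (laguerre n a).eval x := by
  have h1 := eval_X_mul_derivative_succ n a x
  have h2 := eval_X_mul_derivative (n + 1) a x
  push_cast at h2
  linear_combination h1 - h2

/-- The right side is a multiple of x times the Wronskian of the antiderivative and L_{n+1}, so this
is the telescoping step for the sum over pairs. Everything is eliminated in favour of L_n, L_{n+1}
and `g`, after which it is an identity of rational functions. -/
theorem bracket_succ_succ (n : ℕ) (a x g g' : ℝ) (hx : x ≠ 0)
    (hg : ((n : ℝ) + 3) * g' = (n + 2 + a) * g + 2 * (laguerre (n + 2) a).eval x) :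
    ((n : ℝ) + 2) * (n + 1) * bracket (n + 2) a x g' -
      (n + a + 2) * (n + a + 1) * bracket n a x g =
    -2 * (n + 1) * (n + a + 2) *
      (g * (x * (derivative (laguerre (n + 1) a)).eval x) -
        (laguerre (n + 1) a).eval x *
          ((laguerre (n + 1) a).eval x - (a + 1 - x) / 2 * g)) := by
  have h0 := eval_X_mul_derivative n a x
  have h1 := eval_X_mul_derivative_succ n a x
  have h2 := eval_X_mul_derivative_succ (n + 1) a x
  have h3 := eval_succ_succ n a x
  rw [show n + 1 + 1 = n + 2 from rfl] at h2
  push_cast at h2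
  have hn : ((n : ℝ) + 2) ≠ 0 := by positivity
  have hn3 : ((n : ℝ) + 3) ≠ 0 := by positivity
  simp only [bracket]
  generalize (laguerre n a).eval x = A at *
  generalize (laguerre (n + 1) a).eval x = B at *
  generalize (laguerre (n + 2) a).eval x = D at *
  generalize (derivative (laguerre n a)).eval x = dA at *
  generalize (derivative (laguerre (n + 1) a)).eval x = dB at *
  generalize (derivative (laguerre (n + 2) a)).eval x = dD at *
  obtain rfl : D = ((2 * n + 3 + a - x) * B - (n + 1 + a) * A) / (n + 2) := by
    field_simp; linear_combination h3
  obtain rfl : dA = ((n + 1) * B - (n + 1 + a - x) * A) / x := by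
    field_simp; linear_combination h0
  obtain rfl : dB = ((n + 1) * B - (n + 1 + a) * A) / x := by
    field_simp; linear_combination h1
  obtain rfl : dD = ((n + 1 + 1) * (((2 * n + 3 + a - x) * B - (n + 1 + a) * A) / (n + 2)) -
      (n + 1 + 1 + a) * B) / x := by
    field_simp; field_simp at h2; linear_combination h2
  obtain rfl : g' = ((n + 2 + a) * g +
      2 * (((2 * n + 3 + a - x) * B - (n + 1 + a) * A) / (n + 2))) / (n + 3) := by
    field_simp; field_simp at hg; linear_combination hg
  push_cast
  field_simp
  ring

/-- A summation of Christoffel-Darboux type by telescoping. It starts from 0 because L_0 = 1 and γ_0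
= 2 make the bracket at degree 0 vanish. -/
theorem sum_skewBasis {a : ℝ} (ha : -1 < a + 1) {x : ℝ} (hx : 0 < x) (N : ℕ) :
    2 * (x * ∑ i ∈ Finset.range N, (wronskian (antideriv a i) (laguerre (2 * i + 1) a)).eval x /
      (-2 * (Real.Gamma (2 * i + a + 2) / (2 * i + 1).factorial))) =
    (2 * N).factorial * (2 * N + a + 1) / Real.Gamma (2 * N + a + 2) / 2 *
      bracket (2 * N) a x ((antideriv a N).eval x) := by
  induction N with
  | zero => simp [bracket, zero_eq, antideriv_zero]
  | succ i ih =>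
    have hi : (0 : ℝ) ≤ i := i.cast_nonneg
    rw [Finset.sum_range_succ, mul_add, mul_add, ih]
    have h1 := congrArg (eval x) (antideriv_succ a i)
    have h2 := congrArg (eval x) (X_mul_derivative_antideriv a i)
    simp only [eval_mul, eval_sub, eval_add, eval_C, eval_X] at h1 h2
    have h3 := bracket_succ_succ (2 * i) a x ((antideriv a i).eval x)
      ((antideriv a (i + 1)).eval x) hx.ne' (by push_cast; linear_combination h1)
    have hG : Real.Gamma (2 * (i : ℝ) + a + 3) =
        (2 * (i : ℝ) + a + 2) * Real.Gamma (2 * (i : ℝ) + a + 2) := by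
      rw [← Real.Gamma_add_one (by linarith)]; congr 1; ring
    have hG' : Real.Gamma (2 * ((i + 1 : ℕ) : ℝ) + a + 2) =
        (2 * (i : ℝ) + a + 3) * Real.Gamma (2 * (i : ℝ) + a + 3) := by
      rw [← Real.Gamma_add_one (by linarith)]; congr 1; push_cast; ring
    have hG0 : Real.Gamma (2 * (i : ℝ) + a + 2) ≠ 0 :=
      (Real.Gamma_pos_of_pos (by linarith)).ne'
    have p2 : (2 * (i : ℝ) + a + 2) ≠ 0 := by linarith
    have p3 : (2 * (i : ℝ) + a + 3) ≠ 0 := by linarith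
    rw [hG', hG, show 2 * (i + 1) = 2 * i + 1 + 1 by ring, Nat.factorial_succ (2 * i + 1),
      Nat.factorial_succ (2 * i)]
    have hf := Nat.cast_ne_zero (R := ℝ).2 (Nat.factorial_ne_zero (2 * i))
    rw [show 2 * i + 1 + 1 = 2 * i + 2 by ring]
    have hw : x * (wronskian (antideriv a i) (laguerre (2 * i + 1) a)).eval x =
        (antideriv a i).eval x * (x * (derivative (laguerre (2 * i + 1) a)).eval x) -
        (laguerre (2 * i + 1) a).eval x * ((laguerre (2 * i + 1) a).eval x -
          (a + 1 - x) / 2 * (antideriv a i).eval x) := by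
      simp only [wronskian, eval_sub, eval_mul]
      linear_combination (-(laguerre (2 * i + 1) a).eval x / 2) * h2
    rw [← mul_div_assoc x, hw]
    push_cast at h3 ⊢
    generalize bracket (2 * i + 2) a x _ = R2 at *
    generalize bracket (2 * i) a x _ = R0 at *
    generalize (antideriv a i).eval x * (x * (derivative (laguerre (2 * i + 1) a)).eval x) -
        (laguerre (2 * i + 1) a).eval x * ((laguerre (2 * i + 1) a).eval x -
          (a + 1 - x) / 2 * (antideriv a i).eval x) = Y at *
    have q1 : (2 * (i : ℝ) + 1) ≠ 0 := by positivity
    have q3 : 2 * ((i : ℝ) + 1) + a + 1 = 2 * i + a + 3 := by ring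
    rw [q3]
    field_simp
    linear_combination (-1) * h3

end laguerre

/-- The eigenvalue density of the Laguerre symplectic ensemble in closed form. -/
theorem laguerreDensity_four {a : ℝ} (ha : -1 < a + 1) (N : ℕ) :
    ensembleZ 4 (laguerreWeight 4 a) (N + 1) ≠ 0 ∧ ∀ x, 0 < x →
      2 * (x * ensembleDensity 4 (laguerreWeight 4 a) (N + 1) x) =
        (2 * (N + 1)).factorial / Real.Gamma (2 * (N + 1) + a + 1) / 2 *
          (x ^ (a + 1) * Real.exp (-x)) *
          laguerre.bracket (2 * (N + 1)) a x ((laguerre.antideriv a (N + 1)).eval x) := by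
  have hexp : laguerreExponent 4 a = a + 1 := by simp [laguerreExponent]
  have hint := fun p => integral_laguerreWeight (β := 4) (a := a) (by rw [hexp]; exact ha) p
  simp only [hexp] at hint
  have hB := laguerre.isBlock_skewBasis ha (N + 1)
  simp only [← (hint _).2] at hB
  obtain ⟨hZ, hd⟩ := PairIndex.ensembleDensity_four (laguerreWeight 4 a)
    (laguerre.skewBasis a (N + 1)) (by
      rintro ((j | j) | r)
      · exact (laguerre.natDegree_antideriv_le a j).trans_lt (by omega)
      · exact (laguerre.natDegree_le _ a).trans_lt (by omega)
      · exact r.elim) (fun p => (hint p).1) hB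
  refine ⟨hZ, fun x hx => ?_⟩
  rw [hd]
  simp only [(hint _).2, laguerre.skewBasis]
  have hw : laguerreWeight 4 a x = x ^ (a + 1) * Real.exp (-x) := by
    rw [laguerreWeight, if_pos hx, hexp]
  have h := laguerre.sum_skewBasis ha hx (N + 1)
  rw [← Fin.sum_univ_eq_sum_range (fun i : ℕ => (Polynomial.wronskian (laguerre.antideriv a i)
    (laguerre (2 * i + 1) a)).eval x / (-2 * (Real.Gamma (2 * i + a + 2) /
      (2 * i + 1).factorial)))] at h
  simp only [laguerre.skew_antideriv_odd ha, if_true, hw,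
    mul_div_right_comm _ (x ^ (a + 1) * Real.exp (-x)), ← Finset.sum_mul]
  have hN : (0 : ℝ) ≤ N := N.cast_nonneg
  have hG : Real.Gamma (2 * ((N : ℝ) + 1) + a + 2) =
      (2 * ((N : ℝ) + 1) + a + 1) * Real.Gamma (2 * ((N : ℝ) + 1) + a + 1) := by
    rw [← Real.Gamma_add_one (by linarith)]; congr 1; ring
  push_cast at h ⊢
  rw [hG] at h
  have p1 : 2 * ((N : ℝ) + 1) + a + 1 ≠ 0 := by linarith
  rw [mul_comm (2 * ((N : ℝ) + 1) + a + 1), mul_div_mul_right _ _ p1] at h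
  linear_combination (x ^ (a + 1) * Real.exp (-x)) * h

/-! ### The orthogonal ensemble: skew orthogonal basis and closed form of the density. -/

theorem signInt_eq {g : ℝ → ℝ} (hg : Integrable g) (x : ℝ) :
    signInt g x = (∫ t, g t) - 2 * ∫ t in Iic x, g t := by
  have h1 : signInt g x = (∫ t in Ioi x, g t) - ∫ t in Iic x, g t := by
    rw [integral_Iic_eq_integral_Iio, ← integral_indicator measurableSet_Ioi,
      ← integral_indicator measurableSet_Iio, ← integral_sub (hg.indicator measurableSet_Ioi)
        (hg.indicator measurableSet_Iio), signInt]
    refine integral_congr_ae (Eventually.of_forall fun y => ?_)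
    simp only [indicator, mem_Ioi, mem_Iio]
    rcases lt_trichotomy x y with h | h | h
    · rw [Real.sign_of_pos (sub_pos.2 h), if_pos h, if_neg h.not_gt]; ring
    · subst h; simp
    · rw [Real.sign_of_neg (sub_neg.2 h), if_pos h, if_neg h.not_gt]; ring
  have h2 := intervalIntegral.integral_Iic_add_Ioi (b := x) hg.integrableOn hg.integrableOn
  rw [h1, ← h2]; ring

theorem signForm_linear_right {f g h : ℝ → ℝ} (hf : Integrable f) (hg : Integrable g)
    (hh : Integrable h) (b c : ℝ) :
    signForm f (fun t => b * g t + c * h t) = b * signForm f g + c * signForm f h := by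
  simp only [signForm, Measure.volume_eq_prod]
  have hg' := integrable_mul_sign hf hg
  have hh' := integrable_mul_sign hf hh
  rw [← integral_const_mul, ← integral_const_mul, ← integral_add (hg'.const_mul _)
    (hh'.const_mul _)]
  refine integral_congr_ae (Eventually.of_forall fun p => ?_)
  simp only; ring

namespace laguerre
open Polynomial PairIndex

variable (a : ℝ)

/-- The weighted Laguerre polynomials for `β = 1`. -/
def waveOne (k : ℕ) (t : ℝ) : ℝ := laguerreWeight 1 a t * (laguerre k a).eval (2 * t)

/-- The functions `t^((a+1)/2) e^(-t) L_k(2t)`. -/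
def primitive (k : ℕ) (t : ℝ) : ℝ :=
  t ^ ((a + 1) / 2) * Real.exp (-t) * (laguerre k a).eval (2 * t)

/-- The polynomial factor of the derivative of `primitive a k`. -/
def primitivePoly : ℕ → ℝ[X]
  | 0 => C (1 / 2) * (laguerre 1 a).comp (C 2 * X)
  | k + 1 => C (1 / 2) * (C ((k : ℝ) + 2) * (laguerre (k + 2) a).comp (C 2 * X) -
      C ((k : ℝ) + 1 + a) * (laguerre k a).comp (C 2 * X))

/-- The derivative of `primitive a k`. -/
def derivOne (k : ℕ) (t : ℝ) : ℝ := laguerreWeight 1 a t * (primitivePoly a k).eval t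

theorem derivOne_zero (t : ℝ) : waveOne a 1 t = 2 * derivOne a 0 t := by
  simp only [derivOne, waveOne, primitivePoly, eval_mul, eval_C, eval_comp, eval_X]; ring

/-- Modulo exact derivatives the waves of degree k + 2 and k are proportional. Their integrals,
antiderivatives and skew products follow from this in steps of two. -/
theorem derivOne_succ (k : ℕ) (t : ℝ) : ((k : ℝ) + 2) * waveOne a (k + 2) t =
    (k + 1 + a) * waveOne a k t + 2 * derivOne a (k + 1) t := by
  simp only [derivOne, waveOne, primitivePoly, eval_mul, eval_C, eval_comp, eval_X, eval_sub]
  ring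

theorem eval_primitivePoly (k : ℕ) (t : ℝ) : (primitivePoly a k).eval t =
    ((a + 1) / 2 - t) * (laguerre k a).eval (2 * t) +
      2 * t * (derivative (laguerre k a)).eval (2 * t) := by
  rcases k with _ | k
  · have h := congrArg (eval (2 * t)) (succ_mul 0 a)
    simp only [zero_eq, eval_mul, eval_sub, eval_C, eval_X, eval_one, Nat.cast_zero] at h
    simp only [primitivePoly, eval_mul, eval_C, eval_comp, eval_X, zero_eq, derivative_one,
      eval_one, eval_zero]
    linear_combination h / 2
  · have h := congrArg (eval (2 * t)) (three_term_derivative k a)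
    simp only [eval_mul, eval_sub, eval_add, eval_C, eval_X, eval_ofNat] at h
    simp only [primitivePoly, eval_mul, eval_C, eval_comp, eval_X, eval_sub]
    linear_combination -h / 2

theorem natDegree_comp_le (k : ℕ) : ((laguerre k a).comp (C 2 * X)).natDegree ≤ k := by
  rw [natDegree_comp, natDegree_C_mul_X _ two_ne_zero, mul_one]
  exact natDegree_le k a

theorem natDegree_primitivePoly_le (k : ℕ) : (primitivePoly a k).natDegree ≤ k + 1 := by
  rcases k with _ | k
  · exact (natDegree_C_mul_le _ _).trans (natDegree_comp_le a 1)
  · refine (natDegree_C_mul_le _ _).trans ((natDegree_sub_le _ _).trans (max_le ?_ ?_))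
    · exact (natDegree_C_mul_le _ _).trans (natDegree_comp_le a _)
    · exact (natDegree_C_mul_le _ _).trans ((natDegree_comp_le a _).trans (by omega))

variable {a}

theorem laguerreWeight_one_of_pos {t : ℝ} (ht : 0 < t) :
    laguerreWeight 1 a t = t ^ ((a - 1) / 2) * Real.exp (-t) := by
  rw [laguerreWeight, if_pos ht, laguerreExponent, if_pos rfl]

theorem laguerreWeight_of_nonpos {β : ℕ} {t : ℝ} (ht : t ≤ 0) : laguerreWeight β a t = 0 := by
  rw [laguerreWeight, if_neg ht.not_gt]

theorem mul_laguerreWeight_one {t : ℝ} (ht : 0 < t) :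
    t * laguerreWeight 1 a t = t ^ ((a + 1) / 2) * Real.exp (-t) := by
  rw [laguerreWeight_one_of_pos ht, show (a + 1) / 2 = (a - 1) / 2 + 1 by ring,
    Real.rpow_add_one ht.ne']; ring

theorem integrable_eval_one (ha : -1 < a) (p : ℝ[X]) :
    Integrable fun t => laguerreWeight 1 a t * p.eval t := by
  have h := (integral_laguerreWeight (β := 1) (a := a) (by
    rw [laguerreExponent, if_pos rfl]; linarith) p).1
  simpa only [mul_comm] using h

theorem integrable_waveOne (ha : -1 < a) (k : ℕ) : Integrable (waveOne a k) := by
  have h := integrable_eval_one ha ((laguerre k a).comp (C 2 * X))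
  simp only [eval_comp, eval_mul, eval_C, eval_X] at h
  exact h

theorem integrable_derivOne (ha : -1 < a) (k : ℕ) : Integrable (derivOne a k) :=
  integrable_eval_one ha _

theorem primitive_eq {t : ℝ} (ht : 0 < t) (k : ℕ) : primitive a k t = t * waveOne a k t := by
  rw [primitive, ← mul_laguerreWeight_one ht, waveOne]; ring

theorem hasDerivAt_primitive {t : ℝ} (ht : 0 < t) (k : ℕ) :
    HasDerivAt (primitive a k) (derivOne a k t) t := by
  have h1 := Real.hasDerivAt_rpow_const (x := t) (p := (a + 1) / 2) (Or.inl ht.ne')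
  have h2 : HasDerivAt (fun t : ℝ => Real.exp (-t)) (-Real.exp (-t)) t := by
    simpa using (hasDerivAt_neg t).exp
  have h3 : HasDerivAt (fun t : ℝ => (laguerre k a).eval (2 * t))
      ((derivative (laguerre k a)).eval (2 * t) * 2) t :=
    ((laguerre k a).hasDerivAt (2 * t)).comp t (by simpa using (hasDerivAt_id t).const_mul 2)
  have h : HasDerivAt (primitive a k) _ t := (h1.mul h2).mul h3
  refine h.congr_deriv ?_
  have e : t ^ ((a + 1) / 2) = t * t ^ ((a - 1) / 2) := by
    rw [show (a + 1) / 2 = (a - 1) / 2 + 1 by ring, Real.rpow_add_one ht.ne']; ring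
  rw [derivOne, eval_primitivePoly, laguerreWeight_one_of_pos ht,
    show (a + 1) / 2 - 1 = (a - 1) / 2 by ring, Pi.mul_apply, e]
  ring

theorem continuous_primitive (ha : -1 < a) (k : ℕ) : Continuous (primitive a k) := by
  unfold primitive
  have := Real.continuous_rpow_const (q := (a + 1) / 2) (by linarith)
  fun_prop

theorem primitive_zero (ha : -1 < a) (k : ℕ) : primitive a k 0 = 0 := by
  rw [primitive, Real.zero_rpow (by linarith)]; ring

theorem tendsto_primitive (ha : -1 < a) (k : ℕ) : Tendsto (primitive a k) atTop (nhds 0) := by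
  refine tendsto_zero_of_hasDerivAt_of_integrableOn_Ioi (a := 0)
    (fun x hx => hasDerivAt_primitive hx k) (integrable_derivOne ha k).integrableOn ?_
  have h := integrable_eval_one ha (X * (laguerre k a).comp (C 2 * X))
  refine (integrableOn_congr_fun (fun t ht => ?_) measurableSet_Ioi).1 h.integrableOn
  rw [primitive_eq ht, waveOne]
  simp only [eval_comp, eval_mul, eval_C, eval_X]; ring

theorem setIntegral_Ioi_derivOne (ha : -1 < a) (k : ℕ) {x : ℝ} (hx : 0 ≤ x) :
    ∫ t in Ioi x, derivOne a k t = -primitive a k x := by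
  rw [integral_Ioi_of_hasDerivAt_of_tendsto (continuous_primitive ha k).continuousWithinAt
    (fun t ht => hasDerivAt_primitive (hx.trans_lt ht) k) (integrable_derivOne ha k).integrableOn
    (tendsto_primitive ha k), zero_sub]

theorem integral_derivOne (ha : -1 < a) (k : ℕ) : ∫ t, derivOne a k t = 0 := by
  rw [← setIntegral_eq_integral_of_forall_compl_eq_zero (s := Ioi 0),
    setIntegral_Ioi_derivOne ha k le_rfl, primitive_zero ha, neg_zero]
  intro t ht
  rw [derivOne, laguerreWeight_of_nonpos (not_lt.1 ht), zero_mul]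

theorem setIntegral_Iic_derivOne (ha : -1 < a) (k : ℕ) {x : ℝ} (hx : 0 ≤ x) :
    ∫ t in Iic x, derivOne a k t = primitive a k x := by
  have h := intervalIntegral.integral_Iic_add_Ioi (b := x) (integrable_derivOne ha k).integrableOn
    (integrable_derivOne ha k).integrableOn
  rw [integral_derivOne ha, setIntegral_Ioi_derivOne ha k hx] at h
  linarith

theorem signInt_derivOne (ha : -1 < a) (k : ℕ) {x : ℝ} (hx : 0 ≤ x) :
    signInt (derivOne a k) x = -2 * primitive a k x := by
  rw [signInt_eq (integrable_derivOne ha k), integral_derivOne ha, setIntegral_Iic_derivOne ha k hx]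
  ring

/-- The sign kernel undoes differentiation: applied to an exact derivative whose primitive vanishes
at both ends it gives -2 times that primitive. The skew form thus becomes an ordinary inner product,
to which Laguerre orthogonality applies. -/
theorem signForm_derivOne (ha : -1 < a) {f : ℝ → ℝ} (hf : Integrable f)
    (hf0 : ∀ t ≤ 0, f t = 0) (k : ℕ) :
    signForm f (derivOne a k) = -2 * ∫ t in Ioi 0, f t * primitive a k t := by
  rw [signForm_eq hf (integrable_derivOne ha k), ← integral_const_mul,
    ← setIntegral_eq_integral_of_forall_compl_eq_zero (s := Ioi 0)]
  · refine setIntegral_congr_fun measurableSet_Ioi fun t ht => ?_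
    simp only [signInt_derivOne ha k (mem_Ioi.1 ht).le]; ring
  · intro t ht
    rw [hf0 t (not_lt.1 ht), zero_mul]

theorem waveOne_of_nonpos (k : ℕ) (t : ℝ) (ht : t ≤ 0) : waveOne a k t = 0 := by
  rw [waveOne, laguerreWeight_of_nonpos ht, zero_mul]

/-- The norms of the weighted Laguerre polynomials. -/
def normOne (a : ℝ) (k : ℕ) : ℝ := 2⁻¹ ^ (a + 1) * (Real.Gamma (k + a + 1) / k.factorial)

theorem normOne_pos (ha : -1 < a) (k : ℕ) : 0 < normOne a k := by
  have : 0 < Real.Gamma (k + a + 1) := Real.Gamma_pos_of_pos (by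
    have : (0 : ℝ) ≤ k := k.cast_nonneg
    linarith)
  unfold normOne; positivity

theorem normOne_succ (ha : -1 < a) (k : ℕ) :
    ((k : ℝ) + 1) * normOne a (k + 1) = (k + 1 + a) * normOne a k := by
  have hk : (0 : ℝ) ≤ k := k.cast_nonneg
  rw [normOne, normOne, Nat.factorial_succ]
  push_cast
  rw [show (k : ℝ) + 1 + a + 1 = (k + a + 1) + 1 by ring, Real.Gamma_add_one (by linarith)]
  have := Nat.cast_ne_zero (R := ℝ).2 (Nat.factorial_ne_zero k)
  field_simp; ring

/-- The two weights multiply to t^a e^(-2t), and x = 2t leads back to the moment functional. This is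
why the Laguerre polynomials are taken at 2t. -/
theorem integral_waveOne_mul_primitive (ha : -1 < a) (j k : ℕ) :
    IntegrableOn (fun t => waveOne a j t * primitive a k t) (Ioi 0) ∧
    ∫ t in Ioi 0, waveOne a j t * primitive a k t = if j = k then normOne a k else 0 := by
  have key : ∀ t ∈ Ioi (0 : ℝ), waveOne a j t * primitive a k t = 2⁻¹ ^ a *
      (fun x => (laguerre j a * laguerre k a).eval x * (x ^ a * Real.exp (-x))) (2 * t) := by
    intro t ht
    have ht' : 0 < t := ht
    have e1 : (2⁻¹ : ℝ) ^ a * (2 * t) ^ a = t ^ ((a - 1) / 2) * t ^ ((a + 1) / 2) := by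
      rw [← Real.mul_rpow (by norm_num) (by positivity), ← Real.rpow_add ht']
      congr 1 <;> ring
    have e2 : Real.exp (-(2 * t)) = Real.exp (-t) * Real.exp (-t) := by
      rw [← Real.exp_add]; congr 1; ring
    rw [waveOne, primitive, laguerreWeight_one_of_pos ht']
    simp only [eval_mul]
    rw [e2]
    linear_combination (-(laguerre j a).eval (2 * t) * (laguerre k a).eval (2 * t) *
      (Real.exp (-t) * Real.exp (-t))) * e1
  have hp := gammaFunctional.integrable_and_eq ha (laguerre j a * laguerre k a)
  constructor
  · refine (integrableOn_congr_fun (fun t ht => (key t ht).symm) measurableSet_Ioi).1 ?_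
    refine Integrable.const_mul ?_ _
    exact (integrableOn_Ioi_comp_mul_left_iff (fun x => (laguerre j a * laguerre k a).eval x *
      (x ^ a * Real.exp (-x))) 0 (by norm_num : (0 : ℝ) < 2)).2 (by rw [mul_zero]; exact hp.1)
  · rw [setIntegral_congr_fun measurableSet_Ioi key, integral_const_mul,
      integral_comp_mul_left_Ioi (fun x => (laguerre j a * laguerre k a).eval x *
        (x ^ a * Real.exp (-x))) 0 (by norm_num : (0 : ℝ) < 2), mul_zero, hp.2,
      gammaFunctional.laguerre_orthogonal ha, normOne, Real.rpow_add_one (by norm_num)]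
    split_ifs with h
    · simp only [smul_eq_mul]; ring
    · simp

theorem signForm_waveOne_derivOne (ha : -1 < a) (j k : ℕ) :
    signForm (waveOne a j) (derivOne a k) = if j = k then -2 * normOne a k else 0 := by
  rw [signForm_derivOne ha (integrable_waveOne ha j) (waveOne_of_nonpos j),
    (integral_waveOne_mul_primitive ha j k).2]
  split_ifs <;> simp

/-- One of the derivatives is rewritten in waves whose degrees have the opposite parity; these are
orthogonal to the other derivative. -/
theorem signForm_derivOne_derivOne (ha : -1 < a) (j k : ℕ) (h : j % 2 = k % 2) :
    signForm (derivOne a j) (derivOne a k) = 0 := by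
  rw [signForm_anti]
  rcases j with _ | j
  · have e : derivOne a 0 = fun t => 1 / 2 * waveOne a 1 t + 0 * waveOne a 0 t := by
      funext t; rw [derivOne_zero]; ring
    rw [e, signForm_linear_right (integrable_derivOne ha k) (integrable_waveOne ha _)
      (integrable_waveOne ha _), signForm_anti, signForm_waveOne_derivOne ha,
      if_neg (by rintro rfl; omega)]
    simp
  · have e : derivOne a (j + 1) = fun t => (j + 2) / 2 * waveOne a (j + 2) t +
        (-(j + 1 + a) / 2) * waveOne a j t := by
      funext t; linear_combination (-1 / 2) * derivOne_succ a j t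
    rw [e, signForm_linear_right (integrable_derivOne ha k) (integrable_waveOne ha _)
      (integrable_waveOne ha _), signForm_anti, signForm_waveOne_derivOne ha,
      signForm_anti (waveOne a j), signForm_waveOne_derivOne ha,
      if_neg (by rintro rfl; omega), if_neg (by rintro rfl; omega)]
    simp

theorem waveOne_succ_succ (k : ℕ) : waveOne a (k + 2) =
    fun t => (k + 1 + a) / (k + 2) * waveOne a k t + 2 / (k + 2) * derivOne a (k + 1) t := by
  funext t
  have h := derivOne_succ a k t
  have : (k : ℝ) + 2 ≠ 0 := by positivity
  field_simp
  linear_combination h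

theorem waveOne_one : waveOne a 1 = fun t => 0 * waveOne a 0 t + 2 * derivOne a 0 t := by
  funext t; rw [derivOne_zero]; ring

theorem signForm_waveOne_odd_odd (ha : -1 < a) (m i : ℕ) :
    signForm (waveOne a (2 * m + 1)) (waveOne a (2 * i + 1)) = 0 := by
  induction i with
  | zero =>
    rw [mul_zero, zero_add, waveOne_one, signForm_linear_right (integrable_waveOne ha _)
      (integrable_waveOne ha _) (integrable_derivOne ha _), signForm_waveOne_derivOne ha,
      if_neg (by omega)]
    simp
  | succ i ih =>
    rw [show 2 * (i + 1) + 1 = 2 * i + 1 + 2 by ring, waveOne_succ_succ,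
      signForm_linear_right (integrable_waveOne ha _)
      (integrable_waveOne ha _) (integrable_derivOne ha _), ih, signForm_waveOne_derivOne ha,
      if_neg (by omega)]
    simp

/-- Passing to degree 2i+1 adds a derivative of index 2i, and only the index 2m pairs with degree
2m. Beyond i = m the nonzero value would be inherited, whence the bound on `i`. -/
theorem signForm_waveOne_even_odd (ha : -1 < a) (m i : ℕ) (hi : i ≤ m) :
    signForm (waveOne a (2 * m)) (waveOne a (2 * i + 1)) =
      if i = m then -4 / (2 * m + 1) * normOne a (2 * m) else 0 := by
  induction i with
  | zero =>
    rw [mul_zero, zero_add, waveOne_one, signForm_linear_right (integrable_waveOne ha _)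
      (integrable_waveOne ha _) (integrable_derivOne ha _), signForm_waveOne_derivOne ha]
    rcases eq_or_ne m 0 with rfl | h
    · simp; ring
    · rw [if_neg (by omega), if_neg (Ne.symm h)]; simp
  | succ i ih =>
    rw [show 2 * (i + 1) + 1 = 2 * i + 1 + 2 by ring, waveOne_succ_succ,
      signForm_linear_right (integrable_waveOne ha _)
      (integrable_waveOne ha _) (integrable_derivOne ha _), ih (by omega), if_neg (by omega),
      signForm_waveOne_derivOne ha]
    rcases eq_or_ne (i + 1) m with rfl | h
    · rw [if_pos (by omega), if_pos rfl, show 2 * i + 1 + 1 = 2 * (i + 1) by ring]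
      push_cast
      have : (2 * (i : ℝ) + 1 + 2) ≠ 0 := by positivity
      have : (2 * ((i : ℝ) + 1) + 1) ≠ 0 := by positivity
      field_simp; ring
    · rw [if_neg (by omega), if_neg h]; simp

theorem integral_waveOne_odd (ha : -1 < a) (i : ℕ) : ∫ t, waveOne a (2 * i + 1) t = 0 := by
  induction i with
  | zero =>
    rw [mul_zero, zero_add]
    simp only [derivOne_zero]
    rw [integral_const_mul, integral_derivOne ha, mul_zero]
  | succ i ih =>
    rw [show 2 * (i + 1) + 1 = 2 * i + 1 + 2 by ring, waveOne_succ_succ,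
      integral_add ((integrable_waveOne ha _).const_mul _) ((integrable_derivOne ha _).const_mul _),
      integral_const_mul, integral_const_mul, ih, integral_derivOne ha]
    simp

theorem integral_waveOne_even (ha : -1 < a) (m : ℕ) :
    ∫ t, waveOne a (2 * m) t = Real.Gamma (m + (a + 1) / 2) / m.factorial := by
  induction m with
  | zero =>
    have h := (integral_laguerreWeight (β := 1) (a := a) (by
      rw [laguerreExponent, if_pos rfl]; linarith) (monomial 0 1)).2
    rw [gammaFunctional.monomial_eq, laguerreExponent, if_pos rfl] at h
    simp only [monomial_zero_left, eval_C, one_mul] at h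
    simp only [waveOne, mul_zero, zero_eq, eval_one, mul_one, h]
    simp only [Nat.cast_zero, Nat.factorial_zero, Nat.cast_one, div_one]
    congr 1; ring
  | succ m ih =>
    rw [show 2 * (m + 1) = 2 * m + 2 by ring, waveOne_succ_succ,
      integral_add ((integrable_waveOne ha _).const_mul _) ((integrable_derivOne ha _).const_mul _),
      integral_const_mul, integral_const_mul, ih, integral_derivOne ha, Nat.factorial_succ]
    push_cast
    have hm : (0 : ℝ) ≤ m := m.cast_nonneg
    rw [show (m : ℝ) + 1 + (a + 1) / 2 = m + (a + 1) / 2 + 1 by ring,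
      Real.Gamma_add_one (by linarith)]
    have := Nat.cast_ne_zero (R := ℝ).2 (Nat.factorial_ne_zero m)
    have : 2 * (m : ℝ) + 2 ≠ 0 := by positivity
    field_simp; ring

end laguerre

namespace laguerre
open Polynomial PairIndex

/-- The companion of `bracket_succ_succ` for a single step in the degree; it absorbs the additional
pair that occurs for an even number of eigenvalues. -/
theorem bracket_succ (n : ℕ) (a x g₀ g₁ g₂ : ℝ) (hx : x ≠ 0)
    (hg : ((n : ℝ) + 2) * g₂ = (n + 1 + a) * g₀ + 2 * (laguerre (n + 1) a).eval x) :
    ((n : ℝ) + 1) * bracket (n + 1) a x g₂ - (n + 1 + a) * bracket n a x g₁ =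
      (n + 1) * (n + 1 + a) * ((laguerre n a).eval x * g₁ - (laguerre (n + 1) a).eval x * g₀) := by
  have h0 := eval_X_mul_derivative n a x
  have h1 := eval_X_mul_derivative_succ n a x
  simp only [bracket]
  generalize (laguerre n a).eval x = A at *
  generalize (laguerre (n + 1) a).eval x = B at *
  generalize (derivative (laguerre n a)).eval x = dA at *
  generalize (derivative (laguerre (n + 1) a)).eval x = dB at *
  have hn : ((n : ℝ) + 2) ≠ 0 := by positivity
  obtain rfl : dA = ((n + 1) * B - (n + 1 + a - x) * A) / x := by
    field_simp; linear_combination h0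
  obtain rfl : dB = ((n + 1) * B - (n + 1 + a) * A) / x := by
    field_simp; linear_combination h1
  obtain rfl : g₂ = ((n + 1 + a) * g₀ + 2 * B) / (n + 2) := by
    field_simp; linear_combination hg
  push_cast
  field_simp
  ring

/-- The antiderivative of `waveOne a k`. -/
def cumOne (a : ℝ) (k : ℕ) (x : ℝ) : ℝ := ∫ t in Iic x, waveOne a k t

variable {a : ℝ}

theorem cumOne_one (ha : -1 < a) {x : ℝ} (hx : 0 ≤ x) : cumOne a 1 x = 2 * primitive a 0 x := by
  simp only [cumOne, derivOne_zero]
  rw [integral_const_mul, setIntegral_Iic_derivOne ha 0 hx]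

theorem cumOne_succ_succ (ha : -1 < a) {x : ℝ} (hx : 0 ≤ x) (k : ℕ) :
    ((k : ℝ) + 2) * cumOne a (k + 2) x = (k + 1 + a) * cumOne a k x +
      2 * primitive a (k + 1) x := by
  have h : cumOne a (k + 2) x = (k + 1 + a) / (k + 2) * cumOne a k x +
      2 / (k + 2) * primitive a (k + 1) x := by
    rw [cumOne, waveOne_succ_succ, integral_add ((integrable_waveOne ha _).integrableOn.const_mul _)
      ((integrable_derivOne ha _).integrableOn.const_mul _), integral_const_mul,
      integral_const_mul, setIntegral_Iic_derivOne ha _ hx, cumOne]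
  have : (k : ℝ) + 2 ≠ 0 := by positivity
  rw [h]; field_simp

/-- The contribution of a pair to the density. -/
def pairTerm (a : ℝ) (k : ℕ) (x : ℝ) : ℝ :=
  (waveOne a k x * primitive a k x - derivOne a k x * cumOne a k x) / normOne a k

/-- The weight `t^((a+1)/2) e^(-t)`. -/
def halfWeight (a x : ℝ) : ℝ := x ^ ((a + 1) / 2) * Real.exp (-x)

theorem halfWeight_pos {x : ℝ} (hx : 0 < x) : 0 < halfWeight a x := by
  unfold halfWeight; positivity

theorem halfWeight_sq {x : ℝ} (hx : 0 < x) :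
    (2 * x) ^ (a + 1) * Real.exp (-(2 * x)) = 2 ^ (a + 1) * halfWeight a x ^ 2 := by
  have e1 : x ^ (a + 1) = x ^ ((a + 1) / 2) * x ^ ((a + 1) / 2) := by
    rw [← Real.rpow_add hx]; congr 1; ring
  have e2 : Real.exp (-(2 * x)) = Real.exp (-x) * Real.exp (-x) := by
    rw [← Real.exp_add]; congr 1; ring
  rw [Real.mul_rpow (by norm_num) hx.le, e1, e2, halfWeight]; ring

theorem primitive_eq_halfWeight (k : ℕ) (x : ℝ) :
    primitive a k x = halfWeight a x * (laguerre k a).eval (2 * x) := rfl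

/-- The part of the density of the Laguerre orthogonal ensemble that is analogous to the density of
the symplectic ensemble. -/
def mainOne (a : ℝ) (n : ℕ) (x : ℝ) : ℝ :=
  n.factorial / Real.Gamma (n + a + 1) / 2 * ((2 * x) ^ (a + 1) * Real.exp (-(2 * x))) *
    bracket n a (2 * x) (cumOne a (n + 1) x / halfWeight a x)

theorem mainOne_eq {x : ℝ} (hx : 0 < x) (n : ℕ) : mainOne a n x = halfWeight a x ^ 2 *
    bracket n a (2 * x) (cumOne a (n + 1) x / halfWeight a x) / (2 * normOne a n) := by
  rw [mainOne, halfWeight_sq hx, normOne, Real.inv_rpow (by norm_num)]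
  have : (0 : ℝ) < 2 ^ (a + 1) := by positivity
  field_simp

/-- The same telescoping as for β = 4, with the antiderivative of the wave divided by its weight in
place of the polynomial γ. -/
theorem mainOne_succ_succ (ha : -1 < a) {x : ℝ} (hx : 0 < x) (n : ℕ) :
    mainOne a (n + 2) x = mainOne a n x + x * pairTerm a (n + 1) x := by
  have hn : (0 : ℝ) ≤ n := n.cast_nonneg
  have hw := halfWeight_pos (a := a) hx
  have hG := cumOne_succ_succ ha hx.le (n + 1)
  rw [primitive_eq_halfWeight] at hG
  push_cast at hG
  have h := bracket_succ_succ n a (2 * x) (cumOne a (n + 1) x / halfWeight a x)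
    (cumOne a (n + 3) x / halfWeight a x) (by positivity) (by
      rw [show n + 1 + 2 = n + 3 from rfl] at hG
      field_simp
      linear_combination hG)
  rw [mainOne_eq hx, mainOne_eq hx, pairTerm]
  have h1 := normOne_succ ha (n + 1)
  have h2 := normOne_succ ha n
  have p0 := (normOne_pos ha n).ne'
  have hna : (n : ℝ) + 1 + a ≠ 0 := by linarith
  have hna2 : (n : ℝ) + a + 2 ≠ 0 := by linarith
  rw [show n + 1 + 1 = n + 2 from rfl] at h1
  push_cast at h1
  have e1 : normOne a (n + 1) = (n + 1 + a) * normOne a n / (n + 1) := by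
    field_simp; linear_combination h2
  have e2 : normOne a (n + 2) = (n + a + 2) * ((n + 1 + a) * normOne a n / (n + 1)) / (n + 2) := by
    rw [← e1]; field_simp; linear_combination h1
  have hxd : x * derivOne a (n + 1) x = halfWeight a x *
      (((a + 1) / 2 - x) * (laguerre (n + 1) a).eval (2 * x) +
        2 * x * (derivative (laguerre (n + 1) a)).eval (2 * x)) := by
    rw [derivOne, ← mul_assoc, mul_laguerreWeight_one hx, eval_primitivePoly, halfWeight]
  have hxw := primitive_eq (a := a) hx (n + 1)
  rw [primitive_eq_halfWeight] at hxw
  have hp : x * ((waveOne a (n + 1) x * primitive a (n + 1) x -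
      derivOne a (n + 1) x * cumOne a (n + 1) x) / normOne a (n + 1)) =
      (halfWeight a x * (laguerre (n + 1) a).eval (2 * x) *
        (halfWeight a x * (laguerre (n + 1) a).eval (2 * x)) -
        halfWeight a x * (((a + 1) / 2 - x) * (laguerre (n + 1) a).eval (2 * x) +
        2 * x * (derivative (laguerre (n + 1) a)).eval (2 * x)) * cumOne a (n + 1) x) /
        normOne a (n + 1) := by
    rw [primitive_eq_halfWeight, ← mul_div_assoc]
    congr 1
    linear_combination (-halfWeight a x * (laguerre (n + 1) a).eval (2 * x)) * hxw -
      cumOne a (n + 1) x * hxd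
  rw [hp, e1, e2]
  rw [show n + 2 + 1 = n + 3 from rfl]
  generalize bracket (n + 2) a (2 * x) _ = R2 at *
  generalize bracket n a (2 * x) _ = R0 at *
  generalize (derivative (laguerre (n + 1) a)).eval (2 * x) = dB at *
  generalize (laguerre (n + 1) a).eval (2 * x) = B at *
  generalize normOne a n = h0 at *
  generalize halfWeight a x = w at *
  generalize cumOne a (n + 1) x = G at *
  clear hp hxw hxd h1 h2 e1 e2 hG
  field_simp at h ⊢
  linear_combination h

/-- The increment is the contribution of the pair formed by the waves of degree n and n + 1, apart
from the term with their integrals. -/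
theorem mainOne_succ (ha : -1 < a) {x : ℝ} (hx : 0 < x) (n : ℕ) :
    mainOne a (n + 1) x = mainOne a n x + x * ((waveOne a n x * cumOne a (n + 1) x -
      waveOne a (n + 1) x * cumOne a n x) * ((n + 1) / (2 * normOne a n))) := by
  have hn : (0 : ℝ) ≤ n := n.cast_nonneg
  have hw := halfWeight_pos (a := a) hx
  have hG := cumOne_succ_succ ha hx.le n
  rw [primitive_eq_halfWeight] at hG
  have h := bracket_succ n a (2 * x) (cumOne a n x / halfWeight a x)
    (cumOne a (n + 1) x / halfWeight a x) (cumOne a (n + 2) x / halfWeight a x) (by positivity) (by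
      field_simp
      linear_combination hG)
  rw [mainOne_eq hx, mainOne_eq hx]
  have h2 := normOne_succ ha n
  have p0 := (normOne_pos ha n).ne'
  have hna : (n : ℝ) + 1 + a ≠ 0 := by linarith
  have e1 : normOne a (n + 1) = (n + 1 + a) * normOne a n / (n + 1) := by
    field_simp; linear_combination h2
  have hx0 := primitive_eq (a := a) hx n
  have hx1 := primitive_eq (a := a) hx (n + 1)
  rw [primitive_eq_halfWeight] at hx0 hx1
  have hp : x * ((waveOne a n x * cumOne a (n + 1) x -
      waveOne a (n + 1) x * cumOne a n x) * ((n + 1) / (2 * normOne a n))) =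
      (halfWeight a x * (laguerre n a).eval (2 * x) * cumOne a (n + 1) x -
        halfWeight a x * (laguerre (n + 1) a).eval (2 * x) * cumOne a n x) *
        ((n + 1) / (2 * normOne a n)) := by
    rw [hx0, hx1]; ring
  rw [hp, e1, show n + 1 + 1 = n + 2 from rfl]
  generalize bracket (n + 1) a (2 * x) _ = R2 at *
  generalize bracket n a (2 * x) _ = R0 at *
  generalize (laguerre (n + 1) a).eval (2 * x) = B at *
  generalize (laguerre n a).eval (2 * x) = A at *
  generalize normOne a n = h0 at *
  generalize halfWeight a x = w at *
  generalize cumOne a (n + 1) x = G at *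
  generalize cumOne a n x = G0 at *
  clear hp hx0 hx1 h2 e1 hG
  field_simp at h ⊢
  linear_combination h

theorem mainOne_zero (ha : -1 < a) {x : ℝ} (hx : 0 < x) : mainOne a 0 x = 0 := by
  have hw := (halfWeight_pos (a := a) hx).ne'
  rw [mainOne, zero_add, cumOne_one ha hx.le, primitive_eq_halfWeight]
  simp only [bracket, zero_eq, eval_one, derivative_one, eval_zero]
  field_simp; simp

theorem mainOne_even (ha : -1 < a) {x : ℝ} (hx : 0 < x) (m : ℕ) :
    mainOne a (2 * m) x = x * ∑ j ∈ Finset.range m, pairTerm a (2 * j + 1) x := by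
  induction m with
  | zero => simp [mainOne_zero ha hx]
  | succ m ih =>
    rw [show 2 * (m + 1) = 2 * m + 2 by ring, mainOne_succ_succ ha hx, ih,
      Finset.sum_range_succ, mul_add]

/-- Legendre's duplication formula. An even number of eigenvalues produces the left side, an odd
number directly a Gamma quotient; thanks to this identity one formula `extraCoeff` serves both
parities. -/
theorem gamma_duplication_ratio (ha : -1 < a) (m : ℕ) :
    (2 * m + 1) * (Real.Gamma (m + (a + 1) / 2) / m.factorial) / (4 * normOne a (2 * m)) =
      Real.Gamma ((2 * m + 1) / 2 + 1) / Real.Gamma ((2 * m + 1) / 2 + (a + 1) / 2) := by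
  have hm : (0 : ℝ) ≤ m := m.cast_nonneg
  have h1 := Real.Gamma_mul_Gamma_add_half (m + 1)
  have h2 := Real.Gamma_mul_Gamma_add_half (m + (a + 1) / 2)
  have f1 : Real.Gamma ((m : ℝ) + 1) = m.factorial := Real.Gamma_nat_eq_factorial m
  have f2 : Real.Gamma (2 * ((m : ℝ) + 1)) = (2 * m + 1) * (2 * m).factorial := by
    have := Real.Gamma_nat_eq_factorial (2 * m + 1)
    rw [Nat.factorial_succ] at this
    push_cast at this
    rw [← this]; congr 1; ring
  rw [f1, f2] at h1
  rw [show 2 * ((m : ℝ) + (a + 1) / 2) = 2 * m + a + 1 by ring] at h2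
  have e1 : (2 : ℝ) ^ (1 - 2 * ((m : ℝ) + 1)) = 2 ^ (1 - (2 * (m : ℝ) + a + 1)) * 2 ^ (a + 1) / 2 / 2 := by
    rw [← Real.rpow_add (by norm_num), ← Real.rpow_sub_one (by norm_num),
      ← Real.rpow_sub_one (by norm_num)]; congr 1; ring
  rw [e1] at h1
  rw [normOne, Real.inv_rpow (by norm_num), show (2 * (m : ℝ) + 1) / 2 + 1 = m + 1 + 1 / 2 by ring,
    show (2 * (m : ℝ) + 1) / 2 + (a + 1) / 2 = m + (a + 1) / 2 + 1 / 2 by ring]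
  push_cast
  have g1 : 0 < Real.Gamma ((m : ℝ) + (a + 1) / 2 + 1 / 2) := Real.Gamma_pos_of_pos (by linarith)
  have g2 : 0 < Real.Gamma (2 * (m : ℝ) + a + 1) := Real.Gamma_pos_of_pos (by linarith)
  have g3 : (0 : ℝ) < m.factorial := Nat.cast_pos.2 (Nat.factorial_pos m)
  have g4 : (0 : ℝ) < (2 * m).factorial := Nat.cast_pos.2 (Nat.factorial_pos _)
  have t1 : (0 : ℝ) < 2 ^ (a + 1) := by positivity
  have t2 : (0 : ℝ) < 2 ^ (1 - (2 * (m : ℝ) + a + 1)) := by positivity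
  have t3 : 0 < √Real.pi := Real.sqrt_pos.2 Real.pi_pos
  rw [div_eq_div_iff (by positivity) g1.ne']
  generalize Real.Gamma ((m : ℝ) + (a + 1) / 2 + 1 / 2) = A at *
  generalize Real.Gamma ((m : ℝ) + (a + 1) / 2) = B at *
  generalize Real.Gamma ((m : ℝ) + 1 + 1 / 2) = D at *
  generalize Real.Gamma (2 * (m : ℝ) + a + 1) = E at *
  generalize (2 : ℝ) ^ (1 - (2 * (m : ℝ) + a + 1)) = t at *
  generalize (2 : ℝ) ^ (a + 1) = s at *
  generalize √Real.pi = r at *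
  field_simp
  field_simp at h1
  have hne : t * r ≠ 0 := by positivity
  apply mul_left_cancel₀ hne
  linear_combination (2 * (m : ℝ) + 1) * ((2 * m).factorial : ℝ) * s * t * r * h2 -
    t * r * E * h1

/-- The coefficient of the additional term in the density for `β = 1`. -/
def extraCoeff (a : ℝ) (n : ℕ) : ℝ :=
  Real.Gamma ((n : ℝ) / 2 + 1) / Real.Gamma ((n : ℝ) / 2 + (a + 1) / 2)

/-- The skew orthogonal basis for an odd number of variables. -/
def basisOdd (a : ℝ) (m : ℕ) : PairIndex (Fin m) Unit → ℝ[X]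
  | .inl (.inl j) => (laguerre (2 * j + 1) a).comp (C 2 * X)
  | .inl (.inr j) => primitivePoly a (2 * j + 1)
  | .inr _ => (laguerre (2 * m) a).comp (C 2 * X)

/-- The weighted skew orthogonal basis for an odd number of variables. -/
def waveOdd (a : ℝ) (m : ℕ) : PairIndex (Fin m) Unit → ℝ → ℝ
  | .inl (.inl j) => waveOne a (2 * j + 1)
  | .inl (.inr j) => derivOne a (2 * j + 1)
  | .inr _ => waveOne a (2 * m)

/-- The skew orthogonal basis for an even number of variables. -/
def basisEven (a : ℝ) (m : ℕ) : PairIndex (Option (Fin m)) Empty → ℝ[X]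
  | .inl (.inl (some j)) => (laguerre (2 * j + 1) a).comp (C 2 * X)
  | .inl (.inr (some j)) => primitivePoly a (2 * j + 1)
  | .inl (.inl none) => (laguerre (2 * m) a).comp (C 2 * X)
  | .inl (.inr none) => (laguerre (2 * m + 1) a).comp (C 2 * X)

/-- The weighted skew orthogonal basis for an even number of variables. -/
def waveEven (a : ℝ) (m : ℕ) : PairIndex (Option (Fin m)) Empty → ℝ → ℝ
  | .inl (.inl (some j)) => waveOne a (2 * j + 1)
  | .inl (.inr (some j)) => derivOne a (2 * j + 1)
  | .inl (.inl none) => waveOne a (2 * m)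
  | .inl (.inr none) => waveOne a (2 * m + 1)

theorem waveOne_eq (k : ℕ) :
    waveOne a k = fun t => laguerreWeight 1 a t * ((laguerre k a).comp (C 2 * X)).eval t := by
  funext t; simp only [waveOne, eval_comp, eval_mul, eval_C, eval_X]

theorem waveOdd_eq (m : ℕ) :
    waveOdd a m = fun b t => laguerreWeight 1 a t * (basisOdd a m b).eval t := by
  funext b
  rcases b with (j | j) | r
  · exact waveOne_eq _
  · rfl
  · exact waveOne_eq _

theorem waveEven_eq (m : ℕ) :
    waveEven a m = fun b t => laguerreWeight 1 a t * (basisEven a m b).eval t := by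
  funext b
  rcases b with ((_ | j) | (_ | j)) | r
  · exact waveOne_eq _
  · exact waveOne_eq _
  · exact waveOne_eq _
  · rfl
  · exact r.elim

theorem signForm_self (f : ℝ → ℝ) : signForm f f = 0 := by
  have := signForm_anti f f
  linarith

theorem signForm_derivOne_waveOne (ha : -1 < a) (j k : ℕ) :
    signForm (derivOne a k) (waveOne a j) = if j = k then 2 * normOne a k else 0 := by
  rw [signForm_anti, signForm_waveOne_derivOne ha]
  split_ifs <;> simp

theorem signForm_waveOne_odd_even (ha : -1 < a) (m i : ℕ) (hi : i ≤ m) :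
    signForm (waveOne a (2 * i + 1)) (waveOne a (2 * m)) =
      if i = m then 4 / (2 * m + 1) * normOne a (2 * m) else 0 := by
  rw [signForm_anti, signForm_waveOne_even_odd ha m i hi]
  split_ifs <;> ring

theorem isBlock_waveOdd (ha : -1 < a) (m : ℕ) :
    IsBlock (fun b c => signForm (waveOdd a m b) (waveOdd a m c))
      (fun b => ∫ t, waveOdd a m b t) where
  anti b c := signForm_anti _ _
  eq_star b c h := by
    contrapose! h
    rcases b with (i | i) | r <;> rcases c with (j | j) | s <;>
      simp only [waveOdd, PairIndex.star, Sum.isLeft_inl, Sum.isLeft_inr, ne_eq, reduceCtorEq,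
        Sum.inl.injEq, Sum.inr.injEq, not_true_eq_false, imp_false,
        forall_const, not_false_eq_true, implies_true, Fin.ext_iff, Bool.false_eq_true] at h ⊢
    · exact signForm_waveOne_odd_odd ha _ _
    · rw [signForm_waveOne_derivOne ha, if_neg (by omega)]
    · rw [signForm_waveOne_odd_even ha _ _ i.2.le, if_neg i.2.ne]
    · rw [signForm_derivOne_waveOne ha, if_neg (by omega)]
    · exact signForm_derivOne_derivOne ha _ _ (by omega)
    · rw [signForm_derivOne_waveOne ha, if_neg (by omega)]
    · rw [signForm_waveOne_even_odd ha _ _ j.2.le, if_neg j.2.ne]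
    · rw [signForm_waveOne_derivOne ha, if_neg (by omega)]
    · exact signForm_self _
  pair_ne j := by
    simp only [waveOdd]
    rw [signForm_waveOne_derivOne ha, if_pos rfl]
    have := (normOne_pos ha (2 * j + 1)).ne'
    simpa
  l_left r b := by
    rcases b with j | j
    · exact integral_waveOne_odd ha j
    · exact integral_derivOne ha _
  l_right r := by
    simp only [waveOdd]
    rw [integral_waveOne_even ha]
    have : 0 < Real.Gamma (m + (a + 1) / 2) := Real.Gamma_pos_of_pos (by
      have : (0 : ℝ) ≤ m := m.cast_nonneg
      linarith)
    positivity

theorem isBlock_waveEven (ha : -1 < a) (m : ℕ) :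
    IsBlock (fun b c => signForm (waveEven a m b) (waveEven a m c))
      (fun b => ∫ t, waveEven a m b t) where
  anti b c := signForm_anti _ _
  eq_star b c h := by
    contrapose! h
    rcases b with ((_ | i) | (_ | i)) | r <;> rcases c with ((_ | j) | (_ | j)) | s <;>
      first
      | exact r.elim
      | exact s.elim
      | skip
    all_goals
      simp only [waveEven, PairIndex.star, Sum.isLeft_inl, ne_eq, reduceCtorEq,
        Sum.inl.injEq, Sum.inr.injEq, not_true_eq_false, imp_false, Option.some.injEq,
        not_false_eq_true, Fin.ext_iff] at h ⊢
    · exact signForm_self _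
    · rw [signForm_waveOne_even_odd ha _ _ j.2.le, if_neg j.2.ne]
    · rw [signForm_waveOne_derivOne ha, if_neg (by omega)]
    · rw [signForm_waveOne_odd_even ha _ _ i.2.le, if_neg i.2.ne]
    · exact signForm_waveOne_odd_odd ha _ _
    · exact signForm_waveOne_odd_odd ha _ _
    · rw [signForm_waveOne_derivOne ha, if_neg (by omega)]
    · exact signForm_waveOne_odd_odd ha _ _
    · exact signForm_self _
    · rw [signForm_waveOne_derivOne ha, if_neg (by omega)]
    · rw [signForm_derivOne_waveOne ha, if_neg (by omega)]
    · rw [signForm_derivOne_waveOne ha, if_neg (by omega)]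
    · rw [signForm_derivOne_waveOne ha, if_neg (by omega)]
    · exact signForm_derivOne_derivOne ha _ _ (by omega)
  pair_ne j := by
    rcases j with _ | j
    · simp only [waveEven]
      rw [signForm_waveOne_even_odd ha _ _ le_rfl, if_pos rfl]
      have := (normOne_pos ha (2 * m)).ne'
      have : (2 * (m : ℝ) + 1) ≠ 0 := by positivity
      positivity
    · simp only [waveEven]
      rw [signForm_waveOne_derivOne ha, if_pos rfl]
      have := (normOne_pos ha (2 * j + 1)).ne'
      simpa
  l_left r := r.elim
  l_right r := r.elim

theorem ratio_pair (ha : -1 < a) {x : ℝ} (hx : 0 < x) (j : ℕ) :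
    waveOne a (2 * j + 1) x * signInt (derivOne a (2 * j + 1)) x /
        signForm (waveOne a (2 * j + 1)) (derivOne a (2 * j + 1)) +
      derivOne a (2 * j + 1) x * signInt (waveOne a (2 * j + 1)) x /
        signForm (derivOne a (2 * j + 1)) (waveOne a (2 * j + 1)) = pairTerm a (2 * j + 1) x := by
  rw [signForm_waveOne_derivOne ha, signForm_derivOne_waveOne ha, if_pos rfl, if_pos rfl,
    signInt_derivOne ha _ hx.le, signInt_eq (integrable_waveOne ha _), integral_waveOne_odd ha,
    pairTerm, cumOne]
  have := (normOne_pos ha (2 * j + 1)).ne'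
  field_simp; ring

/-- The eigenvalue density of the Laguerre orthogonal ensemble in closed form. -/
theorem laguerreDensity_one (ha : -1 < a) (n : ℕ) :
    ensembleZ 1 (laguerreWeight 1 a) (n + 1) ≠ 0 ∧ ∀ x, 0 < x →
      x * ensembleDensity 1 (laguerreWeight 1 a) (n + 1) x =
        mainOne a n x + extraCoeff a n * primitive a n x := by
  -- For even n the number n + 1 of variables is odd and the wave of degree n stays unpaired; for
  -- odd n = 2m + 1 the waves of degree 2m and 2m + 1 form the additional pair `none`.
  rcases Nat.even_or_odd' n with ⟨m, rfl | rfl⟩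
  · let e : PairIndex (Fin m) Unit ≃ Fin (2 * m + 1) := Fintype.equivOfCardEq (by simp; ring)
    obtain ⟨hZ, hd⟩ := ensembleDensity_one e (laguerreWeight 1 a) (basisOdd a m) (by
      rintro ((j | j) | r)
      · exact (natDegree_comp_le a _).trans_lt (by omega)
      · exact (natDegree_primitivePoly_le a (2 * j + 1)).trans_lt (by omega)
      · exact (natDegree_comp_le a _).trans_lt (by omega)) (waveOdd a m) (waveOdd_eq m) (by
      rw [waveOdd_eq]; exact fun b => integrable_eval_one ha _) (isBlock_waveOdd ha m)
    refine ⟨hZ, fun x hx => ?_⟩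
    rw [hd, mainOne_even ha hx, Fintype.sum_sum_type, Fintype.sum_sum_type,
      ← Finset.sum_add_distrib]
    simp only [ratio, waveOdd, PairIndex.star, ratio_pair ha hx, Finset.univ_unique,
      Finset.sum_singleton, integral_waveOne_even ha]
    rw [Fin.sum_univ_eq_sum_range (fun j => pairTerm a (2 * j + 1) x), mul_add,
      primitive_eq hx, extraCoeff]
    push_cast
    rw [mul_div_cancel_left₀ _ (two_ne_zero), Real.Gamma_nat_eq_factorial,
      div_div_eq_mul_div]
    ring
  · let e : PairIndex (Option (Fin m)) Empty ≃ Fin (2 * m + 1 + 1) :=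
      Fintype.equivOfCardEq (by simp; ring)
    obtain ⟨hZ, hd⟩ := ensembleDensity_one e (laguerreWeight 1 a) (basisEven a m) (by
      rintro (((_ | j) | (_ | j)) | r)
      · exact (natDegree_comp_le a _).trans_lt (by omega)
      · exact (natDegree_comp_le a _).trans_lt (by omega)
      · exact (natDegree_comp_le a _).trans_lt (by omega)
      · exact (natDegree_primitivePoly_le a (2 * j + 1)).trans_lt (by omega)
      · exact r.elim) (waveEven a m) (waveEven_eq m) (by
      rw [waveEven_eq]; exact fun b => integrable_eval_one ha _) (isBlock_waveEven ha m)
    refine ⟨hZ, fun x hx => ?_⟩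
    rw [hd, mainOne_succ ha hx, mainOne_even ha hx, Fintype.sum_sum_type, Fintype.sum_sum_type,
      ← Finset.sum_add_distrib, Fintype.sum_option]
    simp only [ratio, waveEven, PairIndex.star, ratio_pair ha hx, Finset.univ_eq_empty,
      Finset.sum_empty, add_zero]
    rw [Fin.sum_univ_eq_sum_range (fun j => pairTerm a (2 * j + 1) x), primitive_eq hx, extraCoeff,
      signForm_waveOne_even_odd ha _ _ le_rfl, if_pos rfl,
      signForm_waveOne_odd_even ha _ _ le_rfl, if_pos rfl,
      signInt_eq (integrable_waveOne ha _), signInt_eq (integrable_waveOne ha _),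
      integral_waveOne_odd ha, integral_waveOne_even ha]
    have h := gamma_duplication_ratio ha m
    push_cast
    rw [← h, cumOne, cumOne]
    have p0 := (normOne_pos ha (2 * m)).ne'
    have : (2 * (m : ℝ) + 1) ≠ 0 := by positivity
    have := Nat.cast_ne_zero (R := ℝ).2 (Nat.factorial_ne_zero m)
    field_simp
    ring

end laguerre

/-! ### Entire power series and their expansion in a small parameter. -/

/-- The power series with coefficients `f` converges everywhere. -/
def IsEntire (f : ℕ → ℝ) : Prop := ∀ R : ℝ, 0 ≤ R → Summable fun k => |f k| * R ^ k

/-- The sum of a real power series. -/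
def ser (f : ℕ → ℝ) (x : ℝ) : ℝ := ∑' k, f k * x ^ k

/-- The sum of a power series with real coefficients at a complex number. -/
def serC (f : ℕ → ℝ) (z : ℂ) : ℂ := ∑' k, (f k : ℂ) * z ^ k

/-- The coefficients of `z f(z)`. -/
def shift (f : ℕ → ℝ) : ℕ → ℝ
  | 0 => 0
  | k + 1 => f k

/-- The coefficients of `z f'(z)`. -/
def euler (f : ℕ → ℝ) (k : ℕ) : ℝ := k * f k

namespace IsEntire
variable {f g : ℕ → ℝ}

theorem mono (hg : IsEntire g) (h : ∀ k, |f k| ≤ |g k|) : IsEntire f := fun R hR =>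
  (hg R hR).of_nonneg_of_le (fun _ => by positivity) fun k =>
    mul_le_mul_of_nonneg_right (h k) (by positivity)

theorem add (hf : IsEntire f) (hg : IsEntire g) : IsEntire fun k => f k + g k := fun R hR =>
  ((hf R hR).add (hg R hR)).of_nonneg_of_le (fun _ => by positivity) fun k => by
    rw [← add_mul]
    exact mul_le_mul_of_nonneg_right (abs_add_le _ _) (by positivity)

theorem const_mul (hf : IsEntire f) (c : ℝ) : IsEntire fun k => c * f k := fun R hR =>
  ((hf R hR).mul_left |c|).congr fun k => by rw [abs_mul, mul_assoc]

theorem sub (hf : IsEntire f) (hg : IsEntire g) : IsEntire fun k => f k - g k := by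
  simpa [sub_eq_add_neg] using hf.add (hg.const_mul (-1))

theorem abs (hf : IsEntire f) : IsEntire fun k => |f k| := hf.mono fun k => by rw [abs_abs]

theorem euler (hf : IsEntire f) : IsEntire (euler f) := fun R hR =>
  (hf (2 * R) (by positivity)).of_nonneg_of_le (fun _ => by positivity) fun k => by
    have h : (k : ℝ) ≤ 2 ^ k := by exact_mod_cast Nat.lt_two_pow_self.le
    rw [_root_.euler, abs_mul, Nat.abs_cast, mul_pow]
    have : 0 ≤ |f k| * R ^ k := by positivity
    nlinarith

theorem shift (hf : IsEntire f) : IsEntire (shift f) := fun R hR => by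
  rw [← summable_nat_add_iff 1]
  refine ((hf R hR).mul_right R).congr fun k => ?_
  rw [_root_.shift, pow_succ, mul_assoc]

theorem tail (hf : IsEntire f) : IsEntire fun k => f (k + 1) := fun R hR => by
  refine ((summable_nat_add_iff 1).2 (hf (R + 1) (by positivity))).of_nonneg_of_le
    (fun _ => by positivity) fun k => ?_
  refine mul_le_mul_of_nonneg_left ?_ (abs_nonneg _)
  calc R ^ k ≤ (R + 1) ^ k := pow_le_pow_left₀ hR (by linarith) k
    _ ≤ (R + 1) ^ (k + 1) := pow_le_pow_right₀ (by linarith) (Nat.le_succ k)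

theorem summable (hf : IsEntire f) (x : ℝ) : Summable fun k => f k * x ^ k :=
  Summable.of_norm ((hf |x| (abs_nonneg x)).congr fun k => by
    rw [Real.norm_eq_abs, abs_mul, abs_pow])

theorem summableC (hf : IsEntire f) (z : ℂ) : Summable fun k => (f k : ℂ) * z ^ k :=
  Summable.of_norm ((hf ‖z‖ (norm_nonneg z)).congr fun k => by
    rw [norm_mul, norm_pow, Complex.norm_real, Real.norm_eq_abs])

theorem abs_ser_le (hg : IsEntire g) (h : ∀ k, |f k| ≤ g k) {x R : ℝ} (hx : |x| ≤ R) :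
    |ser f x| ≤ ser g R := by
  have hR : 0 ≤ R := (abs_nonneg x).trans hx
  rw [← Real.norm_eq_abs]
  refine tsum_of_norm_bounded (E := ℝ) (hg.summable R).hasSum fun k => ?_
  rw [Real.norm_eq_abs, abs_mul, abs_pow]
  exact mul_le_mul (h k) (pow_le_pow_left₀ (abs_nonneg x) hx k) (by positivity)
    ((abs_nonneg _).trans (h k))

theorem ser_add (hf : IsEntire f) (hg : IsEntire g) (x : ℝ) :
    ser (fun k => f k + g k) x = ser f x + ser g x := by
  rw [ser, ser, ser, ← (hf.summable x).tsum_add (hg.summable x)]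
  exact tsum_congr fun k => by ring

theorem ser_sub (hf : IsEntire f) (hg : IsEntire g) (x : ℝ) :
    ser (fun k => f k - g k) x = ser f x - ser g x := by
  rw [ser, ser, ser, ← (hf.summable x).tsum_sub (hg.summable x)]
  exact tsum_congr fun k => by ring

theorem ser_shift (hf : IsEntire f) (x : ℝ) : ser (_root_.shift f) x = x * ser f x := by
  rw [ser, ser, hf.shift.summable x |>.tsum_eq_zero_add, ← tsum_mul_left, _root_.shift, zero_mul,
    zero_add]
  exact tsum_congr fun k => by rw [_root_.shift, pow_succ]; ring

end IsEntire

theorem ser_const_mul (f : ℕ → ℝ) (c x : ℝ) : ser (fun k => c * f k) x = c * ser f x := by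
  rw [ser, ser, ← tsum_mul_left]
  exact tsum_congr fun k => by ring

theorem ofReal_ser (f : ℕ → ℝ) (x : ℝ) : ((ser f x : ℝ) : ℂ) = serC f x := by
  rw [ser, serC, Complex.ofReal_tsum]
  exact tsum_congr fun k => by push_cast; rfl

namespace IsEntire
variable {f g : ℕ → ℝ}

theorem hasDerivAt_serC (hf : IsEntire f) (z : ℂ) :
    HasDerivAt (serC f) (serC (fun k => ((k + 1 : ℕ) : ℝ) * f (k + 1)) z) z := by
  have h := hasDerivAt_tsum_of_isPreconnected (𝕜 := ℂ)
    (u := fun k => |_root_.euler f k| * (‖z‖ + 1) ^ k)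
    (t := Metric.ball 0 (‖z‖ + 1)) (g := fun k (w : ℂ) => (f k : ℂ) * w ^ k)
    (g' := fun k (w : ℂ) => (f k : ℂ) * (k * w ^ (k - 1))) (y₀ := 0) (y := z)
    (hf.euler _ (by positivity)) Metric.isOpen_ball (convex_ball _ _).isPreconnected
    (fun k w _ => (hasDerivAt_pow k w).const_mul _) (fun k w hw => ?_)
    (Metric.mem_ball_self (by positivity)) (hf.summableC 0) (by simp)
  · have e : serC (fun k => ((k + 1 : ℕ) : ℝ) * f (k + 1)) z =
        ∑' k, (f k : ℂ) * (k * z ^ (k - 1)) := by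
      have hs : Summable fun k => (f k : ℂ) * (k * z ^ (k - 1)) := by
        rw [← summable_nat_add_iff 1]
        refine (hf.euler.tail.summableC z).congr fun k => ?_
        simp [_root_.euler]; ring
      rw [hs.tsum_eq_zero_add, serC]
      simp only [Nat.cast_zero, zero_mul, mul_zero, zero_add]
      exact tsum_congr fun k => by push_cast; ring
    rw [e]; exact h
  · rw [mem_ball_zero_iff] at hw
    rcases k with _ | k
    · simp
    · rw [norm_mul, norm_mul, norm_pow, Complex.norm_real, Complex.norm_natCast, _root_.euler,
        abs_mul, Nat.abs_cast, Real.norm_eq_abs, Nat.add_sub_cancel]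
      have h1 : ‖w‖ ^ k ≤ (‖z‖ + 1) ^ (k + 1) :=
        (pow_le_pow_left₀ (norm_nonneg _) hw.le k).trans
          (pow_le_pow_right₀ (by linarith [norm_nonneg z]) (Nat.le_succ k))
      calc |f (k + 1)| * (((k + 1 : ℕ) : ℝ) * ‖w‖ ^ k)
          = ((k + 1 : ℕ) : ℝ) * |f (k + 1)| * ‖w‖ ^ k := by ring
        _ ≤ _ := mul_le_mul_of_nonneg_left h1 (by positivity)

theorem hasDerivAt_ser (hf : IsEntire f) (x : ℝ) :
    HasDerivAt (ser f) (ser (fun k => ((k + 1 : ℕ) : ℝ) * f (k + 1)) x) x := by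
  have h := (hf.hasDerivAt_serC x).real_of_complex
  simpa only [← ofReal_ser, Complex.ofReal_re] using h

theorem mul_ser_deriv (hf : IsEntire f) (x : ℝ) :
    x * ser (fun k => ((k + 1 : ℕ) : ℝ) * f (k + 1)) x = ser (_root_.euler f) x := by
  rw [← ser_shift (f := fun k => ((k + 1 : ℕ) : ℝ) * f (k + 1)) hf.euler.tail]
  congr 1
  funext k
  rcases k with _ | k <;> simp [_root_.shift, _root_.euler]

/-- Derivatives are expressed by the Euler operator z d/dz, which acts diagonally on coefficients;
differential equations then become identities between sequences. -/
theorem hasDerivAt_ser' (hf : IsEntire f) {x : ℝ} (hx : x ≠ 0) :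
    HasDerivAt (ser f) (ser (_root_.euler f) x / x) x := by
  rw [← hf.mul_ser_deriv, mul_div_cancel_left₀ _ hx]
  exact hf.hasDerivAt_ser x

theorem differentiable_serC (hf : IsEntire f) : Differentiable ℂ (serC f) := fun z =>
  (hf.hasDerivAt_serC z).differentiableAt

theorem continuous_ser (hf : IsEntire f) : Continuous (ser f) :=
  continuous_iff_continuousAt.2 fun x => (hf.hasDerivAt_ser x).continuousAt

theorem contDiff_ser (hf : IsEntire f) : ContDiff ℝ ∞ (ser f) := by
  have h : ∀ (n : ℕ) (f : ℕ → ℝ), IsEntire f → ContDiff ℝ n (ser f) := by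
    intro n
    induction n with
    | zero => exact fun f hf => contDiff_zero.2 hf.continuous_ser
    | succ n ih =>
      intro f hf
      push_cast
      rw [contDiff_succ_iff_deriv]
      refine ⟨fun x => (hf.hasDerivAt_ser x).differentiableAt, by simp, ?_⟩
      rw [funext fun x => (hf.hasDerivAt_ser x).deriv]
      exact ih _ hf.euler.tail
  exact contDiff_infty.2 fun n => h n f hf

end IsEntire

/-- The reciprocals of the Gamma function at `a + 1, a + 2, …`. -/
def rGamma (a : ℝ) (k : ℕ) : ℝ := (Real.Gamma (k + a + 1))⁻¹

/-- It holds also at the poles, where `Real.Gamma` is 0 by convention and its inverse is 0, the true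
value of 1/Γ. This admits a = -1, which occurs for β = 4. -/
theorem rGamma_succ (a : ℝ) (k : ℕ) : (k + 1 + a) * rGamma a (k + 1) = rGamma a k := by
  rw [rGamma, rGamma]
  push_cast
  rcases eq_or_ne ((k : ℝ) + 1 + a) 0 with h | h
  · rw [h, zero_mul, show (k : ℝ) + a + 1 = 0 by linarith, Real.Gamma_zero, inv_zero]
  · rw [Real.Gamma_add_one h, mul_inv, show (k : ℝ) + a + 1 = k + 1 + a by ring, ← mul_assoc,
      mul_inv_cancel₀ h, one_mul]

theorem isEntire_rGamma (a M : ℝ) : IsEntire fun k => M ^ k * rGamma a k := fun R hR => by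
  obtain ⟨K, hK⟩ := exists_nat_gt (2 * |M| * R + |a|)
  refine summable_of_ratio_norm_eventually_le (r := 1 / 2) (by norm_num)
    (eventually_atTop.2 ⟨K, fun k hk => ?_⟩)
  have hk' : 2 * |M| * R + |a| ≤ k := hK.le.trans (by exact_mod_cast hk)
  have hpos : 2 * |M| * R ≤ k + 1 + a := by linarith [neg_abs_le a]
  have h := rGamma_succ a k
  simp only [norm_mul, Real.norm_eq_abs, abs_abs, abs_mul, abs_pow, abs_of_nonneg hR]
  rw [← h, abs_mul, abs_of_nonneg (a := (k : ℝ) + 1 + a) (by linarith [show 0 ≤ 2 * |M| * R by positivity]),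
    pow_succ, pow_succ]
  have h0 : 0 ≤ |M| ^ k * |rGamma a (k + 1)| * R ^ k := by positivity
  nlinarith

/-- `F ε = f₀ + ε f₁ + O(ε²)` for families of entire power series. -/
def SeqExpansion (F : ℝ → ℕ → ℝ) (f₀ f₁ : ℕ → ℝ) : Prop :=
  IsEntire f₀ ∧ IsEntire f₁ ∧ ∃ B : ℕ → ℝ, IsEntire B ∧
    ∀ ε : ℝ, |ε| ≤ 1 → ∀ k, |F ε k - f₀ k - ε * f₁ k| ≤ ε ^ 2 * B k

namespace SeqExpansion
variable {F G : ℝ → ℕ → ℝ} {f₀ f₁ g₀ g₁ : ℕ → ℝ}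

theorem isEntire (h : SeqExpansion F f₀ f₁) {ε : ℝ} (hε : |ε| ≤ 1) : IsEntire (F ε) := by
  obtain ⟨h0, h1, B, hB, hF⟩ := h
  have hd : IsEntire fun k => F ε k - f₀ k - ε * f₁ k :=
    (hB.const_mul (ε ^ 2)).mono fun k => (hF ε hε k).trans (le_abs_self _)
  have := (hd.add h0).add (h1.const_mul ε)
  exact this.mono fun k => le_of_eq (by congr 1; ring)

theorem add (hF : SeqExpansion F f₀ f₁) (hG : SeqExpansion G g₀ g₁) :
    SeqExpansion (fun ε k => F ε k + G ε k) (fun k => f₀ k + g₀ k) (fun k => f₁ k + g₁ k) := by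
  obtain ⟨h0, h1, B, hB, hF⟩ := hF
  obtain ⟨h0', h1', B', hB', hG⟩ := hG
  refine ⟨h0.add h0', h1.add h1', _, hB.add hB', fun ε hε k => ?_⟩
  have := abs_add_le (F ε k - f₀ k - ε * f₁ k) (G ε k - g₀ k - ε * g₁ k)
  calc _ = |F ε k - f₀ k - ε * f₁ k + (G ε k - g₀ k - ε * g₁ k)| := by congr 1; ring
    _ ≤ _ := this
    _ ≤ _ := by have := hF ε hε k; have := hG ε hε k; linarith

theorem mul_seq (hF : SeqExpansion F f₀ f₁) {m : ℕ → ℝ} {M : ℝ} (hm : ∀ k, |m k| ≤ M) :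
    SeqExpansion (fun ε k => m k * F ε k) (fun k => m k * f₀ k) (fun k => m k * f₁ k) := by
  obtain ⟨h0, h1, B, hB, hF⟩ := hF
  have hM : ∀ {f : ℕ → ℝ}, IsEntire f → IsEntire fun k => m k * f k := fun {f} hf =>
    (hf.const_mul M).mono fun k => by
      rw [abs_mul, abs_mul]
      exact mul_le_mul_of_nonneg_right ((hm k).trans (le_abs_self M)) (abs_nonneg _)
  refine ⟨hM h0, hM h1, _, hB.const_mul M, fun ε hε k => ?_⟩
  rw [show m k * F ε k - m k * f₀ k - ε * (m k * f₁ k) = m k * (F ε k - f₀ k - ε * f₁ k) by ring,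
    abs_mul]
  have h1 := mul_le_mul (hm k) (hF ε hε k) (abs_nonneg _) ((abs_nonneg _).trans (hm k))
  linarith

theorem euler (hF : SeqExpansion F f₀ f₁) :
    SeqExpansion (fun ε => euler (F ε)) (euler f₀) (euler f₁) := by
  obtain ⟨h0, h1, B, hB, hF⟩ := hF
  refine ⟨h0.euler, h1.euler, _, hB.euler, fun ε hε k => ?_⟩
  simp only [_root_.euler]
  rw [show k * F ε k - k * f₀ k - ε * (k * f₁ k) = k * (F ε k - f₀ k - ε * f₁ k) by ring,
    abs_mul, Nat.abs_cast]
  have h1 := mul_le_mul_of_nonneg_left (hF ε hε k) k.cast_nonneg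
  linarith

theorem shift (hF : SeqExpansion F f₀ f₁) :
    SeqExpansion (fun ε => shift (F ε)) (shift f₀) (shift f₁) := by
  obtain ⟨h0, h1, B, hB, hF⟩ := hF
  refine ⟨h0.shift, h1.shift, _, hB.shift, fun ε hε k => ?_⟩
  rcases k with _ | k
  · simp [_root_.shift]
  · exact hF ε hε k

theorem eps_mul (hF : SeqExpansion F f₀ f₁) :
    SeqExpansion (fun ε k => ε * F ε k) (fun _ => 0) f₀ := by
  obtain ⟨h0, h1, B, hB, hF⟩ := hF
  refine ⟨fun R _ => by simp, h0, _, h1.abs.add hB, fun ε hε k => ?_⟩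
  have h := hF ε hε k
  rw [show ε * F ε k - 0 - ε * f₀ k = ε * ((F ε k - f₀ k - ε * f₁ k) + ε * f₁ k) by ring, abs_mul]
  have h2 := abs_add_le (F ε k - f₀ k - ε * f₁ k) (ε * f₁ k)
  rw [abs_mul ε (f₁ k)] at h2
  have h3 : 0 ≤ ε ^ 2 * B k := (abs_nonneg _).trans h
  have h4 := sq_abs ε
  have h5 := abs_nonneg ε
  have h6 := mul_le_mul_of_nonneg_left h2 h5
  have h7 := mul_le_mul_of_nonneg_right hε (abs_nonneg (F ε k - f₀ k - ε * f₁ k))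
  rw [← h4] at h ⊢
  linarith

theorem const (hf : IsEntire f₀) : SeqExpansion (fun _ => f₀) f₀ (fun _ => 0) :=
  ⟨hf, fun R _ => by simp, fun _ => 0, fun R _ => by simp,
    fun ε _ k => by simp⟩

/-- The expansion of the sum of the power series, along a filter. -/
theorem tendsto (hF : SeqExpansion F f₀ f₁) {Ω : Type*} {L : Filter Ω} {e x : Ω → ℝ} {z : ℝ}
    (he : Tendsto e L (nhds 0)) (he0 : ∀ᶠ w in L, e w ≠ 0) (hx : Tendsto x L (nhds z)) :
    Tendsto (fun w => (ser (F (e w)) (x w) - ser f₀ (x w)) / e w) L (nhds (ser f₁ z)) := by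
  have hFF := hF
  obtain ⟨h0, h1, B, hB, hF⟩ := hF
  have h2 : Tendsto (fun w => ser f₁ (x w)) L (nhds (ser f₁ z)) :=
    (h1.continuous_ser.tendsto z).comp hx
  have h3 : Tendsto (fun w => |e w| * ser B (|z| + 1)) L (nhds 0) := by
    simpa using he.abs.mul_const (ser B (|z| + 1))
  have h4 : Tendsto (fun w => (ser (F (e w)) (x w) - ser f₀ (x w)) / e w - ser f₁ (x w)) L
      (nhds 0) := by
    refine squeeze_zero_norm' ?_ h3
    have a1 : ∀ᶠ w in L, |e w| ≤ 1 := by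
      have := he.abs.eventually_le_const (u := 1) (by simp)
      simpa using this
    have a2 : ∀ᶠ w in L, |x w| ≤ |z| + 1 := hx.abs.eventually_le_const (by linarith)
    filter_upwards [a1, a2, he0] with w h1w h2w h3w
    have hE := hFF.isEntire h1w
    have hd := hB.const_mul (e w ^ 2)
    have := hd.abs_ser_le (f := fun k => F (e w) k - f₀ k - e w * f₁ k)
      (fun k => hF (e w) h1w k) h2w
    rw [(hE.sub h0).ser_sub (h1.const_mul _), hE.ser_sub h0, ser_const_mul, ser_const_mul] at this
    rw [Real.norm_eq_abs, show (ser (F (e w)) (x w) - ser f₀ (x w)) / e w - ser f₁ (x w) =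
      (ser (F (e w)) (x w) - ser f₀ (x w) - e w * ser f₁ (x w)) / e w by field_simp, abs_div,
      div_le_iff₀ (abs_pos.2 h3w)]
    rw [← sq_abs] at this
    linarith
  simpa using h4.add h2

end SeqExpansion

/-! ### Coefficients of the scaled Laguerre functions and their first corrections. -/

/-- The coefficients of `e^(-x/2) L_n(x)` in the scaled variable, up to Gamma factors. -/
def bSeq (a ε : ℝ) : ℕ → ℝ
  | 0 => 1
  | 1 => -(1 / 4)
  | k + 2 => (-(1 / 4) * bSeq a ε (k + 1) + ε * (k + 1 + a) * bSeq a ε k) / (k + 2)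

/-- The coefficients of `exp(-z/4)`. -/
def bSeq₀ (k : ℕ) : ℝ := (-(1 / 4)) ^ k / k.factorial

/-- The first order correction of `bSeq`. -/
def bSeq₁ (a : ℝ) (k : ℕ) : ℝ := 8 / 3 * k * (k - 1) * (2 * k + 3 * a - 1) * bSeq₀ k

theorem bSeq₀_succ (k : ℕ) : bSeq₀ (k + 1) = -(1 / 4) * bSeq₀ k / (k + 1) := by
  rw [bSeq₀, bSeq₀, Nat.factorial_succ, pow_succ]
  have := Nat.cast_ne_zero (R := ℝ).2 (Nat.factorial_ne_zero k)
  push_cast; field_simp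

theorem abs_bSeq₀_le (k : ℕ) : |bSeq₀ k| ≤ 1 := by
  induction k with
  | zero => simp [bSeq₀]
  | succ k ih =>
    rw [bSeq₀_succ, abs_div, abs_mul, abs_of_nonneg (a := (k : ℝ) + 1) (by positivity),
      div_le_one (by positivity), abs_neg, abs_of_pos (by norm_num : (0 : ℝ) < 1 / 4)]
    have : (0 : ℝ) ≤ k := k.cast_nonneg
    linarith

/-- The recursion of `bSeq` is the Frobenius recursion of z Y'' + (a+1) Y' + (1/4 - εz) Y = 0 with
1/Γ(k+a+1) split off. Its derivative in ε at 0 is the recursion here, and the cubic in `bSeq₁` is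
the solution vanishing at k = 0 and k = 1. -/
theorem bSeq₁_succ_succ (a : ℝ) (k : ℕ) : bSeq₁ a (k + 2) =
    (-(1 / 4) * bSeq₁ a (k + 1) + (k + 1 + a) * bSeq₀ k) / (k + 2) := by
  rw [bSeq₁, bSeq₁, bSeq₀_succ (k + 1), bSeq₀_succ k]
  push_cast
  have h1 : (k : ℝ) + 1 ≠ 0 := by positivity
  have h2 : (k : ℝ) + 2 ≠ 0 := by positivity
  have h3 : (k : ℝ) + 1 + 1 ≠ 0 := by positivity
  field_simp; ring

/-- A bound for the growth of `bSeq`. -/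
def bBound (a : ℝ) : ℝ := 4 + 2 * |a|

theorem abs_step_le (a : ℝ) (k : ℕ) {u v U V : ℝ} (hu : |u| ≤ U) (hv : |v| ≤ V) :
    |(-(1 / 4) * u + (k + 1 + a) * v) / (k + 2)| ≤ U / 4 + (1 + |a|) * V := by
  have hk : (0 : ℝ) ≤ k := k.cast_nonneg
  have h1 : |(k : ℝ) + 1 + a| ≤ (k + 2) * (1 + |a|) := by
    have := abs_add_le ((k : ℝ) + 1) a
    rw [abs_of_nonneg (a := (k : ℝ) + 1) (by positivity)] at this
    nlinarith [abs_nonneg a]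
  rw [abs_div, abs_of_nonneg (a := (k : ℝ) + 2) (by positivity), div_le_iff₀ (by positivity)]
  have h2 := abs_add_le (-(1 / 4) * u) ((k + 1 + a) * v)
  rw [abs_mul, abs_mul, abs_neg, abs_of_pos (by norm_num : (0 : ℝ) < 1 / 4)] at h2
  have hV : 0 ≤ V := (abs_nonneg v).trans hv
  have hU : 0 ≤ U := (abs_nonneg u).trans hu
  have h3 : |(k : ℝ) + 1 + a| * |v| ≤ (k + 2) * (1 + |a|) * V :=
    mul_le_mul h1 hv (abs_nonneg _) (by positivity)
  nlinarith

theorem bBound_step (a : ℝ) (k : ℕ) :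
    bBound a ^ (k + 1) / 4 + (1 + |a|) * (2 * bBound a ^ k) ≤ bBound a ^ (k + 2) := by
  have ha := abs_nonneg a
  have h : 0 < bBound a ^ k := by unfold bBound; positivity
  rw [pow_succ, show k + 2 = k + 1 + 1 from rfl, pow_succ, pow_succ]
  have h2 : bBound a / 4 + (1 + |a|) * 2 ≤ bBound a * bBound a := by
    unfold bBound; nlinarith
  nlinarith

theorem one_le_bBound_pow (a : ℝ) (k : ℕ) : 1 ≤ bBound a ^ k :=
  one_le_pow₀ (by unfold bBound; linarith [abs_nonneg a])

theorem abs_bSeq₁_le (a : ℝ) (k : ℕ) : |bSeq₁ a k| ≤ bBound a ^ k := by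
  induction k using Nat.strong_induction_on with
  | _ k ih =>
    match k with
    | 0 => simp [bSeq₁]
    | 1 => simp [bSeq₁]; unfold bBound; positivity
    | k + 2 =>
      rw [bSeq₁_succ_succ]
      refine (abs_step_le a k (ih (k + 1) (by omega)) (abs_bSeq₀_le k)).trans ?_
      have := bBound_step a k
      have := one_le_bBound_pow a k
      have := abs_nonneg a
      nlinarith

/-- The remainder obeys the same recursion with a source of size ε². The base `bBound` is chosen so
large that geometric growth is reproduced by each step (`bBound_step`). -/
theorem abs_bSeq_sub_le (a : ℝ) {ε : ℝ} (hε : |ε| ≤ 1) (k : ℕ) :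
    |bSeq a ε k - bSeq₀ k - ε * bSeq₁ a k| ≤ ε ^ 2 * bBound a ^ k := by
  have hb : 0 ≤ bBound a := by unfold bBound; positivity
  induction k using Nat.strong_induction_on with
  | _ k ih =>
    match k with
    | 0 => simp [bSeq, bSeq₁, bSeq₀]; positivity
    | 1 => simp [bSeq, bSeq₁, bSeq₀]; positivity
    | k + 2 =>
      have e : bSeq a ε (k + 2) - bSeq₀ (k + 2) - ε * bSeq₁ a (k + 2) =
          (-(1 / 4) * (bSeq a ε (k + 1) - bSeq₀ (k + 1) - ε * bSeq₁ a (k + 1)) +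
            (k + 1 + a) * (ε * ((bSeq a ε k - bSeq₀ k - ε * bSeq₁ a k) + ε * bSeq₁ a k))) /
              (k + 2) := by
        rw [bSeq, bSeq₁_succ_succ, bSeq₀_succ (k + 1)]
        push_cast
        have h2 : (k : ℝ) + 2 ≠ 0 := by positivity
        have h3 : (k : ℝ) + 1 + 1 ≠ 0 := by positivity
        field_simp; ring
      have h1 := ih k (by omega)
      have h2 : |ε * ((bSeq a ε k - bSeq₀ k - ε * bSeq₁ a k) + ε * bSeq₁ a k)| ≤
          ε ^ 2 * (2 * bBound a ^ k) := by
        rw [abs_mul]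
        have h3 := abs_add_le (bSeq a ε k - bSeq₀ k - ε * bSeq₁ a k) (ε * bSeq₁ a k)
        rw [abs_mul ε] at h3
        have h4 := abs_bSeq₁_le a k
        have h5 := abs_nonneg ε
        have h6 : 0 ≤ bBound a ^ k := by positivity
        rw [← sq_abs] at h1 ⊢
        have h7 : |ε| ^ 2 * bBound a ^ k ≤ |ε| * bBound a ^ k :=
          mul_le_mul_of_nonneg_right (by nlinarith) h6
        nlinarith [mul_le_mul_of_nonneg_left h4 h5]
      rw [e]
      refine (abs_step_le a k (ih (k + 1) (by omega)) h2).trans ?_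
      have := mul_le_mul_of_nonneg_left (bBound_step a k) (sq_nonneg ε)
      linarith

/-- The coefficients of the scaled function `e^(-x/2) L_n(x)`. -/
def pSeq (a ε : ℝ) (k : ℕ) : ℝ := bSeq a ε k * rGamma a k

/-- The coefficients of the leading order of `pSeq`. -/
def pSeq₀ (a : ℝ) (k : ℕ) : ℝ := bSeq₀ k * rGamma a k

/-- The coefficients of the first correction to `pSeq`. -/
def pSeq₁ (a : ℝ) (k : ℕ) : ℝ := bSeq₁ a k * rGamma a k

/-- The factor 1/Γ(k+a+1) beats the geometric bounds on the `bSeq` sequences. -/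
theorem pSeq_expansion (a : ℝ) : SeqExpansion (pSeq a) (pSeq₀ a) (pSeq₁ a) := by
  have hb : 0 ≤ bBound a := by unfold bBound; positivity
  have h := isEntire_rGamma a (bBound a)
  refine ⟨h.mono fun k => ?_, h.mono fun k => ?_, _, h.abs, fun ε hε k => ?_⟩
  · rw [pSeq₀, abs_mul, abs_mul, abs_of_nonneg (a := bBound a ^ k) (by positivity)]
    exact mul_le_mul_of_nonneg_right ((abs_bSeq₀_le k).trans (one_le_bBound_pow a k))
      (abs_nonneg _)
  · rw [pSeq₁, abs_mul, abs_mul, abs_of_nonneg (a := bBound a ^ k) (by positivity)]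
    exact mul_le_mul_of_nonneg_right (abs_bSeq₁_le a k) (abs_nonneg _)
  · rw [pSeq, pSeq₀, pSeq₁, abs_mul, abs_of_nonneg (a := bBound a ^ k) (by positivity),
      show bSeq a ε k * rGamma a k - bSeq₀ k * rGamma a k - ε * (bSeq₁ a k * rGamma a k) =
        (bSeq a ε k - bSeq₀ k - ε * bSeq₁ a k) * rGamma a k by ring, abs_mul, ← mul_assoc]
    exact mul_le_mul_of_nonneg_right (abs_bSeq_sub_le a hε k) (abs_nonneg _)

/-- The reciprocals `1 / (k + (a+1)/2)`, except at `k = 0`. -/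
def recipSeq (a : ℝ) (k : ℕ) : ℝ := if k = 0 then 0 else (k + (a + 1) / 2)⁻¹

/-- The coefficients of the scaled antiderivative. -/
def qSeq (a ε : ℝ) (k : ℕ) : ℝ :=
  (if k = 0 then 2 * rGamma a 1 else 0) +
    recipSeq a k * (pSeq a ε k + -8 * (ε * shift (pSeq a ε) k))

/-- The leading order of `qSeq`. -/
def qSeq₀ (a : ℝ) (k : ℕ) : ℝ :=
  (if k = 0 then 2 * rGamma a 1 else 0) + recipSeq a k * pSeq₀ a k

/-- The first correction to `qSeq`. -/
def qSeq₁ (a : ℝ) (k : ℕ) : ℝ := recipSeq a k * (pSeq₁ a k + -8 * shift (pSeq₀ a) k)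

theorem abs_recipSeq_le {a : ℝ} (ha : -2 < a) (k : ℕ) : |recipSeq a k| ≤ 2 := by
  rw [recipSeq]
  split_ifs with h
  · simp
  · have hk : (1 : ℝ) ≤ k := by exact_mod_cast Nat.one_le_iff_ne_zero.2 h
    rw [abs_of_pos (inv_pos.2 (by linarith)), inv_le_comm₀ (by linarith) (by norm_num)]
    linarith

theorem isEntire_single (c : ℝ) : IsEntire fun k => if k = 0 then c else 0 := fun R _ =>
  summable_of_ne_finset_zero (s := {0}) fun k hk => by
    simp [show k ≠ 0 by simpa using hk]

theorem qSeq_expansion {a : ℝ} (ha : -2 < a) :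
    SeqExpansion (qSeq a) (qSeq₀ a) (qSeq₁ a) := by
  have hp := pSeq_expansion a
  have h1 := (SeqExpansion.const (isEntire_single (2 * rGamma a 1))).add
    ((hp.add ((hp.shift.eps_mul).mul_seq (m := fun _ => -8) fun _ => le_rfl)).mul_seq
      (abs_recipSeq_le ha))
  simp only [mul_zero, add_zero, zero_add] at h1
  exact h1

theorem recip_mul {a : ℝ} (ha : -2 < a) (k : ℕ) (c : ℝ) :
    (((k + 1 : ℕ) : ℝ) + (a + 1) / 2) * (recipSeq a (k + 1) * c) = c := by
  rw [recipSeq, if_neg (Nat.succ_ne_zero k), ← mul_assoc, mul_inv_cancel₀, one_mul]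
  have : (0 : ℝ) ≤ k := k.cast_nonneg
  push_cast; linarith

theorem rGamma_one (a : ℝ) : (a + 1) * rGamma a 1 = rGamma a 0 := by
  simpa [add_comm] using rGamma_succ a 0

/-- For functions: z^((a+1)/2) q is an antiderivative of z^((a-1)/2) (1 - 8εz) p. At k = 0 the
division by (a+1)/2 is replaced by the value 2/Γ(a+2), which agrees with it for a ≠ -1 and remains
correct at a = -1. -/
theorem qSeq_rel {a : ℝ} (ha : -2 < a) (ε : ℝ) (k : ℕ) :
    euler (qSeq a ε) k + (a + 1) / 2 * qSeq a ε k = pSeq a ε k - 8 * ε * shift (pSeq a ε) k := by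
  rw [euler, ← add_mul]
  rcases k with _ | k
  · simp only [qSeq, shift, pSeq, bSeq, recipSeq, if_true]
    have := rGamma_one a
    simp; linarith
  · rw [qSeq, if_neg (Nat.succ_ne_zero k), zero_add, recip_mul ha]; ring

theorem qSeq₀_rel {a : ℝ} (ha : -2 < a) (k : ℕ) :
    euler (qSeq₀ a) k + (a + 1) / 2 * qSeq₀ a k = pSeq₀ a k := by
  rw [euler, ← add_mul]
  rcases k with _ | k
  · simp only [qSeq₀, pSeq₀, bSeq₀, recipSeq, if_true]
    have := rGamma_one a
    simp; linarith
  · rw [qSeq₀, if_neg (Nat.succ_ne_zero k), zero_add, recip_mul ha]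

/-- Bessel's equation θ²p + aθp + zp/4 = 0 with θ = z d/dz. -/
theorem pSeq₀_rel (a : ℝ) (k : ℕ) :
    euler (euler (pSeq₀ a)) k = -a * euler (pSeq₀ a) k - 1 / 4 * shift (pSeq₀ a) k := by
  rcases k with _ | k
  · simp [euler, shift]
  · have h := rGamma_succ a k
    simp only [euler, shift, pSeq₀, bSeq₀_succ]
    push_cast
    have h1 : (k : ℝ) + 1 ≠ 0 := by positivity
    rw [← h]
    field_simp; ring

/-- The cubic factor in k is a third order operator in θ; Bessel's recursion reduces it to first
order, so that the correction involves only p and θp. -/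
theorem pSeq₁_rel (a : ℝ) (k : ℕ) : pSeq₁ a k = 8 / 3 * (1 - a ^ 2) * euler (pSeq₀ a) k +
    shift (fun k => 4 / 3 * ((1 - a) / 2 * pSeq₀ a k - euler (pSeq₀ a) k)) k := by
  rcases k with _ | k
  · simp [pSeq₁, euler, shift, bSeq₁]
  · have h := rGamma_succ a k
    simp only [euler, shift, pSeq₀, pSeq₁, bSeq₁, bSeq₀_succ]
    push_cast
    have h1 : (k : ℝ) + 1 ≠ 0 := by positivity
    rw [← h]
    field_simp; ring

/-- For k ≥ 1 one may multiply by k + (a+1)/2, which turns q₀ into p₀, and Bessel's recursion closes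
the identity. The coefficient k = 0 is checked apart, since there the factor can vanish. -/
theorem qSeq₁_rel {a : ℝ} (ha : -2 < a) (k : ℕ) : qSeq₁ a k =
    -(4 / 3) * (1 - a ^ 2) * (a + 1) * qSeq₀ a k + 8 / 3 * (1 - a ^ 2) * pSeq₀ a k -
      4 / 3 * shift (pSeq₀ a) k -
      16 / 3 * ((2 - 2 * a) * pSeq₀ a k - 4 * euler (pSeq₀ a) k - (1 - a ^ 2) * qSeq₀ a k) := by
  rcases k with _ | k
  · have := rGamma_one a
    simp [qSeq₁, recipSeq, shift, euler, qSeq₀, pSeq₀, bSeq₀, ← this]; ring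
  · have hk : (0 : ℝ) ≤ k := k.cast_nonneg
    have hne : (((k + 1 : ℕ) : ℝ) + (a + 1) / 2) ≠ 0 := by push_cast; linarith
    apply mul_left_cancel₀ hne
    rw [qSeq₁, recip_mul ha, pSeq₁_rel]
    have h0 := qSeq₀_rel ha (k + 1)
    have h2 := pSeq₀_rel a (k + 1)
    simp only [shift, euler] at h0 h2 ⊢
    push_cast at h0 h2 ⊢
    linear_combination (-(-(4 / 3) * (1 - a ^ 2) * (a + 1) + 16 / 3 * (1 - a ^ 2))) * h0 -
      64 / 3 * h2

/-! ### Second order asymptotics of Gamma quotients. -/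

theorem abs_log_div_sub_le {x : ℝ} (hx : |x| ≤ 1 / 2) :
    |Real.log (1 + x) - Real.log (1 - x) - 2 * x - 2 / 3 * x ^ 3| ≤ 4 * |x| ^ 5 := by
  have h1 := Real.abs_log_sub_add_sum_range_le (x := x) (by linarith) 4
  have h2 := Real.abs_log_sub_add_sum_range_le (x := -x) (by rw [abs_neg]; linarith) 4
  rw [abs_neg] at h2
  have h3 : |x| ^ (4 + 1) / (1 - |x|) ≤ 2 * |x| ^ 5 := by
    rw [div_le_iff₀ (by linarith)]
    have h := mul_nonneg (pow_nonneg (abs_nonneg x) 5) (by linarith : 0 ≤ 1 / 2 - |x|)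
    rw [show 4 + 1 = 5 from rfl, show 2 * |x| ^ 5 * (1 - |x|) =
      |x| ^ 5 + 2 * (|x| ^ 5 * (1 / 2 - |x|)) by ring]
    linarith
  have h4 := abs_sub _ _ |>.trans (add_le_add (h2.trans h3) (h1.trans h3))
  simp only [Finset.sum_range_succ, Finset.sum_range_zero, sub_neg_eq_add] at h4
  norm_num at h4
  calc _ = _ := ?_
    _ ≤ 2 * |x| ^ 5 + 2 * |x| ^ 5 := h4
    _ = _ := by ring
  congr 1; ring

/-- The logarithm of `Γ(s + (1+b)/2) / Γ(s + (1-b)/2) s^(-b)`, minus its leading behaviour. -/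
def gammaDefect (b s : ℝ) : ℝ :=
  Real.log (Real.Gamma (s + (1 + b) / 2)) - Real.log (Real.Gamma (s + (1 - b) / 2)) -
    b * Real.log s + b * (b ^ 2 - 1) / 24 / s ^ 2

/-- At the midpoint t = s + 1/2 the increment contains log(t ± b/2) and log(t ± 1/2) only through
differences odd in 1/t. The terms 1/t cancel because of the coefficient b, the terms 1/t³ because of
the correction b(b²-1)/24, and order t^(-5) remains. -/
theorem abs_gammaDefect_sub_le (b : ℝ) {t : ℝ} (ht : |b| + 1 ≤ t) :
    |gammaDefect b (t - 1 / 2) - gammaDefect b (t - 1 / 2 + 1)| ≤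
      (|b| ^ 5 + |b| + |b * (b ^ 2 - 1)|) / t ^ 5 := by
  have hb := abs_nonneg b
  have hb1 := neg_abs_le b
  have hb2 := le_abs_self b
  have ht1 : 1 ≤ t := by linarith
  have ht0 : 0 < t := by linarith
  have e1 : t - 1 / 2 + 1 + (1 + b) / 2 = (t - 1 / 2 + (1 + b) / 2) + 1 := by ring
  have e2 : t - 1 / 2 + 1 + (1 - b) / 2 = (t - 1 / 2 + (1 - b) / 2) + 1 := by ring
  have p1 : 0 < t - 1 / 2 + (1 + b) / 2 := by linarith
  have p2 : 0 < t - 1 / 2 + (1 - b) / 2 := by linarith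
  have hx1 : |b / (2 * t)| ≤ 1 / 2 := by
    rw [abs_div, abs_of_pos (by positivity : 0 < 2 * t), div_le_iff₀ (by positivity)]; linarith
  have hx2 : |1 / (2 * t)| ≤ 1 / 2 := by
    rw [abs_div, abs_of_pos (by positivity : 0 < 2 * t), abs_one, div_le_iff₀ (by positivity)]
    linarith
  have l1 : Real.log (t - 1 / 2 + (1 + b) / 2) = Real.log t + Real.log (1 + b / (2 * t)) := by
    rw [← Real.log_mul ht0.ne' (by linarith [neg_abs_le (b / (2 * t))])]; congr 1; field_simp; ring
  have l2 : Real.log (t - 1 / 2 + (1 - b) / 2) = Real.log t + Real.log (1 - b / (2 * t)) := by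
    rw [← Real.log_mul ht0.ne' (by linarith [le_abs_self (b / (2 * t))])]; congr 1; field_simp; ring
  have l3 : Real.log (t - 1 / 2 + 1) = Real.log t + Real.log (1 + 1 / (2 * t)) := by
    rw [← Real.log_mul ht0.ne' (by linarith [neg_abs_le (1 / (2 * t))])]; congr 1; field_simp; ring
  have l4 : Real.log (t - 1 / 2) = Real.log t + Real.log (1 - 1 / (2 * t)) := by
    rw [← Real.log_mul ht0.ne' (by linarith [le_abs_self (1 / (2 * t))])]; congr 1; field_simp
  have a1 := abs_log_div_sub_le hx1
  have a2 := abs_log_div_sub_le hx2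
  rw [abs_div, abs_of_pos (by positivity : 0 < 2 * t)] at a1 a2
  rw [abs_one] at a2
  have hq : |1 / (t - 1 / 2) ^ 2 - 1 / (t - 1 / 2 + 1) ^ 2 - 2 / t ^ 3| ≤ 16 / t ^ 5 := by
    have q1 : 0 < t - 1 / 2 := by linarith
    have q2 : 0 < t - 1 / 2 + 1 := by linarith
    have e : 1 / (t - 1 / 2) ^ 2 - 1 / (t - 1 / 2 + 1) ^ 2 - 2 / t ^ 3 =
        (t ^ 2 - 1 / 8) / (t ^ 3 * (t ^ 2 - 1 / 4) ^ 2) := by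
      have h1 : t ^ 2 - 1 / 4 = (t - 1 / 2) * (t - 1 / 2 + 1) := by ring
      have h2 : t = t - 1 / 2 + 1 / 2 := by ring
      rw [h1]
      generalize t - 1 / 2 = u at q1 q2 h2 ⊢
      field_simp
      rw [h2]; ring
    have h2 : 1 / 2 * t ^ 2 ≤ t ^ 2 - 1 / 4 := by nlinarith
    have h3 : 0 < t ^ 2 - 1 / 4 := by nlinarith
    rw [e, abs_of_nonneg (div_nonneg (by nlinarith) (by positivity)),
      div_le_div_iff₀ (by positivity) (by positivity)]
    have h4 : (1 / 2 * t ^ 2) ^ 2 ≤ (t ^ 2 - 1 / 4) ^ 2 := pow_le_pow_left₀ (by positivity) h2 2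
    have h5 : 0 < t ^ 3 := by positivity
    have h6 : 0 < t ^ 5 := by positivity
    calc (t ^ 2 - 1 / 8) * t ^ 5 ≤ t ^ 2 * t ^ 5 :=
          mul_le_mul_of_nonneg_right (by linarith) h6.le
      _ = 4 * (t ^ 3 * (1 / 2 * t ^ 2) ^ 2) := by ring
      _ ≤ 4 * (t ^ 3 * (t ^ 2 - 1 / 4) ^ 2) := by gcongr
      _ ≤ 16 * (t ^ 3 * (t ^ 2 - 1 / 4) ^ 2) := by
        have : 0 ≤ t ^ 3 * (t ^ 2 - 1 / 4) ^ 2 := by positivity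
        linarith
  have key : gammaDefect b (t - 1 / 2) - gammaDefect b (t - 1 / 2 + 1) =
      b * (Real.log (1 + 1 / (2 * t)) - Real.log (1 - 1 / (2 * t)) - 2 * (1 / (2 * t)) -
        2 / 3 * (1 / (2 * t)) ^ 3) -
      (Real.log (1 + b / (2 * t)) - Real.log (1 - b / (2 * t)) - 2 * (b / (2 * t)) -
        2 / 3 * (b / (2 * t)) ^ 3) +
      b * (b ^ 2 - 1) / 24 * (1 / (t - 1 / 2) ^ 2 - 1 / (t - 1 / 2 + 1) ^ 2 - 2 / t ^ 3) := by
    rw [gammaDefect, gammaDefect, e1, e2, Real.Gamma_add_one p1.ne', Real.Gamma_add_one p2.ne',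
      Real.log_mul p1.ne' (Real.Gamma_pos_of_pos p1).ne',
      Real.log_mul p2.ne' (Real.Gamma_pos_of_pos p2).ne', l1, l2, l3, l4]
    have : 2 / 3 * b * (1 / (2 * t)) ^ 3 - 2 / 3 * (b / (2 * t)) ^ 3 =
        -(b * (b ^ 2 - 1) / 24 * (2 / t ^ 3)) := by field_simp; ring
    have h2 : 2 * b * (1 / (2 * t)) - 2 * (b / (2 * t)) = 0 := by field_simp; ring
    linear_combination this + h2
  rw [key]
  have t1 : |b| * (4 * (1 / (2 * t)) ^ 5) ≤ |b| / 8 / t ^ 5 := le_of_eq (by field_simp; ring)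
  have t2 : 4 * (|b| / (2 * t)) ^ 5 ≤ |b| ^ 5 / 8 / t ^ 5 := le_of_eq (by field_simp; ring)
  have m1 := mul_le_mul_of_nonneg_left a2 hb
  have m2 := mul_le_mul_of_nonneg_left hq (abs_nonneg (b * (b ^ 2 - 1) / 24))
  rw [← abs_mul] at m1 m2
  refine (abs_add_le _ _).trans ((add_le_add_left (abs_sub _ _) _).trans ?_)
  have e3 : |b * (b ^ 2 - 1) / 24| * (16 / t ^ 5) = 16 / 24 * |b * (b ^ 2 - 1)| / t ^ 5 := by
    rw [abs_div, abs_of_pos (by norm_num : (0 : ℝ) < 24)]; ring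
  have e4 : (|b| ^ 5 + |b| + |b * (b ^ 2 - 1)|) / t ^ 5 =
    |b| / 8 / t ^ 5 + |b| ^ 5 / 8 / t ^ 5 + 16 / 24 * |b * (b ^ 2 - 1)| / t ^ 5 +
      (7 / 8 * |b| ^ 5 + 7 / 8 * |b| + 1 / 3 * |b * (b ^ 2 - 1)|) / t ^ 5 := by ring
  have e5 : 0 ≤ (7 / 8 * |b| ^ 5 + 7 / 8 * |b| + 1 / 3 * |b * (b ^ 2 - 1)|) / t ^ 5 := by positivity
  linarith

/-- Euler's limit formula for Gamma, inverted. -/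
theorem tendsto_gamma_div {u : ℝ} (hu : 0 < u) :
    Tendsto (fun m : ℕ => Real.Gamma (u + m + 1) / ((m : ℝ) ^ u * m.factorial)) atTop (nhds 1) := by
  have h := (Real.GammaSeq_tendsto_Gamma u).inv₀ (Real.Gamma_pos_of_pos hu).ne'
  have h2 := h.const_mul (Real.Gamma u)
  rw [mul_inv_cancel₀ (Real.Gamma_pos_of_pos hu).ne'] at h2
  refine h2.congr fun m => ?_
  have h3 : ∀ m : ℕ, Real.Gamma (u + m + 1) =
      Real.Gamma u * ∏ j ∈ Finset.range (m + 1), (u + j) := by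
    intro m
    induction m with
    | zero => simp [Real.Gamma_add_one hu.ne', mul_comm]
    | succ m ih =>
      have hm : (0 : ℝ) ≤ m := m.cast_nonneg
      push_cast
      rw [Finset.prod_range_succ, ← mul_assoc, ← ih, Real.Gamma_add_one (by linarith)]
      push_cast
      rw [mul_comm, ← add_assoc]
  rw [Real.GammaSeq, inv_div, h3]; ring

theorem tendsto_gammaDefect (b : ℝ) {s : ℝ} (hs : |b| + 1 ≤ s) :
    Tendsto (fun m : ℕ => gammaDefect b (s + m + 1)) atTop (nhds 0) := by
  have hb := abs_nonneg b
  have hb1 := neg_abs_le b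
  have hb2 := le_abs_self b
  have hs0 : 0 < s := by linarith
  have p1 : 0 < s + (1 + b) / 2 := by linarith
  have p2 : 0 < s + (1 - b) / 2 := by linarith
  have h1 := (tendsto_gamma_div p1).log one_ne_zero
  have h2 := (tendsto_gamma_div p2).log one_ne_zero
  rw [Real.log_one] at h1 h2
  have hd : Tendsto (fun m : ℕ => (s + 1) / (m : ℝ)) atTop (nhds 0) :=
    tendsto_const_nhds.div_atTop tendsto_natCast_atTop_atTop
  have h3 : Tendsto (fun m : ℕ => Real.log (1 + (s + 1) / (m : ℝ))) atTop (nhds 0) := by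
    have := (hd.const_add 1).log (by simp)
    simpa using this
  have h4 : Tendsto (fun m : ℕ => b * (b ^ 2 - 1) / 24 / (s + m + 1) ^ 2) atTop (nhds 0) := by
    refine tendsto_const_nhds.div_atTop ((tendsto_pow_atTop two_ne_zero).comp ?_)
    exact tendsto_atTop_add_const_right _ _
      (tendsto_atTop_add_const_left _ _ tendsto_natCast_atTop_atTop)
  have h := ((h1.sub h2).sub (h3.const_mul b)).add h4
  simp only [sub_zero, mul_zero, add_zero] at h
  refine h.congr' ?_
  filter_upwards [eventually_gt_atTop 0] with m hm
  have hm0 : (0 : ℝ) < m := Nat.cast_pos.2 hm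
  have hf : (0 : ℝ) < m.factorial := Nat.cast_pos.2 m.factorial_pos
  have q1 : 0 < Real.Gamma (s + (1 + b) / 2 + m + 1) := Real.Gamma_pos_of_pos (by linarith)
  have q2 : 0 < Real.Gamma (s + (1 - b) / 2 + m + 1) := Real.Gamma_pos_of_pos (by linarith)
  have e : Real.log (s + m + 1) = Real.log m + Real.log (1 + (s + 1) / m) := by
    rw [← Real.log_mul hm0.ne' (by positivity)]; congr 1; field_simp; ring
  rw [Real.log_div q1.ne' (by positivity), Real.log_div q2.ne' (by positivity),
    Real.log_mul (by positivity) hf.ne', Real.log_mul (by positivity) hf.ne',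
    Real.log_rpow hm0, Real.log_rpow hm0, gammaDefect, e,
    show s + m + 1 + (1 + b) / 2 = s + (1 + b) / 2 + m + 1 by ring,
    show s + m + 1 + (1 - b) / 2 = s + (1 - b) / 2 + m + 1 by ring]
  ring

/-- The increments are summed up to infinity, where the defect tends to 0. -/
theorem abs_gammaDefect_le (b : ℝ) {s : ℝ} (hs : |b| + 1 ≤ s) :
    |gammaDefect b s| ≤ (|b| ^ 5 + |b| + |b * (b ^ 2 - 1)|) / s ^ 3 := by
  set K := |b| ^ 5 + |b| + |b * (b ^ 2 - 1)| with hK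
  have hK0 : 0 ≤ K := by positivity
  have hb := abs_nonneg b
  have hs1 : 1 ≤ s := by linarith
  have step : ∀ m : ℕ, |gammaDefect b s - gammaDefect b (s + m)| ≤
      K / s ^ 3 - K / (s + m) ^ 3 := by
    intro m
    induction m with
    | zero => simp
    | succ m ih =>
      have hm : (0 : ℝ) ≤ m := m.cast_nonneg
      have h := abs_gammaDefect_sub_le b (t := s + m + 1 / 2) (by linarith)
      rw [show s + m + 1 / 2 - 1 / 2 = s + m by ring] at h
      set u := s + (m : ℝ) with hu
      have hu1 : 1 ≤ u := by linarith
      -- A crude telescoping majorant; decay like s^(-3) is enough, as the defect is multiplied by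
      -- s² later.
      have h5 : K / (u + 1 / 2) ^ 5 ≤ K / u ^ 3 - K / (u + 1) ^ 3 := by
        have e : K / u ^ 3 - K / (u + 1) ^ 3 = K * ((3 * u ^ 2 + 3 * u + 1) / (u * (u + 1)) ^ 3) := by
          field_simp; ring
        rw [e, div_eq_mul_inv, ← one_div]
        refine mul_le_mul_of_nonneg_left ?_ hK0
        rw [div_le_div_iff₀ (by positivity) (by positivity), one_mul]
        have e1 : u * (u + 1) ≤ (u + 1 / 2) ^ 2 := by nlinarith
        have e2 : (u * (u + 1)) ^ 3 ≤ ((u + 1 / 2) ^ 2) ^ 3 :=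
          pow_le_pow_left₀ (by positivity) e1 3
        have e3 : u + 1 / 2 ≤ 3 * u ^ 2 + 3 * u + 1 := by nlinarith
        calc _ ≤ _ := e2
          _ = (u + 1 / 2) * (u + 1 / 2) ^ 5 := by ring
          _ ≤ _ := mul_le_mul_of_nonneg_right e3 (by positivity)
      have h6 := abs_sub_le (gammaDefect b s) (gammaDefect b u) (gammaDefect b (u + 1))
      push_cast
      rw [← add_assoc, ← hu]
      linarith
  have hlim := (tendsto_gammaDefect b hs).const_sub (gammaDefect b s) |>.abs
  rw [sub_zero] at hlim
  refine le_of_tendsto hlim (Eventually.of_forall fun m => ?_)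
  have h := step (m + 1)
  push_cast at h
  rw [← add_assoc] at h
  have : 0 ≤ K / (s + m + 1) ^ 3 := by positivity
  linarith

/-- The second order asymptotics of a ratio of Gamma functions. -/
theorem tendsto_gamma_ratio (b : ℝ) :
    Tendsto (fun s : ℝ => (Real.Gamma (s + (1 + b) / 2) / Real.Gamma (s + (1 - b) / 2) * s ^ (-b) - 1) *
      s ^ 2) atTop (nhds (-(b * (b ^ 2 - 1)) / 24)) := by
  set B := -(b * (b ^ 2 - 1)) / 24 with hB
  set K := |b| ^ 5 + |b| + |b * (b ^ 2 - 1)| with hK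
  have hinv : Tendsto (fun s : ℝ => s⁻¹) atTop (nhds 0) := tendsto_inv_atTop_zero
  have hX : Tendsto (fun s : ℝ => (gammaDefect b s + B / s ^ 2) * s ^ 2) atTop (nhds B) := by
    have h1 : Tendsto (fun s : ℝ => gammaDefect b s * s ^ 2) atTop (nhds 0) := by
      have h2 : Tendsto (fun s : ℝ => K * s⁻¹) atTop (nhds 0) := by simpa using hinv.const_mul K
      refine squeeze_zero_norm' ?_ h2
      filter_upwards [eventually_ge_atTop (|b| + 1)] with s hs
      have hs0 : 0 < s := by linarith [abs_nonneg b]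
      rw [Real.norm_eq_abs, abs_mul, abs_of_pos (by positivity : 0 < s ^ 2)]
      calc _ ≤ K / s ^ 3 * s ^ 2 :=
            mul_le_mul_of_nonneg_right (abs_gammaDefect_le b hs) (by positivity)
        _ = _ := by field_simp
    have h3 := h1.add_const B
    rw [zero_add] at h3
    refine h3.congr' ?_
    filter_upwards [eventually_gt_atTop 0] with s hs
    field_simp
  have hX0 : Tendsto (fun s : ℝ => gammaDefect b s + B / s ^ 2) atTop (nhds 0) := by
    have := hX.mul ((hinv.pow 2))
    simp only [ne_eq, OfNat.ofNat_ne_zero, not_false_eq_true, zero_pow, mul_zero] at this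
    refine this.congr' ?_
    filter_upwards [eventually_gt_atTop 0] with s hs
    field_simp
  have hexp : Tendsto (fun x : ℝ => (Real.exp x - 1 - x) / x) (nhds 0) (nhds 0) := by
    have h1 : Tendsto (fun x : ℝ => |x|) (nhds 0) (nhds 0) := by
      simpa using (continuous_abs (G := ℝ)).tendsto 0
    refine squeeze_zero_norm' ?_ h1
    have : ∀ᶠ x : ℝ in nhds 0, |x| ≤ 1 := by
      simpa using (continuous_abs (G := ℝ)).continuousAt.eventually_le_const (by simp : |(0 : ℝ)| < 1)
    filter_upwards [this] with x hx
    rcases eq_or_ne x 0 with rfl | h0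
    · simp
    rw [Real.norm_eq_abs, abs_div, div_le_iff₀ (abs_pos.2 h0)]
    have := Real.abs_exp_sub_one_sub_id_le hx
    rwa [← sq_abs, sq] at this
  -- With X the exponent: (e^X - 1) s² = X s² · (e^X - 1 - X)/X + X s².
  have h5 := (hX.mul (hexp.comp hX0)).add hX
  rw [mul_zero, zero_add] at h5
  refine h5.congr' ?_
  filter_upwards [eventually_ge_atTop (|b| + 1)] with s hs
  have hb := abs_nonneg b
  have hb1 := neg_abs_le b
  have hb2 := le_abs_self b
  have hs0 : 0 < s := by linarith
  have q1 : 0 < Real.Gamma (s + (1 + b) / 2) := Real.Gamma_pos_of_pos (by linarith)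
  have q2 : 0 < Real.Gamma (s + (1 - b) / 2) := Real.Gamma_pos_of_pos (by linarith)
  have e : Real.Gamma (s + (1 + b) / 2) / Real.Gamma (s + (1 - b) / 2) * s ^ (-b) =
      Real.exp (gammaDefect b s + B / s ^ 2) := by
    rw [gammaDefect, show Real.log (Real.Gamma (s + (1 + b) / 2)) -
      Real.log (Real.Gamma (s + (1 - b) / 2)) - b * Real.log s + b * (b ^ 2 - 1) / 24 / s ^ 2 +
      B / s ^ 2 = Real.log (Real.Gamma (s + (1 + b) / 2)) -
      Real.log (Real.Gamma (s + (1 - b) / 2)) + Real.log s * (-b) by rw [hB]; ring,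
      Real.exp_add, Real.exp_sub, Real.exp_log q1, Real.exp_log q2, ← Real.rpow_def_of_pos hs0]
  rw [e]
  simp only [Function.comp_apply]
  generalize gammaDefect b s + B / s ^ 2 = x
  rcases eq_or_ne x 0 with rfl | h0
  · simp
  · field_simp; ring

/-! ### Laguerre functions as power series in the hard edge variable. -/

namespace laguerre
open PowerSeries

/-- The power series of `exp(-x/2)`. -/
def halfExp : ℝ⟦X⟧ := PowerSeries.mk fun i => (-(1 / 2)) ^ i / (i.factorial : ℝ)

theorem derivative_halfExp : derivative ℝ halfExp = C (-(1 / 2)) * halfExp := by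
  ext k
  rw [coeff_derivative, coeff_C_mul, halfExp, coeff_mk, coeff_mk, Nat.factorial_succ, pow_succ]
  have := Nat.cast_ne_zero (R := ℝ).2 (Nat.factorial_ne_zero k)
  push_cast; field_simp

theorem exp_mul_eval (f : Polynomial ℝ) (x : ℝ) :
    Real.exp (-x / 2) * f.eval x = ser (fun k => coeff k (halfExp * (f : ℝ⟦X⟧))) x := by
  have h1 : Real.exp (-x / 2) = ∑' i : ℕ, (-x / 2) ^ i / (i.factorial : ℝ) := by
    rw [Real.exp_eq_exp_ℝ, NormedSpace.exp_eq_tsum_div]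
  have s1 : Summable fun i : ℕ => ‖(-x / 2) ^ i / (i.factorial : ℝ)‖ :=
    NormedSpace.norm_expSeries_div_summable (-x / 2)
  have hz : ∀ i ∉ Finset.range (f.natDegree + 1), f.coeff i * x ^ i = 0 := fun i hi => by
    rw [Polynomial.coeff_eq_zero_of_natDegree_lt (by simpa using hi), zero_mul]
  have h2 : f.eval x = ∑' i : ℕ, f.coeff i * x ^ i := by
    rw [Polynomial.eval_eq_sum_range, tsum_eq_sum hz]
  have s2 : Summable fun i : ℕ => ‖f.coeff i * x ^ i‖ :=
    summable_of_ne_finset_zero (s := Finset.range (f.natDegree + 1)) fun i hi => by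
      rw [hz i hi, norm_zero]
  rw [h1, h2, tsum_mul_tsum_eq_tsum_sum_antidiagonal_of_summable_norm s1 s2, ser]
  refine tsum_congr fun k => ?_
  rw [coeff_mul, Finset.sum_mul]
  refine Finset.sum_congr rfl fun p hp => ?_
  rw [← Finset.HasAntidiagonal.mem_antidiagonal.1 hp, pow_add, halfExp, coeff_mk, Polynomial.coeff_coe]
  rw [show -x / 2 = -(1 / 2) * x by ring, mul_pow]; ring

theorem coeff_zero_halfExp_mul (f : Polynomial ℝ) :
    coeff 0 (halfExp * (f : ℝ⟦X⟧)) = f.coeff 0 := by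
  rw [coeff_mul]; simp [halfExp]

theorem coeff_one_halfExp_mul (f : Polynomial ℝ) :
    coeff 1 (halfExp * (f : ℝ⟦X⟧)) = f.coeff 1 - 1 / 2 * f.coeff 0 := by
  rw [coeff_mul, Finset.Nat.antidiagonal_succ]; simp [halfExp, coeff_mk]; ring

/-- The constant `Γ(n + a + 1) / n!`. -/
def lagConst (a : ℝ) (n : ℕ) : ℝ := Real.Gamma (n + a + 1) / n.factorial

theorem coeff_zero_eq {b : ℝ} (hb : -1 < b) (m : ℕ) :
    (laguerre m b).coeff 0 = lagConst b m * rGamma b 0 := by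
  rw [Polynomial.coeff_zero_eq_eval_zero]
  induction m with
  | zero =>
    have : Real.Gamma (b + 1) ≠ 0 := (Real.Gamma_pos_of_pos (by linarith)).ne'
    simp [zero_eq, lagConst, rGamma, this]
  | succ m ih =>
    have h := congrArg (Polynomial.eval 0) (succ_mul m b)
    simp only [Polynomial.eval_mul, Polynomial.eval_sub, Polynomial.eval_C, Polynomial.eval_X,
      zero_mul, sub_zero, ih] at h
    have hm : (0 : ℝ) ≤ m := m.cast_nonneg
    have h1 : (m : ℝ) + 1 ≠ 0 := by positivity
    apply mul_left_cancel₀ h1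
    have := Nat.cast_ne_zero (R := ℝ).2 (Nat.factorial_ne_zero m)
    rw [h, lagConst, lagConst, Nat.factorial_succ]
    push_cast
    rw [show (m : ℝ) + 1 + b + 1 = (m + b + 1) + 1 by ring, Real.Gamma_add_one
      (show (m : ℝ) + b + 1 ≠ 0 by linarith)]
    field_simp; ring

theorem rGamma_shift (a : ℝ) (k : ℕ) : rGamma (a + 1) k = rGamma a (k + 1) := by
  rw [rGamma, rGamma]; push_cast; congr 2; ring

theorem lagConst_shift (a : ℝ) (m : ℕ) : lagConst (a + 1) m = (m + 1) * lagConst a (m + 1) := by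
  rw [lagConst, lagConst, Nat.factorial_succ]
  have := Nat.cast_ne_zero (R := ℝ).2 (Nat.factorial_ne_zero m)
  push_cast
  rw [show (m : ℝ) + (a + 1) + 1 = m + 1 + a + 1 by ring]
  field_simp

theorem coeff_one_eq {a : ℝ} (ha : -2 < a) (m : ℕ) :
    (laguerre (m + 1) a).coeff 1 = -((m + 1) * lagConst a (m + 1) * rGamma a 1) := by
  have h := congrArg (fun f : Polynomial ℝ => f.coeff 0) (derivative_succ m a)
  simp only [Polynomial.coeff_derivative, Polynomial.coeff_neg] at h
  rw [coeff_zero_eq (by linarith), rGamma_shift, lagConst_shift] at h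
  simpa using h

/-- Laguerre's differential equation. -/
theorem differential_equation (m : ℕ) (a : ℝ) :
    Polynomial.X * (laguerre (m + 1) a).derivative.derivative +
      (Polynomial.C (a + 1) - Polynomial.X) * (laguerre (m + 1) a).derivative +
      Polynomial.C ((m : ℝ) + 1) * laguerre (m + 1) a = 0 := by
  have h := raising m a
  rw [derivative_succ, Polynomial.derivative_neg]
  linear_combination -h

/-- Laguerre's equation at x = 0 gives the value from the derivative, whose parameter a + 1 exceeds
-1. This reaches the range -2 < a ≤ -1 that `coeff_zero_eq` does not cover. -/
theorem coeff_zero_eq' {a : ℝ} (ha : -2 < a) (m : ℕ) :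
    (laguerre (m + 1) a).coeff 0 = lagConst a (m + 1) * rGamma a 0 := by
  have h := congrArg (Polynomial.eval 0) (differential_equation m a)
  simp only [Polynomial.eval_add, Polynomial.eval_mul, Polynomial.eval_sub, Polynomial.eval_C,
    Polynomial.eval_X, zero_mul, sub_zero, zero_add, Polynomial.eval_zero,
    ← Polynomial.coeff_zero_eq_eval_zero, Polynomial.coeff_derivative] at h
  simp only [coeff_one_eq ha] at h
  have h1 : (m : ℝ) + 1 ≠ 0 := by positivity
  apply mul_left_cancel₀ h1
  rw [← rGamma_one a]
  push_cast at h
  linear_combination h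

/-- The large parameter `n + (a+1)/2`. -/
def kap (a : ℝ) (n : ℕ) : ℝ := n + (a + 1) / 2

/-- The small parameter `1 / (64 κ²)`. -/
def eps (a : ℝ) (n : ℕ) : ℝ := 1 / (64 * kap a n ^ 2)

theorem kap_pos {a : ℝ} (ha : -2 < a) (m : ℕ) : 0 < kap a (m + 1) := by
  have hm : (0 : ℝ) ≤ m := m.cast_nonneg
  rw [kap]; push_cast; linarith

/-- The factor e^(-x/2) removes the term -x y' from Laguerre's equation and leaves x y'' + (a+1) y'
+ (κ - x/4) y = 0, where the degree enters only through κ. -/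
theorem coeff_halfExp_ode (m : ℕ) (a : ℝ) (k : ℕ) :
    (k + 2) * (k + 2 + a) * coeff (k + 2) (halfExp * (laguerre (m + 1) a : ℝ⟦X⟧)) =
      -kap a (m + 1) * coeff (k + 1) (halfExp * (laguerre (m + 1) a : ℝ⟦X⟧)) +
        1 / 4 * coeff k (halfExp * (laguerre (m + 1) a : ℝ⟦X⟧)) := by
  set F : Polynomial ℝ := laguerre (m + 1) a with hF
  have hode := congrArg (fun f : Polynomial ℝ => (f : ℝ⟦X⟧)) (differential_equation m a)
  simp only [Polynomial.coe_add, Polynomial.coe_mul, Polynomial.coe_sub, Polynomial.coe_C,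
    Polynomial.coe_X, Polynomial.coe_zero, ← hF] at hode
  have d1 : derivative ℝ (halfExp * (F : ℝ⟦X⟧)) =
      halfExp * ((F.derivative : ℝ⟦X⟧) - C (1 / 2) * (F : ℝ⟦X⟧)) := by
    rw [Derivation.leibniz, derivative_halfExp, derivative_coe, smul_eq_mul, smul_eq_mul, map_neg]
    ring
  have d2 : derivative ℝ (derivative ℝ (halfExp * (F : ℝ⟦X⟧))) =
      halfExp * ((F.derivative.derivative : ℝ⟦X⟧) - (F.derivative : ℝ⟦X⟧) +
        C (1 / 4) * (F : ℝ⟦X⟧)) := by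
    rw [d1, Derivation.leibniz, map_sub, Derivation.leibniz, derivative_halfExp, derivative_coe,
      derivative_coe, derivative_C, smul_eq_mul, smul_eq_mul, smul_eq_mul, smul_eq_mul, map_neg]
    have : (C (1 / 4) : ℝ⟦X⟧) = C (1 / 2) * C (1 / 2) := by rw [← map_mul]; norm_num
    have h2 : (C (1 / 2) : ℝ⟦X⟧) + C (1 / 2) = 1 := by rw [← map_add]; norm_num
    rw [this]
    linear_combination (-(halfExp * (F.derivative : ℝ⟦X⟧))) * h2
  have e : X * derivative ℝ (derivative ℝ (halfExp * (F : ℝ⟦X⟧))) +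
      C (a + 1) * derivative ℝ (halfExp * (F : ℝ⟦X⟧)) + C (kap a (m + 1)) * (halfExp * (F : ℝ⟦X⟧)) -
      X * (C (1 / 4) * (halfExp * (F : ℝ⟦X⟧))) = 0 := by
    have hk : (C (kap a (m + 1)) : ℝ⟦X⟧) = C ((m : ℝ) + 1) + C (a + 1) * C (1 / 2) := by
      rw [← map_mul, ← map_add, kap]; congr 1; push_cast; ring
    rw [d2, d1, hk]
    linear_combination halfExp * hode
  generalize hc : a + 1 = c at e
  have h := congrArg (coeff (k + 1)) e
  simp only [map_add, map_sub, coeff_succ_X_mul, coeff_C_mul, coeff_derivative, map_zero] at h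
  push_cast at h
  rw [← hc] at h
  linear_combination h

/-- Rescaling by 4κ turns the recursion into that of `bSeq` with ε = 1/(64κ²); the coefficients 0
and 1 fix the normalisation. -/
theorem coeff_halfExp_laguerre {a : ℝ} (ha : -2 < a) (m k : ℕ) :
    coeff k (halfExp * (laguerre (m + 1) a : ℝ⟦X⟧)) =
      lagConst a (m + 1) * ((4 * kap a (m + 1)) ^ k * pSeq a (eps a (m + 1)) k) := by
  have hkap := (kap_pos ha m).ne'
  induction k using Nat.strong_induction_on with
  | _ k ih =>
    match k with
    | 0 => rw [coeff_zero_halfExp_mul, coeff_zero_eq' ha, pow_zero, pSeq, bSeq, one_mul, one_mul]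
    | 1 =>
      rw [coeff_one_halfExp_mul, coeff_zero_eq' ha, coeff_one_eq ha, ← rGamma_one, pSeq, bSeq, kap]
      push_cast; ring
    | k + 2 =>
      have h := coeff_halfExp_ode m a k
      rw [ih k (by omega), ih (k + 1) (by omega)] at h
      have hk : (0 : ℝ) ≤ k := k.cast_nonneg
      have h1 : ((k : ℝ) + 2) * (k + 2 + a) ≠ 0 := mul_ne_zero (by positivity) (by linarith)
      apply mul_left_cancel₀ h1
      rw [h]
      have r1 := rGamma_succ a (k + 1)
      have r0 := rGamma_succ a k
      push_cast at r1
      have e0 : pSeq a (eps a (m + 1)) k =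
          bSeq a (eps a (m + 1)) k * ((k + 1 + a) * rGamma a (k + 1)) := by rw [pSeq, r0]
      have e2 : ((k : ℝ) + 2) * (k + 2 + a) * pSeq a (eps a (m + 1)) (k + 2) =
          (-(1 / 4) * bSeq a (eps a (m + 1)) (k + 1) + eps a (m + 1) * (k + 1 + a) *
            bSeq a (eps a (m + 1)) k) * rGamma a (k + 1) := by
        rw [pSeq, bSeq, ← r1]
        have : (k : ℝ) + 2 ≠ 0 := by positivity
        field_simp; ring
      have e3 : ((k : ℝ) + 2) * (k + 2 + a) * (lagConst a (m + 1) *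
          ((4 * kap a (m + 1)) ^ (k + 2) * pSeq a (eps a (m + 1)) (k + 2))) =
          lagConst a (m + 1) * (4 * kap a (m + 1)) ^ (k + 2) *
          (((k : ℝ) + 2) * (k + 2 + a) * pSeq a (eps a (m + 1)) (k + 2)) := by ring
      rw [e3, e2, e0, pSeq, eps, pow_succ, pow_succ]
      field_simp
      ring

theorem ser_scale (f : ℕ → ℝ) (K c x : ℝ) :
    ser (fun k => K * (c ^ k * f k)) x = K * ser f (c * x) := by
  rw [ser_const_mul]
  congr 1
  exact tsum_congr fun k => by rw [mul_pow]; ring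

/-- The Laguerre polynomials in the hard edge variable. -/
theorem exp_mul_laguerre {a : ℝ} (ha : -2 < a) (m : ℕ) (x : ℝ) :
    Real.exp (-x / 2) * (laguerre (m + 1) a).eval x =
      lagConst a (m + 1) * ser (pSeq a (eps a (m + 1))) (4 * kap a (m + 1) * x) := by
  rw [exp_mul_eval, ← ser_scale]
  congr 1
  funext k
  rw [coeff_halfExp_laguerre ha]

theorem eval_zero_antideriv (a : ℝ) (i : ℕ) :
    (2 * (i : ℝ) + 1) * (antideriv a i).coeff 0 = 2 * (laguerre (2 * i) (a + 1)).coeff 0 := by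
  induction i with
  | zero => simp [antideriv_zero, zero_eq]
  | succ i ih =>
    have h1 := congrArg (fun f : Polynomial ℝ => f.coeff 0) (antideriv_succ a i)
    have h2 := congrArg (fun f : Polynomial ℝ => f.coeff 0) (succ_sub (2 * i + 1) a)
    have h3 := congrArg (fun f : Polynomial ℝ => f.coeff 0) (succ_mul (2 * i) (a + 1))
    simp only [Polynomial.mul_coeff_zero, Polynomial.coeff_add, Polynomial.coeff_sub,
      Polynomial.coeff_C_zero, Polynomial.coeff_X_zero, zero_mul, sub_zero] at h1 h2 h3
    have hi : (2 * (i : ℝ) + 1) ≠ 0 := by positivity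
    rw [show 2 * (i + 1) = 2 * i + 1 + 1 by ring]
    rw [show 2 * i + 2 = 2 * i + 1 + 1 by ring] at h1
    push_cast at h3 ⊢
    apply mul_left_cancel₀ hi
    linear_combination (2 * (i : ℝ) + 1) * h1 + (2 * (i : ℝ) + 2 + a) * ih +
      2 * (2 * (i : ℝ) + 1) * h2 - 2 * h3

/-- Subtracting the Laguerre polynomial makes the source of the first order equation κL - xL/2 = κ(1
- 8εz)L, free of odd powers of 1/κ relative to κL. Rescaled, this is `qSeq_rel`. -/
theorem coeff_halfExp_antideriv {a : ℝ} (ha : -2 < a) (N k : ℕ) :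
    coeff k (halfExp * ((Polynomial.C (2 * (N : ℝ) + 3) * antideriv a (N + 1) -
      laguerre (2 * N + 1 + 1) a : Polynomial ℝ) : ℝ⟦X⟧)) =
      kap a (2 * N + 1 + 1) * lagConst a (2 * N + 1 + 1) *
        ((4 * kap a (2 * N + 1 + 1)) ^ k * qSeq a (eps a (2 * N + 1 + 1)) k) := by
  have hkap := (kap_pos ha (2 * N + 1)).ne'
  rcases k with _ | k
  · have h1 := eval_zero_antideriv a (N + 1)
    rw [show 2 * (N + 1) = 2 * N + 1 + 1 by ring, coeff_zero_eq (by linarith), rGamma_shift,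
      lagConst] at h1
    rw [coeff_zero_halfExp_mul, Polynomial.coeff_sub, Polynomial.coeff_C_mul, coeff_zero_eq' ha,
      ← rGamma_one, pow_zero, qSeq, recipSeq, if_pos rfl, if_pos rfl]
    have hN : (0 : ℝ) ≤ N := N.cast_nonneg
    have h2 : Real.Gamma (((2 * N + 1 + 1 : ℕ) : ℝ) + (a + 1) + 1) / (2 * N + 1 + 1).factorial =
        (2 * N + 2 + a + 1) * lagConst a (2 * N + 1 + 1) := by
      rw [lagConst]
      push_cast
      rw [show 2 * (N : ℝ) + 1 + 1 + (a + 1) + 1 = (2 * N + 2 + a + 1) + 1 by ring,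
        Real.Gamma_add_one (by linarith), show 2 * (N : ℝ) + 1 + 1 + a + 1 = 2 * N + 2 + a + 1 by ring]
      ring
    rw [h2] at h1
    simp only [kap]
    push_cast at h1 ⊢
    linear_combination h1
  · set F : Polynomial ℝ := laguerre (2 * N + 1 + 1) a with hF
    set G : Polynomial ℝ := antideriv a (N + 1) with hG
    have p1 := X_mul_derivative_antideriv a (N + 1)
    have p3 := three_term_derivative (2 * N + 1) a
    have p4 := X_mul_derivative (2 * N + 1) a
    rw [← hF] at p3 p4
    rw [← hG] at p1
    rw [show 2 * (N + 1) + 1 = 2 * N + 1 + 2 by ring] at p1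
    have key : (Polynomial.C (2 : ℝ)) * (Polynomial.X * Polynomial.derivative
        (Polynomial.C (2 * (N : ℝ) + 3) * G - F) - Polynomial.C (1 / 2) * Polynomial.X *
        (Polynomial.C (2 * (N : ℝ) + 3) * G - F) + Polynomial.C ((a + 1) / 2) *
        (Polynomial.C (2 * (N : ℝ) + 3) * G - F)) = Polynomial.C (2 : ℝ) *
        (Polynomial.C (kap a (2 * N + 1 + 1)) * F - Polynomial.C (1 / 2) * (Polynomial.X * F)) := by
      apply Polynomial.funext
      intro x
      have p1' := congrArg (Polynomial.eval x) p1
      have p3' := congrArg (Polynomial.eval x) p3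
      have p4' := congrArg (Polynomial.eval x) p4
      simp only [Polynomial.eval_mul, Polynomial.eval_add, Polynomial.eval_sub, Polynomial.eval_C,
        Polynomial.eval_X, Polynomial.derivative_sub, Polynomial.derivative_C_mul,
        Polynomial.eval_ofNat] at p1' p3' p4' ⊢
      rw [kap]
      push_cast at p1' p3' p4' ⊢
      linear_combination (2 * (N : ℝ) + 3) * p1' - 2 * p3' + 2 * p4'
    have key2 := mul_left_cancel₀ (Polynomial.C_ne_zero.2 two_ne_zero) key
    set H : Polynomial ℝ := Polynomial.C (2 * (N : ℝ) + 3) * G - F with hH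
    have key3 := congrArg (fun f : Polynomial ℝ => (f : ℝ⟦X⟧)) key2
    simp only [Polynomial.coe_add, Polynomial.coe_mul, Polynomial.coe_sub, Polynomial.coe_C,
      Polynomial.coe_X] at key3
    have d1 : derivative ℝ (halfExp * (H : ℝ⟦X⟧)) =
        halfExp * ((H.derivative : ℝ⟦X⟧) - C (1 / 2) * (H : ℝ⟦X⟧)) := by
      rw [Derivation.leibniz, derivative_halfExp, derivative_coe, smul_eq_mul, smul_eq_mul, map_neg]
      ring
    have e : X * derivative ℝ (halfExp * (H : ℝ⟦X⟧)) + C ((a + 1) / 2) * (halfExp * (H : ℝ⟦X⟧)) =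
        C (kap a (2 * N + 1 + 1)) * (halfExp * (F : ℝ⟦X⟧)) -
          X * (C (1 / 2) * (halfExp * (F : ℝ⟦X⟧))) := by
      rw [d1]
      linear_combination halfExp * key3
    have h := congrArg (coeff (k + 1)) e
    simp only [map_add, map_sub, coeff_succ_X_mul, coeff_C_mul, coeff_derivative] at h
    rw [hF, coeff_halfExp_laguerre ha, coeff_halfExp_laguerre ha] at h
    have hq := qSeq_rel ha (eps a (2 * N + 1 + 1)) (k + 1)
    simp only [euler, shift] at hq
    have hk : (0 : ℝ) ≤ k := k.cast_nonneg
    have h1 : ((k + 1 : ℕ) : ℝ) + (a + 1) / 2 ≠ 0 := by push_cast; linarith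
    apply mul_left_cancel₀ h1
    push_cast at h hq ⊢
    have h2 : eps a (2 * N + 1 + 1) * (64 * kap a (2 * N + 1 + 1) ^ 2) = 1 := by
      rw [eps]; field_simp
    generalize kap a (2 * N + 1 + 1) = κ at *
    generalize lagConst a (2 * N + 1 + 1) = K at *
    generalize eps a (2 * N + 1 + 1) = ε at *
    rw [pow_succ] at h ⊢
    linear_combination h - κ * K * (4 * κ) ^ k * (4 * κ) * hq +
      (1 / 2) * K * (4 * κ) ^ k * pSeq a ε k * h2

/-- The antiderivatives in the hard edge variable, for `β = 4`. -/
theorem exp_mul_antideriv {a : ℝ} (ha : -2 < a) (N : ℕ) (x : ℝ) :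
    Real.exp (-x / 2) * ((2 * N + 3) * (antideriv a (N + 1)).eval x -
      (laguerre (2 * N + 1 + 1) a).eval x) =
      kap a (2 * N + 1 + 1) * lagConst a (2 * N + 1 + 1) *
        ser (qSeq a (eps a (2 * N + 1 + 1))) (4 * kap a (2 * N + 1 + 1) * x) := by
  have h := exp_mul_eval (Polynomial.C (2 * (N : ℝ) + 3) * antideriv a (N + 1) -
      laguerre (2 * N + 1 + 1) a) x
  simp only [Polynomial.eval_sub, Polynomial.eval_mul, Polynomial.eval_C] at h
  rw [h, ← ser_scale]
  congr 1
  funext k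
  rw [coeff_halfExp_antideriv ha]

end laguerre

/-! ### The closed densities in the hard edge variable. -/

theorem abs_eps_le {a : ℝ} (ha : -2 < a) (m : ℕ) : |laguerre.eps a (m + 1)| ≤ 1 := by
  have hm : (0 : ℝ) ≤ m := m.cast_nonneg
  have hk : 1 / 2 ≤ laguerre.kap a (m + 1) := by rw [laguerre.kap]; push_cast; linarith
  have h2 : 1 / 4 ≤ laguerre.kap a (m + 1) ^ 2 := by nlinarith
  rw [laguerre.eps, abs_of_nonneg (by positivity), div_le_one (by positivity)]
  linarith

theorem ser_qSeq_rel {a ε : ℝ} (ha : -2 < a) (hε : |ε| ≤ 1) (z : ℝ) :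
    ser (euler (qSeq a ε)) z + (a + 1) / 2 * ser (qSeq a ε) z =
      ser (pSeq a ε) z - 8 * ε * z * ser (pSeq a ε) z := by
  have hp := (pSeq_expansion a).isEntire hε
  have hq := (qSeq_expansion ha).isEntire hε
  rw [← ser_const_mul, ← hq.euler.ser_add (hq.const_mul _), mul_assoc (8 * ε), ← hp.ser_shift,
    ← ser_const_mul, ← hp.ser_sub (hp.shift.const_mul _)]
  congr 1
  funext k
  exact qSeq_rel ha ε k

namespace laguerre
open Polynomial

variable {a : ℝ}

theorem cumOne_eq_interval (ha : -1 < a) (k : ℕ) (t : ℝ) :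
    cumOne a k t = ∫ u in (0 : ℝ)..t, waveOne a k u := by
  have hi := (integrable_waveOne ha k)
  rw [← intervalIntegral.integral_Iic_sub_Iic hi.integrableOn hi.integrableOn, cumOne]
  rw [setIntegral_eq_zero_of_forall_eq_zero (t := Iic (0 : ℝ))
    fun u hu => waveOne_of_nonpos k u hu, sub_zero]

theorem continuous_cumOne (ha : -1 < a) (k : ℕ) : Continuous (cumOne a k) := by
  rw [funext (cumOne_eq_interval ha k)]
  exact intervalIntegral.continuous_primitive
    (fun _ _ => (integrable_waveOne ha k).intervalIntegrable) 0

theorem cumOne_zero (ha : -1 < a) (k : ℕ) : cumOne a k 0 = 0 := by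
  rw [cumOne_eq_interval ha, intervalIntegral.integral_same]

theorem hasDerivAt_cumOne (ha : -1 < a) (k : ℕ) {t : ℝ} (ht : 0 < t) :
    HasDerivAt (cumOne a k) (waveOne a k t) t := by
  rw [funext (cumOne_eq_interval ha k)]
  have hc : ContinuousAt (waveOne a k) t := by
    have h1 : ContinuousAt (fun u : ℝ => u ^ ((a - 1) / 2) * Real.exp (-u) *
        (laguerre k a).eval (2 * u)) t :=
      ((Real.continuousAt_rpow_const t _ (Or.inl ht.ne')).mul (by fun_prop)).mul (by fun_prop)
    refine h1.congr ?_
    filter_upwards [eventually_gt_nhds ht] with u hu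
    rw [waveOne, laguerreWeight_one_of_pos hu]
  exact intervalIntegral.integral_hasDerivAt_right (integrable_waveOne ha k).intervalIntegrable
    (integrable_waveOne ha k).aestronglyMeasurable.stronglyMeasurableAtFilter hc

/-- The antiderivatives in the hard edge variable, for `β = 1`. -/
theorem cumOne_eq (ha : -1 < a) (m : ℕ) {t : ℝ} (ht : 0 < t) :
    (m + 2) * cumOne a (m + 1 + 1) t - primitive a (m + 1) t =
      kap a (m + 1) * lagConst a (m + 1) * (t ^ ((a + 1) / 2) *
        ser (qSeq a (eps a (m + 1))) (8 * kap a (m + 1) * t)) := by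
  have ha2 : -2 < a := by linarith
  have hε := abs_eps_le ha2 m
  have hκ := kap_pos ha2 m
  have hq := (qSeq_expansion ha2).isEntire hε
  have hL := exp_mul_laguerre ha2 m
  have hrel := ser_qSeq_rel ha2 hε
  have h64 : eps a (m + 1) * (64 * kap a (m + 1) ^ 2) = 1 := by rw [eps]; field_simp
  have hkap : kap a (m + 1) = m + 1 + (a + 1) / 2 := by rw [kap]; push_cast; ring
  set κ := kap a (m + 1) with hκdef
  set ε := eps a (m + 1) with hεdef
  set K := lagConst a (m + 1) with hKdef
  -- Both sides vanish at 0, because (a+1)/2 > 0, and have the same derivative on t > 0 by the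
  -- equation for q.
  let D : ℝ → ℝ := fun t => (m + 2) * cumOne a (m + 1 + 1) t - primitive a (m + 1) t -
    κ * K * (t ^ ((a + 1) / 2) * ser (qSeq a ε) (8 * κ * t))
  have hcont : Continuous D := by
    have h1 := continuous_cumOne ha (m + 1 + 1)
    have h2 := continuous_primitive ha (m + 1)
    have h3 := Real.continuous_rpow_const (q := (a + 1) / 2) (by linarith)
    have h4 := hq.continuous_ser
    fun_prop
  have hD0 : D 0 = 0 := by
    simp only [D, cumOne_zero ha, primitive_zero ha, Real.zero_rpow (by linarith : (a + 1) / 2 ≠ 0)]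
    ring
  have hder : ∀ u : ℝ, 0 < u → HasDerivAt D 0 u := by
    intro u hu
    have hc : 8 * κ * u ≠ 0 := by positivity
    have h1 := (hasDerivAt_cumOne ha (m + 1 + 1) hu).const_mul ((m : ℝ) + 2)
    have h2 := hasDerivAt_primitive (a := a) hu (m + 1)
    have h3 := Real.hasDerivAt_rpow_const (x := u) (p := (a + 1) / 2) (Or.inl hu.ne')
    have h4 : HasDerivAt (fun u => ser (qSeq a ε) (8 * κ * u))
        (ser (euler (qSeq a ε)) (8 * κ * u) / (8 * κ * u) * (8 * κ)) u :=
      (hq.hasDerivAt_ser' hc).comp u (by simpa using (hasDerivAt_id u).const_mul (8 * κ))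
    have h5 := ((h1.sub h2).sub ((h3.mul h4).const_mul (κ * K)))
    refine HasDerivAt.congr_deriv (f := D) h5 ?_
    apply mul_left_cancel₀ hu.ne'
    have e1 : u * waveOne a (m + 1 + 1) u =
        halfWeight a u * (laguerre (m + 1 + 1) a).eval (2 * u) := by
      rw [← primitive_eq hu, primitive_eq_halfWeight]
    have e2 : u * derivOne a (m + 1) u = halfWeight a u *
        (((a + 1) / 2 - u) * (laguerre (m + 1) a).eval (2 * u) +
          2 * u * (derivative (laguerre (m + 1) a)).eval (2 * u)) := by
      rw [derivOne, ← mul_assoc, mul_laguerreWeight_one hu, eval_primitivePoly, halfWeight]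
    have e3 := eval_X_mul_derivative (m + 1) a (2 * u)
    have e4 := hL (2 * u)
    rw [show -(2 * u) / 2 = -u by ring, show 4 * κ * (2 * u) = 8 * κ * u by ring] at e4
    have e5 := hrel (8 * κ * u)
    have e6 : u ^ ((a + 1) / 2 - 1) * u = u ^ ((a + 1) / 2) := by
      rw [← Real.rpow_add_one hu.ne']; congr 1; ring
    have e7 : u * (κ * K * ((a + 1) / 2 * u ^ ((a + 1) / 2 - 1) * ser (qSeq a ε) (8 * κ * u) +
        u ^ ((a + 1) / 2) * (ser (euler (qSeq a ε)) (8 * κ * u) / (8 * κ * u) * (8 * κ)))) =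
        κ * K * u ^ ((a + 1) / 2) * (ser (euler (qSeq a ε)) (8 * κ * u) +
          (a + 1) / 2 * ser (qSeq a ε) (8 * κ * u)) := by
      rw [← e6]; field_simp; ring
    rw [mul_sub, e7, e5, mul_sub, mul_left_comm, e1, e2]
    simp only [halfWeight]
    push_cast at e3
    linear_combination (-u ^ ((a + 1) / 2) * Real.exp (-u)) * e3 +
      (u ^ ((a + 1) / 2) * (κ - u)) * e4 +
      (K * u ^ ((a + 1) / 2) * u * ser (pSeq a ε) (8 * κ * u)) * h64 -
      (u ^ ((a + 1) / 2) * Real.exp (-u) * (laguerre (m + 1) a).eval (2 * u)) * hkap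
  obtain ⟨c, hc, hc'⟩ := exists_hasDerivAt_eq_slope D (fun _ => 0) ht hcont.continuousOn
    fun x hx => hder x hx.1
  rw [hD0, sub_zero, sub_zero, eq_comm, div_eq_zero_iff] at hc'
  have := hc'.resolve_right ht.ne'
  simp only [D] at this
  linarith

end laguerre

/-- The quadratic expression for the density in terms of the scaled Laguerre function `p`, its
Euler derivative `u` and the scaled antiderivative `q`. -/
def bulkForm (a ε z p u q : ℝ) : ℝ :=
  -z * (p * q) + 8 * u ^ 2 + 8 * a * (p * u) + (2 * z - 8 * ε * z ^ 2) * p ^ 2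

/-- `bulkForm` evaluated at the series of the Laguerre functions. -/
def bulkSer (a ε z : ℝ) : ℝ :=
  bulkForm a ε z (ser (pSeq a ε) z) (ser (euler (pSeq a ε)) z) (ser (qSeq a ε) z)

namespace laguerre
open Polynomial

variable {a : ℝ}

theorem exp_mul_derivative_laguerre (ha : -2 < a) (m : ℕ) {x : ℝ} (hx : 0 < x) :
    x * (Real.exp (-x / 2) * ((derivative (laguerre (m + 1) a)).eval x -
      (laguerre (m + 1) a).eval x / 2)) =
      lagConst a (m + 1) *
        ser (euler (pSeq a (eps a (m + 1)))) (4 * kap a (m + 1) * x) := by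
  have hκ := kap_pos ha m
  have hp := (pSeq_expansion a).isEntire (abs_eps_le ha m)
  have hc : 4 * kap a (m + 1) * x ≠ 0 := by positivity
  have h1 : HasDerivAt (fun x => lagConst a (m + 1) *
      ser (pSeq a (eps a (m + 1))) (4 * kap a (m + 1) * x))
      (lagConst a (m + 1) * (ser (euler (pSeq a (eps a (m + 1)))) (4 * kap a (m + 1) * x) /
        (4 * kap a (m + 1) * x) * (4 * kap a (m + 1)))) x := by
    have h := ((hp.hasDerivAt_ser' hc).comp (h := fun x => 4 * kap a (m + 1) * x) x
      (by simpa using (hasDerivAt_id x).const_mul (4 * kap a (m + 1))))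
    exact h.const_mul _
  have h2 : HasDerivAt (fun x => Real.exp (-x / 2) * (laguerre (m + 1) a).eval x)
      (Real.exp (-x / 2) * (-1 / 2) * (laguerre (m + 1) a).eval x +
        Real.exp (-x / 2) * (derivative (laguerre (m + 1) a)).eval x) x :=
    (((hasDerivAt_id x).neg.div_const 2).exp).mul ((laguerre (m + 1) a).hasDerivAt x)
  rw [funext (exp_mul_laguerre ha m)] at h2
  have h3 := h2.unique h1
  rw [show x * (Real.exp (-x / 2) * ((derivative (laguerre (m + 1) a)).eval x -
      (laguerre (m + 1) a).eval x / 2)) = x * (Real.exp (-x / 2) * (-1 / 2) *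
      (laguerre (m + 1) a).eval x + Real.exp (-x / 2) *
      (derivative (laguerre (m + 1) a)).eval x) by ring, h3]
  field_simp

/-- In scaled form the derivative becomes u + xp/2, the antiderivative p + κq, and the degree is κ
minus a constant. The explicit κ drop out: apart from the prefactor, κ enters only through z = 4κx
and ε. -/
theorem mul_exp_mul_bracket (ha : -2 < a) (m : ℕ) {x g : ℝ} (hx : 0 < x)
    (hg : Real.exp (-x / 2) * ((m + 2) * g - (laguerre (m + 1) a).eval x) =
      kap a (m + 1) * lagConst a (m + 1) *
        ser (qSeq a (eps a (m + 1))) (4 * kap a (m + 1) * x)) :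
    x * (Real.exp (-x) * bracket (m + 1) a x g) =
      lagConst a (m + 1) ^ 2 / 4 * bulkSer a (eps a (m + 1)) (4 * kap a (m + 1) * x) := by
  have h1 := exp_mul_laguerre ha m x
  have h2 := exp_mul_derivative_laguerre ha m hx
  have h64 : eps a (m + 1) * (64 * kap a (m + 1) ^ 2) = 1 := by
    have := (kap_pos ha m).ne'
    rw [eps]; field_simp
  have hk : kap a (m + 1) = m + 1 + (a + 1) / 2 := by rw [kap]; push_cast; ring
  have he : Real.exp (-x) = Real.exp (-x / 2) ^ 2 := by
    rw [← Real.exp_nat_mul]; congr 1; push_cast; ring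
  rw [bulkSer, bulkForm, he, bracket]
  push_cast
  generalize ser (pSeq a (eps a (m + 1))) (4 * kap a (m + 1) * x) = p at *
  generalize ser (euler (pSeq a (eps a (m + 1)))) (4 * kap a (m + 1) * x) = u at *
  generalize ser (qSeq a (eps a (m + 1))) (4 * kap a (m + 1) * x) = q at *
  generalize lagConst a (m + 1) = K at *
  generalize eps a (m + 1) = ε at *
  generalize (derivative (laguerre (m + 1) a)).eval x = D at *
  generalize (laguerre (m + 1) a).eval x = P at *
  generalize Real.exp (-x / 2) = E at *
  generalize kap a (m + 1) = κ at *
  have hm : (m : ℝ) = κ - 1 - (a + 1) / 2 := by linarith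
  rw [hm] at hg ⊢
  have h2' : x * (E * D) = K * (u + x * p / 2) := by linear_combination h2 + x / 2 * h1
  have hg' : E * ((κ - 1 - (a + 1) / 2 + 2) * g) = K * (p + κ * q) := by linear_combination hg + h1
  have key : x * (E ^ 2 * (2 * x * D ^ 2 + 2 * (a - x) * P * D +
      (2 * (κ - 1 - (a + 1) / 2 + 1) + 2) * P ^ 2 -
      ((κ - 1 - (a + 1) / 2 + 1) + 1) * P * g)) =
      2 * (x * (E * D)) ^ 2 + 2 * (a - x) * (E * P) * (x * (E * D)) +
        x * (2 * (κ - 1 - (a + 1) / 2 + 1) + 2) * (E * P) ^ 2 -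
        x * (E * P) * (E * ((κ - 1 - (a + 1) / 2 + 2) * g)) := by ring
  rw [key, h2', hg', h1]
  linear_combination (K ^ 2 * x ^ 2 * p ^ 2 / 2) * h64

/-- The scaled density without the contribution special to the orthogonal ensemble. -/
def bulkPart (a : ℝ) (n : ℕ) (z : ℝ) : ℝ :=
  4 ^ (-a) / 8 * (lagConst a n * kap a n ^ (-a)) * (z ^ a * bulkSer a (eps a n) z)

/-- The contribution to the scaled density special to the orthogonal ensemble. -/
def extraPart (a : ℝ) (n : ℕ) (z : ℝ) : ℝ :=
  (8 * kap a n) ^ (-((a + 1) / 2)) * lagConst a n * extraCoeff a n *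
    (z ^ ((a + 1) / 2) * ser (pSeq a (eps a n)) z)

theorem lagConst_pos (ha : -2 < a) (m : ℕ) : 0 < lagConst a (m + 1) := by
  have hm : (0 : ℝ) ≤ m := m.cast_nonneg
  have := Real.Gamma_pos_of_pos (s := ((m + 1 : ℕ) : ℝ) + a + 1) (by push_cast; linarith)
  rw [lagConst]; positivity

theorem weighted_bracket (ha : -2 < a) (m : ℕ) {x g : ℝ} (hx : 0 < x)
    (hg : Real.exp (-x / 2) * ((m + 2) * g - (laguerre (m + 1) a).eval x) =
      kap a (m + 1) * lagConst a (m + 1) *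
        ser (qSeq a (eps a (m + 1))) (4 * kap a (m + 1) * x)) :
    (m + 1).factorial / Real.Gamma ((m + 1 : ℕ) + a + 1) / 2 * (x ^ (a + 1) * Real.exp (-x)) *
      bracket (m + 1) a x g = bulkPart a (m + 1) (4 * kap a (m + 1) * x) := by
  have h := mul_exp_mul_bracket ha m hx hg
  have hκ := kap_pos ha m
  have hK := lagConst_pos ha m
  have h1 : (m + 1).factorial / Real.Gamma ((m + 1 : ℕ) + a + 1) = (lagConst a (m + 1))⁻¹ := by
    rw [lagConst, inv_div]
  have h2 : (4 * kap a (m + 1) * x) ^ a = 4 ^ a * kap a (m + 1) ^ a * x ^ a := by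
    rw [Real.mul_rpow (by positivity) hx.le, Real.mul_rpow (by norm_num) hκ.le]
  rw [bulkPart, h1, Real.rpow_add_one hx.ne', h2, Real.rpow_neg (by norm_num),
    Real.rpow_neg hκ.le]
  have h4 : (0 : ℝ) < 4 ^ a := by positivity
  have h5 : 0 < kap a (m + 1) ^ a := by positivity
  generalize (4 : ℝ) ^ a = A at *
  generalize kap a (m + 1) ^ a = B at *
  generalize bulkSer a (eps a (m + 1)) (4 * kap a (m + 1) * x) = S at *
  generalize lagConst a (m + 1) = K at *
  field_simp
  linear_combination 8 * h

/-- The degree is one less than the number of eigenvalues, and the polynomials are taken at 2x,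
whence 8κx. -/
theorem density_one_eq (ha : -1 < a) (m : ℕ) {x : ℝ} (hx : 0 < x) :
    x * ensembleDensity 1 (laguerreWeight 1 a) (m + 1 + 1) x =
      bulkPart a (m + 1) (8 * kap a (m + 1) * x) +
        extraPart a (m + 1) (8 * kap a (m + 1) * x) := by
  have ha2 : -2 < a := by linarith
  have hκ := kap_pos ha2 m
  have hw := halfWeight_pos (a := a) hx
  rw [(laguerreDensity_one ha (m + 1)).2 x hx, mainOne]
  have e1 : 8 * kap a (m + 1) * x = 4 * kap a (m + 1) * (2 * x) := by ring
  rw [e1, weighted_bracket ha2 m (by positivity), ← e1]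
  · congr 1
    have h := exp_mul_laguerre ha2 m (2 * x)
    rw [show -(2 * x) / 2 = -x by ring, ← e1] at h
    rw [primitive, extraPart, mul_assoc (x ^ _), h, Real.mul_rpow (by positivity) hx.le,
      Real.rpow_neg (by positivity)]
    have : 0 < (8 * kap a (m + 1)) ^ ((a + 1) / 2) := by positivity
    field_simp
  · have h := cumOne_eq ha m hx
    rw [← e1, show -(2 * x) / 2 = -x by ring]
    rw [primitive_eq_halfWeight] at h
    have hpow : x ^ ((a + 1) / 2) = halfWeight a x * Real.exp x := by
      rw [halfWeight, mul_assoc, ← Real.exp_add]; simp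
    have hee : Real.exp (-x) * Real.exp x = 1 := by rw [← Real.exp_add]; simp
    rw [hpow] at h
    apply mul_left_cancel₀ hw.ne'
    generalize ser (qSeq a (eps a (m + 1))) (8 * kap a (m + 1) * x) = q at *
    generalize (laguerre (m + 1) a).eval (2 * x) = P at *
    generalize cumOne a (m + 1 + 1) x = G at *
    generalize halfWeight a x = W at *
    have : W * (Real.exp (-x) * ((m + 2) * (G / W) - P)) = Real.exp (-x) * ((m + 2) * G - W * P) := by
      field_simp
    rw [this, h]
    linear_combination (kap a (m + 1) * lagConst a (m + 1) * W * q) * hee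

/-- For β = 4 the degree is twice the number of eigenvalues. -/
theorem density_four_eq (ha : -2 < a) (N : ℕ) {x : ℝ} (hx : 0 < x) :
    2 * (x * ensembleDensity 4 (laguerreWeight 4 a) (N + 1) x) =
      bulkPart a (2 * N + 1 + 1) (4 * kap a (2 * N + 1 + 1) * x) := by
  rw [(laguerreDensity_four (by linarith) N).2 x hx]
  have h := weighted_bracket ha (2 * N + 1) (g := (antideriv a (N + 1)).eval x) hx (by
    have h := exp_mul_antideriv ha N x
    push_cast at h ⊢
    convert h using 3
    ring)
  rw [← h]
  push_cast
  rw [show 2 * (N + 1) = 2 * N + 1 + 1 by ring]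
  congr 3
  ring_nf

end laguerre

/-! ### First order expansion of the scaled densities. -/

/-- `F = F₀ + e F₁ + o(e)` along the filter `L`, where `F₀` and `F₁` have limits `f₀`, `f₁`. -/
structure FirstOrder {ι : Type*} (L : Filter ι) (e F F₀ : ι → ℝ) (f₀ f₁ : ℝ) : Prop where
  base : Tendsto F₀ L (nhds f₀)
  first : Tendsto (fun w => (F w - F₀ w) / e w) L (nhds f₁)

namespace FirstOrder
variable {ι : Type*} {L : Filter ι} {e F F₀ G G₀ : ι → ℝ} {f₀ f₁ g₀ g₁ : ℝ}

theorem of_tendsto (h : Tendsto F L (nhds f₀)) : FirstOrder L e F F f₀ 0 :=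
  ⟨h, by simpa using tendsto_const_nhds⟩

theorem const (c : ℝ) : FirstOrder L e (fun _ => c) (fun _ => c) c 0 :=
  of_tendsto tendsto_const_nhds

theorem param (hne : ∀ w, e w ≠ 0) : FirstOrder L e e (fun _ => 0) 0 1 :=
  ⟨tendsto_const_nhds, by simp [div_self (hne _), tendsto_const_nhds]⟩

theorem tendsto (hF : FirstOrder L e F F₀ f₀ f₁) (he : Tendsto e L (nhds 0))
    (hne : ∀ w, e w ≠ 0) : Tendsto F L (nhds f₀) := by
  have h := hF.base.add (he.mul hF.first)
  rw [zero_mul, add_zero] at h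
  refine h.congr fun w => ?_
  have := hne w
  field_simp; ring

theorem add (hF : FirstOrder L e F F₀ f₀ f₁) (hG : FirstOrder L e G G₀ g₀ g₁) :
    FirstOrder L e (fun w => F w + G w) (fun w => F₀ w + G₀ w) (f₀ + g₀) (f₁ + g₁) :=
  ⟨hF.base.add hG.base, (hF.first.add hG.first).congr fun w => by ring⟩

theorem mul (he : Tendsto e L (nhds 0)) (hne : ∀ w, e w ≠ 0)
    (hF : FirstOrder L e F F₀ f₀ f₁) (hG : FirstOrder L e G G₀ g₀ g₁) :
    FirstOrder L e (fun w => F w * G w) (fun w => F₀ w * G₀ w) (f₀ * g₀)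
      (f₁ * g₀ + f₀ * g₁) :=
  ⟨hF.base.mul hG.base, ((hF.first.mul (hG.tendsto he hne)).add
    (hF.base.mul hG.first)).congr fun w => by ring⟩

end FirstOrder

/-- The derivative of `bulkForm` with respect to `ε` at `ε = 0`, when `p`, `u`, `q` depend on `ε`
with derivatives `p₁`, `u₁`, `q₁`. -/
def bulkFormOne (a z p u q p₁ u₁ q₁ : ℝ) : ℝ :=
  -z * (p₁ * q + p * q₁) + 16 * (u * u₁) + 8 * a * (p₁ * u + p * u₁) + 4 * z * (p * p₁) -
    8 * z ^ 2 * p ^ 2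

theorem FirstOrder.bulkForm {ι : Type*} {L : Filter ι} {e z p p₀ u u₀ q q₀ : ι → ℝ}
    {x fp fp₁ fu fu₁ fq fq₁ : ℝ} (a : ℝ)
    (he : Tendsto e L (nhds 0)) (hne : ∀ w, e w ≠ 0) (hz : Tendsto z L (nhds x))
    (hp : FirstOrder L e p p₀ fp fp₁) (hu : FirstOrder L e u u₀ fu fu₁)
    (hq : FirstOrder L e q q₀ fq fq₁) :
    FirstOrder L e (fun w => bulkForm a (e w) (z w) (p w) (u w) (q w))
      (fun w => _root_.bulkForm a 0 (z w) (p₀ w) (u₀ w) (q₀ w)) (_root_.bulkForm a 0 x fp fu fq)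
      (bulkFormOne a x fp fu fq fp₁ fu₁ fq₁) := by
  have hz' := of_tendsto (e := e) hz
  have c : ∀ r : ℝ, FirstOrder L e (fun _ => r) (fun _ => r) r 0 := FirstOrder.const
  have M := fun {F F₀ G G₀ : ι → ℝ} {f₀ f₁ g₀ g₁ : ℝ} (h : FirstOrder L e F F₀ f₀ f₁)
    (h' : FirstOrder L e G G₀ g₀ g₁) => FirstOrder.mul he hne h h'
  have h := (((M (c (-1)) (M hz' (M hp hq))).add (M (c 8) (M hu hu))).add
    (M (c (8 * a)) (M hp hu))).add
    ((M (c 2) (M hz' (M hp hp))).add (M (c (-8)) (M (M (param hne) (M hz' hz')) (M hp hp))))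
  constructor
  · refine (h.base.congr fun w => ?_).trans_eq ?_
    · simp only [_root_.bulkForm]; ring
    · simp only [_root_.bulkForm]; ring_nf
  · refine (h.first.congr fun w => ?_).trans_eq ?_
    · simp only [_root_.bulkForm]; ring
    · simp only [bulkFormOne]; ring_nf

namespace laguerre
variable {a : ℝ}

/-- The hard edge limit of `bulkSer`. -/
def bulkSer₀ (a z : ℝ) : ℝ :=
  bulkForm a 0 z (ser (pSeq₀ a) z) (ser (euler (pSeq₀ a)) z) (ser (qSeq₀ a) z)

/-- The first correction to `bulkSer`. -/
def bulkSer₁ (a z : ℝ) : ℝ :=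
  bulkFormOne a z (ser (pSeq₀ a) z) (ser (euler (pSeq₀ a)) z) (ser (qSeq₀ a) z)
    (ser (pSeq₁ a) z) (ser (euler (pSeq₁ a)) z) (ser (qSeq₁ a) z)

theorem eps_ne_zero (ha : -2 < a) (m : ℕ) : eps a (m + 1) ≠ 0 := by
  have := kap_pos ha m
  rw [eps]; positivity

theorem tendsto_kap (a : ℝ) : Tendsto (fun m : ℕ => kap a (m + 1)) atTop atTop :=
  tendsto_atTop_add_const_right _ _
    (tendsto_natCast_atTop_atTop.comp (tendsto_add_atTop_nat 1))

theorem tendsto_eps (a : ℝ) : Tendsto (fun m : ℕ => eps a (m + 1)) atTop (nhds 0) := by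
  have h := ((tendsto_pow_atTop (α := ℝ) two_ne_zero).comp (tendsto_kap a)).const_mul_atTop
    (show (0 : ℝ) < 64 by norm_num)
  refine h.inv_tendsto_atTop.congr fun m => ?_
  simp [eps]

/-- The Gamma arguments n + a + 1 and n + 1 are κ + (1 ± a)/2, the symmetric position in which the
quotient has no term of order 1/κ. -/
theorem firstOrder_lagConst (ha : -2 < a) {ι : Type*} {L : Filter ι} {m : ι → ℕ}
    (hm : Tendsto m L atTop) :
    FirstOrder L (fun w => eps a (m w + 1))
      (fun w => lagConst a (m w + 1) * kap a (m w + 1) ^ (-a)) (fun _ => 1) 1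
      (-(8 / 3) * (a * (a ^ 2 - 1))) := by
  refine ⟨tendsto_const_nhds, ?_⟩
  have h := (((tendsto_gamma_ratio a).comp (tendsto_kap a)).comp hm).const_mul 64
  rw [show 64 * (-(a * (a ^ 2 - 1)) / 24) = -(8 / 3) * (a * (a ^ 2 - 1)) by ring] at h
  refine h.congr fun w => ?_
  have hκ := kap_pos ha (m w)
  simp only [Function.comp]
  rw [lagConst, eps, show kap a (m w + 1) + (1 + a) / 2 = ((m w + 1 : ℕ) : ℝ) + a + 1 by
    rw [kap]; ring, show kap a (m w + 1) + (1 - a) / 2 = ((m w + 1 : ℕ) : ℝ) + 1 by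
    rw [kap]; ring, Real.Gamma_nat_eq_factorial]
  field_simp

/-- Again a symmetric quotient, now about κ/2 with b = (1-a)/2; the factor 256 = 64 · 4 converts
(κ/2)^(-2) into ε. -/
theorem firstOrder_extraCoeff (ha : -2 < a) {ι : Type*} {L : Filter ι} {m : ι → ℕ}
    (hm : Tendsto m L atTop) :
    FirstOrder L (fun w => eps a (m w + 1))
      (fun w => extraCoeff a (m w + 1) * (kap a (m w + 1) / 2) ^ (-((1 - a) / 2))) (fun _ => 1) 1
      (-(4 / 3) * ((1 - a) * (a + 1) * (a - 3))) := by
  refine ⟨tendsto_const_nhds, ?_⟩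
  have h := (((tendsto_gamma_ratio ((1 - a) / 2)).comp
    ((tendsto_kap a).atTop_div_const two_pos)).comp hm).const_mul 256
  rw [show 256 * (-((1 - a) / 2 * (((1 - a) / 2) ^ 2 - 1)) / 24) =
    -(4 / 3) * ((1 - a) * (a + 1) * (a - 3)) by ring] at h
  refine h.congr fun w => ?_
  have hκ := kap_pos ha (m w)
  simp only [Function.comp]
  rw [extraCoeff, eps, show kap a (m w + 1) / 2 + (1 + (1 - a) / 2) / 2 =
    ((m w + 1 : ℕ) : ℝ) / 2 + 1 by rw [kap]; ring,
    show kap a (m w + 1) / 2 + (1 - (1 - a) / 2) / 2 =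
      ((m w + 1 : ℕ) : ℝ) / 2 + (a + 1) / 2 by rw [kap]; ring]
  field_simp
  ring

theorem firstOrder_extraConst (ha : -2 < a) {ι : Type*} {L : Filter ι} {m : ι → ℕ}
    (hm : Tendsto m L atTop) :
    FirstOrder L (fun w => eps a (m w + 1))
      (fun w => (8 * kap a (m w + 1)) ^ (-((a + 1) / 2)) * lagConst a (m w + 1) *
        extraCoeff a (m w + 1)) (fun _ => 4 ^ (-a) / 8 * 2 ^ (1 + a))
      (4 ^ (-a) / 8 * 2 ^ (1 + a))
      (4 ^ (-a) / 8 * 2 ^ (1 + a) * (-(4 / 3) * ((a ^ 2 - 1) * (a + 3)))) := by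
  have he := (tendsto_eps a).comp hm
  have h := (FirstOrder.const (4 ^ (-a) / 8 * 2 ^ (1 + a))).mul he
    (fun w => eps_ne_zero ha (m w))
    ((firstOrder_lagConst ha hm).mul he (fun w => eps_ne_zero ha (m w))
      (firstOrder_extraCoeff ha hm))
  simp only [mul_one, one_mul, zero_add] at h
  refine ⟨h.base, ?_⟩
  refine (h.first.congr fun w => ?_).trans_eq ?_
  · have hκ := kap_pos ha (m w)
    have h8 : ((8 : ℝ) * kap a (m w + 1)) ^ (-((a + 1) / 2)) =
        4 ^ (-a) / 8 * 2 ^ (1 + a) * kap a (m w + 1) ^ (-a) *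
          (kap a (m w + 1) / 2) ^ (-((1 - a) / 2)) := by
      rw [Real.mul_rpow (by norm_num) hκ.le, Real.div_rpow hκ.le (by norm_num),
        show (8 : ℝ) = 2 ^ (3 : ℝ) by norm_num, show (4 : ℝ) = 2 ^ (2 : ℝ) by norm_num,
        ← Real.rpow_mul (by norm_num), ← Real.rpow_mul (by norm_num)]
      rw [show (2 : ℝ) ^ (2 * -a) / 2 ^ (3 : ℝ) * 2 ^ (1 + a) * kap a (m w + 1) ^ (-a) *
        (kap a (m w + 1) ^ (-((1 - a) / 2)) / 2 ^ (-((1 - a) / 2))) =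
        (2 : ℝ) ^ (2 * -a) / 2 ^ (3 : ℝ) * 2 ^ (1 + a) / 2 ^ (-((1 - a) / 2)) *
        (kap a (m w + 1) ^ (-a) * kap a (m w + 1) ^ (-((1 - a) / 2))) by ring,
        ← Real.rpow_sub two_pos, ← Real.rpow_add two_pos, ← Real.rpow_sub two_pos,
        ← Real.rpow_add hκ]
      congr 2 <;> ring
    simp only [Function.comp] at *
    rw [h8]
    ring
  · ring_nf

/-- The constant in front of the hard edge density. -/
def edgeConst (a : ℝ) : ℝ := 4 ^ (-a) / 8

/-- The hard edge limit of `bulkPart + σ extraPart`. -/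
def edge₀ (a σ z : ℝ) : ℝ :=
  edgeConst a * (z ^ a * bulkSer₀ a z) +
    σ * (edgeConst a * 2 ^ (1 + a)) * (z ^ ((a + 1) / 2) * ser (pSeq₀ a) z)

/-- The first correction to `bulkPart + σ extraPart`. -/
def edge₁ (a σ z : ℝ) : ℝ :=
  edgeConst a * (z ^ a * (bulkSer₁ a z - 8 / 3 * (a * (a ^ 2 - 1)) * bulkSer₀ a z)) +
    σ * (edgeConst a * 2 ^ (1 + a)) * (z ^ ((a + 1) / 2) *
      (ser (pSeq₁ a) z - 4 / 3 * ((a ^ 2 - 1) * (a + 3)) * ser (pSeq₀ a) z))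

/-- The filter is arbitrary so that the degree and the point can vary together; local uniformity
results from this. -/
theorem firstOrder_edge (ha : -2 < a) (σ : ℝ) {ι : Type*} {L : Filter ι} {m : ι → ℕ} {z : ι → ℝ}
    {x : ℝ} (hm : Tendsto m L atTop) (hz : Tendsto z L (nhds x)) (hx : x ≠ 0) :
    Tendsto (fun w => (bulkPart a (m w + 1) (z w) + σ * extraPart a (m w + 1) (z w) -
      edge₀ a σ (z w)) / eps a (m w + 1)) L (nhds (edge₁ a σ x)) := by
  have he := (tendsto_eps a).comp hm
  have hne := fun w => eps_ne_zero ha (m w)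
  have S := fun {F : ℝ → ℕ → ℝ} {f₀ f₁ : ℕ → ℝ} (h : SeqExpansion F f₀ f₁) =>
    (⟨(h.1.continuous_ser.tendsto x).comp hz, h.tendsto he (Eventually.of_forall hne) hz⟩ :
      FirstOrder L (fun w => eps a (m w + 1)) (fun w => ser (F (eps a (m w + 1))) (z w))
        (fun w => ser f₀ (z w)) (ser f₀ x) (ser f₁ x))
  have hp := S (pSeq_expansion a)
  have hb := FirstOrder.bulkForm a he hne hz hp (S (pSeq_expansion a).euler)
    (S (qSeq_expansion ha))
  have R := fun r : ℝ => FirstOrder.of_tendsto (e := fun w => eps a (m w + 1))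
    ((Real.continuousAt_rpow_const x r (Or.inl hx)).tendsto.comp hz)
  have h1 := ((FirstOrder.const (edgeConst a)).mul he hne (firstOrder_lagConst ha hm)).mul he hne
    ((R a).mul he hne hb)
  have h2 := (FirstOrder.const σ).mul he hne ((firstOrder_extraConst ha hm).mul he hne
    ((R ((a + 1) / 2)).mul he hne hp))
  refine ((h1.add h2).first.congr fun w => ?_).trans_eq ?_
  · simp only [bulkPart, extraPart, edge₀, edgeConst, bulkSer₀, bulkSer, Function.comp]
    ring
  · simp only [edge₁, edgeConst, bulkSer₀, bulkSer₁]
    ring_nf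

end laguerre

/-! ### The differential relation between the limit density and its correction. -/

namespace laguerre
variable {a : ℝ}

theorem ser_pSeq₀_rel (a z : ℝ) : ser (euler (euler (pSeq₀ a))) z =
    -a * ser (euler (pSeq₀ a)) z - 1 / 4 * (z * ser (pSeq₀ a) z) := by
  have hp := (pSeq_expansion a).1
  rw [← hp.ser_shift, ← ser_const_mul, ← ser_const_mul,
    ← (hp.euler.const_mul _).ser_sub (hp.shift.const_mul _)]
  exact congrArg (ser · z) (funext (pSeq₀_rel a))

theorem ser_qSeq₀_rel (ha : -2 < a) (z : ℝ) : ser (euler (qSeq₀ a)) z =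
    ser (pSeq₀ a) z - (a + 1) / 2 * ser (qSeq₀ a) z := by
  have hq := (qSeq_expansion ha).1
  rw [eq_sub_iff_add_eq, ← ser_const_mul, ← hq.euler.ser_add (hq.const_mul _)]
  exact congrArg (ser · z) (funext (qSeq₀_rel ha))

theorem ser_pSeq₁ (a z : ℝ) : ser (pSeq₁ a) z = 8 / 3 * (1 - a ^ 2) * ser (euler (pSeq₀ a)) z +
    z * (4 / 3 * ((1 - a) / 2 * ser (pSeq₀ a) z - ser (euler (pSeq₀ a)) z)) := by
  have hp := (pSeq_expansion a).1
  have h := (hp.const_mul ((1 - a) / 2)).sub hp.euler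
  have e : ser (pSeq₁ a) z = _ := congrArg (ser · z) (funext (pSeq₁_rel a))
  rw [e, (hp.euler.const_mul _).ser_add (h.const_mul _).shift, (h.const_mul _).ser_shift]
  rw [ser_const_mul _ (4 / 3), (hp.const_mul _).ser_sub hp.euler]
  simp only [ser_const_mul]

theorem ser_qSeq₁ (ha : -2 < a) (z : ℝ) : ser (qSeq₁ a) z =
    -(4 / 3) * (1 - a ^ 2) * (a + 1) * ser (qSeq₀ a) z +
      8 / 3 * (1 - a ^ 2) * ser (pSeq₀ a) z - 4 / 3 * (z * ser (pSeq₀ a) z) -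
      16 / 3 * ((2 - 2 * a) * ser (pSeq₀ a) z - 4 * ser (euler (pSeq₀ a)) z -
        (1 - a ^ 2) * ser (qSeq₀ a) z) := by
  have hp := (pSeq_expansion a).1
  have hq := (qSeq_expansion ha).1
  have h1 := ((hp.const_mul (2 - 2 * a)).sub (hp.euler.const_mul 4))
  have h2 := (hq.const_mul (-(4 / 3) * (1 - a ^ 2) * (a + 1))).add
    (hp.const_mul (8 / 3 * (1 - a ^ 2)))
  have h3 := hp.shift.const_mul (4 / 3)
  have h4 := hq.const_mul (1 - a ^ 2)
  have e : ser (qSeq₁ a) z = _ := congrArg (ser · z) (funext (qSeq₁_rel ha))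
  rw [e, (h2.sub h3).ser_sub ((h1.sub h4).const_mul _), h2.ser_sub h3,
    (hq.const_mul _).ser_add (hp.const_mul _), ser_const_mul _ (16 / 3), h1.ser_sub h4,
    (hp.const_mul _).ser_sub (hp.euler.const_mul _)]
  simp only [ser_const_mul, hp.ser_shift]

theorem hasDerivAt_bessel (a : ℝ) {z : ℝ} (hz : z ≠ 0) :
    HasDerivAt (ser (pSeq₀ a)) (ser (euler (pSeq₀ a)) z / z) z :=
  (pSeq_expansion a).1.hasDerivAt_ser' hz

theorem hasDerivAt_bessel_euler (a : ℝ) {z : ℝ} (hz : z ≠ 0) :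
    HasDerivAt (ser (euler (pSeq₀ a)))
      ((-a * ser (euler (pSeq₀ a)) z - 1 / 4 * (z * ser (pSeq₀ a) z)) / z) z := by
  rw [← ser_pSeq₀_rel]
  exact (pSeq_expansion a).1.euler.hasDerivAt_ser' hz

theorem hasDerivAt_antibessel (ha : -2 < a) {z : ℝ} (hz : z ≠ 0) :
    HasDerivAt (ser (qSeq₀ a)) ((ser (pSeq₀ a) z - (a + 1) / 2 * ser (qSeq₀ a) z) / z) z := by
  rw [← ser_qSeq₀_rel ha]
  exact (qSeq_expansion ha).1.hasDerivAt_ser' hz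

theorem ser_euler_pSeq₁ (a : ℝ) {z : ℝ} (hz : z ≠ 0) : ser (euler (pSeq₁ a)) z =
    8 / 3 * (1 - a ^ 2) * (-a * ser (euler (pSeq₀ a)) z - 1 / 4 * (z * ser (pSeq₀ a) z)) +
    z * (4 / 3 * ((1 - a) / 2 * ser (pSeq₀ a) z - ser (euler (pSeq₀ a)) z)) +
    z * (4 / 3 * ((1 - a) / 2 * ser (euler (pSeq₀ a)) z -
      (-a * ser (euler (pSeq₀ a)) z - 1 / 4 * (z * ser (pSeq₀ a) z)))) := by
  have h1 := (pSeq_expansion a).2.1.hasDerivAt_ser' hz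
  have hu := hasDerivAt_bessel_euler a hz
  have h2 := (hu.const_mul (8 / 3 * (1 - a ^ 2))).add ((hasDerivAt_id z).mul
    ((((hasDerivAt_bessel a hz).const_mul ((1 - a) / 2)).sub hu).const_mul (4 / 3)))
  have h3 := h1.unique (h2.congr_of_eventuallyEq (Eventually.of_forall fun z => ser_pSeq₁ a z))
  rw [div_eq_iff hz] at h3
  rw [h3]
  simp only [id, Pi.sub_apply]
  field_simp
  ring

/-- The Euler derivative of `edge₀`. -/
def edgeDeriv (a σ z : ℝ) : ℝ :=
  edgeConst a * (z ^ a * (z * (ser (pSeq₀ a) z ^ 2 -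
      (a + 1) / 2 * (ser (pSeq₀ a) z * ser (qSeq₀ a) z) -
        ser (euler (pSeq₀ a)) z * ser (qSeq₀ a) z))) +
    σ * (edgeConst a * 2 ^ (1 + a)) * (z ^ ((a + 1) / 2) *
      ((a + 1) / 2 * ser (pSeq₀ a) z + ser (euler (pSeq₀ a)) z))

theorem hasDerivAt_rpow_euler (r : ℝ) {z : ℝ} (hz : 0 < z) :
    HasDerivAt (fun z : ℝ => z ^ r) (r * z ^ r / z) z := by
  refine (Real.hasDerivAt_rpow_const (Or.inl hz.ne')).congr_deriv ?_
  rw [Real.rpow_sub_one hz.ne']; ring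

/-- By Bessel's equation and the equation of q the terms u² and pu cancel in the derivative of the
quadratic part, which leaves the short form `edgeDeriv`. -/
theorem hasDerivAt_edge₀ (ha : -2 < a) (σ : ℝ) {z : ℝ} (hz : 0 < z) :
    HasDerivAt (edge₀ a σ) (edgeDeriv a σ z / z) z := by
  have hp := hasDerivAt_bessel a hz.ne'
  have hu := hasDerivAt_bessel_euler a hz.ne'
  have hq := hasDerivAt_antibessel ha hz.ne'
  have hi := hasDerivAt_id z
  have hS := (((hi.neg.mul (hp.mul hq)).add ((hu.pow 2).const_mul 8)).add
    ((hp.mul hu).const_mul (8 * a))).add (((hi.const_mul 2).sub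
      ((hi.pow 2).const_mul (8 * 0))).mul (hp.pow 2))
  have h := (((hasDerivAt_rpow_euler a hz).mul hS).const_mul (edgeConst a)).add
    (((hasDerivAt_rpow_euler ((a + 1) / 2) hz).mul hp).const_mul
      (σ * (edgeConst a * 2 ^ (1 + a))))
  refine HasDerivAt.congr_deriv (f := edge₀ a σ) h ?_
  rw [edgeDeriv]
  simp only [id, Pi.add_apply, Pi.sub_apply, Pi.mul_apply, Pi.neg_apply, Pi.pow_apply]
  generalize ser (pSeq₀ a) z = p
  generalize ser (euler (pSeq₀ a)) z = u
  generalize ser (qSeq₀ a) z = q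
  generalize z ^ a = A
  generalize z ^ ((a + 1) / 2) = B
  generalize σ * (edgeConst a * 2 ^ (1 + a)) = D
  field_simp
  ring

/-- The heart of part (i). Once p₁, θp₁ and q₁ are written through p, u, q, this is a polynomial
identity, valid separately for the coefficients of z^a and of z^((a+1)/2). Hence it holds for every
σ, and one relation covers both ensembles. -/
theorem hasDerivAt_edgeDeriv (ha : -2 < a) (σ : ℝ) {z : ℝ} (hz : 0 < z) :
    HasDerivAt (edgeDeriv a σ) ((-(3 / 4) * edge₁ a σ z - z * edge₀ a σ z -
      z * edgeDeriv a σ z - 2 * (a ^ 2 - 5) * edgeDeriv a σ z) / 8 / z) z := by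
  have hp := hasDerivAt_bessel a hz.ne'
  have hu := hasDerivAt_bessel_euler a hz.ne'
  have hq := hasDerivAt_antibessel ha hz.ne'
  have hi := hasDerivAt_id z
  have hS := hi.mul (((hp.pow 2).sub ((hp.mul hq).const_mul ((a + 1) / 2))).sub (hu.mul hq))
  have h := (((hasDerivAt_rpow_euler a hz).mul hS).const_mul (edgeConst a)).add
    (((hasDerivAt_rpow_euler ((a + 1) / 2) hz).mul ((hp.const_mul ((a + 1) / 2)).add hu)).const_mul
      (σ * (edgeConst a * 2 ^ (1 + a))))
  refine HasDerivAt.congr_deriv (f := edgeDeriv a σ) h ?_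
  rw [edgeDeriv, edge₀, edge₁, bulkSer₀, bulkSer₁, bulkForm, bulkFormOne, ser_qSeq₁ ha,
    ser_euler_pSeq₁ a hz.ne', ser_pSeq₁]
  simp only [id, Pi.add_apply, Pi.sub_apply, Pi.mul_apply, Pi.pow_apply]
  generalize ser (pSeq₀ a) z = p
  generalize ser (euler (pSeq₀ a)) z = u
  generalize ser (qSeq₀ a) z = q
  generalize z ^ a = A
  generalize z ^ ((a + 1) / 2) = B
  generalize σ * (edgeConst a * 2 ^ (1 + a)) = D
  field_simp
  ring

theorem contDiffOn_rpow (r : ℝ) : ContDiffOn ℝ ∞ (fun z : ℝ => z ^ r) (Ioi 0) := fun _ hz =>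
  (Real.contDiffAt_rpow_const_of_ne (ne_of_gt hz)).contDiffWithinAt

theorem contDiffOn_edge₀ (ha : -2 < a) (σ : ℝ) : ContDiffOn ℝ ∞ (edge₀ a σ) (Ioi 0) := by
  have hp := (pSeq_expansion a).1.contDiff_ser.contDiffOn (s := Ioi 0)
  have hu := (pSeq_expansion a).1.euler.contDiff_ser.contDiffOn (s := Ioi 0)
  have hq := (qSeq_expansion ha).1.contDiff_ser.contDiffOn (s := Ioi 0)
  have h1 := contDiffOn_rpow a
  have h2 := contDiffOn_rpow ((a + 1) / 2)
  unfold edge₀ bulkSer₀ bulkForm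
  fun_prop

theorem contDiffOn_edge₁ (ha : -2 < a) (σ : ℝ) : ContDiffOn ℝ ∞ (edge₁ a σ) (Ioi 0) := by
  have hp := (pSeq_expansion a).1.contDiff_ser.contDiffOn (s := Ioi 0)
  have hu := (pSeq_expansion a).1.euler.contDiff_ser.contDiffOn (s := Ioi 0)
  have hq := (qSeq_expansion ha).1.contDiff_ser.contDiffOn (s := Ioi 0)
  have hp1 := (pSeq_expansion a).2.1.contDiff_ser.contDiffOn (s := Ioi 0)
  have hu1 := (pSeq_expansion a).2.1.euler.contDiff_ser.contDiffOn (s := Ioi 0)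
  have hq1 := (qSeq_expansion ha).2.1.contDiff_ser.contDiffOn (s := Ioi 0)
  have h1 := contDiffOn_rpow a
  have h2 := contDiffOn_rpow ((a + 1) / 2)
  unfold edge₁ bulkSer₀ bulkSer₁ bulkForm bulkFormOne
  fun_prop

end laguerre

/-! ### Part (i): the hard edge density, its limit and its correction. -/

theorem tendstoLocallyUniformlyOn_of_tendsto_prod {F : ℕ → ℝ → ℝ} {f : ℝ → ℝ} {s : Set ℝ}
    (hs : IsOpen s) (hf : ContinuousOn f s)
    (h : ∀ x ∈ s, Tendsto (fun w : ℕ × ℝ => F w.1 w.2) (atTop ×ˢ nhds x) (nhds (f x))) :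
    TendstoLocallyUniformlyOn F f atTop s := by
  rw [hs.tendstoLocallyUniformlyOn_iff_forall_tendsto]
  intro x hx
  have h1 := ((hf.continuousAt (hs.mem_nhds hx)).tendsto.comp
    (tendsto_snd (f := (atTop : Filter ℕ)))).prodMk_nhds (h x hx)
  exact h1.mono_right (nhds_le_uniformity (f x))

/-- The limit of the hard edge density. -/
def hardEdgeLimit (β : ℕ) (a y : ℝ) : ℝ :=
  (if β = 1 then laguerre.edge₀ a 1 (2 * y) else laguerre.edge₀ a 0 (2 * y) / 2) / y

/-- The first correction to the limit of the hard edge density. -/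
def hardEdgeCorrection (β : ℕ) (a y : ℝ) : ℝ :=
  (if β = 1 then laguerre.edge₁ a 1 (2 * y) else laguerre.edge₁ a 0 (2 * y) / 2) / (16 * y)

theorem laguerreExponent_cases {β : ℕ} (hβ : β = 1 ∨ β = 4) {a : ℝ}
    (ha : -1 < laguerreExponent β a) : (β = 1 ∧ -1 < a) ∨ (β = 4 ∧ -2 < a) := by
  rcases hβ with rfl | rfl
  · left; refine ⟨rfl, ?_⟩
    simp only [laguerreExponent, if_true] at ha; linarith
  · right; refine ⟨rfl, ?_⟩
    simp only [laguerreExponent] at ha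
    norm_num at ha; linarith

theorem laguerreExponent_gt {β : ℕ} (hβ : β = 1 ∨ β = 4) {a : ℝ}
    (ha : -1 < laguerreExponent β a) : -2 < a := by
  rcases laguerreExponent_cases hβ ha with h | h <;> linarith [h.2]

theorem contDiffOn_hardEdgeLimit {β : ℕ} (hβ : β = 1 ∨ β = 4) {a : ℝ}
    (ha : -1 < laguerreExponent β a) : ContDiffOn ℝ ∞ (hardEdgeLimit β a) (Ioi 0) := by
  have h2 : ContDiffOn ℝ ∞ (fun y : ℝ => 2 * y) (Ioi 0) := by fun_prop
  have hm : MapsTo (fun y : ℝ => 2 * y) (Ioi 0) (Ioi 0) := fun y (hy : 0 < y) =>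
    show (0 : ℝ) < 2 * y by positivity
  have h := fun σ => (laguerre.contDiffOn_edge₀ (laguerreExponent_gt hβ ha) σ).comp h2 hm
  refine ContDiffOn.div ?_ contDiffOn_id fun y hy => ne_of_gt hy
  split_ifs
  · exact h 1
  · exact (h 0).div_const 2

theorem contDiffOn_hardEdgeCorrection {β : ℕ} (hβ : β = 1 ∨ β = 4) {a : ℝ}
    (ha : -1 < laguerreExponent β a) : ContDiffOn ℝ ∞ (hardEdgeCorrection β a) (Ioi 0) := by
  have h2 : ContDiffOn ℝ ∞ (fun y : ℝ => 2 * y) (Ioi 0) := by fun_prop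
  have hm : MapsTo (fun y : ℝ => 2 * y) (Ioi 0) (Ioi 0) := fun y (hy : 0 < y) =>
    show (0 : ℝ) < 2 * y by positivity
  have h := fun σ => (laguerre.contDiffOn_edge₁ (laguerreExponent_gt hβ ha) σ).comp h2 hm
  refine ContDiffOn.div ?_ (by fun_prop) fun y (hy : 0 < y) => by positivity
  split_ifs
  · exact h 1
  · exact (h 0).div_const 2

/-- Here κ equals N̂, and the scale 4κ² is 1/(16ε), the origin of the factor 16. -/
theorem hardEdgeDensity_one {a : ℝ} (ha : -1 < a) (m : ℕ) {y : ℝ} (hy : 0 < y) :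
    hardEdgeScale 1 a (m + 1 + 1) * (hardEdgeDensity 1 a (m + 1 + 1) y - hardEdgeLimit 1 a y) =
      (laguerre.bulkPart a (m + 1) (2 * y) + 1 * laguerre.extraPart a (m + 1) (2 * y) -
        laguerre.edge₀ a 1 (2 * y)) / laguerre.eps a (m + 1) / (16 * y) := by
  have hκ := laguerre.kap_pos (a := a) (by linarith) m
  have hs : hardEdgeSize 1 a (m + 1 + 1) = laguerre.kap a (m + 1) := by
    simp only [hardEdgeSize, if_true, laguerre.kap]; push_cast; ring
  have h := laguerre.density_one_eq ha m (x := y / (4 * laguerre.kap a (m + 1))) (by positivity)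
  rw [show 8 * laguerre.kap a (m + 1) * (y / (4 * laguerre.kap a (m + 1))) = 2 * y by
    field_simp; ring] at h
  rw [one_mul, ← h, hardEdgeScale, hardEdgeDensity, hs, hardEdgeLimit, laguerre.eps, if_pos rfl]
  rw [Nat.cast_one, Real.sqrt_one]
  generalize laguerre.kap a (m + 1) = κ at *
  field_simp
  ring

/-- Here κ equals 2N̂, so the scale (4N̂)² is again 4κ² = 1/(16ε); the 2 in 32 = 2 · 16 is the one
in `density_four_eq`. -/
theorem hardEdgeDensity_four {a : ℝ} (ha : -2 < a) (N : ℕ) {y : ℝ} (hy : 0 < y) :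
    hardEdgeScale 4 a (N + 1) * (hardEdgeDensity 4 a (N + 1) y - hardEdgeLimit 4 a y) =
      (laguerre.bulkPart a (2 * N + 1 + 1) (2 * y) +
        0 * laguerre.extraPart a (2 * N + 1 + 1) (2 * y) - laguerre.edge₀ a 0 (2 * y)) /
          laguerre.eps a (2 * N + 1 + 1) / (32 * y) := by
  have hκ := laguerre.kap_pos ha (2 * N + 1)
  have hs : hardEdgeSize 4 a (N + 1) = laguerre.kap a (2 * N + 1 + 1) / 2 := by
    simp only [hardEdgeSize, laguerre.kap]; norm_num; ring
  have h := laguerre.density_four_eq ha N (x := y / (2 * laguerre.kap a (2 * N + 1 + 1)))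
    (by positivity)
  rw [show 4 * laguerre.kap a (2 * N + 1 + 1) * (y / (2 * laguerre.kap a (2 * N + 1 + 1))) = 2 * y by
    field_simp; ring] at h
  have h4 : √((4 : ℕ) : ℝ) = 2 := by
    rw [show ((4 : ℕ) : ℝ) = 2 ^ 2 by norm_num, Real.sqrt_sq (by norm_num)]
  rw [zero_mul, add_zero, ← h, hardEdgeScale, hardEdgeDensity, hs, hardEdgeLimit, laguerre.eps,
    if_neg (by norm_num), h4]
  rw [show 4 * (laguerre.kap a (2 * N + 1 + 1) / 2) = 2 * laguerre.kap a (2 * N + 1 + 1) by ring]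
  generalize laguerre.kap a (2 * N + 1 + 1) = κ at *
  field_simp
  ring

theorem isHardEdgeDensityExpansion {β : ℕ} (hβ : β = 1 ∨ β = 4) {a : ℝ}
    (ha : -1 < laguerreExponent β a) :
    IsHardEdgeDensityExpansion β a (hardEdgeLimit β a) (hardEdgeCorrection β a) := by
  -- Local uniformity is obtained by letting N tend to infinity and the argument tend to x
  -- simultaneously; the limit is continuous.
  refine tendstoLocallyUniformlyOn_of_tendsto_prod isOpen_Ioi
    (contDiffOn_hardEdgeCorrection hβ ha).continuousOn fun x (hx : 0 < x) => ?_
  have ha2 := laguerreExponent_gt hβ ha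
  have hfst : Tendsto (fun w : ℕ × ℝ => w.1) (atTop ×ˢ nhds x) atTop := tendsto_fst
  have hsnd : Tendsto (fun w : ℕ × ℝ => w.2) (atTop ×ˢ nhds x) (nhds x) := tendsto_snd
  have h2y := hsnd.const_mul 2
  have hpos := hsnd.eventually (eventually_gt_nhds hx)
  have hx2 : 2 * x ≠ 0 := by positivity
  rcases laguerreExponent_cases hβ ha with ⟨rfl, ha1⟩ | ⟨rfl, -⟩
  · have h := (laguerre.firstOrder_edge ha2 1 ((tendsto_sub_atTop_nat 2).comp hfst) h2y hx2).div
      (hsnd.const_mul 16) (by positivity)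
    rw [hardEdgeCorrection, if_pos rfl]
    refine h.congr' ?_
    filter_upwards [hpos, hfst.eventually_ge_atTop 2] with w hw hw2
    obtain ⟨m, hm⟩ := Nat.exists_eq_add_of_le' hw2
    simp only [Function.comp, Pi.div_apply, hm, Nat.add_sub_cancel]
    exact (hardEdgeDensity_one ha1 m hw).symm
  · have ht : Tendsto (fun w : ℕ × ℝ => 2 * w.1 - 1) (atTop ×ˢ nhds x) atTop :=
      ((tendsto_sub_atTop_nat 1).comp (tendsto_id.const_mul_atTop' (by norm_num))).comp hfst
    have h := (laguerre.firstOrder_edge ha2 0 ht h2y hx2).div (hsnd.const_mul 32) (by positivity)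
    rw [hardEdgeCorrection, if_neg (by norm_num), div_div,
      show 2 * (16 * x) = 32 * x by ring]
    refine h.congr' ?_
    filter_upwards [hpos, hfst.eventually_ge_atTop 1] with w hw hw2
    obtain ⟨m, hm⟩ := Nat.exists_eq_add_of_le' hw2
    simp only [Pi.div_apply, hm]
    rw [show 2 * (m + 1) - 1 = 2 * m + 1 by omega]
    exact (hardEdgeDensity_four ha2 m hw).symm

/-- As t r₀(t/2) = 2c · `edge₀` at t, each application of `opD` is an ordinary derivative of a
function already known, and the claim reduces to `hasDerivAt_edgeDeriv`. -/
theorem edge_relation {a : ℝ} (ha : -2 < a) (σ c : ℝ) {r₀ r₁ : ℝ → ℝ}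
    (h0 : ∀ y, 0 < y → r₀ y = c * laguerre.edge₀ a σ (2 * y) / y)
    (h1 : ∀ y, 0 < y → r₁ y = c * laguerre.edge₁ a σ (2 * y) / (16 * y)) {y : ℝ} (hy : 0 < y) :
    r₁ (y / 2) = -(1 / 12) * (8 * opD (opD (fun t => r₀ (t / 2))) y +
      opD (fun t => t * r₀ (t / 2)) y + 2 * (a ^ 2 - 5) * opD (fun t => r₀ (t / 2)) y) := by
  have e0 : ∀ t, 0 < t → t * r₀ (t / 2) = 2 * c * laguerre.edge₀ a σ t := fun t ht => by
    rw [h0 _ (by positivity), mul_div_cancel₀ t two_ne_zero]; field_simp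
  have d0 : ∀ t, 0 < t → opD (fun t => r₀ (t / 2)) t =
      2 * c * (laguerre.edgeDeriv a σ t / t) := fun t ht => by
    refine HasDerivAt.deriv (HasDerivAt.congr_of_eventuallyEq
      ((laguerre.hasDerivAt_edge₀ ha σ ht).const_mul (2 * c)) ?_)
    filter_upwards [eventually_gt_nhds ht] with s hs using e0 s hs
  have d1 := HasDerivAt.deriv (HasDerivAt.congr_of_eventuallyEq
      (f₁ := fun t => t * opD (fun t => r₀ (t / 2)) t)
      ((laguerre.hasDerivAt_edgeDeriv ha σ hy).const_mul (2 * c)) (by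
    filter_upwards [eventually_gt_nhds hy] with s hs
    rw [d0 s hs]; field_simp))
  have d2 := HasDerivAt.deriv (HasDerivAt.congr_of_eventuallyEq
      (f₁ := fun t => t * (t * r₀ (t / 2)))
      (((hasDerivAt_id y).mul (laguerre.hasDerivAt_edge₀ ha σ hy)).const_mul (2 * c)) (by
    filter_upwards [eventually_gt_nhds hy] with s hs
    rw [e0 s hs]; simp only [Pi.mul_apply, id]; ring))
  rw [opD, d1, opD, d2, d0 y hy, h1 _ (by positivity), mul_div_cancel₀ y two_ne_zero]
  simp only [id]
  field_simp
  ring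

theorem hardEdgeCorrection_eq {β : ℕ} (hβ : β = 1 ∨ β = 4) {a : ℝ}
    (ha : -1 < laguerreExponent β a) {y : ℝ} (hy : 0 < y) :
    hardEdgeCorrection β a (y / 2) = -(1 / 12) *
      (8 * opD (opD (fun t => hardEdgeLimit β a (t / 2))) y +
        opD (fun t => t * hardEdgeLimit β a (t / 2)) y +
        2 * (a ^ 2 - 5) * opD (fun t => hardEdgeLimit β a (t / 2)) y) := by
  have ha2 := laguerreExponent_gt hβ ha
  rcases hβ with rfl | rfl
  · exact edge_relation ha2 1 1 (fun y _ => by rw [hardEdgeLimit, if_pos rfl, one_mul])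
      (fun y _ => by rw [hardEdgeCorrection, if_pos rfl, one_mul]) hy
  · exact edge_relation ha2 0 (1 / 2)
      (fun y _ => by rw [hardEdgeLimit, if_neg (by norm_num)]; ring)
      (fun y _ => by rw [hardEdgeCorrection, if_neg (by norm_num)]; ring) hy

/-! ### Growth conditions excluding first order equations with polynomial coefficients. -/

section growth
variable {F D : ℝ → ℝ} {x₀ : ℝ}

/-- `D` is the Euler derivative xF'. Integrating F' ≥ x^(n+1) leaves enough surplus to absorb the
constant of integration. -/
theorem pow_le_of_pow_le_euler (hF : ∀ x, 0 < x → HasDerivAt F (D x / x) x) (n : ℕ)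
    (hD : ∀ᶠ x in atTop, x ^ (n + 2) ≤ D x) : ∀ᶠ x in atTop, x ^ n ≤ F x := by
  obtain ⟨x₀, h0⟩ := eventually_atTop.1 (hD.and (eventually_gt_atTop 0))
  have hmono : MonotoneOn (fun x => F x - x ^ (n + 2) / (n + 2)) (Ici x₀) := by
    have hd : ∀ x, x₀ ≤ x → HasDerivAt (fun x => F x - x ^ (n + 2) / (n + 2))
        (D x / x - x ^ (n + 1)) x := fun x hx => by
      have := (hF x (h0 x hx).2).sub ((hasDerivAt_pow (n + 2) x).div_const ((n : ℝ) + 2))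
      refine this.congr_deriv ?_
      have : (n : ℝ) + 2 ≠ 0 := by positivity
      push_cast; field_simp; try rfl
    refine monotoneOn_of_deriv_nonneg (convex_Ici _)
      (fun x hx => (hd x hx).continuousAt.continuousWithinAt)
      (fun x hx => (hd x (interior_subset hx)).differentiableAt.differentiableWithinAt)
      fun x hx => ?_
    have hx' := interior_subset hx
    rw [(hd x hx').deriv, sub_nonneg, le_div_iff₀ (h0 x hx').2]
    exact (pow_succ x (n + 1)).symm.trans_le (h0 x hx').1
  filter_upwards [eventually_ge_atTop x₀, eventually_ge_atTop (2 * (n : ℝ) + 4),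
    eventually_ge_atTop (|x₀ ^ (n + 2) / (n + 2) - F x₀|)] with x hx hx4 hxl
  have h1 := hmono self_mem_Ici hx hx
  simp only at h1
  have hn : (0 : ℝ) ≤ n := n.cast_nonneg
  have hxp : 1 ≤ x ^ n := one_le_pow₀ (by linarith)
  have h2 : 2 * x * x ^ n ≤ x ^ (n + 2) / (n + 2) := by
    rw [le_div_iff₀ (by positivity), pow_add]
    have : 2 * x * (n + 2) ≤ x ^ 2 := by nlinarith
    nlinarith
  have h3 := le_abs_self (x₀ ^ (n + 2) / (n + 2) - F x₀)
  nlinarith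

/-- Under the hypothesis F/x^k does not increase. -/
theorem le_pow_of_euler_le (hF : ∀ x, 0 < x → HasDerivAt F (D x / x) x) (h0 : 0 < x₀) {k : ℕ}
    (h : ∀ x, x₀ ≤ x → D x ≤ k * F x) {x : ℝ} (hx : x₀ ≤ x) :
    F x ≤ F x₀ / x₀ ^ k * x ^ k := by
  have hd : ∀ x, x₀ ≤ x → HasDerivAt (fun x => F x / x ^ k)
      ((D x - k * F x) / (x * x ^ k)) x := fun x hx => by
    have hx0 : 0 < x := h0.trans_le hx
    refine ((hF x hx0).div (hasDerivAt_pow k x) (by positivity)).congr_deriv ?_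
    rcases k with _ | k
    · simp
    · rw [Nat.add_sub_cancel]; field_simp; ring
  have hmono : AntitoneOn (fun x => F x / x ^ k) (Ici x₀) := by
    refine antitoneOn_of_deriv_nonpos (convex_Ici _)
      (fun x hx => (hd x hx).continuousAt.continuousWithinAt)
      (fun x hx => (hd x (interior_subset hx)).differentiableAt.differentiableWithinAt)
      fun x hx => ?_
    have hx' := interior_subset hx
    have hx0 : 0 < x := h0.trans_le hx'
    rw [(hd x hx').deriv]
    exact div_nonpos_of_nonpos_of_nonneg (sub_nonpos.2 (h x hx')) (by positivity)
  have h1 := hmono self_mem_Ici hx hx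
  have hx0 : 0 < x := h0.trans_le hx
  simp only at h1
  rwa [div_le_iff₀ (by positivity)] at h1

/-- Under the hypothesis F e^(-rx) does not decrease. -/
theorem exp_le_of_le_euler (hF : ∀ x, 0 < x → HasDerivAt F (D x / x) x) (h0 : 0 < x₀) {r : ℝ}
    (h : ∀ x, x₀ ≤ x → r * x * F x ≤ D x) {x : ℝ} (hx : x₀ ≤ x) :
    F x₀ * Real.exp (-r * x₀) * Real.exp (r * x) ≤ F x := by
  have hd : ∀ x, x₀ ≤ x → HasDerivAt (fun x => F x * Real.exp (-r * x))
      ((D x - r * x * F x) / x * Real.exp (-r * x)) x := fun x hx => by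
    have hx0 : 0 < x := h0.trans_le hx
    have he : HasDerivAt (fun x => Real.exp (-r * x)) (Real.exp (-r * x) * -r) x := by
      simpa using ((hasDerivAt_id x).const_mul (-r)).exp
    refine ((hF x hx0).mul he).congr_deriv ?_
    field_simp; try ring
  have hmono : MonotoneOn (fun x => F x * Real.exp (-r * x)) (Ici x₀) := by
    refine monotoneOn_of_deriv_nonneg (convex_Ici _)
      (fun x hx => (hd x hx).continuousAt.continuousWithinAt)
      (fun x hx => (hd x (interior_subset hx)).differentiableAt.differentiableWithinAt)
      fun x hx => ?_
    have hx' := interior_subset hx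
    have hx0 : 0 < x := h0.trans_le hx'
    rw [(hd x hx').deriv]
    have := sub_nonneg.2 (h x hx')
    positivity
  have h1 := mul_le_mul_of_nonneg_right (hmono self_mem_Ici hx hx) (Real.exp_pos (r * x)).le
  rwa [mul_assoc (F x), ← Real.exp_add, show -r * x + r * x = 0 by ring, Real.exp_zero,
    mul_one] at h1

theorem Polynomial.eventually_abs_le {P Q : Polynomial ℝ} (h : P.degree ≤ Q.degree) :
    ∃ M : ℝ, 0 ≤ M ∧ ∀ᶠ x in atTop, |P.eval x| ≤ M * |Q.eval x| := by
  obtain ⟨M, hM, h⟩ := (Polynomial.isBigO_atTop_of_degree_le P Q h).exists_nonneg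
  exact ⟨M, hM, h.bound⟩

/-- An eventually increasing function satisfies no first order linear differential equation with
polynomial coefficients if it grows faster than every polynomial and slower than every
exponential function. -/
theorem eq_zero_of_intermediate_growth
    (hF : ∀ x, 0 < x → HasDerivAt F (D x / x) x)
    (hD : ∀ n : ℕ, ∀ᶠ x in atTop, x ^ n ≤ D x)
    (hexp : ∀ δ : ℝ, 0 < δ → ∃ C, ∀ᶠ x in atTop, F x ≤ C * Real.exp (δ * x))
    {A B : Polynomial ℝ} {c : ℝ}
    (h : ∀ᶠ x in atTop, A.eval x * D x + B.eval x * F x = c * x ^ 2) : A = 0 ∧ B = 0 := by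
  have hFn : ∀ n : ℕ, ∀ᶠ x in atTop, x ^ n ≤ F x := fun n =>
    pow_le_of_pow_le_euler hF n (hD (n + 2))
  have hbig : ∀ (k : ℕ) (C : ℝ), ¬ ∀ᶠ x in atTop, F x ≤ C * x ^ k := fun k C hk => by
    obtain ⟨x, h1, h2, h3, h4⟩ := (hk.and ((hFn (k + 1)).and
      ((eventually_gt_atTop C).and (eventually_gt_atTop 0)))).exists
    have := pow_pos h4 k
    rw [pow_succ] at h2
    nlinarith
  have hone : ∀ {P : Polynomial ℝ}, P ≠ 0 → ∃ M : ℝ, 0 ≤ M ∧ ∀ᶠ x in atTop, 1 ≤ M * |P.eval x| :=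
    fun {P} hP => by
      obtain ⟨M, hM, h⟩ := Polynomial.eventually_abs_le (P := 1) (Q := P)
        (by rw [Polynomial.degree_one]; exact Polynomial.zero_le_degree_iff.2 hP)
      exact ⟨M, hM, by simpa using h⟩
  have hA : A = 0 := by
    by_contra hA
    obtain ⟨m, hm, hAm⟩ := hone hA
    -- If deg B ≤ deg A, the equation bounds D by a multiple of F, so F grows at most polynomially.
    -- Otherwise it bounds xF by a multiple of D, so F grows at least exponentially. Both are
    -- excluded.
    rcases le_or_gt B.degree A.degree with hdeg | hdeg
    · obtain ⟨M, hM, hB⟩ := Polynomial.eventually_abs_le hdeg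
      obtain ⟨k, hk⟩ := exists_nat_ge (m * |c| + M)
      obtain ⟨x₀, h0⟩ := eventually_atTop.1 (h.and (hAm.and (hB.and ((hFn 2).and
        ((hD 2).and (eventually_gt_atTop 0))))))
      have hx0 := (h0 x₀ le_rfl).2.2.2.2.2
      refine hbig k _ (eventually_atTop.2 ⟨x₀, fun x hx => le_pow_of_euler_le hF hx0 (k := k)
        (fun x hx => ?_) hx⟩)
      obtain ⟨e1, e2, e3, e4, e5, e6⟩ := h0 x hx
      have hx2 : 0 < x ^ 2 := by positivity
      have hF0 : 0 ≤ F x := hx2.le.trans e4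
      have hApos : 0 < |A.eval x| := by
        by_contra hneg
        have : |A.eval x| = 0 := le_antisymm (not_lt.1 hneg) (abs_nonneg _)
        rw [this] at e2; linarith
      have e7 : |A.eval x| * D x ≤ |A.eval x| * (k * F x) := by
        calc |A.eval x| * D x = |c * x ^ 2 - B.eval x * F x| := by
              rw [← e1, add_sub_cancel_right, abs_mul, abs_of_nonneg (hx2.le.trans e5)]
          _ ≤ |c| * x ^ 2 + |B.eval x| * F x := by
              refine (abs_sub _ _).trans_eq ?_
              rw [abs_mul, abs_mul, abs_of_pos hx2, abs_of_nonneg hF0]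
          _ ≤ |c| * (m * |A.eval x| * F x) + M * |A.eval x| * F x := by
              refine add_le_add (mul_le_mul_of_nonneg_left ?_ (abs_nonneg c))
                (mul_le_mul_of_nonneg_right e3 hF0)
              nlinarith
          _ = |A.eval x| * ((m * |c| + M) * F x) := by ring
          _ ≤ _ := by gcongr
      exact le_of_mul_le_mul_left e7 hApos
    · have hdeg' : (Polynomial.X * A).degree ≤ B.degree := by
        rw [Polynomial.degree_mul, Polynomial.degree_X, add_comm]
        have hB : B ≠ 0 := by rintro rfl; simp at hdeg
        rw [Polynomial.degree_eq_natDegree hA, Polynomial.degree_eq_natDegree hB] at hdeg ⊢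
        exact_mod_cast hdeg
      obtain ⟨M, hM, hB⟩ := Polynomial.eventually_abs_le hdeg'
      set K := M * m * |c| + M + 1 with hK
      have hKpos : 0 < K := by positivity
      obtain ⟨C, hC⟩ := hexp (1 / (2 * K)) (by positivity)
      obtain ⟨x₀, h0⟩ := eventually_atTop.1 (h.and (hAm.and (hB.and ((hFn 2).and
        ((hD 2).and (eventually_gt_atTop 0))))))
      have hx0 := (h0 x₀ le_rfl).2.2.2.2.2
      have key : ∀ x, x₀ ≤ x → 1 / K * x * F x ≤ D x := by
        intro x hx
        obtain ⟨e1, e2, e3, e4, e5, e6⟩ := h0 x hx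
        have hx2 : 0 < x ^ 2 := by positivity
        have hF0 : 0 ≤ F x := hx2.le.trans e4
        have hD0 : 0 ≤ D x := hx2.le.trans e5
        have hApos : 0 < |A.eval x| := by
          by_contra hneg
          have : |A.eval x| = 0 := le_antisymm (not_lt.1 hneg) (abs_nonneg _)
          rw [this] at e2; linarith
        rw [Polynomial.eval_mul, Polynomial.eval_X, abs_mul, abs_of_pos e6] at e3
        have e7 : |A.eval x| * (x * F x) ≤ |A.eval x| * (K * D x) := by
          calc |A.eval x| * (x * F x) = x * |A.eval x| * F x := by ring
            _ ≤ M * |B.eval x| * F x := mul_le_mul_of_nonneg_right e3 hF0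
            _ = M * |c * x ^ 2 - A.eval x * D x| := by
                rw [← e1, add_sub_cancel_left, abs_mul, abs_of_nonneg hF0]; ring
            _ ≤ M * (|c| * x ^ 2 + |A.eval x| * D x) := by
                refine mul_le_mul_of_nonneg_left ((abs_sub _ _).trans_eq ?_) hM
                rw [abs_mul, abs_mul, abs_of_pos hx2, abs_of_nonneg hD0]
            _ ≤ M * (|c| * (m * |A.eval x| * D x) + |A.eval x| * D x) := by
                refine mul_le_mul_of_nonneg_left (add_le_add_left
                  (mul_le_mul_of_nonneg_left ?_ (abs_nonneg c)) _) hM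
                nlinarith
            _ = |A.eval x| * ((M * m * |c| + M) * D x) := by ring
            _ ≤ _ := by
                refine mul_le_mul_of_nonneg_left (mul_le_mul_of_nonneg_right ?_ hD0) hApos.le
                linarith
        have e8 := le_of_mul_le_mul_left e7 hApos
        rw [mul_assoc, one_div, inv_mul_le_iff₀ hKpos]
        exact e8
      set c₀ := F x₀ * Real.exp (-(1 / K) * x₀) with hc₀
      have hc0 : 0 < c₀ := by
        have := (h0 x₀ le_rfl).2.2.2.1
        have : 0 < F x₀ := (by positivity : (0 : ℝ) < x₀ ^ 2).trans_le this
        positivity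
      have htend : Tendsto (fun x => Real.exp (1 / (2 * K) * x)) atTop atTop :=
        Real.tendsto_exp_atTop.comp (tendsto_id.const_mul_atTop (by positivity))
      obtain ⟨x, hx1, hx2, hx3⟩ := (hC.and ((eventually_ge_atTop x₀).and
        (htend.eventually_gt_atTop (C / c₀)))).exists
      have h1 := (exp_le_of_le_euler hF hx0 key hx2).trans hx1
      rw [← hc₀, show 1 / K * x = 1 / (2 * K) * x + 1 / (2 * K) * x by field_simp; ring,
        Real.exp_add, ← mul_assoc] at h1
      have h2 := le_of_mul_le_mul_right h1 (Real.exp_pos _)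
      rw [div_lt_iff₀' hc0] at hx3
      linarith
  refine ⟨hA, ?_⟩
  by_contra hB
  obtain ⟨m, hm, hBm⟩ := hone hB
  refine hbig 2 (m * |c|) ?_
  filter_upwards [h, hBm, hFn 0] with x e1 e2 e3
  rw [hA, Polynomial.eval_zero, zero_mul, zero_add] at e1
  rw [pow_zero] at e3
  calc F x ≤ m * |B.eval x| * F x := by nlinarith
    _ = m * |c * x ^ 2| := by rw [← e1, abs_mul, abs_of_nonneg (a := F x) (by linarith)]; ring
    _ = _ := by rw [abs_mul, abs_of_nonneg (sq_nonneg x)]; ring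
end growth

/-- Growth slower than every exponential function. -/
def Subexponential (F : ℝ → ℝ) : Prop :=
  ∀ δ : ℝ, 0 < δ → F =O[atTop] fun x => Real.exp (δ * x)

namespace Subexponential
variable {F G : ℝ → ℝ}

theorem add (hF : Subexponential F) (hG : Subexponential G) :
    Subexponential fun x => F x + G x := fun δ hδ => (hF δ hδ).add (hG δ hδ)

theorem mul (hF : Subexponential F) (hG : Subexponential G) :
    Subexponential fun x => F x * G x := fun δ hδ => by
  refine ((hF (δ / 2) (by positivity)).mul (hG (δ / 2) (by positivity))).congr_right fun x => ?_
  rw [← Real.exp_add]; ring_nf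

theorem rpow (s : ℝ) : Subexponential fun x => x ^ s := fun _ hδ =>
  (isLittleO_rpow_exp_pos_mul_atTop s hδ).isBigO

theorem id : Subexponential fun x => x := by simpa using rpow 1

theorem const (c : ℝ) : Subexponential fun _ => c := by
  have h := rpow 0
  simp only [Real.rpow_zero] at h
  exact fun δ hδ => by simpa using (h δ hδ).const_mul_left c

/-- The spare factorial allows a comparison, term by term, with the exponential series of δx for
every δ > 0. -/
theorem ser_neg {f : ℕ → ℝ} (hf : IsEntire fun k => k.factorial * f k) :
    Subexponential fun x => ser f (-x) := fun δ hδ => by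
  set S := ∑' k, |k.factorial * f k| * δ⁻¹ ^ k with hS
  refine Asymptotics.IsBigO.of_bound S ?_
  filter_upwards [eventually_ge_atTop 0] with x hx
  have hexp : HasSum (fun k : ℕ => (δ * x) ^ k / (k.factorial : ℝ)) (Real.exp (δ * x)) := by
    rw [Real.exp_eq_exp_ℝ]; exact NormedSpace.expSeries_div_hasSum_exp (δ * x)
  rw [Real.norm_of_nonneg (Real.exp_pos _).le]
  refine tsum_of_norm_bounded (E := ℝ) (hexp.mul_left S) fun k => ?_
  have h1 : |k.factorial * f k| * δ⁻¹ ^ k ≤ S :=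
    (hf δ⁻¹ (by positivity)).le_tsum k fun j _ => by positivity
  have hk : (0 : ℝ) < k.factorial := by exact_mod_cast k.factorial_pos
  rw [Real.norm_eq_abs, abs_mul, abs_pow, abs_neg, abs_of_nonneg hx]
  calc |f k| * x ^ k = |k.factorial * f k| * δ⁻¹ ^ k * ((δ * x) ^ k / k.factorial) := by
        rw [abs_mul, abs_of_pos hk, mul_pow, inv_pow]; field_simp
    _ ≤ _ := mul_le_mul_of_nonneg_right h1 (by positivity)

end Subexponential

theorem ser_neg_arg (f : ℕ → ℝ) (x : ℝ) : ser f (-x) = ser (fun k => (-1) ^ k * f k) x := by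
  rw [ser, ser]
  exact tsum_congr fun k => by rw [neg_pow]; ring

/-- The variance of a positive sequence dominates its second moment. -/
theorem exists_variance_bound {v : ℕ → ℝ} (hv : ∀ k, 0 < v k) (he : IsEntire v) (r : ℝ) (n : ℕ) :
    ∃ c, 0 < c ∧ ∀ x, 1 ≤ x → c * x ^ n * ser (fun k => (k + r) ^ 2 * v k) x ≤
      ser (fun k => (k + r) ^ 2 * v k) x * ser v x - ser (fun k => (k + r) * v k) x ^ 2 := by
  -- From (k+r)² ≤ 2(k-n)² + 2(n+r)² and (k-n)² + (k-n-1)² ≥ 1/2 this `C` gives (k+r)² ≤ C((k-n)² +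
  -- (k-n-1)²).
  set C := 2 + 4 * (n + r) ^ 2 with hC
  have hCpos : 0 < C := by positivity
  set v₀ := min (v n) (v (n + 1)) with hv₀
  have hv0 : 0 < v₀ := lt_min (hv _) (hv _)
  refine ⟨v₀ / C / 2, by positivity, fun x hx => ?_⟩
  have hx0 : 0 < x := by linarith
  have e1 : IsEntire fun k => (k + r) * v k := by
    have := he.euler.add (he.const_mul r)
    refine this.mono fun k => ?_
    rw [euler, ← add_mul]
  have e2 : IsEntire fun k => (k + r) ^ 2 * v k := by
    have := e1.euler.add (e1.const_mul r)
    refine this.mono fun k => le_of_eq ?_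
    congr 1
    simp only [euler]; ring
  set Q := ser v x with hQ
  set P := ser (fun k => (k + r) * v k) x with hP
  set R := ser (fun k => (k + r) ^ 2 * v k) x with hR
  have sQ : HasSum _ Q := (he.summable x).hasSum
  have sP : HasSum _ P := (e1.summable x).hasSum
  have sR : HasSum _ R := (e2.summable x).hasSum
  have hh : ∀ t : ℝ, HasSum (fun k : ℕ => (k + r - t) ^ 2 * (v k * x ^ k))
      (R - 2 * t * P + t ^ 2 * Q) := fun t => by
    refine ((sR.sub (sP.mul_left (2 * t))).add (sQ.mul_left (t ^ 2))).congr_fun ?_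
    intro k; ring
  have hpos : ∀ k, 0 < v k * x ^ k := fun k => mul_pos (hv k) (by positivity)
  have hnn : ∀ t : ℝ, 0 ≤ R - 2 * t * P + t ^ 2 * Q := fun t =>
    (hh t).nonneg fun k => mul_nonneg (sq_nonneg _) (hpos k).le
  -- The symmetric form of the variance: the double sum of (k-j)² v_j v_k x^(j+k).
  have htot : HasSum (fun j : ℕ => (v j * x ^ j) * (R - 2 * (j + r) * P + (j + r) ^ 2 * Q))
      (2 * (R * Q - P ^ 2)) := by
    have := ((sQ.mul_left R).sub (sP.mul_left (2 * P))).add (sR.mul_left Q)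
    rw [show R * Q - 2 * P * P + Q * R = 2 * (R * Q - P ^ 2) by ring] at this
    refine this.congr_fun fun k => ?_
    ring
  -- Two neighbouring centres are kept, because the single centre j = n would lose the term k = n.
  have hlow := sum_le_hasSum {n, n + 1} (fun j _ => mul_nonneg (hpos j).le (hnn (j + r))) htot
  rw [Finset.sum_pair (by omega)] at hlow
  have hsum : R / C ≤ (R - 2 * (n + r) * P + (n + r) ^ 2 * Q) +
      (R - 2 * ((n + 1 : ℕ) + r) * P + ((n + 1 : ℕ) + r) ^ 2 * Q) := by
    rw [div_le_iff₀ hCpos]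
    refine hasSum_le (fun k => ?_) sR (((hh (n + r)).add (hh ((n + 1 : ℕ) + r))).mul_right C)
    have hs : (1 : ℝ) / 2 ≤ (k - n : ℝ) ^ 2 + (k - n - 1 : ℝ) ^ 2 := by
      nlinarith [sq_nonneg (2 * (k - n : ℝ) - 1)]
    have e : (k + r : ℝ) ^ 2 ≤ 2 * (k - n : ℝ) ^ 2 + 2 * (n + r) ^ 2 := by
      nlinarith [sq_nonneg ((k - n : ℝ) - (n + r))]
    have e' : (k + r : ℝ) ^ 2 ≤ ((k - n : ℝ) ^ 2 + (k - n - 1 : ℝ) ^ 2) * C := by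
      rw [hC]
      nlinarith [sq_nonneg (n + r : ℝ), sq_nonneg (k - n - 1 : ℝ),
        mul_nonneg (sq_nonneg (n + r : ℝ)) (sub_nonneg.2 hs)]
    calc (k + r : ℝ) ^ 2 * v k * x ^ k = (k + r) ^ 2 * (v k * x ^ k) := by ring
      _ ≤ ((k - n : ℝ) ^ 2 + (k - n - 1 : ℝ) ^ 2) * C * (v k * x ^ k) :=
        mul_le_mul_of_nonneg_right e' (hpos k).le
      _ = _ := by push_cast; ring
  have hm : ∀ j, n ≤ j → v₀ ≤ v j → v₀ * x ^ n ≤ v j * x ^ j := fun j hj hvj =>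
    mul_le_mul hvj (pow_le_pow_right₀ hx hj) (by positivity) (hv j).le
  have h1 := mul_le_mul_of_nonneg_right (hm n le_rfl (min_le_left _ _)) (hnn (n + r))
  have h2 := mul_le_mul_of_nonneg_right (hm (n + 1) (Nat.le_succ n) (min_le_right _ _))
    (hnn ((n + 1 : ℕ) + r))
  have h3 := mul_le_mul_of_nonneg_left hsum (show 0 ≤ v₀ * x ^ n by positivity)
  have e3 : v₀ / C / 2 * x ^ n * R = v₀ * x ^ n * (R / C) / 2 := by ring
  rw [e3]
  linarith

/-! ### The edge density on the negative axis. -/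

namespace laguerre
variable {a : ℝ}

theorem rGamma_pos {k : ℕ} (h : 0 < (k : ℝ) + a + 1) : 0 < rGamma a k :=
  inv_pos.2 (Real.Gamma_pos_of_pos h)

/-- The absolute values of the coefficients `qSeq₀`. -/
def vSeq (a : ℝ) (k : ℕ) : ℝ := (-1) ^ k * qSeq₀ a k

/-- The only alternating factor of `qSeq₀` is (-1/4)^k; for k ≥ 1 the number k + (a+1)/2 is positive
since a > -2. -/
theorem vSeq_pos (ha : -2 < a) (k : ℕ) : 0 < vSeq a k := by
  rcases k with _ | k
  · have := rGamma_pos (a := a) (k := 1) (by push_cast; linarith)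
    simp [vSeq, qSeq₀, recipSeq, this]
  · have hk : (0 : ℝ) ≤ k := k.cast_nonneg
    have h1 := rGamma_pos (a := a) (k := k + 1) (by push_cast; linarith)
    have h2 : (0 : ℝ) < ((k + 1 : ℕ) : ℝ) + (a + 1) / 2 := by push_cast; linarith
    have h3 : (0 : ℝ) < (k + 1).factorial := by exact_mod_cast (k + 1).factorial_pos
    rw [vSeq, qSeq₀, if_neg (Nat.succ_ne_zero k), recipSeq, if_neg (Nat.succ_ne_zero k), zero_add,
      pSeq₀, bSeq₀]
    have h4 : (-1 : ℝ) ^ (k + 1) * (((k + 1 : ℕ) + (a + 1) / 2)⁻¹ *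
        ((-(1 / 4)) ^ (k + 1) / ((k + 1).factorial : ℝ) * rGamma a (k + 1))) =
        ((k + 1 : ℕ) + (a + 1) / 2)⁻¹ *
        ((1 / 4) ^ (k + 1) / ((k + 1).factorial : ℝ) * rGamma a (k + 1)) := by
      rw [neg_pow (1 / 4 : ℝ)]
      have : (-1 : ℝ) ^ (k + 1) * (-1) ^ (k + 1) = 1 := by rw [← mul_pow]; norm_num
      linear_combination ((((k + 1 : ℕ) : ℝ) + (a + 1) / 2)⁻¹ *
        ((1 / 4) ^ (k + 1) / ((k + 1).factorial : ℝ) * rGamma a (k + 1))) * this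
    rw [h4]
    positivity

theorem isEntire_vSeq (ha : -2 < a) : IsEntire (vSeq a) :=
  (qSeq_expansion ha).1.mono fun k => by rw [vSeq, abs_mul, abs_pow]; simp

theorem ser_qSeq₀_neg (x : ℝ) : ser (qSeq₀ a) (-x) = ser (vSeq a) x := ser_neg_arg _ x

theorem ser_pSeq₀_neg (ha : -2 < a) (x : ℝ) :
    ser (pSeq₀ a) (-x) = ser (fun k => (k + (a + 1) / 2) * vSeq a k) x := by
  rw [ser_neg_arg]
  refine congrArg (ser · x) (funext fun k => ?_)
  rw [← qSeq₀_rel ha, vSeq, euler]; ring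

theorem ser_pSeq₀_euler_neg (ha : -2 < a) (x : ℝ) :
    (a + 1) / 2 * ser (pSeq₀ a) (-x) + ser (euler (pSeq₀ a)) (-x) =
      ser (fun k => (k + (a + 1) / 2) ^ 2 * vSeq a k) x := by
  have hp := (pSeq_expansion a).1
  rw [← ser_const_mul, ← (hp.const_mul _).ser_add hp.euler, ser_neg_arg]
  refine congrArg (ser · x) (funext fun k => ?_)
  rw [euler, ← qSeq₀_rel ha, vSeq, euler]; ring

/-- The analytic continuation of the edge density to the negative axis, up to phases. -/
def negEdge (a K x : ℝ) : ℝ :=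
  x ^ a * bulkSer₀ a (-x) + K * (x ^ ((a + 1) / 2) * ser (pSeq₀ a) (-x))

/-- The Euler derivative of `negEdge`. -/
def negEdgeDeriv (a K x : ℝ) : ℝ :=
  x ^ a * (x * (((a + 1) / 2 * ser (pSeq₀ a) (-x) + ser (euler (pSeq₀ a)) (-x)) *
      ser (qSeq₀ a) (-x) - ser (pSeq₀ a) (-x) ^ 2)) +
    K * (x ^ ((a + 1) / 2) * ((a + 1) / 2 * ser (pSeq₀ a) (-x) + ser (euler (pSeq₀ a)) (-x)))

theorem hasDerivAt_negEdge (ha : -2 < a) (K : ℝ) {x : ℝ} (hx : 0 < x) :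
    HasDerivAt (negEdge a K) (negEdgeDeriv a K x / x) x := by
  have hz : -x ≠ 0 := by linarith
  have hi := (hasDerivAt_id x).neg
  have hp := (hasDerivAt_bessel a hz).comp x hi
  have hu := (hasDerivAt_bessel_euler a hz).comp x hi
  have hq := (hasDerivAt_antibessel ha hz).comp x hi
  have hS := (((hi.neg.mul (hp.mul hq)).add ((hu.pow 2).const_mul 8)).add
    ((hp.mul hu).const_mul (8 * a))).add (((hi.const_mul 2).sub
      ((hi.pow 2).const_mul (8 * 0))).mul (hp.pow 2))
  have h := ((hasDerivAt_rpow_euler a hx).mul hS).add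
    (((hasDerivAt_rpow_euler ((a + 1) / 2) hx).mul hp).const_mul K)
  refine HasDerivAt.congr_deriv (f := negEdge a K) h ?_
  rw [negEdgeDeriv]
  simp only [id, Pi.add_apply, Pi.sub_apply, Pi.mul_apply, Pi.neg_apply, Pi.pow_apply,
    Function.comp]
  generalize ser (pSeq₀ a) (-x) = p
  generalize ser (euler (pSeq₀ a)) (-x) = u
  generalize ser (qSeq₀ a) (-x) = q
  generalize x ^ a = A
  generalize x ^ ((a + 1) / 2) = B
  field_simp
  ring

/-- At -x the functions q, p and (a+1)p/2 + u are the moments of order 0, 1, 2 of a positive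
sequence, and the quadratic part is their Cauchy-Schwarz defect. By `exists_variance_bound` it
exceeds every power of x times the second moment, which also dominates the linear term, whatever the
sign of K. -/
theorem pow_le_negEdgeDeriv (ha : -2 < a) (K : ℝ) (n : ℕ) :
    ∀ᶠ x in atTop, x ^ n ≤ negEdgeDeriv a K x := by
  obtain ⟨c, hc, h⟩ := exists_variance_bound (vSeq_pos ha) (isEntire_vSeq ha) ((a + 1) / 2) (n + 2)
  set r := (1 + (a + 1) / 2) ^ 2 * vSeq a 1 with hr
  have hrpos : 0 < r := mul_pos (pow_pos (by linarith) 2) (vSeq_pos ha 1)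
  filter_upwards [eventually_ge_atTop 1, eventually_ge_atTop ((|K| + 1 / r) / c)] with x hx hxc
  have hx0 : 0 < x := by linarith
  have h1 := h x hx
  rw [negEdgeDeriv, ser_pSeq₀_euler_neg ha, ser_qSeq₀_neg, ser_pSeq₀_neg ha]
  set Q := ser (vSeq a) x
  set P := ser (fun k => (k + (a + 1) / 2) * vSeq a k) x
  set R := ser (fun k => (k + (a + 1) / 2) ^ 2 * vSeq a k) x with hR
  have hR1 : r * x ≤ R := by
    have hs : IsEntire fun k => (k + (a + 1) / 2) ^ 2 * vSeq a k := by
      have h1 := (isEntire_vSeq ha).euler.add ((isEntire_vSeq ha).const_mul ((a + 1) / 2))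
      have h2 := h1.euler.add (h1.const_mul ((a + 1) / 2))
      refine h2.mono fun k => le_of_eq ?_
      congr 1
      simp only [euler]; ring
    have := (hs.summable x).le_tsum 1 fun k _ =>
      mul_nonneg (mul_nonneg (sq_nonneg _) (vSeq_pos ha k).le) (by positivity)
    rw [hR, ser, hr]
    simpa using this
  have hRpos : 0 < R := (by positivity : 0 < r * x).trans_le hR1
  have e1 : x ^ a * x = x ^ ((a + 1) / 2) * x ^ ((a + 1) / 2) := by
    rw [← Real.rpow_add_one hx0.ne', ← Real.rpow_add hx0]; ring_nf
  have e2 : x⁻¹ ≤ x ^ ((a + 1) / 2) := by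
    rw [← Real.rpow_neg_one]
    exact Real.rpow_le_rpow_of_exponent_le hx (by linarith)
  set B := x ^ ((a + 1) / 2)
  have hB : 0 < B := (inv_pos.2 hx0).trans_le e2
  have hBx : 1 ≤ B * x := by rw [inv_eq_one_div, div_le_iff₀ hx0] at e2; exact e2
  have e3 : r ≤ B * R := by nlinarith
  have e4 : |K| + 1 / r ≤ c * x := by rw [div_le_iff₀' hc] at hxc; exact hxc
  have hxn : 1 ≤ x ^ n := one_le_pow₀ hx
  have e5 : |K| + x ^ n / r ≤ c * x ^ (n + 1) := by
    have : |K| + x ^ n / r ≤ x ^ n * (|K| + 1 / r) := by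
      have := abs_nonneg K
      rw [mul_add, mul_one_div]; nlinarith
    rw [pow_succ]; nlinarith
  have e6 : c * x ^ (n + 1) ≤ B * (c * x ^ (n + 2)) := by
    have : 0 ≤ c * x ^ (n + 1) := by positivity
    rw [pow_succ x (n + 1)]; nlinarith
  calc x ^ n = r * (x ^ n / r) := by field_simp
    _ ≤ B * R * (x ^ n / r) := mul_le_mul_of_nonneg_right e3 (by positivity)
    _ ≤ B * R * (B * (c * x ^ (n + 2)) - |K|) :=
        mul_le_mul_of_nonneg_left (by linarith) (by positivity)
    _ = B * B * (c * x ^ (n + 2) * R) - |K| * (B * R) := by ring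
    _ ≤ B * B * (R * Q - P ^ 2) + K * (B * R) := by
        have h2 := mul_le_mul_of_nonneg_left h1 (by positivity : 0 ≤ B * B)
        have h3 : -|K| * (B * R) ≤ K * (B * R) :=
          mul_le_mul_of_nonneg_right (neg_abs_le K) (by positivity)
        linarith
    _ = _ := by rw [← e1]; ring

/-- The coefficients contain both 1/k! and 1/Γ(k+a+1), so one factorial can be spared. -/
theorem isEntire_factorial_pSeq₀ (a : ℝ) : IsEntire fun k => k.factorial * pSeq₀ a k :=
  (isEntire_rGamma a (-(1 / 4))).mono fun k => by
    have hk : (k.factorial : ℝ) ≠ 0 := by exact_mod_cast k.factorial_ne_zero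
    rw [pSeq₀, bSeq₀, ← mul_assoc, mul_div_cancel₀ _ hk]

theorem subexponential_negEdge (ha : -2 < a) (K : ℝ) : Subexponential (negEdge a K) := by
  have hp := isEntire_factorial_pSeq₀ a
  have sp := Subexponential.ser_neg hp
  have su : Subexponential fun x => ser (euler (pSeq₀ a)) (-x) :=
    Subexponential.ser_neg (hp.euler.mono fun k => by rw [euler, euler, mul_left_comm])
  have sq : Subexponential fun x => ser (qSeq₀ a) (-x) := by
    refine Subexponential.ser_neg (((isEntire_single (2 * rGamma a 1)).abs.add
      (hp.const_mul 2).abs).mono fun k => ?_)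
    rw [qSeq₀, mul_add]
    refine (abs_add_le _ _).trans (le_trans ?_ (le_abs_self _))
    refine add_le_add ?_ ?_
    · split_ifs with h
      · subst h; simp
      · simp
    · rw [mul_left_comm, abs_mul, abs_mul 2]
      exact mul_le_mul_of_nonneg_right ((abs_recipSeq_le ha k).trans (le_abs_self 2))
        (abs_nonneg _)
  have c := Subexponential.const
  have hS : Subexponential fun x => bulkSer₀ a (-x) := by
    have h := (((Subexponential.id.mul (sp.mul sq)).add ((c 8).mul (su.mul su))).add
      ((c (8 * a)).mul (sp.mul su))).add ((c (-2)).mul (Subexponential.id.mul (sp.mul sp)))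
    refine (congrArg Subexponential (funext fun x => ?_)).mp h
    rw [bulkSer₀, bulkForm]; ring
  exact ((Subexponential.rpow a).mul hS).add ((c K).mul ((Subexponential.rpow _).mul sp))

theorem eq_zero_of_negEdge (ha : -2 < a) (K : ℝ) {A B : Polynomial ℝ} {c : ℝ}
    (h : ∀ x, 0 < x → A.eval x * negEdgeDeriv a K x + B.eval x * negEdge a K x = c * x ^ 2) :
    A = 0 ∧ B = 0 := by
  refine eq_zero_of_intermediate_growth (fun x hx => hasDerivAt_negEdge ha K hx)
    (pow_le_negEdgeDeriv ha K) (fun δ hδ => ?_)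
    ((eventually_gt_atTop 0).mono h)
  obtain ⟨C, hC⟩ := (subexponential_negEdge ha K δ hδ).bound
  refine ⟨C, hC.mono fun x hx => (le_abs_self _).trans ?_⟩
  rwa [Real.norm_eq_abs, Real.norm_of_nonneg (Real.exp_pos _).le] at hx

end laguerre

/-! ### Analytic continuation of the edge density from the positive to the negative axis. -/

namespace laguerre
variable {a : ℝ}

/-- The edge density as an entire function of the logarithm of its argument. -/
def contEdge (a K : ℝ) (ζ : ℂ) : ℂ :=
  Complex.exp (a * ζ) * (-Complex.exp ζ *
      (serC (pSeq₀ a) (Complex.exp ζ) * serC (qSeq₀ a) (Complex.exp ζ)) +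
      8 * serC (euler (pSeq₀ a)) (Complex.exp ζ) ^ 2 +
      8 * a * (serC (pSeq₀ a) (Complex.exp ζ) * serC (euler (pSeq₀ a)) (Complex.exp ζ)) +
      2 * Complex.exp ζ * serC (pSeq₀ a) (Complex.exp ζ) ^ 2) +
    K * (Complex.exp ((a + 1) / 2 * ζ) * serC (pSeq₀ a) (Complex.exp ζ))

/-- The derivative of the edge density as an entire function of the logarithm of its argument. -/
def contEdgeDeriv (a K : ℝ) (ζ : ℂ) : ℂ :=
  Complex.exp (a * ζ) * (Complex.exp ζ * (serC (pSeq₀ a) (Complex.exp ζ) ^ 2 -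
      (a + 1) / 2 * (serC (pSeq₀ a) (Complex.exp ζ) * serC (qSeq₀ a) (Complex.exp ζ)) -
      serC (euler (pSeq₀ a)) (Complex.exp ζ) * serC (qSeq₀ a) (Complex.exp ζ))) +
    K * (Complex.exp ((a + 1) / 2 * ζ) * ((a + 1) / 2 * serC (pSeq₀ a) (Complex.exp ζ) +
      serC (euler (pSeq₀ a)) (Complex.exp ζ)))

theorem differentiable_contEdge (ha : -2 < a) (K : ℝ) : Differentiable ℂ (contEdge a K) := by
  have hp := (pSeq_expansion a).1.differentiable_serC
  have hu := (pSeq_expansion a).1.euler.differentiable_serC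
  have hq := (qSeq_expansion ha).1.differentiable_serC
  unfold contEdge
  fun_prop

theorem differentiable_contEdgeDeriv (ha : -2 < a) (K : ℝ) :
    Differentiable ℂ (contEdgeDeriv a K) := by
  have hp := (pSeq_expansion a).1.differentiable_serC
  have hu := (pSeq_expansion a).1.euler.differentiable_serC
  have hq := (qSeq_expansion ha).1.differentiable_serC
  unfold contEdgeDeriv
  fun_prop

theorem exp_mul_ofReal_log {x : ℝ} (hx : 0 < x) (r : ℝ) :
    Complex.exp (r * (Real.log x : ℝ)) = ((x ^ r : ℝ) : ℂ) := by
  rw [Real.rpow_def_of_pos hx, ← Complex.ofReal_mul, ← Complex.ofReal_exp, mul_comm]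

theorem contEdge_log (σ : ℝ) {x : ℝ} (hx : 0 < x) :
    edgeConst a * contEdge a (σ * 2 ^ (1 + a)) (Real.log x : ℝ) = (edge₀ a σ x : ℝ) := by
  have e1 := exp_mul_ofReal_log hx a
  have e2 := exp_mul_ofReal_log hx ((a + 1) / 2)
  have e3 : Complex.exp (Real.log x : ℝ) = (x : ℂ) := by rw [← Complex.ofReal_exp, Real.exp_log hx]
  push_cast at e2
  rw [contEdge, e1, e2, e3, edge₀, bulkSer₀, bulkForm]
  simp only [← ofReal_ser]
  push_cast; ring

theorem contEdgeDeriv_log (σ : ℝ) {x : ℝ} (hx : 0 < x) :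
    edgeConst a * contEdgeDeriv a (σ * 2 ^ (1 + a)) (Real.log x : ℝ) =
      (edgeDeriv a σ x : ℝ) := by
  have e1 := exp_mul_ofReal_log hx a
  have e2 := exp_mul_ofReal_log hx ((a + 1) / 2)
  have e3 : Complex.exp (Real.log x : ℝ) = (x : ℂ) := by rw [← Complex.ofReal_exp, Real.exp_log hx]
  push_cast at e2
  rw [contEdgeDeriv, e1, e2, e3, edgeDeriv]
  simp only [← ofReal_ser]
  push_cast; ring

/-- The phase at the argument `π` of the orthogonal contribution relative to the remaining
part. -/
def edgePhase (a : ℝ) : ℂ := Complex.exp (((a + 1) / 2 - a) * (Real.pi * Complex.I))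

theorem exp_log_add_pi {x : ℝ} (hx : 0 < x) :
    Complex.exp ((Real.log x : ℝ) + Real.pi * Complex.I) = ((-x : ℝ) : ℂ) := by
  rw [Complex.exp_add, Complex.exp_pi_mul_I, ← Complex.ofReal_exp, Real.exp_log hx]
  push_cast; ring

theorem exp_phase {x : ℝ} (hx : 0 < x) (r : ℝ) :
    Complex.exp (r * ((Real.log x : ℝ) + Real.pi * Complex.I)) *
      Complex.exp (-a * (Real.pi * Complex.I)) =
      ((x ^ r : ℝ) : ℂ) * Complex.exp ((r - a) * (Real.pi * Complex.I)) := by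
  rw [← exp_mul_ofReal_log hx, ← Complex.exp_add, ← Complex.exp_add]
  congr 1; ring

/-- At argument π the powers z^a and z^((a+1)/2) acquire different phases. Dividing by the first
leaves the quadratic part real and a single phase at the linear part. -/
theorem contEdge_pi (K : ℝ) {x : ℝ} (hx : 0 < x) :
    contEdge a K ((Real.log x : ℝ) + Real.pi * Complex.I) *
      Complex.exp (-a * (Real.pi * Complex.I)) =
      ((x ^ a * bulkSer₀ a (-x) : ℝ) : ℂ) +
        ((K * (x ^ ((a + 1) / 2) * ser (pSeq₀ a) (-x)) : ℝ) : ℂ) * edgePhase a := by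
  have e1 := exp_phase (a := a) hx a
  have e2 := exp_phase (a := a) hx ((a + 1) / 2)
  rw [sub_self, zero_mul, Complex.exp_zero, mul_one] at e1
  push_cast at e2
  rw [contEdge, edgePhase, exp_log_add_pi hx, bulkSer₀, bulkForm]
  simp only [← ofReal_ser]
  push_cast
  linear_combination (-(-(x : ℂ)) *
      ((ser (pSeq₀ a) (-x) : ℂ) * ser (qSeq₀ a) (-x)) +
      8 * (ser (euler (pSeq₀ a)) (-x) : ℂ) ^ 2 +
      8 * a * ((ser (pSeq₀ a) (-x) : ℂ) * ser (euler (pSeq₀ a)) (-x)) +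
      2 * -(x : ℂ) * (ser (pSeq₀ a) (-x) : ℂ) ^ 2) * e1 + K * (ser (pSeq₀ a) (-x) : ℂ) * e2

theorem contEdgeDeriv_pi (K : ℝ) {x : ℝ} (hx : 0 < x) :
    contEdgeDeriv a K ((Real.log x : ℝ) + Real.pi * Complex.I) *
      Complex.exp (-a * (Real.pi * Complex.I)) =
      ((x ^ a * (x * (((a + 1) / 2 * ser (pSeq₀ a) (-x) + ser (euler (pSeq₀ a)) (-x)) *
        ser (qSeq₀ a) (-x) - ser (pSeq₀ a) (-x) ^ 2)) : ℝ) : ℂ) +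
        ((K * (x ^ ((a + 1) / 2) * ((a + 1) / 2 * ser (pSeq₀ a) (-x) +
          ser (euler (pSeq₀ a)) (-x))) : ℝ) : ℂ) * edgePhase a := by
  have e1 := exp_phase (a := a) hx a
  have e2 := exp_phase (a := a) hx ((a + 1) / 2)
  rw [sub_self, zero_mul, Complex.exp_zero, mul_one] at e1
  push_cast at e2
  rw [contEdgeDeriv, edgePhase, exp_log_add_pi hx]
  simp only [← ofReal_ser]
  push_cast
  linear_combination (-(x : ℂ) * ((ser (pSeq₀ a) (-x) : ℂ) ^ 2 -
      (a + 1) / 2 * ((ser (pSeq₀ a) (-x) : ℂ) * ser (qSeq₀ a) (-x)) -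
      (ser (euler (pSeq₀ a)) (-x) : ℂ) * ser (qSeq₀ a) (-x))) * e1 +
    K * ((a + 1) / 2 * (ser (pSeq₀ a) (-x) : ℂ) + ser (euler (pSeq₀ a)) (-x)) * e2

theorem edgeConst_pos (a : ℝ) : 0 < edgeConst a := by rw [edgeConst]; positivity

/-- The edge density solves no first order linear differential equation with polynomial
coefficients. -/
theorem eq_zero_of_edge (ha : -2 < a) (σ : ℝ) {A B : Polynomial ℝ} {c : ℝ}
    (h : ∀ x, 0 < x → A.eval x * edgeDeriv a σ x + B.eval x * edge₀ a σ x = c * x ^ 2) :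
    A = 0 ∧ B = 0 := by
  set K := σ * 2 ^ (1 + a) with hK
  have hE := (edgeConst_pos a).ne'
  -- In the logarithmic variable the real powers are entire. `Φ` vanishes on the real line, hence
  -- everywhere, in particular at log x + iπ.
  let Φ : ℂ → ℂ := fun ζ => Polynomial.aeval (Complex.exp ζ) A * contEdgeDeriv a K ζ +
    Polynomial.aeval (Complex.exp ζ) B * contEdge a K ζ -
      ((c / edgeConst a : ℝ) : ℂ) * Complex.exp ζ ^ 2
  have hΦ : Differentiable ℂ Φ := by
    have h1 := differentiable_contEdge ha K
    have h2 := differentiable_contEdgeDeriv ha K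
    have h3 : ∀ P : Polynomial ℝ, Differentiable ℂ fun ζ => Polynomial.aeval (Complex.exp ζ) P :=
      fun P => P.differentiable_aeval.comp Complex.differentiable_exp
    have h4 := h3 A
    have h5 := h3 B
    fun_prop
  have hreal : ∀ t : ℝ, Φ t = 0 := by
    intro t
    have hx := Real.exp_pos t
    have h1 := contEdge_log (a := a) σ hx
    have h2 := contEdgeDeriv_log (a := a) σ hx
    rw [Real.log_exp, ← hK] at h1 h2
    have h3 : ((A.eval (Real.exp t) * edgeDeriv a σ (Real.exp t) +
      B.eval (Real.exp t) * edge₀ a σ (Real.exp t) : ℝ) : ℂ) = _ := congrArg _ (h _ hx)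
    have hA : ∀ P : Polynomial ℝ, Polynomial.aeval (Complex.exp (t : ℂ)) P =
        ((P.eval (Real.exp t) : ℝ) : ℂ) := fun P => by
      rw [← Complex.ofReal_exp]; exact (Polynomial.ofReal_eval P _).symm
    have hE' : (edgeConst a : ℂ) ≠ 0 := by exact_mod_cast hE
    simp only [Φ, hA]
    push_cast at h3 ⊢
    rw [← h1, ← h2] at h3
    apply mul_left_cancel₀ hE'
    rw [mul_zero, mul_sub, ← mul_assoc _ (_ / _), mul_div_cancel₀ _ hE']
    linear_combination h3
  have hzero : ∀ ζ, Φ ζ = 0 := by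
    have hAn : AnalyticOnNhd ℂ Φ univ := fun z _ => hΦ.analyticAt z
    have hfreq : ∃ᶠ z in nhdsWithin (0 : ℂ) {0}ᶜ, Φ z = 0 := by
      have ht : Tendsto (fun t : ℝ => (t : ℂ)) (nhdsWithin 0 {0}ᶜ)
          (nhdsWithin (0 : ℂ) {0}ᶜ) := by
        refine tendsto_nhdsWithin_iff.2 ⟨?_, ?_⟩
        · exact (Complex.continuous_ofReal.tendsto' 0 0 (by simp)).mono_left nhdsWithin_le_nhds
        · filter_upwards [self_mem_nhdsWithin] with t ht
          simpa using ht
      exact ht.frequently (Eventually.frequently (Eventually.of_forall hreal))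
    intro ζ
    exact hAn.eqOn_zero_of_preconnected_of_frequently_eq_zero isPreconnected_univ (mem_univ _)
      hfreq (mem_univ ζ)
  -- Taking real parts replaces the phase of the linear term by a real factor, which merely changes
  -- K.
  have hneg : ∀ x, 0 < x → (A.comp (-Polynomial.X)).eval x *
      negEdgeDeriv a (K * (edgePhase a).re) x +
      (B.comp (-Polynomial.X)).eval x * negEdge a (K * (edgePhase a).re) x =
        (c / edgeConst a * (Complex.exp (-a * (Real.pi * Complex.I))).re) * x ^ 2 := by
    intro x hx
    have h0 := hzero ((Real.log x : ℝ) + Real.pi * Complex.I)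
    have h1 := contEdge_pi (a := a) K hx
    have h2 := contEdgeDeriv_pi (a := a) K hx
    simp only [Φ, exp_log_add_pi hx] at h0
    rw [show Polynomial.aeval ((-x : ℝ) : ℂ) A = ((A.eval (-x) : ℝ) : ℂ) from
      (Polynomial.ofReal_eval A _).symm, show Polynomial.aeval ((-x : ℝ) : ℂ) B =
      ((B.eval (-x) : ℝ) : ℂ) from (Polynomial.ofReal_eval B _).symm] at h0
    have h3 : ((A.eval (-x) : ℝ) : ℂ) *
        (contEdgeDeriv a K ((Real.log x : ℝ) + Real.pi * Complex.I) *
          Complex.exp (-a * (Real.pi * Complex.I))) + ((B.eval (-x) : ℝ) : ℂ) *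
        (contEdge a K ((Real.log x : ℝ) + Real.pi * Complex.I) *
          Complex.exp (-a * (Real.pi * Complex.I))) =
        ((c / edgeConst a * x ^ 2 : ℝ) : ℂ) * Complex.exp (-a * (Real.pi * Complex.I)) := by
      push_cast at h0 ⊢
      linear_combination (Complex.exp (-a * (Real.pi * Complex.I))) * h0
    rw [h1, h2] at h3
    have h4 := congrArg Complex.re h3
    simp only [Complex.add_re, Complex.re_ofReal_mul, Complex.ofReal_re] at h4
    rw [Polynomial.eval_comp, Polynomial.eval_comp, Polynomial.eval_neg, Polynomial.eval_X,
      negEdge, negEdgeDeriv]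
    linear_combination h4
  have hcomp : ∀ P : Polynomial ℝ, P.comp (-Polynomial.X) = 0 → P = 0 := fun P hP => by
    rw [← Polynomial.comp_neg_X_comp_neg_X P, hP, Polynomial.zero_comp]
  obtain ⟨hA, hB⟩ := eq_zero_of_negEdge ha _ hneg
  exact ⟨hcomp A hA, hcomp B hB⟩

end laguerre

/-! ### Counting probabilities and the generating function at finite N. -/

section ensemble
variable {β : ℕ} {w : ℝ → ℝ} {n N : ℕ}

theorem ensembleWeight_eq_vandermonde (β : ℕ) (w : ℝ → ℝ) (x : Fin N → ℝ) :
    ensembleWeight β w x = (∏ l, w (x l)) * |(Matrix.vandermonde x).det| ^ β := by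
  rw [ensembleWeight, Matrix.det_vandermonde, Finset.abs_prod, ← Finset.prod_pow]
  simp only [Finset.abs_prod, Finset.prod_pow]

theorem ensembleWeight_perm (β : ℕ) (w : ℝ → ℝ) (x : Fin N → ℝ) (σ : Equiv.Perm (Fin N)) :
    ensembleWeight β w (fun i => x (σ i)) = ensembleWeight β w x := by
  rw [ensembleWeight_eq_vandermonde, ensembleWeight_eq_vandermonde,
    Equiv.prod_comp σ fun l => w (x l)]
  congr 2
  rw [vandermonde_det_comp, abs_mul]
  rcases Int.units_eq_one_or (Equiv.Perm.sign σ) with h | h <;> simp [h]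

theorem integrable_ensembleWeight (hZ : ensembleZ β w N ≠ 0) :
    Integrable fun x : Fin N → ℝ => ensembleWeight β w x := by
  by_contra h
  exact hZ (integral_undef h)

/-- The number of components in `(0,s)`. -/
def occupation (s : ℝ) (x : Fin N → ℝ) : ℕ := {l : Fin N | 0 < x l ∧ x l < s}.ncard

theorem occupation_eq_sum (s : ℝ) (x : Fin N → ℝ) :
    (occupation s x : ℝ) = ∑ l, (Ioo 0 s).indicator (fun _ => 1) (x l) := by
  classical
  rw [occupation, Set.ncard_eq_toFinset_card', Set.toFinset_ofPred, Finset.card_filter]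
  push_cast
  exact Finset.sum_congr rfl fun l _ => by simp [indicator, mem_Ioo]

theorem occupation_le (s : ℝ) (x : Fin N → ℝ) : occupation s x ≤ N := by
  refine (Set.ncard_le_ncard (subset_univ _)).trans ?_
  simp

theorem measurableSet_occupation (s : ℝ) (k : ℕ) :
    MeasurableSet {x : Fin N → ℝ | occupation s x = k} := by
  have hm : Measurable fun x : Fin N → ℝ => (occupation s x : ℝ) := by
    simp only [occupation_eq_sum]
    exact Finset.measurable_sum _ fun l _ =>
      (measurable_const.indicator measurableSet_Ioo).comp (measurable_pi_apply l)
  have := hm (measurableSet_singleton (k : ℝ))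
  simpa [preimage, Nat.cast_inj] using this

/-- The level sets of the occupation number partition the configurations, so the sum is an
expectation. -/
theorem sum_mul_countProb (hZ : ensembleZ β w N ≠ 0) (s : ℝ) (f : ℕ → ℝ) :
    ∑ k ∈ Finset.range (N + 1), f k * ensembleCountProb β w N k s =
      (∫ x : Fin N → ℝ, f (occupation s x) * ensembleWeight β w x) / ensembleZ β w N := by
  have hi := integrable_ensembleWeight hZ
  have h1 : ∀ k, f k * ensembleCountProb β w N k s =
      (∫ x : Fin N → ℝ, f k * {x : Fin N → ℝ | occupation s x = k}.indicator
        (fun x => ensembleWeight β w x) x) / ensembleZ β w N := fun k => by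
    rw [ensembleCountProb, integral_const_mul, integral_indicator (measurableSet_occupation s k),
      mul_div_assoc]
    rfl
  simp only [h1]
  rw [← Finset.sum_div, ← integral_finsetSum _ fun k _ =>
    (hi.indicator (measurableSet_occupation s k)).const_mul _]
  congr 2
  funext x
  rw [Finset.sum_eq_single (occupation s x)]
  · simp
  · intro k _ hk
    rw [indicator_of_notMem (by simpa using hk.symm), mul_zero]
  · intro h
    exact absurd (Finset.mem_range.2 (Nat.lt_succ_of_le (occupation_le s x))) h

theorem sum_countProb (hZ : ensembleZ β w N ≠ 0) (s : ℝ) :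
    ∑ k ∈ Finset.range (N + 1), ensembleCountProb β w N k s = 1 := by
  have h := sum_mul_countProb hZ s fun _ => 1
  simp only [one_mul] at h
  rw [h]
  exact div_self hZ

theorem ensembleWeight_nonneg (hw : ∀ x, 0 ≤ w x) (x : Fin N → ℝ) : 0 ≤ ensembleWeight β w x :=
  mul_nonneg (Finset.prod_nonneg fun _ _ => hw _)
    (Finset.prod_nonneg fun _ _ => Finset.prod_nonneg fun _ _ => pow_nonneg (abs_nonneg _) _)

theorem countProb_mem_Icc (hw : ∀ x, 0 ≤ w x) (hZ : ensembleZ β w N ≠ 0) (k : ℕ) (s : ℝ) :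
    0 ≤ ensembleCountProb β w N k s ∧ ensembleCountProb β w N k s ≤ 1 := by
  have hZ0 : 0 < ensembleZ β w N :=
    (integral_nonneg fun x => ensembleWeight_nonneg hw x).lt_of_ne' hZ
  refine ⟨div_nonneg (integral_nonneg fun x => ensembleWeight_nonneg hw x) hZ0.le,
    (div_le_one hZ0).2 ?_⟩
  exact setIntegral_le_integral (integrable_ensembleWeight hZ)
    (Eventually.of_forall fun x => ensembleWeight_nonneg hw x)

theorem integral_apply_eq_zero_apply (β : ℕ) (w g : ℝ → ℝ) (l : Fin (n + 1)) :
    ∫ x : Fin (n + 1) → ℝ, g (x l) * ensembleWeight β w x =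
      ∫ x : Fin (n + 1) → ℝ, g (x 0) * ensembleWeight β w x := by
  have h := integral_reindex (Equiv.swap 0 l) (fun _ => volume)
    fun x : Fin (n + 1) → ℝ => g (x l) * ensembleWeight β w x
  simp only [Equiv.swap_apply_right, ensembleWeight_perm] at h
  exact h.symm

theorem integrable_cons {G : (Fin (n + 1) → ℝ) → ℝ} (hG : Integrable G) :
    Integrable fun p : ℝ × (Fin n → ℝ) => G (Fin.cons p.1 p.2) :=
  ((volume_preserving_piFinSuccAbove (fun _ : Fin (n + 1) => ℝ) 0).symm.integrable_comp_emb
    (MeasurableEquiv.measurableEmbedding _)).2 hG |>.congr (Eventually.of_forall fun p => by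
      simp only [Function.comp, MeasurableEquiv.piFinSuccAbove_symm_apply, Fin.insertNthEquiv,
        Equiv.coe_fn_mk, Fin.insertNth_zero]
      rfl)

theorem integral_eq_integral_cons {G : (Fin (n + 1) → ℝ) → ℝ} (hG : Integrable G) :
    ∫ x, G x = ∫ x : ℝ, ∫ z : Fin n → ℝ, G (Fin.cons x z) := by
  rw [← integral_prod _ (integrable_cons hG),
    ← (volume_preserving_piFinSuccAbove (fun _ : Fin (n + 1) => ℝ) 0).symm.integral_comp']
  refine integral_congr_ae (Eventually.of_forall fun p => ?_)
  simp only [MeasurableEquiv.piFinSuccAbove_symm_apply, Fin.insertNthEquiv,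
    Equiv.coe_fn_mk, Fin.insertNth_zero]
  rfl

theorem integrable_ensembleDensity (hZ : ensembleZ β w (n + 1) ≠ 0) :
    Integrable (ensembleDensity β w (n + 1)) :=
  ((integrable_cons (integrable_ensembleWeight hZ)).integral_prod_left.const_mul _).div_const _

/-- The mean occupation number, by linearity: the indicators of the single variables all have the
same integral by symmetry, which produces the factor N in the density. -/
theorem sum_nat_mul_countProb (hZ : ensembleZ β w (n + 1) ≠ 0) (s : ℝ) :
    ∑ k ∈ Finset.range (n + 1 + 1), (k : ℝ) * ensembleCountProb β w (n + 1) k s =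
      ∫ x in Ioo 0 s, ensembleDensity β w (n + 1) x := by
  have hi := integrable_ensembleWeight hZ
  have hm : ∀ l : Fin (n + 1), Integrable fun x : Fin (n + 1) → ℝ =>
      (Ioo 0 s).indicator (fun _ => (1 : ℝ)) (x l) * ensembleWeight β w x := fun l => by
    have h := hi.indicator ((measurable_pi_apply l) (measurableSet_Ioo (a := (0 : ℝ)) (b := s)))
    refine h.congr (Eventually.of_forall fun x => ?_)
    beta_reduce
    by_cases hx : x l ∈ Ioo 0 s
    · rw [indicator_of_mem hx, indicator_of_mem (by exact hx), one_mul]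
    · rw [indicator_of_notMem hx, indicator_of_notMem (by exact hx), zero_mul]
  rw [sum_mul_countProb hZ]
  simp only [occupation_eq_sum, Finset.sum_mul]
  rw [integral_finsetSum _ fun l _ => hm l]
  simp only [integral_apply_eq_zero_apply β w ((Ioo 0 s).indicator fun _ => (1 : ℝ))]
  rw [Finset.sum_const, Finset.card_univ, Fintype.card_fin, nsmul_eq_mul,
    integral_eq_integral_cons (hm 0), ← integral_indicator measurableSet_Ioo]
  simp only [Fin.cons_zero, integral_const_mul]
  rw [← integral_const_mul, ← integral_div]
  refine integral_congr_ae (Eventually.of_forall fun x => ?_)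
  by_cases hx : x ∈ Ioo 0 s
  · simp only [indicator_of_mem hx, one_mul, ensembleDensity]
    push_cast; rfl
  · simp only [indicator_of_notMem hx, zero_mul, mul_zero, zero_div]

theorem ensembleGenFun_zero (hZ : ensembleZ β w N ≠ 0) (s : ℝ) : ensembleGenFun β w N s 0 = 1 := by
  have h := sum_countProb hZ s
  simp only [ensembleGenFun, sub_zero, one_pow, one_mul]
  exact_mod_cast congrArg (fun r : ℝ => (r : ℂ)) h

theorem differentiable_ensembleGenFun (β : ℕ) (w : ℝ → ℝ) (N : ℕ) (s : ℝ) :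
    Differentiable ℂ (ensembleGenFun β w N s) := by
  unfold ensembleGenFun
  fun_prop

theorem deriv_ensembleGenFun (hZ : ensembleZ β w (n + 1) ≠ 0) (s : ℝ) :
    deriv (ensembleGenFun β w (n + 1) s) 0 =
      -((∫ x in Ioo 0 s, ensembleDensity β w (n + 1) x : ℝ) : ℂ) := by
  rw [← sum_nat_mul_countProb hZ]
  have h : HasDerivAt (ensembleGenFun β w (n + 1) s)
      (∑ k ∈ Finset.range (n + 1 + 1), (k * (1 - (0 : ℂ)) ^ (k - 1) * -1) *
        (ensembleCountProb β w (n + 1) k s : ℂ)) 0 := by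
    refine HasDerivAt.fun_sum fun k _ => HasDerivAt.mul_const ?_ _
    exact ((hasDerivAt_id (0 : ℂ)).const_sub 1).pow k
  rw [h.deriv]
  push_cast
  rw [← Finset.sum_neg_distrib]
  refine Finset.sum_congr rfl fun k _ => ?_
  simp

theorem norm_ensembleGenFun_le (hw : ∀ x, 0 ≤ w x) (hZ : ensembleZ β w N ≠ 0) (s : ℝ) {ξ : ℂ}
    {r : ℝ} (hξ : ‖ξ‖ ≤ r) :
    ‖ensembleGenFun β w N s ξ‖ ≤ ∑ k ∈ Finset.range (N + 1), (1 + r) ^ k := by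
  refine norm_sum_le_of_le _ fun k _ => ?_
  have h := countProb_mem_Icc (β := β) hw hZ k s
  rw [norm_mul, norm_pow, Complex.norm_real, Real.norm_of_nonneg h.1]
  have h1 : ‖1 - ξ‖ ≤ 1 + r := (norm_sub_le _ _).trans (by rw [norm_one]; linarith)
  calc ‖1 - ξ‖ ^ k * _ ≤ ‖1 - ξ‖ ^ k * 1 := mul_le_mul_of_nonneg_left h.2 (by positivity)
    _ ≤ _ := by rw [mul_one]; exact pow_le_pow_left₀ (norm_nonneg _) h1 k

end ensemble

/-! ### Bounds and convergence deduced from a two-term expansion. -/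

section expansion
variable {X : Type*} {K : Set X} {S : ℕ → ℝ} {Λ : ℕ → X → ℂ} {E₀ E₁ : X → ℂ}

/-- Nothing is assumed about the size of `E₀` and `E₁`. Comparing two indices with different scales
eliminates `E₁` and bounds (S_{N'} - S_N) E₀; the bound of `E₁` follows. -/
theorem exists_bound_of_expansion (hS : Tendsto S atTop atTop)
    (hΛ : ∀ᶠ N in atTop, ∃ C, ∀ p ∈ K, ‖Λ N p‖ ≤ C)
    (h : TendstoUniformlyOn (fun N p => (S N : ℂ) * (Λ N p - E₀ p)) E₁ atTop K) :
    ∃ M, ∀ p ∈ K, ‖E₀ p‖ ≤ M ∧ ‖E₁ p‖ ≤ M := by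
  have h1 := (Metric.tendstoUniformlyOn_iff.1 h 1 one_pos).and hΛ
  obtain ⟨N, hN, C, hC⟩ := h1.exists
  obtain ⟨N', ⟨hN', C', hC'⟩, hS'⟩ := (h1.and (hS.eventually_ge_atTop (S N + 1))).exists
  refine ⟨(|S N'| * C' + |S N| * C + 2) + (|S N| * (C + (|S N'| * C' + |S N| * C + 2)) + 1),
    fun p hp => ?_⟩
  have a1 := hN p hp
  have a2 := hN' p hp
  rw [dist_eq_norm] at a1 a2
  have n1 : ‖(S N : ℂ) * Λ N p‖ ≤ |S N| * C := by
    rw [norm_mul, Complex.norm_real]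
    exact mul_le_mul_of_nonneg_left (hC p hp) (abs_nonneg _)
  have n2 : ‖(S N' : ℂ) * Λ N' p‖ ≤ |S N'| * C' := by
    rw [norm_mul, Complex.norm_real]
    exact mul_le_mul_of_nonneg_left (hC' p hp) (abs_nonneg _)
  have hC0 : 0 ≤ |S N| * C := (norm_nonneg _).trans n1
  have hC0' : 0 ≤ |S N'| * C' := (norm_nonneg _).trans n2
  have b0 : ‖E₀ p‖ ≤ |S N'| * C' + |S N| * C + 2 := by
    have e : ((S N' - S N : ℝ) : ℂ) * E₀ p = (S N' : ℂ) * Λ N' p - (S N : ℂ) * Λ N p +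
        (E₁ p - (S N' : ℂ) * (Λ N' p - E₀ p)) - (E₁ p - (S N : ℂ) * (Λ N p - E₀ p)) := by
      push_cast; ring
    have e1 : ‖((S N' - S N : ℝ) : ℂ) * E₀ p‖ ≤ |S N'| * C' + |S N| * C + 2 := by
      rw [e]
      refine (norm_sub_le _ _).trans ?_
      have := norm_add_le ((S N' : ℂ) * Λ N' p - (S N : ℂ) * Λ N p)
        (E₁ p - (S N' : ℂ) * (Λ N' p - E₀ p))
      have := norm_sub_le ((S N' : ℂ) * Λ N' p) ((S N : ℂ) * Λ N p)
      linarith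
    rw [norm_mul, Complex.norm_real, Real.norm_of_nonneg (by linarith)] at e1
    nlinarith [norm_nonneg (E₀ p)]
  have b1 : ‖E₁ p‖ ≤ |S N| * (C + (|S N'| * C' + |S N| * C + 2)) + 1 := by
    have e : E₁ p = (E₁ p - (S N : ℂ) * (Λ N p - E₀ p)) + ((S N : ℂ) * Λ N p - S N * E₀ p) := by
      ring
    rw [e]
    refine (norm_add_le _ _).trans ?_
    have e2 := norm_sub_le ((S N : ℂ) * Λ N p) (S N * E₀ p)
    rw [norm_mul (S N : ℂ) (E₀ p), Complex.norm_real, Real.norm_eq_abs] at e2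
    have := mul_le_mul_of_nonneg_left b0 (abs_nonneg (S N))
    linarith
  have hn := norm_nonneg (E₀ p)
  have hn' := norm_nonneg (E₁ p)
  exact ⟨by linarith, by linarith⟩

theorem tendstoUniformlyOn_of_expansion (hS : Tendsto S atTop atTop)
    (hΛ : ∀ᶠ N in atTop, ∃ C, ∀ p ∈ K, ‖Λ N p‖ ≤ C)
    (h : TendstoUniformlyOn (fun N p => (S N : ℂ) * (Λ N p - E₀ p)) E₁ atTop K) :
    TendstoUniformlyOn Λ E₀ atTop K := by
  obtain ⟨M, hM⟩ := exists_bound_of_expansion hS hΛ h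
  rw [Metric.tendstoUniformlyOn_iff]
  intro ε hε
  filter_upwards [Metric.tendstoUniformlyOn_iff.1 h 1 one_pos, hS.eventually_gt_atTop 0,
    hS.eventually_gt_atTop ((M + 1) / ε)] with N hN hS0 hSε p hp
  have h1 := hN p hp
  have h2 := (hM p hp).2
  rw [dist_comm, dist_eq_norm] at h1 ⊢
  have h3 : ‖(S N : ℂ) * (Λ N p - E₀ p)‖ ≤ M + 1 := by
    have := norm_sub_norm_le ((S N : ℂ) * (Λ N p - E₀ p)) (E₁ p)
    linarith
  rw [norm_mul, Complex.norm_real, Real.norm_of_nonneg hS0.le] at h3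
  rw [div_lt_iff₀ hε] at hSε
  exact lt_of_mul_lt_mul_left (h3.trans_lt hSε) hS0.le

end expansion

/-- The Schwarz lemma; it will bound the difference quotients in ξ uniformly in y. -/
theorem norm_sub_le_of_bounded {f : ℂ → ℂ} {ρ M : ℝ} (hρ : 0 < ρ)
    (hf : DifferentiableOn ℂ f (Metric.ball 0 ρ)) (hM : ∀ ξ ∈ Metric.ball (0 : ℂ) ρ, ‖f ξ‖ ≤ M)
    {ξ : ℂ} (hξ : ξ ∈ Metric.ball (0 : ℂ) ρ) : ‖f ξ - f 0‖ ≤ 2 * M / ρ * ‖ξ‖ := by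
  have h := Complex.dist_le_div_mul_dist_of_mapsTo_ball (R₂ := 2 * M) hf (fun z hz => by
    rw [Metric.mem_closedBall, dist_eq_norm]
    have := norm_sub_le (f z) (f 0)
    have := hM z hz
    have := hM 0 (Metric.mem_ball_self hρ)
    linarith) hξ
  rwa [dist_eq_norm, dist_zero_right] at h

/-! ### Testing against polynomial bumps. -/

section weak
open Polynomial

/-- A polynomial that is positive inside `(u,v)` and vanishes to third order at the endpoints. -/
def bumpPoly (u v : ℝ) : ℂ[X] := ((X - C (u : ℂ)) * (C (v : ℂ) - X)) ^ 3

theorem eval_bumpPoly (u v y : ℝ) :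
    (bumpPoly u v).eval (y : ℂ) = ((((y - u) * (v - y)) ^ 3 : ℝ) : ℂ) := by
  simp [bumpPoly]

/-- The polynomial obtained by applying the adjoint of `p₂ ∂² + p₁ ∂` to `bumpPoly`. -/
def adjointBump (p₁ p₂ : ℂ[X]) (u v : ℝ) : ℂ[X] :=
  derivative (derivative (p₂ * bumpPoly u v)) - derivative (p₁ * bumpPoly u v)

theorem hasDerivAt_eval_ofReal (p : ℂ[X]) (y : ℝ) :
    HasDerivAt (fun y : ℝ => p.eval (y : ℂ)) ((derivative p).eval (y : ℂ)) y :=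
  (p.hasDerivAt (y : ℂ)).comp_ofReal

/-- Integration by parts, twice; the bump vanishes to third order at the ends, so there are no
boundary terms. A constant may be subtracted from `G`, as the operator has no term of order zero. -/
theorem integral_adjointBump (p₁ p₂ : ℂ[X]) {u v : ℝ} (huv : u ≤ v) {G G₁ G₂ : ℝ → ℂ}
    (h1 : ∀ y ∈ Icc u v, HasDerivAt G (G₁ y) y) (h2 : ∀ y ∈ Icc u v, HasDerivAt G₁ (G₂ y) y)
    (hc : ContinuousOn G₂ (Icc u v)) (c : ℂ) :
    ∫ y in u..v, (p₂.eval (y : ℂ) * G₂ y + p₁.eval (y : ℂ) * G₁ y) * (bumpPoly u v).eval (y : ℂ) =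
      ∫ y in u..v, (G y - c) * (adjointBump p₁ p₂ u v).eval (y : ℂ) := by
  have hP : ∀ p : ℂ[X], Continuous fun y : ℝ => p.eval (y : ℂ) := fun p => by fun_prop
  have hG : ContinuousOn G (Icc u v) := fun y hy => (h1 y hy).continuousAt.continuousWithinAt
  have hG1 : ContinuousOn G₁ (Icc u v) := fun y hy => (h2 y hy).continuousAt.continuousWithinAt
  have hI : ∀ {F : ℝ → ℂ}, ContinuousOn F (Icc u v) → IntervalIntegrable F volume u v :=
    fun {F} hF => (hF.mono (by rw [uIcc_of_le huv])).intervalIntegrable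
  have i1 : ContinuousOn (fun y : ℝ => (p₂.eval (y : ℂ) * G₂ y + p₁.eval (y : ℂ) * G₁ y) *
      (bumpPoly u v).eval (y : ℂ)) (Icc u v) := by
    have := hP p₁; have := hP p₂; have := hP (bumpPoly u v)
    fun_prop
  have i2 : ContinuousOn (fun y : ℝ => (G y - c) * (adjointBump p₁ p₂ u v).eval (y : ℂ))
      (Icc u v) := by
    have := hP (adjointBump p₁ p₂ u v)
    fun_prop
  rw [← sub_eq_zero, ← intervalIntegral.integral_sub (hI i1) (hI i2)]
  have hderiv : ∀ y ∈ uIcc u v, HasDerivAt (fun y : ℝ =>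
      G₁ y * (p₂ * bumpPoly u v).eval (y : ℂ) -
        (G y - c) * (derivative (p₂ * bumpPoly u v)).eval (y : ℂ) +
        (G y - c) * (p₁ * bumpPoly u v).eval (y : ℂ))
      ((p₂.eval (y : ℂ) * G₂ y + p₁.eval (y : ℂ) * G₁ y) * (bumpPoly u v).eval (y : ℂ) -
        (G y - c) * (adjointBump p₁ p₂ u v).eval (y : ℂ)) y := fun y hy => by
    rw [uIcc_of_le huv] at hy
    have hGc := (h1 y hy).sub_const c
    have h := (((h2 y hy).mul (hasDerivAt_eval_ofReal (p₂ * bumpPoly u v) y)).sub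
      (hGc.mul (hasDerivAt_eval_ofReal (derivative (p₂ * bumpPoly u v)) y))).add
      (hGc.mul (hasDerivAt_eval_ofReal (p₁ * bumpPoly u v) y))
    refine h.congr_deriv ?_
    simp only [adjointBump, eval_sub, eval_mul]
    ring
  rw [intervalIntegral.integral_eq_sub_of_hasDerivAt hderiv (hI (i1.sub i2))]
  simp [bumpPoly, derivative_mul, derivative_pow]

/-- If h(y) ≠ 0, multiplication by its conjugate makes the real part positive near y, and the bump
on a small interval has a positive integral against it. -/
theorem eq_zero_of_integral_bump {h : ℝ → ℂ} (hc : ContinuousOn h (Ioi 0))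
    (hint : ∀ u v : ℝ, 0 < u → u < v → ∫ y in u..v, h y * (bumpPoly u v).eval (y : ℂ) = 0)
    {y : ℝ} (hy : 0 < y) : h y = 0 := by
  by_contra hne
  set c := (starRingEnd ℂ) (h y) with hcdef
  have hca : ContinuousAt (fun t => (c * h t).re) y :=
    Complex.continuous_re.continuousAt.comp
      (continuousAt_const.mul (hc.continuousAt (Ioi_mem_nhds hy)))
  have hpos : 0 < (c * h y).re := by
    rw [hcdef, ← Complex.normSq_eq_conj_mul_self, Complex.ofReal_re]
    exact Complex.normSq_pos.2 hne
  obtain ⟨δ, hδ, hball⟩ := Metric.eventually_nhds_iff.1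
    ((hca.eventually (lt_mem_nhds hpos)).and (eventually_gt_nhds hy))
  set u := y - δ / 2 with hu
  set v := y + δ / 2 with hv
  have huv : u < v := by rw [hu, hv]; linarith
  have hin : ∀ t ∈ Icc u v, 0 < (c * h t).re ∧ 0 < t := fun t ht => hball (by
    rw [Real.dist_eq, abs_lt]
    constructor <;> [have := ht.1; have := ht.2] <;> rw [hu, hv] at * <;> linarith)
  have hu0 := (hin u (left_mem_Icc.2 huv.le)).2
  have hcon : ContinuousOn (fun t : ℝ => h t * (bumpPoly u v).eval (t : ℂ)) (uIcc u v) := by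
    rw [uIcc_of_le huv.le]
    have h1 : ContinuousOn h (Icc u v) := hc.mono fun t ht => (hin t ht).2
    have h2 : Continuous fun t : ℝ => (bumpPoly u v).eval (t : ℂ) := by fun_prop
    exact h1.mul h2.continuousOn
  have hcon' := (hcon.const_smul c)
  have hre : ∀ t, (c • (h t * (bumpPoly u v).eval (t : ℂ))).re =
      (c * h t).re * ((t - u) * (v - t)) ^ 3 := fun t => by
    rw [eval_bumpPoly, smul_eq_mul, ← mul_assoc, Complex.re_mul_ofReal]
  have h0 := congrArg Complex.re (congrArg (c • ·) (hint u v hu0 huv))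
  simp only [smul_zero, Complex.zero_re] at h0
  rw [← intervalIntegral.integral_smul] at h0
  have h1 := Complex.reCLM.intervalIntegral_comp_comm
    (hcon'.intervalIntegrable (μ := volume))
  simp only [Complex.reCLM_apply] at h1
  simp only [Pi.smul_apply] at h1
  rw [h0] at h1
  simp only [hre] at h1
  have hp : 0 < ∫ t in u..v, (c * h t).re * ((t - u) * (v - t)) ^ 3 := by
    refine intervalIntegral.intervalIntegral_pos_of_pos_on ?_ (fun t ht => ?_) huv
    · have := Complex.continuous_re.comp_continuousOn hcon'
      exact (this.congr fun t _ => (hre t).symm).intervalIntegrable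
    · have h3 := (hin t (Ioo_subset_Icc_self ht)).1
      have h4 := sub_pos.2 ht.1
      have h5 := sub_pos.2 ht.2
      positivity
  linarith

end weak

/-! ### Mean counts in the hard edge scaling. -/

section hardEdge
variable {β : ℕ} {a : ℝ}

theorem laguerreWeight_nonneg (β : ℕ) (a x : ℝ) : 0 ≤ laguerreWeight β a x := by
  rw [laguerreWeight]
  split_ifs with h
  · positivity
  · exact le_rfl

theorem ensembleZ_laguerre_ne_zero (hβ : β = 1 ∨ β = 4) (ha : -1 < laguerreExponent β a) (n : ℕ) :
    ensembleZ β (laguerreWeight β a) (n + 1) ≠ 0 := by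
  rcases laguerreExponent_cases hβ ha with ⟨rfl, h⟩ | ⟨rfl, h⟩
  · exact (laguerre.laguerreDensity_one h n).1
  · exact (laguerreDensity_four (by linarith) n).1

theorem hardEdgeSize_pos (hβ : β = 1 ∨ β = 4) (ha : -1 < laguerreExponent β a) (n : ℕ) :
    0 < hardEdgeSize β a (n + 1) := by
  have hn : (0 : ℝ) ≤ n := n.cast_nonneg
  rcases laguerreExponent_cases hβ ha with ⟨rfl, ha⟩ | ⟨rfl, ha⟩
  · simp only [hardEdgeSize, if_true]; push_cast; linarith
  · rw [hardEdgeSize, if_neg (by norm_num)]; push_cast; linarith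

theorem tendsto_hardEdgeScale (hβ : β = 1 ∨ β = 4) (a : ℝ) :
    Tendsto (hardEdgeScale β a) atTop atTop := by
  have h1 : Tendsto (hardEdgeSize β a) atTop atTop := by
    unfold hardEdgeSize
    split_ifs
    · exact tendsto_atTop_add_const_right _ _ tendsto_natCast_atTop_atTop
    · exact tendsto_atTop_add_const_right _ _ tendsto_natCast_atTop_atTop
  have hβ0 : 0 < 2 * √(β : ℝ) := by rcases hβ with rfl | rfl <;> positivity
  exact (tendsto_pow_atTop two_ne_zero).comp (h1.const_mul_atTop hβ0)

theorem hardEdgeGenFun_zero (hβ : β = 1 ∨ β = 4) (ha : -1 < laguerreExponent β a) (n : ℕ) (y : ℝ) :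
    hardEdgeGenFun β a (n + 1) y 0 = 1 :=
  ensembleGenFun_zero (ensembleZ_laguerre_ne_zero hβ ha n) _

theorem intervalIntegrable_hardEdgeDensity (hβ : β = 1 ∨ β = 4) (ha : -1 < laguerreExponent β a)
    (n : ℕ) (u v : ℝ) : IntervalIntegrable (hardEdgeDensity β a (n + 1)) volume u v := by
  have hH := hardEdgeSize_pos hβ ha n
  have h := integrable_ensembleDensity (ensembleZ_laguerre_ne_zero hβ ha n)
  exact ((h.comp_div (by positivity : 4 * hardEdgeSize β a (n + 1) ≠ 0)).const_mul _).intervalIntegrable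

theorem deriv_hardEdgeGenFun_sub (hβ : β = 1 ∨ β = 4) (ha : -1 < laguerreExponent β a) (n : ℕ)
    {u v : ℝ} (hu : 0 < u) (huv : u ≤ v) :
    deriv (hardEdgeGenFun β a (n + 1) v) 0 - deriv (hardEdgeGenFun β a (n + 1) u) 0 =
      -((∫ y in u..v, hardEdgeDensity β a (n + 1) y : ℝ) : ℂ) := by
  have hZ := ensembleZ_laguerre_ne_zero hβ ha n
  have hH := hardEdgeSize_pos hβ ha n
  have hi := integrable_ensembleDensity hZ
  set c := 4 * hardEdgeSize β a (n + 1) with hc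
  have hc0 : 0 < c := by positivity
  have hI : ∀ y : ℝ, 0 ≤ y → (∫ x in Ioo 0 (y / c), ensembleDensity β (laguerreWeight β a) (n + 1) x) =
      ∫ x in 0..(y / c), ensembleDensity β (laguerreWeight β a) (n + 1) x := fun y hy => by
    rw [intervalIntegral.integral_of_le (by positivity), integral_Ioc_eq_integral_Ioo]
  have e : ∀ y, hardEdgeGenFun β a (n + 1) y =
      ensembleGenFun β (laguerreWeight β a) (n + 1) (y / c) := fun y => rfl
  rw [e, e, deriv_ensembleGenFun hZ, deriv_ensembleGenFun hZ, hI u hu.le,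
    hI v (hu.le.trans huv)]
  have h1 : (∫ y in u..v, hardEdgeDensity β a (n + 1) y) =
      ∫ x in (u / c)..(v / c), ensembleDensity β (laguerreWeight β a) (n + 1) x := by
    rw [← intervalIntegral.inv_mul_integral_comp_div c, ← intervalIntegral.integral_const_mul]
    simp only [hardEdgeDensity, one_div, ← hc]
  rw [h1, ← intervalIntegral.integral_interval_sub_left (a := 0) (b := v / c) (c := u / c)
    hi.intervalIntegrable hi.intervalIntegrable]
  push_cast; ring

/-- Part (i) is uniform on compact intervals, so the expansion may be integrated. -/
theorem tendsto_integral_hardEdgeDensity (hβ : β = 1 ∨ β = 4) (ha : -1 < laguerreExponent β a)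
    {u v : ℝ} (hu : 0 < u) (huv : u ≤ v) :
    Tendsto (fun N => hardEdgeScale β a N * ((∫ y in u..v, hardEdgeDensity β a N y) -
      ∫ y in u..v, hardEdgeLimit β a y)) atTop
      (nhds (∫ y in u..v, hardEdgeCorrection β a y)) := by
  have hsub : uIcc u v ⊆ Ioi 0 := by
    rw [uIcc_of_le huv]; exact fun y hy => hu.trans_le hy.1
  have h0 := (contDiffOn_hardEdgeLimit hβ ha).continuousOn.mono hsub
  have h1 := (contDiffOn_hardEdgeCorrection hβ ha).continuousOn.mono hsub
  have hunif := (tendstoLocallyUniformlyOn_iff_forall_isCompact isOpen_Ioi).1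
    (isHardEdgeDensityExpansion hβ ha) _ hsub isCompact_uIcc
  obtain ⟨M, hM⟩ := isCompact_uIcc.exists_bound_of_continuousOn h1
  have key := intervalIntegral.tendsto_integral_filter_of_dominated_convergence
    (μ := volume) (a := u) (b := v) (l := atTop)
    (F := fun N y => hardEdgeScale β a N * (hardEdgeDensity β a N y - hardEdgeLimit β a y))
    (f := hardEdgeCorrection β a) (fun _ => M + 1) ?_ ?_ (by simp) ?_
  · refine key.congr' ?_
    filter_upwards [eventually_ge_atTop 1] with N hN
    obtain ⟨n, rfl⟩ := Nat.exists_eq_add_of_le' hN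
    rw [intervalIntegral.integral_const_mul, intervalIntegral.integral_sub
      (intervalIntegrable_hardEdgeDensity hβ ha n u v) h0.intervalIntegrable]
  · filter_upwards [eventually_ge_atTop 1] with N hN
    obtain ⟨n, rfl⟩ := Nat.exists_eq_add_of_le' hN
    exact (((intervalIntegrable_hardEdgeDensity hβ ha n u v).sub
      h0.intervalIntegrable).const_mul _).def'.aestronglyMeasurable
  · filter_upwards [Metric.tendstoUniformlyOn_iff.1 hunif 1 one_pos] with N hN
    refine Eventually.of_forall fun y hy => ?_
    have hy' := uIoc_subset_uIcc hy
    have h2 := hN y hy'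
    have h3 := hM y hy'
    rw [dist_comm, dist_eq_norm] at h2
    have := norm_sub_norm_le (hardEdgeScale β a N * (hardEdgeDensity β a N y -
      hardEdgeLimit β a y)) (hardEdgeCorrection β a y)
    linarith
  · exact Eventually.of_forall fun y hy => hunif.tendsto_at (uIoc_subset_uIcc hy)

end hardEdge

/-! ### The expansion of the generating function near ξ = 0. -/

section genFun
variable {β : ℕ} {a : ℝ} {U : Set ℂ} {E₀ E₁ : ℝ → ℂ → ℂ}

theorem eventually_hardEdgeGenFun_bounded (hβ : β = 1 ∨ β = 4) (ha : -1 < laguerreExponent β a)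
    (K : Set ℝ) (ρ : ℝ) : ∀ᶠ N in atTop, ∃ C, ∀ p ∈ K ×ˢ Metric.closedBall (0 : ℂ) ρ,
      ‖hardEdgeGenFun β a N p.1 p.2‖ ≤ C := by
  filter_upwards [eventually_ge_atTop 1] with N hN
  obtain ⟨n, rfl⟩ := Nat.exists_eq_add_of_le' hN
  exact ⟨_, fun p hp => norm_ensembleGenFun_le (laguerreWeight_nonneg β a)
    (ensembleZ_laguerre_ne_zero hβ ha n) _ (mem_closedBall_zero_iff.1 hp.2)⟩

theorem tendstoUniformlyOn_genFun (hU : IsOpen U) (hE : IsHardEdgeGenFunExpansion β a U E₀ E₁)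
    {K : Set ℝ} (hK : IsCompact K) (hK0 : K ⊆ Ioi 0) {ρ : ℝ}
    (hρU : Metric.closedBall (0 : ℂ) ρ ⊆ U) :
    TendstoUniformlyOn (fun N (p : ℝ × ℂ) => (hardEdgeScale β a N : ℂ) *
      (hardEdgeGenFun β a N p.1 p.2 - E₀ p.1 p.2)) (fun p => E₁ p.1 p.2) atTop
      (K ×ˢ Metric.closedBall (0 : ℂ) ρ) :=
  (tendstoLocallyUniformlyOn_iff_forall_isCompact (isOpen_Ioi.prod hU)).1 hE _
    (prod_mono hK0 hρU) (hK.prod (isCompact_closedBall 0 ρ))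

theorem exists_genFun_bound (hβ : β = 1 ∨ β = 4) (ha : -1 < laguerreExponent β a) (hU : IsOpen U)
    (hE : IsHardEdgeGenFunExpansion β a U E₀ E₁) {K : Set ℝ} (hK : IsCompact K)
    (hK0 : K ⊆ Ioi 0) {ρ : ℝ} (hρU : Metric.closedBall (0 : ℂ) ρ ⊆ U) :
    ∃ M, ∀ y ∈ K, ∀ ξ ∈ Metric.closedBall (0 : ℂ) ρ, ‖E₀ y ξ‖ ≤ M ∧ ‖E₁ y ξ‖ ≤ M := by
  obtain ⟨M, hM⟩ := exists_bound_of_expansion (tendsto_hardEdgeScale hβ a)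
    (eventually_hardEdgeGenFun_bounded hβ ha K ρ) (tendstoUniformlyOn_genFun hU hE hK hK0 hρU)
  exact ⟨M, fun y hy ξ hξ => hM (y, ξ) ⟨hy, hξ⟩⟩

theorem tendstoUniformlyOn_section {X Y : Type*} {F : ℕ → X × Y → ℂ} {f : X × Y → ℂ} {x : X}
    {B : Set Y} (h : TendstoUniformlyOn F f atTop ({x} ×ˢ B)) :
    TendstoUniformlyOn (fun N ξ => F N (x, ξ)) (fun ξ => f (x, ξ)) atTop B :=
  fun u hu => (h u hu).mono fun _ hN ξ hξ => hN (x, ξ) ⟨rfl, hξ⟩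

/-- At finite N the generating function is a polynomial in ξ, and locally uniform limits of
holomorphic functions are holomorphic. -/
theorem differentiableOn_genFun (hβ : β = 1 ∨ β = 4) (ha : -1 < laguerreExponent β a)
    (hU : IsOpen U) (hE : IsHardEdgeGenFunExpansion β a U E₀ E₁) {ρ : ℝ}
    (hρU : Metric.closedBall (0 : ℂ) ρ ⊆ U) {y : ℝ} (hy : 0 < y) :
    DifferentiableOn ℂ (E₀ y) (Metric.ball 0 ρ) := by
  have h1 : TendstoUniformlyOn (fun N (p : ℝ × ℂ) => hardEdgeGenFun β a N p.1 p.2)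
      (fun p => E₀ p.1 p.2) atTop ({y} ×ˢ Metric.closedBall (0 : ℂ) ρ) :=
    tendstoUniformlyOn_of_expansion (tendsto_hardEdgeScale hβ a)
      (eventually_hardEdgeGenFun_bounded hβ ha {y} ρ)
      (tendstoUniformlyOn_genFun hU hE isCompact_singleton (singleton_subset_iff.2 hy) hρU)
  have h : TendstoUniformlyOn (fun N ξ => hardEdgeGenFun β a N y ξ) (E₀ y) atTop
      (Metric.closedBall (0 : ℂ) ρ) := tendstoUniformlyOn_section h1
  exact (h.mono Metric.ball_subset_closedBall).tendstoLocallyUniformlyOn.differentiableOn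
    (Eventually.of_forall fun N => (differentiable_ensembleGenFun β _ N _).differentiableOn)
    Metric.isOpen_ball

/-- Weierstrass' theorem for the rescaled differences, which are holomorphic because `E₀` is; their
ξ-derivatives converge as well. -/
theorem differentiableOn_correction (hβ : β = 1 ∨ β = 4) (ha : -1 < laguerreExponent β a)
    (hU : IsOpen U) (hE : IsHardEdgeGenFunExpansion β a U E₀ E₁) {ρ : ℝ} (hρ : 0 < ρ)
    (hρU : Metric.closedBall (0 : ℂ) ρ ⊆ U) {y : ℝ} (hy : 0 < y) :
    DifferentiableOn ℂ (E₁ y) (Metric.ball 0 ρ) ∧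
      Tendsto (fun N => (hardEdgeScale β a N : ℂ) *
        (deriv (hardEdgeGenFun β a N y) 0 - deriv (E₀ y) 0)) atTop (nhds (deriv (E₁ y) 0)) := by
  have h := ((tendstoUniformlyOn_section (tendstoUniformlyOn_genFun hU hE isCompact_singleton
    (singleton_subset_iff.2 hy) hρU)).mono
      Metric.ball_subset_closedBall).tendstoLocallyUniformlyOn
  have hd0 := differentiableOn_genFun hβ ha hU hE hρU hy
  have hd : ∀ᶠ N in atTop, DifferentiableOn ℂ (fun ξ => (hardEdgeScale β a N : ℂ) *
      (hardEdgeGenFun β a N y ξ - E₀ y ξ)) (Metric.ball 0 ρ) :=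
    Eventually.of_forall fun N => (((differentiable_ensembleGenFun β _ N _).differentiableOn).sub
      hd0).const_mul _
  refine ⟨h.differentiableOn hd Metric.isOpen_ball, ?_⟩
  have h2 := (h.deriv hd Metric.isOpen_ball).tendsto_at (Metric.mem_ball_self hρ)
  refine h2.congr fun N => ?_
  have e0 := (hd0.differentiableAt (Metric.ball_mem_nhds 0 hρ))
  have eN : DifferentiableAt ℂ (hardEdgeGenFun β a N y) 0 :=
    (differentiable_ensembleGenFun β _ N _).differentiableAt
  exact ((eN.hasDerivAt.sub e0.hasDerivAt).const_mul _).deriv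

/-- A constant times a diverging scale converges only if the constant is 0. A single limit thus
gives the identities at both orders of the expansion. -/
theorem eq_zero_of_tendsto_mul_const {S : ℕ → ℝ} (hS : Tendsto S atTop atTop) {c d : ℂ}
    (h : Tendsto (fun N => (S N : ℂ) * c) atTop (nhds d)) : c = 0 ∧ d = 0 := by
  have h1 : Tendsto (fun N => ((S N)⁻¹ : ℝ)) atTop (nhds 0) := hS.inv_tendsto_atTop
  have h2 := ((Complex.continuous_ofReal.tendsto 0).comp h1).mul h
  rw [Complex.ofReal_zero, zero_mul] at h2
  have hc : c = 0 := by
    refine tendsto_nhds_unique (tendsto_const_nhds.congr' ?_) h2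
    filter_upwards [hS.eventually_gt_atTop 0] with N hN
    have : (S N : ℂ) ≠ 0 := by exact_mod_cast hN.ne'
    simp only [Function.comp]; push_cast; field_simp
  refine ⟨hc, ?_⟩
  rw [hc] at h
  simpa using tendsto_nhds_unique h (by simp)

theorem genFun_at_zero (hβ : β = 1 ∨ β = 4) (ha : -1 < laguerreExponent β a) (hU0 : (0 : ℂ) ∈ U)
    (hE : IsHardEdgeGenFunExpansion β a U E₀ E₁) {y : ℝ} (hy : 0 < y) :
    E₀ y 0 = 1 ∧ E₁ y 0 = 0 := by
  have h : Tendsto (fun N => (hardEdgeScale β a N : ℂ) * (1 - E₀ y 0)) atTop (nhds (E₁ y 0)) := by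
    refine (TendstoLocallyUniformlyOn.tendsto_at hE (a := (y, 0)) ⟨hy, hU0⟩).congr' ?_
    filter_upwards [eventually_ge_atTop 1] with N hN
    obtain ⟨n, rfl⟩ := Nat.exists_eq_add_of_le' hN
    rw [hardEdgeGenFun_zero hβ ha]
  obtain ⟨h1, h2⟩ := eq_zero_of_tendsto_mul_const (tendsto_hardEdgeScale hβ a) h
  exact ⟨(sub_eq_zero.1 h1).symm, h2⟩

/-- The first derivatives at `ξ = 0` of the terms of the expansion are antiderivatives of the terms
of the expansion of the density. -/
theorem deriv_genFun_sub (hβ : β = 1 ∨ β = 4) (ha : -1 < laguerreExponent β a) (hU : IsOpen U)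
    (hU0 : (0 : ℂ) ∈ U) (hE : IsHardEdgeGenFunExpansion β a U E₀ E₁) {u v : ℝ} (hu : 0 < u)
    (huv : u ≤ v) :
    deriv (E₀ v) 0 - deriv (E₀ u) 0 = -((∫ y in u..v, hardEdgeLimit β a y : ℝ) : ℂ) ∧
    deriv (E₁ v) 0 - deriv (E₁ u) 0 = -((∫ y in u..v, hardEdgeCorrection β a y : ℝ) : ℂ) := by
  obtain ⟨ρ, hρ, hρU⟩ := Metric.nhds_basis_closedBall.mem_iff.1 (hU.mem_nhds hU0)
  have hv := (differentiableOn_correction hβ ha hU hE hρ hρU (hu.trans_le huv)).2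
  have hu' := (differentiableOn_correction hβ ha hU hE hρ hρU hu).2
  have hd := (Complex.continuous_ofReal.tendsto _).comp
    (tendsto_integral_hardEdgeDensity hβ ha hu huv)
  -- The finite N parts cancel exactly in this sum, which leaves the scale times a constant.
  have h := (hv.sub hu').add hd
  have h' : Tendsto (fun N => (hardEdgeScale β a N : ℂ) * (-(deriv (E₀ v) 0 - deriv (E₀ u) 0) -
      ((∫ y in u..v, hardEdgeLimit β a y : ℝ) : ℂ))) atTop (nhds (deriv (E₁ v) 0 -
        deriv (E₁ u) 0 + ((∫ y in u..v, hardEdgeCorrection β a y : ℝ) : ℂ))) := by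
    refine h.congr' ?_
    filter_upwards [eventually_ge_atTop 1] with N hN
    obtain ⟨n, rfl⟩ := Nat.exists_eq_add_of_le' hN
    have hdiff := deriv_hardEdgeGenFun_sub hβ ha n hu huv
    simp only [Function.comp]
    push_cast at hdiff ⊢
    linear_combination (hardEdgeScale β a (n + 1) : ℂ) * hdiff
  obtain ⟨h1, h2⟩ := eq_zero_of_tendsto_mul_const (tendsto_hardEdgeScale hβ a) h'
  exact ⟨by linear_combination -h1, by linear_combination h2⟩

end genFun

/-! ### The limit density satisfies no first order equation with polynomial coefficients. -/

section limit
variable {β : ℕ} {a : ℝ}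

/-- Both ensembles belong to one family: (κ, σ) is (1, 1) for β = 1 and (1/2, 0) otherwise. -/
theorem exists_hardEdgeLimit_eq (β : ℕ) (a : ℝ) : ∃ κ σ : ℝ, κ ≠ 0 ∧
    (∀ y, hardEdgeLimit β a y = κ * laguerre.edge₀ a σ (2 * y) / y) ∧
    ∀ y, hardEdgeCorrection β a y = κ * laguerre.edge₁ a σ (2 * y) / (16 * y) := by
  by_cases h : β = 1
  · exact ⟨1, 1, one_ne_zero, fun y => by rw [hardEdgeLimit, if_pos h, one_mul],
      fun y => by rw [hardEdgeCorrection, if_pos h, one_mul]⟩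
  · exact ⟨1 / 2, 0, by norm_num, fun y => by rw [hardEdgeLimit, if_neg h]; ring,
      fun y => by rw [hardEdgeCorrection, if_neg h]; ring⟩

theorem hasDerivAt_comp_two_mul {f : ℝ → ℝ} {f' y : ℝ} (hy : y ≠ 0)
    (h : HasDerivAt f (f' / (2 * y)) (2 * y)) : HasDerivAt (fun y => f (2 * y)) (f' / y) y := by
  have h2 : HasDerivAt (fun y : ℝ => 2 * y) 2 y := by simpa using (hasDerivAt_id y).const_mul 2
  refine (h.comp y h2).congr_deriv ?_
  field_simp

theorem hasDerivAt_hardEdgeLimit (ha : -2 < a) {κ σ : ℝ}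
    (h0 : ∀ y, hardEdgeLimit β a y = κ * laguerre.edge₀ a σ (2 * y) / y) {y : ℝ} (hy : 0 < y) :
    HasDerivAt (hardEdgeLimit β a)
      (κ * (laguerre.edgeDeriv a σ (2 * y) - laguerre.edge₀ a σ (2 * y)) / y ^ 2) y := by
  have h := hasDerivAt_comp_two_mul hy.ne'
    (laguerre.hasDerivAt_edge₀ ha σ (by positivity : 0 < 2 * y))
  rw [funext h0]
  refine ((h.const_mul κ).div (hasDerivAt_id y) hy.ne').congr_deriv ?_
  simp only [id]
  field_simp

/-- The first correction of the density is the derivative of a second order differential operator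
applied to an antiderivative of the limit of the density. -/
theorem hasDerivAt_hardEdge_operator (hβ : β = 1 ∨ β = 4) (ha : -1 < laguerreExponent β a) {y : ℝ}
    (hy : 0 < y) :
    HasDerivAt (fun y => -(1 / 6) * (4 * y ^ 2 * deriv (hardEdgeLimit β a) y +
      (y ^ 2 + (a ^ 2 - 1) * y) * hardEdgeLimit β a y)) (hardEdgeCorrection β a y) y := by
  have ha2 := laguerreExponent_gt hβ ha
  obtain ⟨κ, σ, -, h0, h1⟩ := exists_hardEdgeLimit_eq β a
  have h2y : 0 < 2 * y := by positivity
  have hT := hasDerivAt_comp_two_mul hy.ne' (laguerre.hasDerivAt_edge₀ ha2 σ h2y)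
  have hV := hasDerivAt_comp_two_mul hy.ne' (laguerre.hasDerivAt_edgeDeriv ha2 σ h2y)
  have h := ((hV.const_mul 4).add (((hasDerivAt_id y).add_const (a ^ 2 - 5)).mul hT)).const_mul
    (-(κ / 6))
  rw [h1]
  refine HasDerivAt.congr_deriv (HasDerivAt.congr_of_eventuallyEq h ?_) ?_
  · filter_upwards [eventually_gt_nhds hy] with t ht
    rw [(hasDerivAt_hardEdgeLimit ha2 h0 ht).deriv, h0]
    simp only [id, Pi.add_apply, Pi.mul_apply]
    field_simp
    ring
  · simp only [id]
    field_simp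
    ring

end limit

section polynomial
open Polynomial

/-- The polynomial of the real parts of the coefficients. -/
def rePart (p : ℂ[X]) : ℝ[X] := ∑ i ∈ Finset.range (p.natDegree + 1), C (p.coeff i).re * X ^ i

theorem eval_rePart (p : ℂ[X]) (x : ℝ) : (rePart p).eval x = (p.eval (x : ℂ)).re := by
  rw [rePart, eval_finsetSum, eval_eq_sum_range, Complex.re_sum]
  refine Finset.sum_congr rfl fun i _ => ?_
  rw [← Complex.ofReal_pow, Complex.re_mul_ofReal]
  simp

theorem eq_zero_of_eval_pos {p : ℂ[X]} (h : ∀ x : ℝ, 0 < x → p.eval (x : ℂ) = 0) : p = 0 := by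
  refine Polynomial.eq_zero_of_infinite_isRoot p (Set.Infinite.mono (s := (fun x : ℝ => (x : ℂ)) '' Ioi 0) ?_ ?_)
  · rintro _ ⟨x, hx, rfl⟩; exact h x hx
  · exact (Ioi_infinite 0).image Complex.ofReal_injective.injOn

theorem eq_zero_of_rePart {p : ℂ[X]} (h : ∀ c : ℂ, rePart (C c * p) = 0) : p = 0 := by
  refine eq_zero_of_eval_pos fun x _ => Complex.ext ?_ ?_
  · have := eval_rePart (C 1 * p) x
    rw [h] at this
    simpa using this.symm
  · have := eval_rePart (C (-Complex.I) * p) x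
    rw [h] at this
    simpa using this.symm

variable {β : ℕ} {a : ℝ}

/-- With x = 2y and denominators cleared this becomes an equation for `edge₀` and its Euler
derivative; clearing y² turns the constant into a multiple of x². -/
theorem eq_zero_of_hardEdgeLimit_real (hβ : β = 1 ∨ β = 4) (ha : -1 < laguerreExponent β a)
    {q₁ q₂ : ℝ[X]} {c : ℝ} (h : ∀ y : ℝ, 0 < y → q₂.eval y * deriv (hardEdgeLimit β a) y +
      q₁.eval y * hardEdgeLimit β a y = c) : q₂ = 0 ∧ q₁ = 0 := by
  have ha2 := laguerreExponent_gt hβ ha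
  obtain ⟨κ, σ, hκ, h0, -⟩ := exists_hardEdgeLimit_eq β a
  have hcomp : ∀ p : ℝ[X], p.comp (C (1 / 2) * X) = 0 → p = 0 := fun p hp => by
    have : (p.comp (C (1 / 2) * X)).comp (C 2 * X) = p := by
      rw [comp_assoc, mul_comp, C_comp, X_comp, ← mul_assoc, ← C_mul]; norm_num
    rw [← this, hp, zero_comp]
  obtain ⟨hA, hB⟩ := laguerre.eq_zero_of_edge (a := a) ha2 σ (A := q₂.comp (C (1 / 2) * X))
    (B := (X * q₁ - q₂).comp (C (1 / 2) * X)) (c := c / κ / 4) fun x hx => by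
      have hy : 0 < 1 / 2 * x := by positivity
      have h1 := h _ hy
      rw [(hasDerivAt_hardEdgeLimit ha2 h0 hy).deriv, h0,
        show 2 * (1 / 2 * x) = x by ring] at h1
      simp only [eval_comp, eval_sub, eval_mul, eval_C, eval_X]
      rw [← h1]
      field_simp
      ring
  have hq2 := hcomp _ hA
  have hq1 := hcomp _ hB
  rw [hq2, sub_zero] at hq1
  exact ⟨hq2, (mul_eq_zero.1 hq1).resolve_left X_ne_zero⟩

/-- The limit of the hard edge density solves no first order linear differential equation with
polynomial coefficients. -/
theorem eq_zero_of_hardEdgeLimit (hβ : β = 1 ∨ β = 4) (ha : -1 < laguerreExponent β a)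
    {q₁ q₂ : ℂ[X]} {c : ℂ} (h : ∀ y : ℝ, 0 < y →
      q₂.eval (y : ℂ) * (deriv (hardEdgeLimit β a) y : ℝ) +
        q₁.eval (y : ℂ) * (hardEdgeLimit β a y : ℝ) = c) : q₂ = 0 ∧ q₁ = 0 := by
  have key : ∀ d : ℂ, rePart (C d * q₂) = 0 ∧ rePart (C d * q₁) = 0 := fun d =>
    eq_zero_of_hardEdgeLimit_real hβ ha (c := (d * c).re) fun y hy => by
      have h1 := congrArg Complex.re (congrArg (d * ·) (h y hy))
      simp only [mul_add, ← mul_assoc, Complex.add_re, Complex.re_mul_ofReal] at h1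
      rw [eval_rePart, eval_rePart, eval_mul, eval_mul, eval_C]
      exact h1
  exact ⟨eq_zero_of_rePart fun d => (key d).1, eq_zero_of_rePart fun d => (key d).2⟩

end polynomial

/-! ### Part (ii): identification of the differential operator. -/

theorem tendsto_integral_slope {E : ℝ → ℂ → ℂ} {u v ρ M : ℝ} (huv : u ≤ v) (hρ : 0 < ρ)
    (hd : ∀ y ∈ Icc u v, DifferentiableOn ℂ (E y) (Metric.ball 0 ρ))
    (hM : ∀ y ∈ Icc u v, ∀ ξ ∈ Metric.ball (0 : ℂ) ρ, ‖E y ξ‖ ≤ M)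
    (hc : ∀ ξ ∈ Metric.ball (0 : ℂ) ρ, ContinuousOn (fun y => E y ξ) (Icc u v))
    {P : ℝ → ℂ} (hP : Continuous P) :
    Tendsto (fun ξ : ℂ => ∫ y in u..v, ξ⁻¹ * (E y ξ - E y 0) * P y) (nhdsWithin 0 {0}ᶜ)
      (nhds (∫ y in u..v, deriv (E y) 0 * P y)) := by
  obtain ⟨B, hB⟩ := (isCompact_Icc (a := u) (b := v)).exists_bound_of_continuousOn hP.continuousOn
  have hball : ∀ᶠ ξ in nhdsWithin (0 : ℂ) {0}ᶜ, ξ ∈ Metric.ball (0 : ℂ) ρ :=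
    nhdsWithin_le_nhds (Metric.ball_mem_nhds 0 hρ)
  have hne : ∀ᶠ ξ in nhdsWithin (0 : ℂ) {0}ᶜ, ξ ≠ 0 := self_mem_nhdsWithin
  have hI : uIoc u v ⊆ Icc u v := by rw [uIoc_of_le huv]; exact Ioc_subset_Icc_self
  refine intervalIntegral.tendsto_integral_filter_of_dominated_convergence
    (fun _ => 2 * M / ρ * B) ?_ ?_ (by simp) ?_
  · filter_upwards [hball] with ξ hξ
    have h1 : ContinuousOn (fun y => ξ⁻¹ * (E y ξ - E y 0) * P y) (Icc u v) :=
      (continuousOn_const.mul ((hc ξ hξ).sub (hc 0 (Metric.mem_ball_self hρ)))).mul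
        hP.continuousOn
    exact (h1.mono hI).aestronglyMeasurable measurableSet_uIoc
  · filter_upwards [hball, hne] with ξ hξ hξ0
    refine Eventually.of_forall fun y hy => ?_
    -- The Schwarz bound dominates the difference quotients by a constant, so dominated convergence
    -- applies.
    have h1 := norm_sub_le_of_bounded hρ (hd y (hI hy)) (hM y (hI hy)) hξ
    have hn : 0 < ‖ξ‖ := norm_pos_iff.2 hξ0
    have h2 : ‖ξ⁻¹ * (E y ξ - E y 0)‖ ≤ 2 * M / ρ := by
      rw [norm_mul, norm_inv, inv_mul_le_iff₀ hn, mul_comm]; exact h1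
    rw [norm_mul]
    exact mul_le_mul h2 (hB y (hI hy)) (norm_nonneg _) ((norm_nonneg _).trans h2)
  · refine Eventually.of_forall fun y hy => ?_
    have h1 := (hd y (hI hy)).differentiableAt (Metric.ball_mem_nhds 0 hρ)
    have h2 := (hasDerivAt_iff_tendsto_slope.1 h1.hasDerivAt).mul_const (P y)
    refine h2.congr fun ξ => ?_
    rw [slope_def_module, sub_zero, smul_eq_mul]

theorem hasDerivAt_of_sub_eq_integral {e : ℝ → ℂ} {r : ℝ → ℝ} (hr : ContinuousOn r (Ioi 0))
    (h : ∀ u v, 0 < u → u ≤ v → e v - e u = -((∫ y in u..v, r y : ℝ) : ℂ)) {y : ℝ} (hy : 0 < y) :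
    HasDerivAt e (-(r y : ℂ)) y := by
  have hu : 0 < y / 2 := by positivity
  have huy : y / 2 < y := by linarith
  have hi : IntervalIntegrable r volume (y / 2) y := by
    refine (hr.mono ?_).intervalIntegrable
    rw [uIcc_of_le huy.le]; exact fun t ht => hu.trans_le ht.1
  have h1 := intervalIntegral.integral_hasDerivAt_right hi
    (hr.stronglyMeasurableAtFilter isOpen_Ioi y hy) (hr.continuousAt (Ioi_mem_nhds hy))
  refine HasDerivAt.congr_of_eventuallyEq (h1.ofReal_comp.neg.add_const (e (y / 2))) ?_
  filter_upwards [eventually_gt_nhds huy] with v hv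
  rw [← sub_eq_iff_eq_add]
  exact h _ _ hu hv.le

section genFun
variable {β : ℕ} {a : ℝ} {U : Set ℂ} {E₀ E₁ : ℝ → ℂ → ℂ} {p₀ p₁ p₂ : Polynomial ℂ}

/-- At ξ = 0 the leading term is identically 1 and the correction 0, so the relation reads 0 =
p₀(y). -/
theorem coeff_zero_eq_zero (hβ : β = 1 ∨ β = 4) (ha : -1 < laguerreExponent β a)
    (hU0 : (0 : ℂ) ∈ U) (hE : IsHardEdgeGenFunExpansion β a U E₀ E₁)
    (h : ∀ y : ℝ, 0 < y → E₁ y 0 = p₂.eval (y : ℂ) * iteratedDeriv 2 (fun t => E₀ t 0) y +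
      p₁.eval (y : ℂ) * deriv (fun t => E₀ t 0) y + p₀.eval (y : ℂ) * E₀ y 0) : p₀ = 0 := by
  refine eq_zero_of_eval_pos fun y hy => ?_
  have h0 := h y hy
  have hev : (fun t => E₀ t 0) =ᶠ[nhds y] fun _ => 1 := by
    filter_upwards [eventually_gt_nhds hy] with t ht using (genFun_at_zero hβ ha hU0 hE ht).1
  obtain ⟨h1, h2⟩ := genFun_at_zero hβ ha hU0 hE hy
  rw [h1, h2, hev.iteratedDeriv_eq, hev.deriv_eq] at h0
  simpa [iteratedDeriv_const] using h0.symm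

/-- The differential relation between the terms of the expansion of the generating function
passes to the first derivatives at `ξ = 0`. -/
theorem deriv_correction_eq (hβ : β = 1 ∨ β = 4) (ha : -1 < laguerreExponent β a) (hU : IsOpen U)
    (hU0 : (0 : ℂ) ∈ U) (hE : IsHardEdgeGenFunExpansion β a U E₀ E₁)
    (hC : ∀ ξ ∈ U, ContDiffOn ℝ 2 (fun t => E₀ t ξ) (Ioi 0))
    (h : ∀ y : ℝ, 0 < y → ∀ ξ ∈ U, E₁ y ξ =
      p₂.eval (y : ℂ) * iteratedDeriv 2 (fun t => E₀ t ξ) y +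
        p₁.eval (y : ℂ) * deriv (fun t => E₀ t ξ) y) {y : ℝ} (hy : 0 < y) :
    deriv (E₁ y) 0 = -(p₂.eval (y : ℂ) * (deriv (hardEdgeLimit β a) y : ℝ) +
      p₁.eval (y : ℂ) * (hardEdgeLimit β a y : ℝ)) := by
  obtain ⟨ρ, hρ, hρU⟩ := Metric.nhds_basis_closedBall.mem_iff.1 (hU.mem_nhds hU0)
  have hbU : Metric.ball (0 : ℂ) ρ ⊆ U := Metric.ball_subset_closedBall.trans hρU
  have hr0 := contDiffOn_hardEdgeLimit hβ ha
  have hr0' : ContDiffOn ℝ ∞ (deriv (hardEdgeLimit β a)) (Ioi 0) :=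
    hr0.deriv_of_isOpen isOpen_Ioi (by simp)
  have hr1 := contDiffOn_hardEdgeCorrection hβ ha
  have he0 : ∀ y, 0 < y → HasDerivAt (fun y => deriv (E₀ y) 0) (-(hardEdgeLimit β a y : ℂ)) y :=
    fun y hy => hasDerivAt_of_sub_eq_integral hr0.continuousOn
      (fun u v hu huv => (deriv_genFun_sub hβ ha hU hU0 hE hu huv).1) hy
  have he1 : ∀ y, 0 < y → HasDerivAt (fun y => deriv (E₁ y) 0)
      (-(hardEdgeCorrection β a y : ℂ)) y :=
    fun y hy => hasDerivAt_of_sub_eq_integral hr1.continuousOn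
      (fun u v hu huv => (deriv_genFun_sub hβ ha hU hU0 hE hu huv).2) hy
  have he0' : ∀ y, 0 < y → HasDerivAt (fun y => -(hardEdgeLimit β a y : ℂ))
      (-((deriv (hardEdgeLimit β a) y : ℝ) : ℂ)) y := fun y hy =>
    ((hr0.contDiffAt (Ioi_mem_nhds hy)).differentiableAt (by simp)).hasDerivAt.ofReal_comp.neg
  have hC' : ∀ ξ ∈ U, ContinuousOn (fun y => E₀ y ξ) (Ioi 0) ∧
      (∀ y, 0 < y → HasDerivAt (fun y => E₀ y ξ) (deriv (fun t => E₀ t ξ) y) y) ∧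
      (∀ y, 0 < y → HasDerivAt (deriv fun t => E₀ t ξ) (iteratedDeriv 2 (fun t => E₀ t ξ) y) y) ∧
      ContinuousOn (iteratedDeriv 2 fun t => E₀ t ξ) (Ioi 0) := fun ξ hξ => by
    have h0 := hC ξ hξ
    have h1 : ContDiffOn ℝ 1 (deriv fun t => E₀ t ξ) (Ioi 0) :=
      h0.deriv_of_isOpen isOpen_Ioi (by norm_num)
    have h2 : ContDiffOn ℝ 0 (deriv (deriv fun t => E₀ t ξ)) (Ioi 0) :=
      h1.deriv_of_isOpen isOpen_Ioi (by norm_num)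
    have e : iteratedDeriv 2 (fun t => E₀ t ξ) = deriv (deriv fun t => E₀ t ξ) := by
      rw [iteratedDeriv_succ, iteratedDeriv_one]
    rw [e]
    exact ⟨h0.continuousOn,
      fun y hy => ((h0.contDiffAt (Ioi_mem_nhds hy)).differentiableAt (by norm_num)).hasDerivAt,
      fun y hy => ((h1.contDiffAt (Ioi_mem_nhds hy)).differentiableAt (by norm_num)).hasDerivAt,
      h2.continuousOn⟩
  have hP : ∀ p : Polynomial ℂ, Continuous fun y : ℝ => p.eval (y : ℂ) := fun p => by fun_prop
  have hcont1 : ∀ ξ ∈ U, ContinuousOn (fun y => E₁ y ξ) (Ioi 0) := fun ξ hξ => by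
    obtain ⟨c0, c1, c2, c3⟩ := hC' ξ hξ
    have c1' : ContinuousOn (deriv fun t => E₀ t ξ) (Ioi 0) := fun y hy =>
      (c2 y hy).continuousAt.continuousWithinAt
    exact (((hP p₂).continuousOn.mul c3).add ((hP p₁).continuousOn.mul c1')).congr
      fun y hy => h y hy ξ hξ
  have hzero : deriv (E₁ y) 0 + (p₂.eval (y : ℂ) * (deriv (hardEdgeLimit β a) y : ℝ) +
      p₁.eval (y : ℂ) * (hardEdgeLimit β a y : ℝ)) = 0 := by
    have ce1 : ContinuousOn (fun y => deriv (E₁ y) 0) (Ioi 0) := fun y hy =>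
      (he1 y hy).continuousAt.continuousWithinAt
    have cop : ContinuousOn (fun y : ℝ => p₂.eval (y : ℂ) * (deriv (hardEdgeLimit β a) y : ℝ) +
        p₁.eval (y : ℂ) * ((hardEdgeLimit β a y : ℝ) : ℂ)) (Ioi 0) :=
      ((hP p₂).continuousOn.mul (Complex.continuous_ofReal.comp_continuousOn
        hr0'.continuousOn)).add ((hP p₁).continuousOn.mul
          (Complex.continuous_ofReal.comp_continuousOn hr0.continuousOn))
    -- Smoothness in y is known for each fixed ξ only; nothing controls the second y-derivative as ξ
    -- varies. The relation is therefore integrated against bumps, and the y-derivatives are moved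
    -- off `E₀` before ξ tends to 0.
    refine eq_zero_of_integral_bump (h := fun y => deriv (E₁ y) 0 +
      (p₂.eval (y : ℂ) * (deriv (hardEdgeLimit β a) y : ℝ) +
        p₁.eval (y : ℂ) * (hardEdgeLimit β a y : ℝ))) (ce1.add cop) (fun u v hu huv => ?_) hy
    have hsub : Icc u v ⊆ Ioi 0 := fun t ht => hu.trans_le ht.1
    obtain ⟨M, hM⟩ := exists_genFun_bound hβ ha hU hE isCompact_Icc hsub hρU
    have t0 := tendsto_integral_slope huv.le hρ
      (fun y hy => differentiableOn_genFun hβ ha hU hE hρU (hsub hy))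
      (fun y hy ξ hξ => (hM y hy ξ (Metric.ball_subset_closedBall hξ)).1)
      (fun ξ hξ => (hC' ξ (hbU hξ)).1.mono hsub) (hP (adjointBump p₁ p₂ u v))
    have t1 := tendsto_integral_slope huv.le hρ
      (fun y hy => (differentiableOn_correction hβ ha hU hE hρ hρU (hsub hy)).1)
      (fun y hy ξ hξ => (hM y hy ξ (Metric.ball_subset_closedBall hξ)).2)
      (fun ξ hξ => (hcont1 ξ (hbU hξ)).mono hsub) (hP (bumpPoly u v))
    have heq : (fun ξ : ℂ => ∫ y in u..v, ξ⁻¹ * (E₁ y ξ - E₁ y 0) *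
        (bumpPoly u v).eval (y : ℂ)) =ᶠ[nhdsWithin 0 {0}ᶜ]
        fun ξ : ℂ => ∫ y in u..v, ξ⁻¹ * (E₀ y ξ - E₀ y 0) *
          (adjointBump p₁ p₂ u v).eval (y : ℂ) := by
      filter_upwards [nhdsWithin_le_nhds (Metric.ball_mem_nhds 0 hρ)] with ξ hξ
      obtain ⟨c0, c1, c2, c3⟩ := hC' ξ (hbU hξ)
      have hw := integral_adjointBump p₁ p₂ huv.le (fun y hy => c1 y (hsub hy))
        (fun y hy => c2 y (hsub hy)) (c3.mono hsub) 1
      simp only [mul_assoc ξ⁻¹]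
      rw [intervalIntegral.integral_const_mul, intervalIntegral.integral_const_mul]
      congr 1
      rw [← uIcc_of_le huv.le] at hsub
      refine Eq.trans (intervalIntegral.integral_congr fun y hy => ?_)
        (hw.trans (intervalIntegral.integral_congr fun y hy => ?_))
      · rw [(genFun_at_zero hβ ha hU0 hE (hsub hy)).2, sub_zero, h y (hsub hy) ξ (hbU hξ)]
      · rw [(genFun_at_zero hβ ha hU0 hE (hsub hy)).1]
    have hlim := tendsto_nhds_unique (t1.congr' heq) t0
    -- The ξ-derivative of `E₀` at 0 is smooth in y, its derivative being -r₀; the derivatives can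
    -- be moved back onto it.
    have hw := integral_adjointBump p₁ p₂ huv.le (fun y hy => he0 y (hsub hy))
      (fun y hy => he0' y (hsub hy)) ((Complex.continuous_ofReal.comp_continuousOn
        (hr0'.continuousOn.mono hsub)).neg) 0
    simp only [sub_zero] at hw
    rw [← hw] at hlim
    have hI : ∀ {F : ℝ → ℂ}, ContinuousOn F (Ioi 0) → IntervalIntegrable F volume u v :=
      fun {F} hF => (hF.mono (by rw [uIcc_of_le huv.le]; exact hsub)).intervalIntegrable
    have i1 : IntervalIntegrable (fun y : ℝ => deriv (E₁ y) 0 * (bumpPoly u v).eval (y : ℂ))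
        volume u v := hI (ce1.mul (hP (bumpPoly u v)).continuousOn)
    have i2 : IntervalIntegrable (fun y : ℝ => (p₂.eval (y : ℂ) *
        (deriv (hardEdgeLimit β a) y : ℝ) + p₁.eval (y : ℂ) * (hardEdgeLimit β a y : ℝ)) *
          (bumpPoly u v).eval (y : ℂ)) volume u v :=
      hI (cop.mul (hP (bumpPoly u v)).continuousOn)
    have e1 := intervalIntegral.integral_add i1 i2
    rw [hlim, ← sub_neg_eq_add, ← intervalIntegral.integral_neg, sub_eq_zero.2] at e1
    · refine Eq.trans (intervalIntegral.integral_congr fun y _ => ?_) e1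
      exact add_mul _ _ _
    · refine intervalIntegral.integral_congr fun y _ => ?_
      ring
  exact eq_neg_of_add_eq_zero_left hzero

/-- The ξ-derivative of `E₁` has y-derivative -r₁, while `hasDerivAt_hardEdge_operator` produces
+r₁, so their sum `F` is constant. Written out, this is a first order equation for r₀ with
polynomial coefficients, all of which must vanish. -/
theorem coeffs_eq (hβ : β = 1 ∨ β = 4) (ha : -1 < laguerreExponent β a) (hU : IsOpen U)
    (hU0 : (0 : ℂ) ∈ U) (hE : IsHardEdgeGenFunExpansion β a U E₀ E₁)
    (hC : ∀ ξ ∈ U, ContDiffOn ℝ 2 (fun t => E₀ t ξ) (Ioi 0))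
    (h : ∀ y : ℝ, 0 < y → ∀ ξ ∈ U, E₁ y ξ =
      p₂.eval (y : ℂ) * iteratedDeriv 2 (fun t => E₀ t ξ) y +
        p₁.eval (y : ℂ) * deriv (fun t => E₀ t ξ) y) (y : ℝ) :
    p₂.eval (y : ℂ) = -(1 / 6) * (4 * (y : ℂ) ^ 2) ∧
      p₁.eval (y : ℂ) = -(1 / 6) * ((y : ℂ) ^ 2 + ((a : ℂ) ^ 2 - 1) * y) := by
  set F : ℝ → ℂ := fun y => deriv (E₁ y) 0 +
    ((-(1 / 6) * (4 * y ^ 2 * deriv (hardEdgeLimit β a) y +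
      (y ^ 2 + (a ^ 2 - 1) * y) * hardEdgeLimit β a y) : ℝ) : ℂ) with hF
  have hF' : ∀ y, 0 < y → HasDerivAt F 0 y := fun y hy => by
    have h1 := hasDerivAt_of_sub_eq_integral (contDiffOn_hardEdgeCorrection hβ ha).continuousOn
      (fun u v hu huv => (deriv_genFun_sub hβ ha hU hU0 hE hu huv).2) hy
    have h2 := h1.add (hasDerivAt_hardEdge_operator hβ ha hy).ofReal_comp
    rwa [neg_add_cancel] at h2
  have hc : ∀ y, 0 < y → F y = F 1 := fun y hy =>
    isOpen_Ioi.is_const_of_deriv_eq_zero isPreconnected_Ioi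
      (fun t ht => (hF' t ht).differentiableAt.differentiableWithinAt)
      (fun t ht => (hF' t ht).deriv) (mem_Ioi.2 hy) (mem_Ioi.2 one_pos)
  obtain ⟨h₂, h₁⟩ := eq_zero_of_hardEdgeLimit (c := -F 1) (q₂ := p₂ + Polynomial.C (1 / 6) *
      (4 * Polynomial.X ^ 2)) (q₁ := p₁ + Polynomial.C (1 / 6) *
      (Polynomial.X ^ 2 + Polynomial.C ((a : ℂ) ^ 2 - 1) * Polynomial.X)) hβ ha fun y hy => by
    rw [← hc y hy, hF]
    beta_reduce
    rw [deriv_correction_eq hβ ha hU hU0 hE hC h hy]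
    simp only [Polynomial.eval_add, Polynomial.eval_mul, Polynomial.eval_C, Polynomial.eval_pow,
      Polynomial.eval_X, Polynomial.eval_ofNat]
    push_cast
    ring
  have e₂ := congrArg (Polynomial.eval (y : ℂ)) h₂
  have e₁ := congrArg (Polynomial.eval (y : ℂ)) h₁
  simp only [Polynomial.eval_add, Polynomial.eval_mul, Polynomial.eval_C, Polynomial.eval_pow,
    Polynomial.eval_X, Polynomial.eval_ofNat, Polynomial.eval_zero] at e₁ e₂
  exact ⟨by linear_combination e₂, by linear_combination e₁⟩

end genFun

end

theorem mainTheorem4 (β : ℕ) (hβ : β = 1 ∨ β = 4) (a : ℝ) (ha : -1 < laguerreExponent β a) :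
    (∃ r₀ r₁ : ℝ → ℝ,
      ContDiffOn ℝ ∞ r₀ (Ioi 0) ∧ ContDiffOn ℝ ∞ r₁ (Ioi 0) ∧
      IsHardEdgeDensityExpansion β a r₀ r₁ ∧
      ∀ y : ℝ, 0 < y →
        r₁ (y / 2) = -(1 / 12) *
          (8 * opD (opD (fun t => r₀ (t / 2))) y
            + opD (fun t => t * r₀ (t / 2)) y
            + 2 * (a ^ 2 - 5) * opD (fun t => r₀ (t / 2)) y)) ∧
    (∀ (U : Set ℂ) (E₀ E₁ : ℝ → ℂ → ℂ), IsOpen U → (0 : ℂ) ∈ U →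
      IsHardEdgeGenFunExpansion β a U E₀ E₁ →
      (∀ ξ ∈ U, ContDiffOn ℝ 2 (fun t => E₀ t ξ) (Ioi 0)) →
      (∃ p₀ p₁ p₂ : Polynomial ℂ, ∀ y : ℝ, 0 < y → ∀ ξ ∈ U,
        E₁ y ξ = p₂.eval (y : ℂ) * iteratedDeriv 2 (fun t => E₀ t ξ) y
          + p₁.eval (y : ℂ) * deriv (fun t => E₀ t ξ) y
          + p₀.eval (y : ℂ) * E₀ y ξ) →
      ∀ y : ℝ, 0 < y → ∀ ξ ∈ U,
        E₁ y ξ = -(1 / 6) *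
          (4 * (y : ℂ) ^ 2 * iteratedDeriv 2 (fun t => E₀ t ξ) y
            + ((y : ℂ) ^ 2 + ((a : ℂ) ^ 2 - 1) * y) * deriv (fun t => E₀ t ξ) y)) := by
  refine ⟨⟨hardEdgeLimit β a, hardEdgeCorrection β a, contDiffOn_hardEdgeLimit hβ ha,
    contDiffOn_hardEdgeCorrection hβ ha, isHardEdgeDensityExpansion hβ ha,
    fun y hy => hardEdgeCorrection_eq hβ ha hy⟩, ?_⟩
  rintro U E₀ E₁ hU hU0 hE hC ⟨p₀, p₁, p₂, h⟩ y hy ξ hξ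
  have hp₀ : p₀ = 0 := coeff_zero_eq_zero hβ ha hU0 hE fun y hy => h y hy 0 hU0
  subst hp₀
  simp only [Polynomial.eval_zero, zero_mul, add_zero] at h
  obtain ⟨h₂, h₁⟩ := coeffs_eq hβ ha hU hU0 hE hC h y
  rw [h y hy ξ hξ, h₂, h₁]
  ring
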